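/- For $a\in\mathbb C$ put $p_a(z)=(z-a)(z^2-1)$. All integrals below are along segments, with a continuous branch of $\sqrt{p_a}$ along the segment (the choice of branch is immaterial, it only changes the sign). For $\theta\in[0,\pi/2)$ let $$\Sigma_{1,\theta}=\Big\{a\in\mathbb C\setminus(-\infty,-1]:\Re\int_{[1,a]}e^{i\theta}\sqrt{p_a(z)}\,dz=0\Big\},\quad \Sigma_{-1,\theta}=\Big\{a\in\mathbb C\setminus[1,+\infty):\Re\int_{[-1,a]}e^{i\theta}\sqrt{p_a(z)}\,dz=0\Big\},$$ $$\Sigma_{\theta}=\Big\{a\in\mathbb C\setminus[-1,1]:\Re\int_{[-1,1]}e^{i\theta}\sqrt{p_a(z)}\,dz=0\Big\}.$$ Let $\mathcal A$ (resp. $\mathcal E$) be the set of all $a$ with $-1\le\Re a\le 1$ (resp. $|\Re a|\ge 1$) such that for some $\theta\in[0,\pi/2)$ both $\Re\int_{[1,a]}e^{i\theta}\sqrt{p_a}\,dz=0$ and $\Re\int_{[-1,a]}e^{i\theta}\sqrt{p_a}\,dz=0$. For $\theta\in[0,\pi/4]$ let $\Sigma^l_{1,\theta},\Sigma^r_{1,\theta}$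 be the rays (smooth arcs, followed until they leave every compact subset of the level set) of $\Sigma_{1,\theta}$ in the closed upper half-plane starting at $1$ with initial angles $\pi-\theta/2$ and $(\pi-\theta)/2$, and let $\Sigma^l_{-1,\theta},\Sigma^r_{-1,\theta}$ be the rays of $\Sigma_{-1,\theta}$ in the closed upper half-plane starting at $-1$ with initial angles $(3\pi-2\theta)/4$ and $(\pi-2\theta)/4$; each ray is taken together with its finite end point if it has one (this occurs only for $\Sigma^l_{1,0}=[-1,1]$, which ends at $-1$). **Proposition.** Let $\theta\in[0,\pi/4]$. 1. The four rays exist. In the closed upper half-plane, $\Sigma_{-1,\theta}$ is the union of its two rays and, for $\theta>0$, $\Sigma_{1,\theta}$ is the union of its two rays. 2. $\Sigma^l_{1,\theta}\cap\Sigma^r_{-1,\theta}=\{t_\theta\}$ is a single point; $\Sigma^l_{1,\theta}\cap\Sigma^l_{-1,\theta}=\{e_\theta\}$ is a single point if $\theta<\pi/8$ and is empty if $\theta\ge\pi/8$; $\Sigma^r_{1,\theta}\cap\Sigma^r_{-1,\theta}=\Sigma^r_{1,\theta}\cap\Sigma^l_{-1,\theta}=\emptyset$. Moreover $t_0=e_0=-1$.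 No other point of the open upper half-plane belongs to $\Sigma_{1,\theta}\cap\Sigma_{-1,\theta}$. 3. As $\theta$ runs over $[0,\pi/4]$, $t_\theta$ describes $\mathcal A\cap\{-1\le\Re a\le0,\ \Im a\ge0\}$, and $\theta\mapsto t_\theta$ is an embedding of $[0,\pi/4]$ that is $C^\infty$ with non-zero derivative on $(0,\pi/4]$. As $\theta$ runs over $[0,\pi/8)$, $e_\theta$ describes $\mathcal E\cap\{\Re a\le-1,\ \Im a\ge0\}$, and $\theta\mapsto e_\theta$ is an embedding of $[0,\pi/8)$ that is $C^\infty$ with non-zero derivative on $(0,\pi/8)$. 4. There is a unique $s_\theta\in[-1,1]$ with $\Re\int_{-1}^{1}e^{i\theta}\big(\sqrt{p_{s_\theta}(x)}\big)_-\,dx=0$, where $(\sqrt{p_s})_-$ denotes the boundary values on $[-1,1]$ of a continuous branch of $\sqrt{p_s(z)}$ on the lower half-plane $\Im z<0$; it satisfies $s_\theta\in[-1,0]$, and $s_0=-1$. 5. $\Sigma_\theta$ is a single smooth curve (the image of an embedding $\gamma:(0,\infty)\to\mathbb C$ that is $C^\infty$ with non-vanishing derivative). It is contained in the part in the closed upper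 half-plane of the closed strip between the lines $y=-\tan(2\theta)(x\pm1)$ (for $\theta=\pi/4$ the lines $x=\mp1$), and for $\theta>0$ in the part in the open upper half-plane of the open strip. For $\theta>0$ it passes through $t_\theta$ and, if $\theta<\pi/8$, through $e_\theta$ (for $\theta=0$ these points coincide with its end $s_0=-1$). One end of the curve converges to $s_\theta$ ($\gamma(x)\to s_\theta$ as $x\to0^+$); the other goes to infinity in the direction $\arg a=\pi-2\theta$ ($|\gamma(x)|\to\infty$ and $\gamma(x)/|\gamma(x)|\to e^{i(\pi-2\theta)}$ as $x\to\infty$). 6. $\Sigma_{1,\theta}\cap\Sigma_{-1,\theta}\cap\{\Im a<0\}=\emptyset$. -/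

import Mathlib

open Set Filter Topology
open scoped ContDiff

/-- The cubic `p_a(z) = (z - a)(z² - 1)`. -/
def cubic (a z : ℂ) : ℂ := (z - a) * (z ^ 2 - 1)

/-- `Re ∫_{[u,v]} e^{iθ} √(p_a(z)) dz = 0`, where `√p_a` is a continuous branch of the square root
along the segment `[u,v]`. When `p_a` has no zero on the open segment (or `u = v`), there are exactly
two branches, opposite to each other (or the integral is `0`), so the choice does not matter. -/
def PeriodVanishes (θ : ℝ) (a u v : ℂ) : Prop :=
  ∃ r : ℝ → ℂ, ContinuousOn r (Icc 0 1) ∧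
    (∀ τ ∈ Icc (0 : ℝ) 1, r τ ^ 2 = cubic a (u + (τ : ℂ) * (v - u))) ∧
    (∫ τ in (0 : ℝ)..1, Complex.exp (θ * Complex.I) * r τ * (v - u)).re = 0

/-- `Σ_{1,θ}`, a subset of `ℂ ∖ (-∞,-1]`. -/
def sigmaOne (θ : ℝ) : Set ℂ :=
  {a | ¬(a.im = 0 ∧ a.re ≤ -1) ∧ PeriodVanishes θ a 1 a}

/-- `Σ_{-1,θ}`, a subset of `ℂ ∖ [1,+∞)`. -/
def sigmaNegOne (θ : ℝ) : Set ℂ :=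
  {a | ¬(a.im = 0 ∧ 1 ≤ a.re) ∧ PeriodVanishes θ a (-1) a}

/-- `Σ_θ`, a subset of `ℂ ∖ [-1,1]`. -/
def sigmaMid (θ : ℝ) : Set ℂ :=
  {a | ¬(a.im = 0 ∧ -1 ≤ a.re ∧ a.re ≤ 1) ∧ PeriodVanishes θ a (-1) 1}

/-- `γ` is injective and bicontinuous from `J` onto its image, and is a `C^∞` curve with nowhere
vanishing velocity on `I`. In the uses below `J` is the interval `I`, possibly with its left end
point added. -/
structure IsSmoothArc (γ : ℝ → ℂ) (J I : Set ℝ) : Prop where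
  embedding : IsEmbedding (J.domRestrict γ)
  smooth : ContDiffOn ℝ ∞ γ I
  regular : ∀ x ∈ I, derivWithin γ I x ≠ 0

/-- `γ : [0,∞) → ℂ` parametrizes the ray of the level set `S` that starts at `c` in the direction
`e^{iφ}`, lies in the closed upper half plane, and is followed all the way: it finally leaves every
compact subset of `S`. -/
structure IsRay (S : Set ℂ) (c : ℂ) (φ : ℝ) (γ : ℝ → ℂ) : Prop where
  arc : IsSmoothArc γ (Ici 0) (Ioi 0)
  start : γ 0 = c
  mem : ∀ x, 0 ≤ x → γ x ∈ S
  upper : ∀ x, 0 ≤ x → 0 ≤ (γ x).im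
  direction : Tendsto (fun x => (γ x - c) / (‖γ x - c‖ : ℂ)) (𝓝[>] 0)
    (𝓝 (Complex.exp (φ * Complex.I)))
  leaves : ∀ K : Set ℂ, IsCompact K → K ⊆ S → ∀ᶠ x in atTop, γ x ∉ K

/-- The ray of `S` from `c` in direction `e^{iφ}`, as a set, together with its end point if it
diverges to a point outside `S`. -/
def ray (S : Set ℂ) (c : ℂ) (φ : ℝ) : Set ℂ :=
  closure {a | ∃ γ : ℝ → ℂ, IsRay S c φ γ ∧ ∃ x, 0 ≤ x ∧ γ x = a}

/-- Initial angles at `1` of the left and right curves of `Σ_{1,θ}` in the upper half plane. -/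
noncomputable def angleOneLeft (θ : ℝ) : ℝ := (2 * Real.pi - θ) / 2
noncomputable def angleOneRight (θ : ℝ) : ℝ := (Real.pi - θ) / 2

/-- Initial angles at `-1` of the left and right curves of `Σ_{-1,θ}` in the upper half plane. -/
noncomputable def angleNegOneLeft (θ : ℝ) : ℝ := (3 * Real.pi - 2 * θ) / 4
noncomputable def angleNegOneRight (θ : ℝ) : ℝ := (Real.pi - 2 * θ) / 4

/-- `Σ^l_{1,θ}`. -/
noncomputable def sigmaOneLeft (θ : ℝ) : Set ℂ := ray (sigmaOne θ) 1 (angleOneLeft θ)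

/-- `Σ^r_{1,θ}`. -/
noncomputable def sigmaOneRight (θ : ℝ) : Set ℂ := ray (sigmaOne θ) 1 (angleOneRight θ)

/-- `Σ^l_{-1,θ}`. -/
noncomputable def sigmaNegOneLeft (θ : ℝ) : Set ℂ := ray (sigmaNegOne θ) (-1) (angleNegOneLeft θ)

/-- `Σ^r_{-1,θ}`. -/
noncomputable def sigmaNegOneRight (θ : ℝ) : Set ℂ := ray (sigmaNegOne θ) (-1) (angleNegOneRight θ)

/-- `𝒜`: points with `-1 ≤ Re a ≤ 1` at which, for some `θ ∈ [0,π/2)`, both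
`Re ∫_{[1,a]} e^{iθ}√p_a` and `Re ∫_{[-1,a]} e^{iθ}√p_a` vanish. -/
def curveA : Set ℂ :=
  {a | -1 ≤ a.re ∧ a.re ≤ 1 ∧
    ∃ θ ∈ Ico (0 : ℝ) (Real.pi / 2), PeriodVanishes θ a 1 a ∧ PeriodVanishes θ a (-1) a}

/-- `ℰ`: the same with `|Re a| ≥ 1`. -/
def curveE : Set ℂ :=
  {a | 1 ≤ |a.re| ∧
    ∃ θ ∈ Ico (0 : ℝ) (Real.pi / 2), PeriodVanishes θ a 1 a ∧ PeriodVanishes θ a (-1) a}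

/-- `Re ∫_{-1}^{1} e^{iθ} √(p_x) = 0`, with the boundary values on `[-1,1]` (from the lower half
plane of the integration variable) of a continuous branch of `√(p_x(z))`, `Im z ≤ 0`. -/
def BoundaryPeriodVanishes (θ x : ℝ) : Prop :=
  ∃ R : ℂ → ℂ, ContinuousOn R {z | z.im ≤ 0} ∧
    (∀ z : ℂ, z.im ≤ 0 → R z ^ 2 = cubic x z) ∧
    (∫ τ in (-1 : ℝ)..1, Complex.exp (θ * Complex.I) * R τ).re = 0

/-- The part in the closed upper half plane of the closed strip between the two lines of slope
`-tan 2θ` through `-1` and through `1`; each line is written as `Im (e^{2iθ}(a ± 1)) = 0`. -/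
def closedStrip (θ : ℝ) : Set ℂ :=
  {a | 0 ≤ a.im ∧ 0 ≤ (Complex.exp (2 * θ * Complex.I) * (a + 1)).im ∧
    (Complex.exp (2 * θ * Complex.I) * (a - 1)).im ≤ 0}

/-- The interior version of `closedStrip`. -/
def openStrip (θ : ℝ) : Set ℂ :=
  {a | 0 < a.im ∧ 0 < (Complex.exp (2 * θ * Complex.I) * (a + 1)).im ∧
    (Complex.exp (2 * θ * Complex.I) * (a - 1)).im < 0}

/-! Notation: g = `gInt`, h = `hInt`, F = `periodMid`, R(a) = (a-1)² g(a-1), L(a) = (a+1)²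
g(-(a+1)). For Im a > 0 the periods over [1,a], [-1,a] and [-1,1] are R, L and F up to constants,
and the three vanishing conditions read Im(e^{iθ}R) = 0, Re(e^{iθ}L) = 0, Re(e^{iθ}F) = 0. Since F =
L + iR (`periodMid_eq_add`), any two of them imply the third. None of the three functions vanishes
in the upper half plane, so every level set becomes a level set of a continuous argument: `argOne`
for R, `argNegOne` for L, `argMid` for F.

Two monotonicity facts give the shape of the curves. On a half circle about 1 the argument of R is
strictly increasing, because g and h have arguments in (0, π/2) and so Re(h/g) > 0; hence each ray
from 1 is parametrized by the distance to 1 (`exists_isRay_sigmaOne`). The reflection a ↦ -ā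
exchanges 1 with -1 and θ with π/2 - θ, which gives the rays from -1. On a horizontal line arg F is
strictly decreasing, because F lies in the first and F' in the fourth quadrant; hence Σ_θ is
parametrized by the height (`midPoint`).

Common points of the level sets are the points of Σ_θ at which arg L is π/2 - θ or 3π/2 - θ. Going
up Σ_θ from s_θ, arg L starts below π/2 - θ and tends to 2π - 5θ. The first value is therefore
always attained, and the second lies below the limit exactly when θ < π/8. That each value is
attained only once, and that the second is not attained for θ ≥ π/8, follows from transversality:
wherever arg L takes one of the two values, its derivative along Σ_θ is positive
(`logDeriv_im_pos`).

Transversality comes from the differential equation. L, R and F solve one second order linear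
equation, and the Wronskian of L and R gives a Legendre relation (`exists_legendre_relation`). At a
common point L/F and iR/F are real, and the relation reduces the sign of the derivative to Im Z > 0
with Z = (a+1) g(-(a+1)) h(a-1). At t_θ crude bounds on arguments suffice. At e_θ two finer
comparisons are needed: arg F ≤ (arg a)/2 (`arg_periodMid_le`) and arg h(a-1) < arg(a+1) - (arg a)/2
(`arg_hInt_lt`), the second resting on an explicit integral estimate.

The same independence of derivatives feeds the inverse function theorem (`contDiffOn_of_im_eq`),
which yields the smoothness of all the arcs. -/

/-! ### The principal square root -/

/-- The principal branch of the complex square root. -/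
noncomputable def csqrt (z : ℂ) : ℂ := z ^ (2⁻¹ : ℂ)

lemma csqrt_sq (z : ℂ) : csqrt z ^ 2 = z := by
  simpa only [csqrt, Nat.cast_ofNat] using Complex.cpow_nat_inv_pow z (n := 2) two_ne_zero

lemma csqrt_ne_zero {z : ℂ} (hz : z ≠ 0) : csqrt z ≠ 0 := by
  intro h
  have := csqrt_sq z
  rw [h] at this
  exact hz (by simpa using this.symm)

lemma csqrt_zero : csqrt 0 = 0 := by simp [csqrt]

lemma csqrt_eq_polar (z : ℂ) :
    csqrt z = (Real.sqrt ‖z‖ : ℂ) * Complex.exp ((z.arg / 2 : ℝ) * Complex.I) := by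
  rcases eq_or_ne z 0 with rfl | hz
  · simp [csqrt_zero]
  · rw [csqrt, Complex.cpow_def_of_ne_zero hz, Complex.log, Real.sqrt_eq_rpow,
      Complex.ofReal_cpow (norm_nonneg z), Complex.cpow_def_of_ne_zero (by simpa using hz),
      ← Complex.exp_add, Complex.ofReal_log (norm_nonneg z)]
    congr 1
    push_cast
    ring

lemma norm_csqrt (z : ℂ) : ‖csqrt z‖ = Real.sqrt ‖z‖ := by
  rw [csqrt_eq_polar, norm_mul, Complex.norm_exp_ofReal_mul_I, mul_one, Complex.norm_real,
    Real.norm_of_nonneg (Real.sqrt_nonneg _)]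

lemma arg_csqrt (z : ℂ) : (csqrt z).arg = z.arg / 2 := by
  rcases eq_or_ne z 0 with rfl | hz
  · simp [csqrt_zero]
  · have h1 := Complex.neg_pi_lt_arg z
    have h2 := Complex.arg_le_pi z
    rw [csqrt_eq_polar, Complex.arg_mul_eq_add_arg_iff _ (Complex.exp_ne_zero _) |>.2]
    all_goals
      try rw [Complex.arg_exp_mul_I, toIocMod_eq_self _ |>.2 (by constructor <;> linarith [Real.pi_pos])]
    · rw [Complex.arg_ofReal_of_nonneg (Real.sqrt_nonneg _), zero_add]
    · rw [Complex.arg_ofReal_of_nonneg (Real.sqrt_nonneg _), zero_add]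
      constructor <;> linarith [Real.pi_pos]
    · simpa using (Real.sqrt_ne_zero'.2 (norm_pos_iff.2 hz))

lemma csqrt_real_mul {r : ℝ} (hr : 0 ≤ r) (z : ℂ) :
    csqrt (r * z) = (Real.sqrt r : ℂ) * csqrt z := by
  rcases hr.eq_or_lt with rfl | hr'
  · simp [csqrt_zero]
  · rw [csqrt_eq_polar, csqrt_eq_polar z, Complex.arg_real_mul _ hr', norm_mul, Complex.norm_real,
      Real.norm_of_nonneg hr, Real.sqrt_mul hr]
    push_cast
    ring

lemma csqrt_ofReal {r : ℝ} (hr : 0 ≤ r) : csqrt (r : ℂ) = (Real.sqrt r : ℂ) := by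
  rw [csqrt_eq_polar, Complex.arg_ofReal_of_nonneg hr, Complex.norm_real, Real.norm_of_nonneg hr]
  simp

lemma csqrt_neg_ofReal {r : ℝ} (hr : 0 ≤ r) :
    csqrt (-(r : ℂ)) = (Real.sqrt r : ℂ) * Complex.I := by
  rcases hr.eq_or_lt with rfl | hr'
  · simp [csqrt_zero]
  · rw [csqrt_eq_polar, ← Complex.ofReal_neg, Complex.arg_ofReal_of_neg (by linarith),
      Complex.norm_real, Real.norm_eq_abs, abs_neg, abs_of_pos hr']
    congr 1
    rw [Complex.exp_mul_I]
    norm_num [← Complex.ofReal_cos, ← Complex.ofReal_sin]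

lemma csqrt_conj {z : ℂ} (hz : z.arg ≠ Real.pi) :
    csqrt ((starRingEnd ℂ) z) = (starRingEnd ℂ) (csqrt z) := by
  rw [csqrt, Complex.conj_cpow _ _ hz, csqrt, map_inv₀, Complex.conj_ofNat]

lemma hasDerivAt_csqrt {z : ℂ} (hz : z ∈ Complex.slitPlane) :
    HasDerivAt csqrt (1 / (2 * csqrt z)) z := by
  have h := (hasDerivAt_id z).cpow_const (c := (2⁻¹ : ℂ)) hz
  have hz0 := Complex.slitPlane_ne_zero hz
  have hs := csqrt_ne_zero hz0
  refine h.congr_deriv ?_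
  have h2 : z ^ ((2⁻¹ : ℂ) - 1) = csqrt z / z := by
    rw [Complex.cpow_sub _ _ hz0, Complex.cpow_one, csqrt]
  simp only [id]
  rw [h2]
  nth_rewrite 2 [← csqrt_sq z]
  field_simp

lemma csqrt_re_pos {z : ℂ} (hz : z ∈ Complex.slitPlane) : 0 < (csqrt z).re := by
  rw [Complex.mem_slitPlane_iff_arg] at hz
  rw [← Complex.norm_mul_cos_arg, arg_csqrt, norm_csqrt]
  have h1 := Complex.neg_pi_lt_arg z
  have h2 := lt_of_le_of_ne (Complex.arg_le_pi z) hz.1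
  have := Real.cos_pos_of_mem_Ioo (x := z.arg / 2) ⟨by linarith, by linarith⟩
  have h3 : 0 < Real.sqrt ‖z‖ := Real.sqrt_pos.2 (norm_pos_iff.2 hz.2)
  positivity

lemma csqrt_im_pos {z : ℂ} (hz : 0 < z.im) : 0 < (csqrt z).im := by
  rw [← Complex.norm_mul_sin_arg, arg_csqrt, norm_csqrt]
  have h0 : z ≠ 0 := by rintro rfl; simp at hz
  have h1 : 0 < z.arg := by
    rcases (Complex.arg_nonneg_iff.2 hz.le).eq_or_lt with h | h
    · have := (Complex.arg_eq_zero_iff.1 h.symm).2; linarith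
    · exact h
  have := Real.sin_pos_of_pos_of_lt_pi (x := z.arg / 2) (by linarith)
    (by linarith [Complex.arg_le_pi z, Real.pi_pos])
  have h3 : 0 < Real.sqrt ‖z‖ := Real.sqrt_pos.2 (norm_pos_iff.2 h0)
  positivity

lemma mem_slitPlane_of_im_pos {z : ℂ} (hz : 0 < z.im) : z ∈ Complex.slitPlane :=
  Complex.mem_slitPlane_iff.2 (Or.inr hz.ne')

lemma continuousWithinAt_arg_upper {z : ℂ} (hz : z ≠ 0) :
    ContinuousWithinAt Complex.arg {z | 0 ≤ z.im} z := by
  by_cases h : z ∈ Complex.slitPlane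
  · exact (Complex.continuousAt_arg h).continuousWithinAt
  · rw [Complex.mem_slitPlane_iff, not_or, not_lt, not_not] at h
    refine Complex.continuousWithinAt_arg_of_re_neg_of_im_zero (lt_of_le_of_ne h.1 ?_) h.2
    intro h'
    exact hz (Complex.ext h' h.2)

/-- On the negative axis the principal branch takes its limit from above, so the cut is invisible
from the closed upper half plane. -/
lemma continuousOn_csqrt : ContinuousOn csqrt {z | 0 ≤ z.im} := by
  intro z hz
  rcases eq_or_ne z 0 with rfl | h0
  · rw [ContinuousWithinAt, csqrt_zero]
    apply tendsto_zero_iff_norm_tendsto_zero.2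
    simp only [norm_csqrt]
    have : Tendsto (fun z : ℂ => Real.sqrt ‖z‖) (𝓝 0) (𝓝 (Real.sqrt ‖(0 : ℂ)‖)) :=
      (Real.continuous_sqrt.comp continuous_norm).tendsto 0
    simp only [norm_zero, Real.sqrt_zero] at this
    exact this.mono_left nhdsWithin_le_nhds
  · have harg := continuousWithinAt_arg_upper h0
    have : csqrt = fun z => (Real.sqrt ‖z‖ : ℂ) * Complex.exp ((z.arg / 2 : ℝ) * Complex.I) :=
      funext csqrt_eq_polar
    rw [this]
    apply ContinuousWithinAt.mul
    · exact (Complex.continuous_ofReal.comp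
        (Real.continuous_sqrt.comp continuous_norm)).continuousWithinAt
    · apply Complex.continuous_exp.continuousAt.comp_continuousWithinAt
      apply ContinuousWithinAt.mul _ continuousWithinAt_const
      exact Complex.continuous_ofReal.continuousAt.comp_continuousWithinAt (harg.div_const 2)

/-- Reflection of the lower half plane into the upper one. -/
noncomputable def foldUp (z : ℂ) : ℂ := ⟨z.re, |z.im|⟩

lemma foldUp_of_nonneg {z : ℂ} (hz : 0 ≤ z.im) : foldUp z = z :=
  Complex.ext rfl (abs_of_nonneg hz)

lemma continuous_foldUp : Continuous foldUp := by
  have : foldUp = fun z : ℂ => (z.re : ℂ) + (|z.im| : ℝ) * Complex.I := by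
    funext z
    apply Complex.ext <;> simp [foldUp]
  rw [this]
  fun_prop

/-- A globally continuous extension of the root from the closed upper half plane, so that continuity
of parametric integrals applies with no restriction on the parameter. -/
lemma continuous_csqrt_foldUp : Continuous (fun z => csqrt (foldUp z)) :=
  continuousOn_csqrt.comp_continuous continuous_foldUp (fun z => abs_nonneg z.im)

/-! ### Arguments of points of the upper half plane -/

lemma im_exp_neg_mul (ψ : ℝ) (z : ℂ) :
    (Complex.exp (-ψ * Complex.I) * z).im = ‖z‖ * Real.sin (z.arg - ψ) := by
  have : -(ψ : ℂ) * Complex.I = ((-ψ : ℝ) : ℂ) * Complex.I := by push_cast; ring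
  rw [this, Complex.mul_im, Complex.exp_ofReal_mul_I_re, Complex.exp_ofReal_mul_I_im,
    Real.sin_sub, Real.cos_neg, Real.sin_neg]
  linear_combination Real.sin ψ * Complex.norm_mul_cos_arg z -
    Real.cos ψ * Complex.norm_mul_sin_arg z

lemma im_mul_conj (z u : ℂ) :
    (z * (starRingEnd ℂ) u).im = ‖z‖ * ‖u‖ * Real.sin (z.arg - u.arg) := by
  rw [Complex.mul_im, Complex.conj_re, Complex.conj_im, Real.sin_sub]
  have h1 := Complex.norm_mul_cos_arg z
  have h2 := Complex.norm_mul_sin_arg z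
  have h3 := Complex.norm_mul_cos_arg u
  have h4 := Complex.norm_mul_sin_arg u
  rw [← h1, ← h2, ← h3, ← h4]
  ring

lemma re_mul_conj (z u : ℂ) :
    (z * (starRingEnd ℂ) u).re = ‖z‖ * ‖u‖ * Real.cos (z.arg - u.arg) := by
  rw [Complex.mul_re, Complex.conj_re, Complex.conj_im, Real.cos_sub]
  have h1 := Complex.norm_mul_cos_arg z
  have h2 := Complex.norm_mul_sin_arg z
  have h3 := Complex.norm_mul_cos_arg u
  have h4 := Complex.norm_mul_sin_arg u
  rw [← h1, ← h2, ← h3, ← h4]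
  ring

lemma arg_pos_of_im_pos {z : ℂ} (hz : 0 < z.im) : 0 < z.arg := by
  rcases (Complex.arg_nonneg_iff.2 hz.le).eq_or_lt with h | h
  · have := (Complex.arg_eq_zero_iff.1 h.symm).2; linarith
  · exact h

lemma arg_lt_pi_of_im_pos {z : ℂ} (hz : 0 < z.im) : z.arg < Real.pi :=
  lt_of_le_of_ne (Complex.arg_le_pi z) (fun h => by
    have := (Complex.arg_eq_pi_iff.1 h).2; linarith)

lemma ne_zero_of_im_pos {z : ℂ} (hz : 0 < z.im) : z ≠ 0 := by
  rintro rfl; simp at hz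

lemma Real.pos_of_sin_pos {x : ℝ} (h : 0 < Real.sin x) (hx : -Real.pi ≤ x) : 0 < x := by
  by_contra hc
  have := Real.sin_nonpos_of_nonpos_of_neg_pi_le (not_lt.1 hc) hx
  linarith

/-- Comparison of arguments in the upper half plane. -/
lemma arg_lt_arg_iff {z u : ℂ} (hz : 0 < z.im) (hu : 0 < u.im) :
    u.arg < z.arg ↔ 0 < (z * (starRingEnd ℂ) u).im := by
  rw [im_mul_conj]
  have h1 := norm_pos_iff.2 (ne_zero_of_im_pos hz)
  have h2 := norm_pos_iff.2 (ne_zero_of_im_pos hu)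
  have := arg_pos_of_im_pos hz
  have := arg_pos_of_im_pos hu
  have := arg_lt_pi_of_im_pos hz
  have := arg_lt_pi_of_im_pos hu
  constructor
  · intro h
    have := Real.sin_pos_of_pos_of_lt_pi (x := z.arg - u.arg) (by linarith) (by linarith)
    positivity
  · intro h
    have := Real.pos_of_sin_pos (pos_of_mul_pos_right h (by positivity)) (by linarith)
    linarith

/-- Two half plane conditions cut out a sector. The only work is to exclude arguments on the wrong
side, which the strict signs of both sines forbid together. -/
lemma arg_between {z : ℂ} {ψ₁ ψ₂ : ℝ} (h0 : 0 ≤ ψ₁) (h12 : ψ₁ ≤ ψ₂) (hpi : ψ₂ ≤ Real.pi)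
    (h1 : 0 < (Complex.exp (-ψ₁ * Complex.I) * z).im)
    (h2 : (Complex.exp (-ψ₂ * Complex.I) * z).im < 0) : ψ₁ < z.arg ∧ z.arg < ψ₂ := by
  rw [im_exp_neg_mul] at h1 h2
  have hn := norm_nonneg z
  have s1 := pos_of_mul_pos_right h1 hn
  have s2 : 0 < Real.sin (ψ₂ - z.arg) := by
    rw [← neg_sub, Real.sin_neg]
    by_contra hc
    have := mul_nonneg hn (show 0 ≤ Real.sin (z.arg - ψ₂) by linarith)
    linarith
  have a1 := Complex.neg_pi_lt_arg z
  have a2 := Complex.arg_le_pi z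
  have key : ψ₁ < z.arg := by
    by_contra hc
    push Not at hc
    have b1 : z.arg - ψ₁ < -Real.pi := by
      by_contra hd
      have := Real.pos_of_sin_pos s1 (by linarith)
      linarith
    have b2 : ψ₂ - z.arg < Real.pi := by
      by_contra hd
      push Not at hd
      have : Real.sin (ψ₂ - z.arg - 2 * Real.pi) ≤ 0 :=
        Real.sin_nonpos_of_nonpos_of_neg_pi_le (by linarith) (by linarith)
      rw [Real.sin_sub_two_pi] at this
      linarith
    linarith
  refine ⟨key, ?_⟩
  have := Real.pos_of_sin_pos s2 (by linarith)
  linarith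

/-- The argument of an integral lies strictly between bounds for the argument of the integrand. -/
lemma arg_integral_between {f : ℝ → ℂ} {ψ₁ ψ₂ a b : ℝ} (hab : a < b)
    (hf : ContinuousOn f (Icc a b)) (h0 : 0 ≤ ψ₁) (h12 : ψ₁ ≤ ψ₂) (hpi : ψ₂ ≤ Real.pi)
    (hb : ∀ t ∈ Ioo a b, ψ₁ < (f t).arg ∧ (f t).arg < ψ₂) :
    ψ₁ < (∫ t in a..b, f t).arg ∧ (∫ t in a..b, f t).arg < ψ₂ := by
  have hne : ∀ t ∈ Ioo a b, 0 < ‖f t‖ := by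
    intro t ht
    apply norm_pos_iff.2
    intro h
    have := (hb t ht).1
    rw [h, Complex.arg_zero] at this
    linarith
  have hint : IntervalIntegrable f MeasureTheory.volume a b :=
    ContinuousOn.intervalIntegrable (by rwa [uIcc_of_le hab.le])
  -- A sector of opening at most π is an intersection of half planes, and each half plane is a
  -- linear condition that passes through the integral.
  have rot : ∀ ψ : ℝ, (Complex.exp (-ψ * Complex.I) * ∫ t in a..b, f t).im =
      ∫ t in a..b, (Complex.exp (-ψ * Complex.I) * f t).im := by
    intro ψ
    rw [← intervalIntegral.integral_const_mul]
    have := Complex.imCLM.intervalIntegral_comp_comm (hint.const_mul (Complex.exp (-ψ * Complex.I)))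
    simpa using this.symm
  have hcont : ∀ ψ : ℝ, ContinuousOn (fun t => (Complex.exp (-ψ * Complex.I) * f t).im)
      (Icc a b) := fun ψ =>
    Complex.continuous_im.comp_continuousOn (continuousOn_const.mul hf)
  apply arg_between h0 h12 hpi
  · rw [rot]
    apply intervalIntegral.intervalIntegral_pos_of_pos_on _ _ hab
    · exact ContinuousOn.intervalIntegrable (by rw [uIcc_of_le hab.le]; exact hcont _)
    · intro t ht
      rw [im_exp_neg_mul]
      exact mul_pos (hne t ht) (Real.sin_pos_of_pos_of_lt_pi (by linarith [(hb t ht).1])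
        (by linarith [(hb t ht).2]))
  · rw [rot, ← neg_pos, ← intervalIntegral.integral_neg]
    apply intervalIntegral.intervalIntegral_pos_of_pos_on _ _ hab
    · exact ContinuousOn.intervalIntegrable (by rw [uIcc_of_le hab.le]; exact (hcont _).neg)
    · intro t ht
      rw [im_exp_neg_mul, ← mul_neg, ← Real.sin_neg]
      exact mul_pos (hne t ht) (Real.sin_pos_of_pos_of_lt_pi (by linarith [(hb t ht).2])
        (by linarith [(hb t ht).1]))

lemma arg_add_real_lt {z : ℂ} {r : ℝ} (hz : 0 < z.im) (hr : 0 < r) : (z + r).arg < z.arg := by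
  rw [arg_lt_arg_iff hz (by simpa using hz)]
  simp
  nlinarith

/-! ### Integrals of square roots depending on a parameter -/

lemma pi_div_two_pos' : (0 : ℝ) < Real.pi / 2 := by positivity

/-- Differentiation under the integral sign: by compactness the argument of the root stays in the
slit plane for all parameters near `z₀`, where the derivative is bounded. -/
lemma hasDerivAt_integral_csqrt {φ p q : ℝ → ℝ} (hφ : Continuous φ) (hp : Continuous p)
    (hq : Continuous q) {a b : ℝ} (hab : a ≤ b) {z₀ : ℂ}
    (hz : ∀ t ∈ Icc a b, (p t + q t * z₀ : ℂ) ∈ Complex.slitPlane) :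
    HasDerivAt (fun z : ℂ => ∫ t in a..b, (φ t : ℂ) * csqrt (p t + q t * z))
      (∫ t in a..b, (φ t : ℂ) * (q t / (2 * csqrt (p t + q t * z₀)))) z₀ := by
  have hcont : Continuous (fun x : ℂ × ℝ => (p x.2 + q x.2 * x.1 : ℂ)) := by fun_prop
  have hev : ∀ᶠ z in 𝓝 z₀, ∀ t ∈ Icc a b, (p t + q t * z : ℂ) ∈ Complex.slitPlane := by
    apply isCompact_Icc.eventually_forall_of_forall_eventually
    intro t ht
    exact hcont.continuousAt.eventually (Complex.isOpen_slitPlane.mem_nhds (hz t ht))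
  obtain ⟨ε, hε, hball⟩ := Metric.eventually_nhds_iff_ball.1 hev
  have hs : Metric.closedBall z₀ (ε / 2) ∈ 𝓝 z₀ := Metric.closedBall_mem_nhds _ (by positivity)
  have hmem : ∀ z ∈ Metric.closedBall z₀ (ε / 2), ∀ t ∈ Icc a b,
      (p t + q t * z : ℂ) ∈ Complex.slitPlane := fun z hz' =>
    hball z (Metric.closedBall_subset_ball (by linarith) hz')
  have hS : ∀ z ∈ Complex.slitPlane, ContinuousAt csqrt z := fun z hz' =>
    (hasDerivAt_csqrt hz').continuousAt
  have hF : ∀ z ∈ Metric.closedBall z₀ (ε / 2),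
      ContinuousOn (fun t => (φ t : ℂ) * csqrt (p t + q t * z)) (Icc a b) := by
    intro z hz' t ht
    apply ContinuousAt.continuousWithinAt
    have : Continuous (fun t : ℝ => (p t + q t * z : ℂ)) := by fun_prop
    exact ContinuousAt.mul (by fun_prop)
      (ContinuousAt.comp (f := fun t : ℝ => (p t + q t * z : ℂ)) (hS _ (hmem z hz' t ht))
        this.continuousAt)
  have hF' : ContinuousOn
      (fun x : ℂ × ℝ => (φ x.2 : ℂ) * (q x.2 / (2 * csqrt (p x.2 + q x.2 * x.1))))
      (Metric.closedBall z₀ (ε / 2) ×ˢ Icc a b) := by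
    intro x hx
    apply ContinuousAt.continuousWithinAt
    have h1 := hmem x.1 hx.1 x.2 hx.2
    have h2 : ContinuousAt (fun x : ℂ × ℝ => csqrt (p x.2 + q x.2 * x.1)) x :=
      ContinuousAt.comp (f := fun x : ℂ × ℝ => (p x.2 + q x.2 * x.1 : ℂ)) (hS _ h1)
        hcont.continuousAt
    have h3 : 2 * csqrt (p x.2 + q x.2 * x.1) ≠ 0 :=
      mul_ne_zero two_ne_zero (csqrt_ne_zero (Complex.slitPlane_ne_zero h1))
    exact ContinuousAt.mul (by fun_prop) (ContinuousAt.div (by fun_prop) (h2.const_mul 2) h3)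
  obtain ⟨C, hC⟩ := ((isCompact_closedBall z₀ (ε / 2)).prod isCompact_Icc).exists_bound_of_continuousOn
    hF'
  have hz0 : z₀ ∈ Metric.closedBall z₀ (ε / 2) := Metric.mem_closedBall_self (by positivity)
  have hsub : uIoc a b ⊆ Icc a b := by rw [uIoc_of_le hab]; exact Ioc_subset_Icc_self
  refine (intervalIntegral.hasDerivAt_integral_of_dominated_loc_of_deriv_le (s :=
    Metric.closedBall z₀ (ε / 2)) (F := fun z t => (φ t : ℂ) * csqrt (p t + q t * z))
    (F' := fun z t => (φ t : ℂ) * (q t / (2 * csqrt (p t + q t * z)))) (bound := fun _ => C)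
    hs ?_ ?_ ?_ ?_ ?_ ?_).2
  · filter_upwards [hs] with z hz'
    exact ((hF z hz').mono hsub).aestronglyMeasurable measurableSet_uIoc
  · exact ContinuousOn.intervalIntegrable (by rw [uIcc_of_le hab]; exact hF z₀ hz0)
  · refine ContinuousOn.aestronglyMeasurable ?_ measurableSet_uIoc
    exact hF'.comp (f := fun t : ℝ => (z₀, t)) (by fun_prop) (fun t ht => ⟨hz0, hsub ht⟩)
  · exact Eventually.of_forall fun t ht z hz' => hC (z, t) ⟨hz', hsub ht⟩
  · exact intervalIntegrable_const
  · refine Eventually.of_forall fun t ht z hz' => ?_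
    have h1 : HasDerivAt (fun z : ℂ => (p t + q t * z : ℂ)) (q t) z := by
      simpa using ((hasDerivAt_id z).const_mul (q t : ℂ)).const_add (p t : ℂ)
    have h2 := (hasDerivAt_csqrt (hmem z hz' t (hsub ht))).comp z h1
    refine (h2.const_mul (φ t : ℂ)).congr_deriv ?_
    ring

/-- `∫₀¹ √(τ(1-τ)) √(2+τw) dτ`, in the variable `τ = sin² t`. -/
noncomputable def gInt (w : ℂ) : ℂ :=
  ∫ t in (0 : ℝ)..(Real.pi / 2), ((2 * Real.sin t ^ 2 * Real.cos t ^ 2 : ℝ) : ℂ) *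
    csqrt ((2 : ℝ) + (Real.sin t ^ 2 : ℝ) * w)

/-- `∫₀¹ √(τ/(1-τ)) √(2+τw) dτ`, in the variable `τ = sin² t`. -/
noncomputable def hInt (w : ℂ) : ℂ :=
  ∫ t in (0 : ℝ)..(Real.pi / 2), ((2 * Real.sin t ^ 2 : ℝ) : ℂ) *
    csqrt ((2 : ℝ) + (Real.sin t ^ 2 : ℝ) * w)

/-- `∫₋₁¹ √(1-x²) √(a-x) dx`, in the variable `x = 2 sin² t - 1`. -/
noncomputable def periodMid (a : ℂ) : ℂ :=
  ∫ t in (0 : ℝ)..(Real.pi / 2), ((8 * Real.sin t ^ 2 * Real.cos t ^ 2 : ℝ) : ℂ) *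
    csqrt ((1 - 2 * Real.sin t ^ 2 : ℝ) + (1 : ℝ) * a)

/-- The point is the convex combination of `2` and `w + 2` with weights cos² t and sin² t, and the
slit plane is star-shaped about `2`. -/
lemma two_add_mem_slitPlane {w : ℂ} (hw : w + 2 ∈ Complex.slitPlane) (t : ℝ) :
    ((2 : ℝ) + (Real.sin t ^ 2 : ℝ) * w : ℂ) ∈ Complex.slitPlane := by
  have hs := Real.sin_sq_add_cos_sq t
  have h1 := sq_nonneg (Real.sin t)
  have h2 := sq_nonneg (Real.cos t)
  rcases h1.eq_or_lt with h | h
  · rw [← h]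
    left; norm_num
  · rw [Complex.mem_slitPlane_iff] at hw ⊢
    have e1 : ((2 : ℝ) + (Real.sin t ^ 2 : ℝ) * w : ℂ).re =
        Real.sin t ^ 2 * (w + 2).re + 2 * Real.cos t ^ 2 := by
      rw [Complex.add_re, Complex.re_ofReal_mul, Complex.ofReal_re, Complex.add_re]
      norm_num
      linarith
    have e2 : ((2 : ℝ) + (Real.sin t ^ 2 : ℝ) * w : ℂ).im = Real.sin t ^ 2 * (w + 2).im := by
      rw [Complex.add_im, Complex.im_ofReal_mul, Complex.ofReal_im, Complex.add_im]
      norm_num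
    rw [e1, e2]
    rcases hw with hw | hw
    · left; positivity
    · right; exact mul_ne_zero h.ne' hw

lemma continuous_two_add_csqrt {w : ℂ} (hw : w + 2 ∈ Complex.slitPlane) :
    Continuous (fun t : ℝ => csqrt ((2 : ℝ) + (Real.sin t ^ 2 : ℝ) * w)) := by
  rw [continuous_iff_continuousAt]
  intro t
  exact ContinuousAt.comp (f := fun t : ℝ => ((2 : ℝ) + (Real.sin t ^ 2 : ℝ) * w : ℂ))
    (hasDerivAt_csqrt (two_add_mem_slitPlane hw t)).continuousAt (by fun_prop)

/-- The total derivative behind the two differential equations for `gInt` and `hInt`. -/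
lemma integral_total_deriv {w : ℂ} (hw : w + 2 ∈ Complex.slitPlane) :
    ∫ t in (0 : ℝ)..(Real.pi / 2),
      ((3 * Real.sin t ^ 2 * Real.cos t ^ 2 - Real.sin t ^ 4 : ℝ) *
        csqrt ((2 : ℝ) + (Real.sin t ^ 2 : ℝ) * w) +
      w * ((Real.sin t ^ 4 * Real.cos t ^ 2 : ℝ) /
        csqrt ((2 : ℝ) + (Real.sin t ^ 2 : ℝ) * w)) : ℂ) = 0 := by
  have hS := continuous_two_add_csqrt hw
  have hne : ∀ t : ℝ, csqrt ((2 : ℝ) + (Real.sin t ^ 2 : ℝ) * w) ≠ 0 := fun t =>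
    csqrt_ne_zero (Complex.slitPlane_ne_zero (two_add_mem_slitPlane hw t))
  -- The primitive sin³t cos t √(2 + w sin²t), that is τ^{3/2} (1-τ)^{1/2} √(2+τw), vanishes at both
  -- ends.
  rw [intervalIntegral.integral_eq_sub_of_hasDerivAt
    (f := fun t : ℝ => ((Real.sin t ^ 3 * Real.cos t : ℝ) : ℂ) *
      csqrt ((2 : ℝ) + (Real.sin t ^ 2 : ℝ) * w))]
  · simp
  · intro t _
    have h1 : HasDerivAt (fun t : ℝ => ((Real.sin t ^ 3 * Real.cos t : ℝ) : ℂ))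
        ((3 * Real.sin t ^ 2 * Real.cos t * Real.cos t + Real.sin t ^ 3 * (-Real.sin t) : ℝ) : ℂ) t
        := by
      apply HasDerivAt.ofReal_comp
      simpa using ((Real.hasDerivAt_sin t).fun_pow 3).fun_mul (Real.hasDerivAt_cos t)
    have h2 : HasDerivAt (fun t : ℝ => ((2 : ℝ) + (Real.sin t ^ 2 : ℝ) * w : ℂ))
        ((2 * Real.sin t * Real.cos t : ℝ) * w) t := by
      have : HasDerivAt (fun t : ℝ => ((Real.sin t ^ 2 : ℝ) : ℂ))
          ((2 * Real.sin t * Real.cos t : ℝ) : ℂ) t := by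
        apply HasDerivAt.ofReal_comp
        simpa using (Real.hasDerivAt_sin t).fun_pow 2
      exact (this.mul_const w).const_add _
    have h3 := (hasDerivAt_csqrt (two_add_mem_slitPlane hw t)).comp t h2
    refine (h1.mul h3).congr_deriv ?_
    have := hne t
    simp only [Function.comp]
    push_cast at this ⊢
    field_simp
    ring
  · apply Continuous.intervalIntegrable
    refine Continuous.add (Continuous.mul (by fun_prop) hS) (Continuous.mul (by fun_prop)
      (Continuous.div (by fun_prop) hS hne))

/-- The derivative is not expressed as a quotient because `w = 0` is allowed; only the relation for
`w * d` is needed later. -/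
lemma hasDerivAt_gInt {w : ℂ} (hw : w + 2 ∈ Complex.slitPlane) :
    ∃ d, HasDerivAt gInt d w ∧ w * d = hInt w / 2 - 2 * gInt w := by
  have hS := continuous_two_add_csqrt hw
  have hne : ∀ t : ℝ, csqrt ((2 : ℝ) + (Real.sin t ^ 2 : ℝ) * w) ≠ 0 := fun t =>
    csqrt_ne_zero (Complex.slitPlane_ne_zero (two_add_mem_slitPlane hw t))
  refine ⟨_, hasDerivAt_integral_csqrt (φ := fun t => 2 * Real.sin t ^ 2 * Real.cos t ^ 2)
    (p := fun _ => 2) (q := fun t => Real.sin t ^ 2) (by fun_prop) (by fun_prop) (by fun_prop)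
    pi_div_two_pos'.le (fun t _ => two_add_mem_slitPlane hw t), ?_⟩
  -- The two sides differ by exactly the integral of the total derivative, so the integrands can be
  -- compared pointwise.
  rw [gInt, hInt, ← sub_eq_zero, ← integral_total_deriv hw, sub_sub_eq_add_sub,
    ← intervalIntegral.integral_const_mul,
    ← intervalIntegral.integral_const_mul, ← intervalIntegral.integral_div,
    ← intervalIntegral.integral_add, ← intervalIntegral.integral_sub]
  · refine intervalIntegral.integral_congr fun t _ => ?_
    have := hne t
    have hc : (Real.cos t : ℂ) ^ 2 = 1 - (Real.sin t : ℂ) ^ 2 := by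
      rw [← Complex.ofReal_pow, Real.cos_sq']; push_cast; ring
    push_cast at this hc ⊢
    rw [hc]
    field_simp
    ring
  all_goals apply Continuous.intervalIntegrable
  · refine Continuous.add (Continuous.mul (by fun_prop) (Continuous.mul (by fun_prop)
      (Continuous.div (by fun_prop) (hS.const_mul 2) fun t => mul_ne_zero two_ne_zero (hne t))))
      (Continuous.mul (by fun_prop) (Continuous.mul (by fun_prop) hS))
  · exact (Continuous.mul (by fun_prop) hS).div_const 2
  · exact (Continuous.mul (by fun_prop) (Continuous.mul (by fun_prop)
      (Continuous.div (by fun_prop) (hS.const_mul 2) fun t => mul_ne_zero two_ne_zero (hne t))))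
  · exact (Continuous.mul (by fun_prop) (Continuous.mul (by fun_prop) hS))

lemma hasDerivAt_hInt {w : ℂ} (hw : w + 2 ∈ Complex.slitPlane) :
    HasDerivAt hInt ((hInt w - 5 / 2 * gInt w) / (w + 2)) w := by
  have hS := continuous_two_add_csqrt hw
  have hne : ∀ t : ℝ, csqrt ((2 : ℝ) + (Real.sin t ^ 2 : ℝ) * w) ≠ 0 := fun t =>
    csqrt_ne_zero (Complex.slitPlane_ne_zero (two_add_mem_slitPlane hw t))
  have h := hasDerivAt_integral_csqrt (φ := fun t => 2 * Real.sin t ^ 2)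
    (p := fun _ => 2) (q := fun t => Real.sin t ^ 2) (by fun_prop) (by fun_prop) (by fun_prop)
    pi_div_two_pos'.le (fun t _ => two_add_mem_slitPlane hw t)
  refine h.congr_deriv ?_
  rw [eq_div_iff (Complex.slitPlane_ne_zero hw)]
  rw [gInt, hInt, ← sub_eq_zero, ← integral_total_deriv hw, sub_sub_eq_add_sub,
    ← intervalIntegral.integral_mul_const,
    ← intervalIntegral.integral_const_mul,
    ← intervalIntegral.integral_add, ← intervalIntegral.integral_sub]
  · refine intervalIntegral.integral_congr fun t _ => ?_
    have := hne t
    have hsq := csqrt_sq ((2 : ℝ) + (Real.sin t ^ 2 : ℝ) * w)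
    have hc : (Real.cos t : ℂ) ^ 2 = 1 - (Real.sin t : ℂ) ^ 2 := by
      rw [← Complex.ofReal_pow, Real.cos_sq']; push_cast; ring
    push_cast at this hc hsq ⊢
    rw [hc]
    field_simp
    linear_combination (-Complex.sin t ^ 4) * hsq
  all_goals apply Continuous.intervalIntegrable
  · refine Continuous.add (Continuous.mul (Continuous.mul (by fun_prop)
      (Continuous.div (by fun_prop) (hS.const_mul 2) fun t => mul_ne_zero two_ne_zero (hne t)))
      (by fun_prop))
      (Continuous.mul (by fun_prop) (Continuous.mul (by fun_prop) hS))
  · exact (Continuous.mul (by fun_prop) hS)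
  · exact (Continuous.mul (Continuous.mul (by fun_prop)
      (Continuous.div (by fun_prop) (hS.const_mul 2) fun t => mul_ne_zero two_ne_zero (hne t)))
      (by fun_prop))
  · exact (Continuous.mul (by fun_prop) (Continuous.mul (by fun_prop) hS))

/-! ### Continuity up to the real axis, real values, complex conjugation -/

lemma continuous_integral_csqrt_foldUp {φ p q : ℝ → ℝ} (hφ : Continuous φ) (hp : Continuous p)
    (hq : Continuous q) (a b : ℝ) :
    Continuous (fun z : ℂ => ∫ t in a..b, (φ t : ℂ) * csqrt (foldUp (p t + q t * z))) := by
  apply intervalIntegral.continuous_parametric_intervalIntegral_of_continuous'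
  have h : Continuous (fun x : ℂ × ℝ => csqrt (foldUp (p x.2 + q x.2 * x.1))) :=
    continuous_csqrt_foldUp.comp (by fun_prop)
  exact Continuous.mul (by fun_prop) h

lemma continuousOn_integral_csqrt {φ p q : ℝ → ℝ} (hφ : Continuous φ) (hp : Continuous p)
    (hq : Continuous q) (hq0 : ∀ t, 0 ≤ q t) (a b : ℝ) :
    ContinuousOn (fun z : ℂ => ∫ t in a..b, (φ t : ℂ) * csqrt (p t + q t * z))
      {z | 0 ≤ z.im} := by
  refine (continuous_integral_csqrt_foldUp hφ hp hq a b).continuousOn.congr fun z hz => ?_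
  refine intervalIntegral.integral_congr fun t _ => ?_
  rw [foldUp_of_nonneg]
  rw [Complex.add_im, Complex.ofReal_im, Complex.im_ofReal_mul, zero_add]
  exact mul_nonneg (hq0 t) hz

lemma continuousOn_gInt : ContinuousOn gInt {z | 0 ≤ z.im} :=
  continuousOn_integral_csqrt (φ := fun t => 2 * Real.sin t ^ 2 * Real.cos t ^ 2)
    (p := fun _ => 2) (q := fun t => Real.sin t ^ 2) (by fun_prop) (by fun_prop) (by fun_prop)
    (fun t => sq_nonneg _) _ _

lemma continuousOn_hInt : ContinuousOn hInt {z | 0 ≤ z.im} :=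
  continuousOn_integral_csqrt (φ := fun t => 2 * Real.sin t ^ 2)
    (p := fun _ => 2) (q := fun t => Real.sin t ^ 2) (by fun_prop) (by fun_prop) (by fun_prop)
    (fun t => sq_nonneg _) _ _

lemma continuousOn_periodMid : ContinuousOn periodMid {z | 0 ≤ z.im} :=
  continuousOn_integral_csqrt (φ := fun t => 8 * Real.sin t ^ 2 * Real.cos t ^ 2)
    (p := fun t => 1 - 2 * Real.sin t ^ 2) (q := fun _ => 1) (by fun_prop) (by fun_prop)
    (by fun_prop) (fun t => zero_le_one) _ _

lemma gInt_conj {w : ℂ} (hw : w + 2 ∈ Complex.slitPlane) :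
    gInt ((starRingEnd ℂ) w) = (starRingEnd ℂ) (gInt w) := by
  rw [gInt, gInt, intervalIntegral, intervalIntegral, map_sub, ← integral_conj, ← integral_conj]
  simp only [map_mul, Complex.conj_ofReal]
  have : ∀ t : ℝ, csqrt ((2 : ℝ) + (Real.sin t ^ 2 : ℝ) * (starRingEnd ℂ) w) =
      (starRingEnd ℂ) (csqrt ((2 : ℝ) + (Real.sin t ^ 2 : ℝ) * w)) := fun t => by
    rw [← csqrt_conj ((Complex.mem_slitPlane_iff_arg.1 (two_add_mem_slitPlane hw t)).1), map_add,
      map_mul, Complex.conj_ofReal, Complex.conj_ofReal]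
  simp only [this]

lemma hInt_conj {w : ℂ} (hw : w + 2 ∈ Complex.slitPlane) :
    hInt ((starRingEnd ℂ) w) = (starRingEnd ℂ) (hInt w) := by
  rw [hInt, hInt, intervalIntegral, intervalIntegral, map_sub, ← integral_conj, ← integral_conj]
  simp only [map_mul, Complex.conj_ofReal]
  have : ∀ t : ℝ, csqrt ((2 : ℝ) + (Real.sin t ^ 2 : ℝ) * (starRingEnd ℂ) w) =
      (starRingEnd ℂ) (csqrt ((2 : ℝ) + (Real.sin t ^ 2 : ℝ) * w)) := fun t => by
    rw [← csqrt_conj ((Complex.mem_slitPlane_iff_arg.1 (two_add_mem_slitPlane hw t)).1), map_add,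
      map_mul, Complex.conj_ofReal, Complex.conj_ofReal]
  simp only [this]

lemma sin_cos_pos {t : ℝ} (ht : t ∈ Ioo 0 (Real.pi / 2)) : 0 < Real.sin t ∧ 0 < Real.cos t :=
  ⟨Real.sin_pos_of_pos_of_lt_pi ht.1 (by linarith [ht.2, Real.pi_pos]),
    Real.cos_pos_of_mem_Ioo ⟨by linarith [ht.1, Real.pi_pos], ht.2⟩⟩

lemma integral_csqrt_ofReal {φ p : ℝ → ℝ} (hφ : Continuous φ) (hp : Continuous p)
    (hφ0 : ∀ t ∈ Ioo 0 (Real.pi / 2), 0 < φ t)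
    (hp0 : ∀ t ∈ Ioo 0 (Real.pi / 2), 0 < p t) :
    ∃ r : ℝ, 0 < r ∧ ∫ t in (0 : ℝ)..(Real.pi / 2), (φ t : ℂ) * csqrt (p t) = r := by
  have hc : Continuous fun t => φ t * Real.sqrt (p t) := hφ.mul (Real.continuous_sqrt.comp hp)
  refine ⟨∫ t in (0 : ℝ)..(Real.pi / 2), φ t * Real.sqrt (p t), ?_, ?_⟩
  · exact intervalIntegral.intervalIntegral_pos_of_pos_on (hc.intervalIntegrable _ _)
      (fun t ht => mul_pos (hφ0 t ht) (Real.sqrt_pos.2 (hp0 t ht))) pi_div_two_pos'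
  · rw [← intervalIntegral.integral_ofReal]
    rw [intervalIntegral.integral_of_le pi_div_two_pos'.le,
      intervalIntegral.integral_of_le pi_div_two_pos'.le, MeasureTheory.integral_Ioc_eq_integral_Ioo,
      MeasureTheory.integral_Ioc_eq_integral_Ioo]
    refine MeasureTheory.setIntegral_congr_fun measurableSet_Ioo fun t ht => ?_
    rw [csqrt_ofReal (hp0 t ht).le, Complex.ofReal_mul]

lemma two_add_sin_sq_pos {x t : ℝ} (hx : -2 ≤ x) (ht : t ∈ Ioo 0 (Real.pi / 2)) :
    0 < 2 + Real.sin t ^ 2 * x := by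
  have := sin_cos_pos ht
  have h := Real.sin_sq_add_cos_sq t
  have h1 : 0 < Real.sin t ^ 2 := by nlinarith
  have h2 : 0 < Real.cos t ^ 2 := by nlinarith
  nlinarith

lemma gInt_ofReal {x : ℝ} (hx : -2 ≤ x) : ∃ r : ℝ, 0 < r ∧ gInt x = r := by
  obtain ⟨r, hr, h⟩ := integral_csqrt_ofReal
    (φ := fun t => 2 * Real.sin t ^ 2 * Real.cos t ^ 2) (p := fun t => 2 + Real.sin t ^ 2 * x)
    (by fun_prop) (by fun_prop) (fun t ht => by obtain ⟨h1, h2⟩ := sin_cos_pos ht; positivity)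
    (fun t ht => two_add_sin_sq_pos hx ht)
  refine ⟨r, hr, ?_⟩
  rw [← h, gInt]
  simp only [Complex.ofReal_add, Complex.ofReal_mul]

lemma hInt_ofReal {x : ℝ} (hx : -2 ≤ x) : ∃ r : ℝ, 0 < r ∧ hInt x = r := by
  obtain ⟨r, hr, h⟩ := integral_csqrt_ofReal
    (φ := fun t => 2 * Real.sin t ^ 2) (p := fun t => 2 + Real.sin t ^ 2 * x)
    (by fun_prop) (by fun_prop) (fun t ht => by have := sin_cos_pos ht; have := this.1; positivity)
    (fun t ht => two_add_sin_sq_pos hx ht)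
  refine ⟨r, hr, ?_⟩
  rw [← h, hInt]
  simp only [Complex.ofReal_add, Complex.ofReal_mul]

/-! ### The differential equation of the periods -/

lemma csqrt_mul {z u : ℂ} (hz : z ≠ 0) (hu : u ≠ 0)
    (h : z.arg + u.arg ∈ Ioc (-Real.pi) Real.pi) : csqrt (z * u) = csqrt z * csqrt u := by
  rw [csqrt_eq_polar, csqrt_eq_polar z, csqrt_eq_polar u, (Complex.arg_mul_eq_add_arg_iff hz hu).2 h,
    norm_mul, Real.sqrt_mul (norm_nonneg z), add_div, Complex.ofReal_add, add_mul,
    Complex.exp_add]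
  push_cast
  ring

/-- `∫ 4 sin² cos² / √(a - x)`, the derivative of `periodMid`. -/
lemma hasDerivAt_periodMid {a : ℂ} (ha : 0 < a.im) :
    HasDerivAt periodMid (∫ t in (0 : ℝ)..(Real.pi / 2),
      ((8 * Real.sin t ^ 2 * Real.cos t ^ 2 : ℝ) : ℂ) *
      ((1 : ℝ) / (2 * csqrt ((1 - 2 * Real.sin t ^ 2 : ℝ) + (1 : ℝ) * a)))) a :=
  hasDerivAt_integral_csqrt (φ := fun t => 8 * Real.sin t ^ 2 * Real.cos t ^ 2)
    (p := fun t => 1 - 2 * Real.sin t ^ 2) (q := fun _ => 1) (by fun_prop) (by fun_prop)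
    (by fun_prop) pi_div_two_pos'.le
    (fun t _ => mem_slitPlane_of_im_pos (by
      rwa [Complex.add_im, Complex.ofReal_im, Complex.im_ofReal_mul, zero_add, one_mul]))

lemma im_neg_four_div {v : ℂ} (hv : 0 < v.im) : 0 < (-4 / v).im := by
  have h0 := Complex.normSq_pos.2 (ne_zero_of_im_pos hv)
  rw [Complex.div_im, Complex.neg_im, Complex.neg_re, Complex.im_ofNat, Complex.re_ofNat]
  rw [show -0 * v.re / Complex.normSq v - -4 * v.im / Complex.normSq v =
    4 * v.im / Complex.normSq v by ring]
  positivity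

lemma im_mul_eq (z u : ℂ) : (z * u).im = ‖z‖ * ‖u‖ * Real.sin (z.arg + u.arg) := by
  rw [Complex.mul_im, Real.sin_add]
  have h1 := Complex.norm_mul_cos_arg z
  have h2 := Complex.norm_mul_sin_arg z
  have h3 := Complex.norm_mul_cos_arg u
  have h4 := Complex.norm_mul_sin_arg u
  rw [← h1, ← h2, ← h3, ← h4]
  ring

lemma arg_add_arg_lt_pi {z u : ℂ} (hz : 0 < z.im) (hu : 0 < u.im) (h : 0 < (z * u).im) :
    z.arg + u.arg < Real.pi := by
  rw [im_mul_eq] at h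
  have h1 := pos_of_mul_pos_right h (by positivity)
  by_contra hc
  have := Real.sin_nonpos_of_nonpos_of_neg_pi_le (x := z.arg + u.arg - 2 * Real.pi)
    (by linarith [arg_lt_pi_of_im_pos hz, arg_lt_pi_of_im_pos hu]) (by linarith)
  rw [Real.sin_sub_two_pi] at this
  linarith

/-- Factor a - x = ((a+1)/2)·(2 - 4 sin²t/(a+1)). Both factors and the product lie in the upper half
plane, so the arguments add without wrapping and the root is multiplicative. The equations of g and
h thus become available for F. -/
lemma periodMid_eq_gInt {a : ℂ} (ha : 0 < a.im) :
    periodMid a = 4 * (csqrt ((a + 1) / 2) * gInt (-4 / (a + 1))) := by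
  have hv : 0 < (a + 1).im := by simpa using ha
  have hv0 := ne_zero_of_im_pos hv
  rw [periodMid, gInt, ← intervalIntegral.integral_const_mul, ← intervalIntegral.integral_const_mul]
  rw [intervalIntegral.integral_of_le pi_div_two_pos'.le,
      intervalIntegral.integral_of_le pi_div_two_pos'.le, MeasureTheory.integral_Ioc_eq_integral_Ioo,
      MeasureTheory.integral_Ioc_eq_integral_Ioo]
  refine MeasureTheory.setIntegral_congr_fun measurableSet_Ioo fun t ht => ?_
  have hs := (sin_cos_pos ht).1
  have hx := im_neg_four_div hv
  have hu : 0 < ((2 : ℝ) + (Real.sin t ^ 2 : ℝ) * (-4 / (a + 1)) : ℂ).im := by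
    rw [Complex.add_im, Complex.im_ofReal_mul, Complex.ofReal_im, zero_add]
    positivity
  have hz : 0 < ((a + 1) / 2).im := by
    rw [show (a + 1) / 2 = ((1 / 2 : ℝ) : ℂ) * (a + 1) by push_cast; ring, Complex.im_ofReal_mul]
    positivity
  have hprod : ((1 - 2 * Real.sin t ^ 2 : ℝ) + (1 : ℝ) * a : ℂ) =
      (a + 1) / 2 * ((2 : ℝ) + (Real.sin t ^ 2 : ℝ) * (-4 / (a + 1))) := by
    field_simp
    push_cast
    ring
  have him : 0 < ((a + 1) / 2 * ((2 : ℝ) + (Real.sin t ^ 2 : ℝ) * (-4 / (a + 1)))).im := by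
    rw [← hprod, Complex.add_im, Complex.im_ofReal_mul, Complex.ofReal_im, zero_add]
    linarith
  rw [hprod, csqrt_mul (ne_zero_of_im_pos hz) (ne_zero_of_im_pos hu)
    ⟨by linarith [Real.pi_pos, arg_pos_of_im_pos hz, arg_pos_of_im_pos hu],
      (arg_add_arg_lt_pi hz hu him).le⟩]
  push_cast
  ring

/-- `y` solves `(a² - 1) y'' - 2 a y' + (5/4) y = 0` on the upper half plane, and `u = y'`. -/
structure IsPeriod (y u : ℂ → ℂ) : Prop where
  deriv_fst : ∀ a : ℂ, 0 < a.im → HasDerivAt y (u a) a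
  deriv_snd : ∀ a : ℂ, 0 < a.im →
    HasDerivAt u ((2 * a * u a - 5 / 4 * y a) / ((a + 1) * (a - 1))) a

lemma add_one_ne_zero_of_im_pos {a : ℂ} (ha : 0 < a.im) : a + 1 ≠ 0 :=
  ne_zero_of_im_pos (by simpa using ha)

lemma sub_one_ne_zero_of_im_pos {a : ℂ} (ha : 0 < a.im) : a - 1 ≠ 0 :=
  ne_zero_of_im_pos (by simpa using ha)

/-- With w = a - 1 the relation for g' gives (w² g)' = w h / 2, and the relation for h' then closes
the system. -/
lemma isPeriod_one :
    IsPeriod (fun a => (a - 1) ^ 2 * gInt (a - 1)) (fun a => 1 / 2 * (a - 1) * hInt (a - 1)) := by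
  have hs : ∀ a : ℂ, 0 < a.im → a - 1 + 2 ∈ Complex.slitPlane := fun a ha =>
    mem_slitPlane_of_im_pos (by simpa using ha)
  have hd : ∀ a : ℂ, HasDerivAt (fun a : ℂ => a - 1) 1 a := fun a =>
    (hasDerivAt_id a).sub_const 1
  constructor
  · intro a ha
    obtain ⟨d, h1, h2⟩ := hasDerivAt_gInt (hs a ha)
    refine (((hd a).fun_pow 2).fun_mul (h1.comp a (hd a))).congr_deriv ?_
    simp only [Function.comp]
    push_cast
    linear_combination (a - 1) * h2
  · intro a ha
    have h1 := hasDerivAt_hInt (hs a ha)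
    refine (((hd a).const_mul (1 / 2)).fun_mul (h1.comp a (hd a))).congr_deriv ?_
    have e1 := add_one_ne_zero_of_im_pos ha
    have e2 := sub_one_ne_zero_of_im_pos ha
    have e3 : a - 1 + 2 = a + 1 := by ring
    simp only [Function.comp, e3]
    field_simp
    ring

lemma neg_add_one_add_two_mem {a : ℂ} (ha : 0 < a.im) : -(a + 1) + 2 ∈ Complex.slitPlane := by
  rw [Complex.mem_slitPlane_iff]
  right
  simpa using ha.ne'

lemma isPeriod_negOne :
    IsPeriod (fun a => (a + 1) ^ 2 * gInt (-(a + 1)))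
      (fun a => 1 / 2 * (a + 1) * hInt (-(a + 1))) := by
  have hd : ∀ a : ℂ, HasDerivAt (fun a : ℂ => a + 1) 1 a := fun a =>
    (hasDerivAt_id a).add_const 1
  constructor
  · intro a ha
    obtain ⟨d, h1, h2⟩ := hasDerivAt_gInt (neg_add_one_add_two_mem ha)
    refine (((hd a).fun_pow 2).fun_mul (h1.comp a (hd a).fun_neg)).congr_deriv ?_
    simp only [Function.comp]
    push_cast
    linear_combination (a + 1) * h2
  · intro a ha
    have h1 := hasDerivAt_hInt (neg_add_one_add_two_mem ha)
    refine (((hd a).const_mul (1 / 2)).fun_mul (h1.comp a (hd a).fun_neg)).congr_deriv ?_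
    have e1 := add_one_ne_zero_of_im_pos ha
    have e2 := sub_one_ne_zero_of_im_pos ha
    have e3 : -(a + 1) + 2 = -(a - 1) := by ring
    simp only [Function.comp, e3]
    field_simp
    ring

/-- The derivative of `periodMid` on the upper half plane. -/
noncomputable def periodMidDeriv (a : ℂ) : ℂ :=
  (5 * gInt (-4 / (a + 1)) - hInt (-4 / (a + 1))) / csqrt ((a + 1) / 2)

/-- The first order system of g and h is pulled back by a ↦ -4/(a+1) and multiplied by √((a+1)/2);
after writing a through S = √((a+1)/2) everything is rational in S. -/
lemma isPeriod_mid : IsPeriod periodMid periodMidDeriv := by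
  have hV : ∀ a : ℂ, 0 < a.im → 0 < ((a + 1) / 2).im := fun a ha => by
    rw [show (a + 1) / 2 = ((1 / 2 : ℝ) : ℂ) * (a + 1) by push_cast; ring, Complex.im_ofReal_mul]
    have : 0 < (a + 1).im := by simpa using ha
    positivity
  have hX : ∀ a : ℂ, 0 < a.im → -4 / (a + 1) + 2 ∈ Complex.slitPlane := fun a ha =>
    mem_slitPlane_of_im_pos (by
      simpa using im_neg_four_div (show 0 < (a + 1).im by simpa using ha))
  have hd1 : ∀ a : ℂ, HasDerivAt (fun a : ℂ => (a + 1) / 2) (1 / 2) a := fun a =>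
    ((hasDerivAt_id a).add_const 1).div_const 2
  have hd2 : ∀ a : ℂ, 0 < a.im → HasDerivAt (fun a : ℂ => -4 / (a + 1)) (4 / (a + 1) ^ 2) a :=
    fun a ha => by
      refine ((hasDerivAt_const a (-4 : ℂ)).fun_div ((hasDerivAt_id a).add_const 1)
        (add_one_ne_zero_of_im_pos ha)).congr_deriv ?_
      simp
  have hS : ∀ a : ℂ, 0 < a.im → HasDerivAt (fun a : ℂ => csqrt ((a + 1) / 2))
      (1 / (2 * csqrt ((a + 1) / 2)) * (1 / 2)) a := fun a ha => by
    have := HasDerivAt.comp a (hasDerivAt_csqrt (z := (a + 1) / 2)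
      (mem_slitPlane_of_im_pos (hV a ha))) (hd1 a)
    exact this
  constructor
  · intro a ha
    obtain ⟨d, h1, h2⟩ := hasDerivAt_gInt (hX a ha)
    have e0 := add_one_ne_zero_of_im_pos ha
    have hne := csqrt_ne_zero (ne_zero_of_im_pos (hV a ha))
    have hsq := csqrt_sq ((a + 1) / 2)
    have hg := h1.comp a (hd2 a ha)
    have h3 : HasDerivAt (fun a => 4 * (csqrt ((a + 1) / 2) * gInt (-4 / (a + 1))))
        (periodMidDeriv a) a := by
      refine (((hS a ha).fun_mul hg).const_mul 4).congr_deriv ?_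
      have hdd : d = -(a + 1) / 4 * (hInt (-4 / (a + 1)) / 2 - 2 * gInt (-4 / (a + 1))) := by
        rw [← h2]; field_simp
      rw [hdd, periodMidDeriv]
      set S := csqrt ((a + 1) / 2)
      have hv : a + 1 = 2 * S ^ 2 := by rw [hsq]; ring
      simp only [Function.comp]
      set G := gInt (-4 / (a + 1))
      set H := hInt (-4 / (a + 1))
      clear_value G H S
      rw [hv]
      field_simp
      ring
    refine h3.congr_of_eventuallyEq ?_
    filter_upwards [(isOpen_lt continuous_const Complex.continuous_im).mem_nhds ha] with b hb
    exact periodMid_eq_gInt hb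
  · intro a ha
    obtain ⟨d, h1, h2⟩ := hasDerivAt_gInt (hX a ha)
    have h5 := hasDerivAt_hInt (hX a ha)
    have e0 := add_one_ne_zero_of_im_pos ha
    have e1 := sub_one_ne_zero_of_im_pos ha
    have hne := csqrt_ne_zero (ne_zero_of_im_pos (hV a ha))
    have hsq := csqrt_sq ((a + 1) / 2)
    have hg := h1.comp a (hd2 a ha)
    have hh := h5.comp a (hd2 a ha)
    refine (((hg.const_mul 5).fun_sub hh).fun_div (hS a ha) hne).congr_deriv ?_
    have hdd : d = -(a + 1) / 4 * (hInt (-4 / (a + 1)) / 2 - 2 * gInt (-4 / (a + 1))) := by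
      rw [← h2]; field_simp
    have h6 : -4 / (a + 1) + 2 = 2 * (a - 1) / (a + 1) := by field_simp; ring
    rw [hdd, periodMidDeriv, periodMid_eq_gInt ha, h6]
    set S := csqrt ((a + 1) / 2)
    have hv : a = 2 * S ^ 2 - 1 := by rw [hsq]; ring
    simp only [Function.comp]
    set G := gInt (-4 / (a + 1))
    set H := hInt (-4 / (a + 1))
    clear_value G H S
    have e3 : 2 * S ^ 2 - 1 - 1 ≠ 0 := by rwa [← hv]
    subst hv
    have e4 : 2 * S ^ 2 - 1 + 1 = 2 * S ^ 2 := by ring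
    have e5 : 2 * S ^ 2 - 1 - 1 = 2 * (S ^ 2 - 1) := by ring
    have e6 : S ^ 2 - 1 ≠ 0 := by
      intro h
      rw [e5, h] at e3
      simp at e3
    rw [e4, e5]
    field_simp
    ring

lemma isOpen_upper : IsOpen {a : ℂ | 0 < a.im} := isOpen_lt continuous_const Complex.continuous_im

lemma isPreconnected_upper : IsPreconnected {a : ℂ | 0 < a.im} :=
  (convex_halfSpace_im_gt 0).isPreconnected

lemma exists_const_of_deriv_eq_zero {f : ℂ → ℂ} (hf : ∀ a : ℂ, 0 < a.im → HasDerivAt f 0 a) :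
    ∃ c, ∀ a : ℂ, 0 < a.im → f a = c := by
  obtain ⟨c, hc⟩ := isOpen_upper.exists_is_const_of_deriv_eq_zero isPreconnected_upper
    (fun a ha => (hf a ha).differentiableAt.differentiableWithinAt) (fun a ha => (hf a ha).deriv)
  exact ⟨c, hc⟩

/-- The Wronskian of two solutions is a multiple of `a² - 1`. -/
lemma IsPeriod.wronskian {y₁ u₁ y₂ u₂ : ℂ → ℂ} (h₁ : IsPeriod y₁ u₁) (h₂ : IsPeriod y₂ u₂) :
    ∃ c, ∀ a : ℂ, 0 < a.im → u₁ a * y₂ a - y₁ a * u₂ a = c * ((a + 1) * (a - 1)) := by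
  -- The Wronskian W satisfies (a² - 1) W' = 2aW, so W/(a² - 1) has derivative zero.
  obtain ⟨c, hc⟩ := exists_const_of_deriv_eq_zero
    (f := fun a => (u₁ a * y₂ a - y₁ a * u₂ a) / ((a + 1) * (a - 1))) (by
      intro a ha
      have e1 := add_one_ne_zero_of_im_pos ha
      have e2 := sub_one_ne_zero_of_im_pos ha
      refine ((((h₁.deriv_snd a ha).fun_mul (h₂.deriv_fst a ha)).fun_sub
        ((h₁.deriv_fst a ha).fun_mul (h₂.deriv_snd a ha))).fun_div
        (((hasDerivAt_id a).add_const 1).fun_mul ((hasDerivAt_id a).sub_const 1))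
        (mul_ne_zero e1 e2)).congr_deriv ?_
      simp only [id]
      field_simp
      ring)
  refine ⟨c, fun a ha => ?_⟩
  rw [← hc a ha, div_mul_cancel₀]
  exact mul_ne_zero (add_one_ne_zero_of_im_pos ha) (sub_one_ne_zero_of_im_pos ha)

/-! ### Arguments of the period integrals -/

lemma im_ofReal_add_mul {x y : ℝ} (z : ℂ) : ((x : ℂ) + (y : ℂ) * z).im = y * z.im := by
  rw [Complex.add_im, Complex.ofReal_im, Complex.im_ofReal_mul, zero_add]

lemma continuous_csqrt_comp {f : ℝ → ℂ} (hf : Continuous f) (h : ∀ t, 0 ≤ (f t).im) :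
    Continuous fun t => csqrt (f t) :=
  continuousOn_csqrt.comp_continuous hf h

/-- Up to the factor sin² t the point is w + 2 plus a positive real number, and adding a positive
real lowers the argument in the upper half plane. -/
lemma arg_two_add_between {w : ℂ} (hw : 0 < w.im) {t : ℝ} (ht : t ∈ Ioo 0 (Real.pi / 2)) :
    0 < ((2 : ℝ) + (Real.sin t ^ 2 : ℝ) * w : ℂ).arg ∧
      ((2 : ℝ) + (Real.sin t ^ 2 : ℝ) * w : ℂ).arg < (w + 2).arg := by
  obtain ⟨hs, hc⟩ := sin_cos_pos ht
  have hs2 : 0 < Real.sin t ^ 2 := by positivity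
  refine ⟨arg_pos_of_im_pos (by rw [im_ofReal_add_mul]; positivity), ?_⟩
  have e : ((2 : ℝ) + (Real.sin t ^ 2 : ℝ) * w : ℂ) = (Real.sin t ^ 2 : ℝ) *
      ((w + 2) + ((2 * Real.cos t ^ 2 / Real.sin t ^ 2 : ℝ) : ℂ)) := by
    rw [Real.cos_sq']
    have : (Real.sin t : ℂ) ≠ 0 := by exact_mod_cast hs.ne'
    push_cast at this ⊢
    field_simp
    ring
  rw [e, Complex.arg_real_mul _ hs2]
  exact arg_add_real_lt (by simpa using hw) (by positivity)

lemma arg_gInt {w : ℂ} (hw : 0 < w.im) : 0 < (gInt w).arg ∧ (gInt w).arg < (w + 2).arg / 2 := by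
  have hpos := arg_pos_of_im_pos (z := w + 2) (by simpa using hw)
  refine arg_integral_between pi_div_two_pos' ?_ le_rfl (by positivity)
    (by linarith [Complex.arg_le_pi (w + 2), Real.pi_pos]) fun t ht => ?_
  · exact (Continuous.mul (by fun_prop) (continuous_csqrt_comp (by fun_prop) fun t => by
      rw [im_ofReal_add_mul]; positivity)).continuousOn
  · obtain ⟨hs, hc⟩ := sin_cos_pos ht
    rw [Complex.arg_real_mul _ (by positivity), arg_csqrt]
    have := arg_two_add_between hw ht
    constructor <;> linarith

lemma arg_hInt {w : ℂ} (hw : 0 < w.im) : 0 < (hInt w).arg ∧ (hInt w).arg < (w + 2).arg / 2 := by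
  have hpos := arg_pos_of_im_pos (z := w + 2) (by simpa using hw)
  refine arg_integral_between pi_div_two_pos' ?_ le_rfl (by positivity)
    (by linarith [Complex.arg_le_pi (w + 2), Real.pi_pos]) fun t ht => ?_
  · exact (Continuous.mul (by fun_prop) (continuous_csqrt_comp (by fun_prop) fun t => by
      rw [im_ofReal_add_mul]; positivity)).continuousOn
  · obtain ⟨hs, hc⟩ := sin_cos_pos ht
    rw [Complex.arg_real_mul _ (by positivity), arg_csqrt]
    have := arg_two_add_between hw ht
    constructor <;> linarith

/-- The point a - x with -1 < x < 1 lies on the horizontal segment between a - 1 and a + 1, along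
which the argument decreases to the right. -/
lemma arg_sub_real_between {a : ℂ} (ha : 0 < a.im) {t : ℝ} (ht : t ∈ Ioo 0 (Real.pi / 2)) :
    (a + 1).arg < ((1 - 2 * Real.sin t ^ 2 : ℝ) + (1 : ℝ) * a : ℂ).arg ∧
      ((1 - 2 * Real.sin t ^ 2 : ℝ) + (1 : ℝ) * a : ℂ).arg < (a - 1).arg := by
  obtain ⟨hs, hc⟩ := sin_cos_pos ht
  have hs2 : 0 < 2 * Real.sin t ^ 2 := by positivity
  have hc2 : 0 < 2 * Real.cos t ^ 2 := by positivity
  have him : 0 < ((1 - 2 * Real.sin t ^ 2 : ℝ) + (1 : ℝ) * a : ℂ).im := by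
    rw [im_ofReal_add_mul]; linarith
  constructor
  · have e : a + 1 = ((1 - 2 * Real.sin t ^ 2 : ℝ) + (1 : ℝ) * a : ℂ) +
        ((2 * Real.sin t ^ 2 : ℝ) : ℂ) := by
      push_cast; ring
    nth_rewrite 1 [e]
    exact arg_add_real_lt him hs2
  · have e : ((1 - 2 * Real.sin t ^ 2 : ℝ) + (1 : ℝ) * a : ℂ) = (a - 1) +
        ((2 * Real.cos t ^ 2 : ℝ) : ℂ) := by
      rw [Real.cos_sq']; push_cast; ring
    rw [e]
    exact arg_add_real_lt (by simpa using ha) hc2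

lemma arg_periodMid {a : ℂ} (ha : 0 < a.im) :
    (a + 1).arg / 2 < (periodMid a).arg ∧ (periodMid a).arg < (a - 1).arg / 2 := by
  have h1 := arg_pos_of_im_pos (z := a + 1) (by simpa using ha)
  have h2 := arg_sub_real_between ha (t := Real.pi / 4) ⟨by positivity, by linarith [Real.pi_pos]⟩
  refine arg_integral_between pi_div_two_pos' ?_ (by positivity) (by linarith)
    (by linarith [Complex.arg_le_pi (a - 1), Real.pi_pos]) fun t ht => ?_
  · exact (Continuous.mul (by fun_prop) (continuous_csqrt_comp (by fun_prop) fun t => by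
      rw [im_ofReal_add_mul]; linarith)).continuousOn
  · obtain ⟨hs, hc⟩ := sin_cos_pos ht
    rw [Complex.arg_real_mul _ (by positivity), arg_csqrt]
    have := arg_sub_real_between ha ht
    constructor <;> linarith

lemma ne_zero_of_arg_pos {z : ℂ} (h : 0 < z.arg) : z ≠ 0 := by
  rintro rfl
  simp at h

lemma gInt_ne_zero {w : ℂ} (hw : 0 < w.im) : gInt w ≠ 0 := ne_zero_of_arg_pos (arg_gInt hw).1

lemma hInt_ne_zero {w : ℂ} (hw : 0 < w.im) : hInt w ≠ 0 := ne_zero_of_arg_pos (arg_hInt hw).1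

lemma arg_periodMid_pos {a : ℂ} (ha : 0 < a.im) : 0 < (periodMid a).arg := by
  have := arg_periodMid ha
  have := arg_pos_of_im_pos (z := a + 1) (by simpa using ha)
  linarith

lemma arg_periodMid_lt {a : ℂ} (ha : 0 < a.im) : (periodMid a).arg < Real.pi / 2 := by
  have := arg_periodMid ha
  have := arg_lt_pi_of_im_pos (z := a - 1) (by simpa using ha)
  linarith

lemma periodMid_ne_zero {a : ℂ} (ha : 0 < a.im) : periodMid a ≠ 0 :=
  ne_zero_of_arg_pos (arg_periodMid_pos ha)

lemma periodMidDeriv_eq_integral {a : ℂ} (ha : 0 < a.im) :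
    periodMidDeriv a = ∫ t in (0 : ℝ)..(Real.pi / 2),
      ((8 * Real.sin t ^ 2 * Real.cos t ^ 2 : ℝ) : ℂ) *
      ((1 : ℝ) / (2 * csqrt ((1 - 2 * Real.sin t ^ 2 : ℝ) + (1 : ℝ) * a))) :=
  (isPeriod_mid.deriv_fst a ha).unique (hasDerivAt_periodMid ha)

/-- The root √(a - x) lies in the open first quadrant, so its inverse lies in the fourth, which is
preserved by integration against a positive weight. -/
lemma periodMidDeriv_re_pos_im_neg {a : ℂ} (ha : 0 < a.im) :
    0 < (periodMidDeriv a).re ∧ (periodMidDeriv a).im < 0 := by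
  have him : ∀ t : ℝ, 0 < ((1 - 2 * Real.sin t ^ 2 : ℝ) + (1 : ℝ) * a : ℂ).im := fun t => by
    rw [im_ofReal_add_mul]; linarith
  have hS : Continuous fun t : ℝ => csqrt ((1 - 2 * Real.sin t ^ 2 : ℝ) + (1 : ℝ) * a) :=
    continuous_csqrt_comp (by fun_prop) fun t => (him t).le
  have hne : ∀ t : ℝ, 2 * csqrt ((1 - 2 * Real.sin t ^ 2 : ℝ) + (1 : ℝ) * a) ≠ 0 := fun t =>
    mul_ne_zero two_ne_zero (csqrt_ne_zero (ne_zero_of_im_pos (him t)))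
  have hf : Continuous fun t : ℝ => ((8 * Real.sin t ^ 2 * Real.cos t ^ 2 : ℝ) : ℂ) *
      ((1 : ℝ) / (2 * csqrt ((1 - 2 * Real.sin t ^ 2 : ℝ) + (1 : ℝ) * a))) :=
    Continuous.mul (by fun_prop) (Continuous.div (by fun_prop) (hS.const_mul 2) hne)
  have hval : ∀ t ∈ Ioo 0 (Real.pi / 2),
      0 < (((8 * Real.sin t ^ 2 * Real.cos t ^ 2 : ℝ) : ℂ) *
      ((1 : ℝ) / (2 * csqrt ((1 - 2 * Real.sin t ^ 2 : ℝ) + (1 : ℝ) * a)))).re ∧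
      0 < -(((8 * Real.sin t ^ 2 * Real.cos t ^ 2 : ℝ) : ℂ) *
      ((1 : ℝ) / (2 * csqrt ((1 - 2 * Real.sin t ^ 2 : ℝ) + (1 : ℝ) * a)))).im := by
    intro t ht
    obtain ⟨hs, hc⟩ := sin_cos_pos ht
    have h1 := csqrt_re_pos (mem_slitPlane_of_im_pos (him t))
    have h2 := csqrt_im_pos (him t)
    have h3 := Complex.normSq_pos.2 (hne t)
    set S := csqrt ((1 - 2 * Real.sin t ^ 2 : ℝ) + (1 : ℝ) * a)
    rw [Complex.re_ofReal_mul, Complex.im_ofReal_mul, Complex.ofReal_one, one_div, Complex.inv_re,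
      Complex.inv_im, show (2 * S).re = 2 * S.re by simp, show (2 * S).im = 2 * S.im by simp,
      ← mul_neg, ← neg_div, neg_neg]
    constructor <;> positivity
  rw [periodMidDeriv_eq_integral ha]
  constructor
  · have := Complex.reCLM.intervalIntegral_comp_comm (μ := MeasureTheory.volume)
      (hf.intervalIntegrable 0 (Real.pi / 2))
    rw [Complex.reCLM_apply] at this
    rw [← this]
    exact intervalIntegral.intervalIntegral_pos_of_pos_on
      ((Complex.continuous_re.comp hf).intervalIntegrable _ _) (fun t ht => (hval t ht).1)
      pi_div_two_pos'
  · have := Complex.imCLM.intervalIntegral_comp_comm (μ := MeasureTheory.volume)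
      (hf.intervalIntegrable 0 (Real.pi / 2))
    rw [Complex.imCLM_apply] at this
    rw [← this, ← neg_pos, ← intervalIntegral.integral_neg]
    exact intervalIntegral.intervalIntegral_pos_of_pos_on
      ((Complex.continuous_im.comp hf).neg.intervalIntegrable _ _) (fun t ht => (hval t ht).2)
      pi_div_two_pos'

/-! ### The Legendre type relation and the linear relation between the periods -/

lemma neBot_upper (x : ℝ) : (𝓝[{a : ℂ | 0 < a.im}] (x : ℂ)).NeBot := by
  rw [← mem_closure_iff_nhdsWithin_neBot, Complex.closure_setOfPred_lt_im]
  simp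

lemma tendsto_upper_of_continuousOn {f k : ℂ → ℂ} (hf : ContinuousOn f {z | 0 ≤ z.im})
    (hk : Continuous k) (hk0 : ∀ a : ℂ, 0 < a.im → 0 ≤ (k a).im) {x : ℝ} (hx : 0 ≤ (k x).im) :
    Tendsto (fun a => f (k a)) (𝓝[{a : ℂ | 0 < a.im}] (x : ℂ)) (𝓝 (f (k x))) := by
  have h1 : Tendsto k (𝓝[{a : ℂ | 0 < a.im}] (x : ℂ)) (𝓝[{z | 0 ≤ z.im}] (k x)) := by
    apply tendsto_nhdsWithin_of_tendsto_nhds_of_eventually_within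
    · exact hk.continuousAt.tendsto.mono_left nhdsWithin_le_nhds
    · filter_upwards [self_mem_nhdsWithin] with a ha using hk0 a ha
  exact (hf (k x) hx).tendsto.comp h1

lemma tendsto_gInt_sub_one (x : ℝ) :
    Tendsto (fun a => gInt (a - 1)) (𝓝[{a : ℂ | 0 < a.im}] (x : ℂ)) (𝓝 (gInt (x - 1))) :=
  tendsto_upper_of_continuousOn continuousOn_gInt (k := fun a => a - 1) (by fun_prop)
    (fun a ha => by simpa using ha.le) (by simp)

lemma tendsto_hInt_sub_one (x : ℝ) :
    Tendsto (fun a => hInt (a - 1)) (𝓝[{a : ℂ | 0 < a.im}] (x : ℂ)) (𝓝 (hInt (x - 1))) :=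
  tendsto_upper_of_continuousOn continuousOn_hInt (k := fun a => a - 1) (by fun_prop)
    (fun a ha => by simpa using ha.le) (by simp)

/-- The reflection in the imaginary axis. -/
noncomputable def reflectIm (a : ℂ) : ℂ := -(starRingEnd ℂ) a

lemma reflectIm_im (a : ℂ) : (reflectIm a).im = a.im := by simp [reflectIm]
lemma reflectIm_re (a : ℂ) : (reflectIm a).re = -a.re := by simp [reflectIm]
lemma reflectIm_reflectIm (a : ℂ) : reflectIm (reflectIm a) = a := by simp [reflectIm]
lemma reflectIm_ofReal (x : ℝ) : reflectIm x = -x := by simp [reflectIm]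
lemma continuous_reflectIm : Continuous reflectIm := Complex.continuous_conj.neg

lemma gInt_neg_add_one {a : ℂ} (ha : 0 < a.im) :
    gInt (-(a + 1)) = (starRingEnd ℂ) (gInt (reflectIm a - 1)) := by
  rw [← gInt_conj (mem_slitPlane_of_im_pos (by simpa [reflectIm] using ha))]
  congr 1
  simp [reflectIm]
  ring

lemma hInt_neg_add_one {a : ℂ} (ha : 0 < a.im) :
    hInt (-(a + 1)) = (starRingEnd ℂ) (hInt (reflectIm a - 1)) := by
  rw [← hInt_conj (mem_slitPlane_of_im_pos (by simpa [reflectIm] using ha))]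
  congr 1
  simp [reflectIm]
  ring

/-- When a descends to the real axis, -(a+1) rises to it from below; the boundary value is the
conjugate of the one that `gInt` takes on the axis. -/
lemma tendsto_gInt_neg_add_one (x : ℝ) :
    Tendsto (fun a => gInt (-(a + 1))) (𝓝[{a : ℂ | 0 < a.im}] (x : ℂ))
      (𝓝 ((starRingEnd ℂ) (gInt (-x - 1)))) := by
  have h := tendsto_upper_of_continuousOn continuousOn_gInt (k := fun a => reflectIm a - 1)
    (continuous_reflectIm.sub continuous_const) (fun a ha => by simpa [reflectIm] using ha.le)
    (x := x) (by simp [reflectIm])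
  have h2 := (Complex.continuous_conj.tendsto _).comp h
  simp only [reflectIm_ofReal] at h2
  refine h2.congr' ?_
  filter_upwards [self_mem_nhdsWithin] with a ha using (gInt_neg_add_one ha).symm

lemma tendsto_hInt_neg_add_one (x : ℝ) :
    Tendsto (fun a => hInt (-(a + 1))) (𝓝[{a : ℂ | 0 < a.im}] (x : ℂ))
      (𝓝 ((starRingEnd ℂ) (hInt (-x - 1)))) := by
  have h := tendsto_upper_of_continuousOn continuousOn_hInt (k := fun a => reflectIm a - 1)
    (continuous_reflectIm.sub continuous_const) (fun a ha => by simpa [reflectIm] using ha.le)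
    (x := x) (by simp [reflectIm])
  have h2 := (Complex.continuous_conj.tendsto _).comp h
  simp only [reflectIm_ofReal] at h2
  refine h2.congr' ?_
  filter_upwards [self_mem_nhdsWithin] with a ha using (hInt_neg_add_one ha).symm

/-- The Legendre type relation between the periods. -/
lemma exists_legendre_relation : ∃ C : ℝ, 0 < C ∧ ∀ a : ℂ, 0 < a.im →
    (a + 1) * gInt (-(a + 1)) * hInt (a - 1) - (a - 1) * gInt (a - 1) * hInt (-(a + 1)) = C := by
  obtain ⟨c, hc⟩ := isPeriod_negOne.wronskian isPeriod_one
  have key : ∀ a : ℂ, 0 < a.im →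
      (a + 1) * gInt (-(a + 1)) * hInt (a - 1) - (a - 1) * gInt (a - 1) * hInt (-(a + 1)) =
        -2 * c := by
    intro a ha
    have h := hc a ha
    have e1 := add_one_ne_zero_of_im_pos ha
    have e2 := sub_one_ne_zero_of_im_pos ha
    have e3 := mul_ne_zero e1 e2
    apply mul_left_cancel₀ e3
    linear_combination (-2) * h
  obtain ⟨g2, hg2, eg2⟩ := gInt_ofReal (x := -2) le_rfl
  obtain ⟨h0, hh0, eh0⟩ := hInt_ofReal (x := 0) (by norm_num)
  -- The constant is read off as a → 1: the second term carries the factor a - 1, and the first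
  -- tends to 2 g(-2) h(0).
  refine ⟨2 * g2 * h0, by positivity, fun a ha => (key a ha).trans ?_⟩
  have lim := ((((tendsto_gInt_neg_add_one 1).mul (tendsto_hInt_sub_one 1)).const_mul 1))
  have hid : Tendsto (fun a : ℂ => a) (𝓝[{a : ℂ | 0 < a.im}] ((1 : ℝ) : ℂ)) (𝓝 ((1 : ℝ) : ℂ)) :=
    tendsto_id.mono_left nhdsWithin_le_nhds
  have lim := (((hid.add_const 1).mul (tendsto_gInt_neg_add_one 1)).mul
    (tendsto_hInt_sub_one 1)).sub (((hid.sub_const 1).mul (tendsto_gInt_sub_one 1)).mul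
    (tendsto_hInt_neg_add_one 1))
  have hconst := tendsto_const_nhds (x := -2 * c) (f := 𝓝[{a : ℂ | 0 < a.im}] ((1 : ℝ) : ℂ))
  have := neBot_upper 1
  have := tendsto_nhds_unique (hconst.congr' (by
    filter_upwards [self_mem_nhdsWithin] with a ha using (key a ha).symm)) lim
  rw [this]
  have e2 : (-((1 : ℝ) : ℂ) - 1) = ((-2 : ℝ) : ℂ) := by push_cast; norm_num
  have e3 : (((1 : ℝ) : ℂ) - 1) = ((0 : ℝ) : ℂ) := by push_cast; norm_num
  rw [e2, e3, eg2, eh0]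
  push_cast
  rw [Complex.conj_ofReal]
  ring

lemma IsPeriod.sub {y₁ u₁ y₂ u₂ : ℂ → ℂ} (h₁ : IsPeriod y₁ u₁) (h₂ : IsPeriod y₂ u₂) :
    IsPeriod (fun a => y₁ a - y₂ a) (fun a => u₁ a - u₂ a) :=
  ⟨fun a ha => (h₁.deriv_fst a ha).fun_sub (h₂.deriv_fst a ha), fun a ha =>
    ((h₁.deriv_snd a ha).fun_sub (h₂.deriv_snd a ha)).congr_deriv (by ring)⟩

lemma IsPeriod.const_mul {y u : ℂ → ℂ} (h : IsPeriod y u) (c : ℂ) :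
    IsPeriod (fun a => c * y a) (fun a => c * u a) :=
  ⟨fun a ha => (h.deriv_fst a ha).const_mul c, fun a ha =>
    ((h.deriv_snd a ha).const_mul c).congr_deriv (by ring)⟩

lemma periodMid_one : periodMid 1 = 4 * gInt (-2) := by
  rw [periodMid, gInt, ← intervalIntegral.integral_const_mul]
  refine intervalIntegral.integral_congr fun t _ => ?_
  have : ((1 - 2 * Real.sin t ^ 2 : ℝ) + (1 : ℝ) * 1 : ℂ) = (2 : ℝ) + (Real.sin t ^ 2 : ℝ) * (-2) := by
    push_cast; ring
  rw [this]
  push_cast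
  ring

/-- The substitution t ↦ π/2 - t is x ↦ -x; it turns √(-1 - x) into i √(1 - x). -/
lemma periodMid_negOne : periodMid (-1) = Complex.I * (4 * gInt (-2)) := by
  have h := intervalIntegral.integral_comp_sub_left (a := 0) (b := Real.pi / 2)
    (fun t : ℝ => ((2 * Real.sin t ^ 2 * Real.cos t ^ 2 : ℝ) : ℂ) *
    csqrt ((2 : ℝ) + (Real.sin t ^ 2 : ℝ) * (-2))) (Real.pi / 2)
  rw [sub_self, sub_zero] at h
  rw [periodMid, gInt, ← h, ← intervalIntegral.integral_const_mul,
    ← intervalIntegral.integral_const_mul]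
  refine intervalIntegral.integral_congr fun t _ => ?_
  rw [Real.sin_pi_div_two_sub, Real.cos_pi_div_two_sub]
  have e1 : ((1 - 2 * Real.sin t ^ 2 : ℝ) + (1 : ℝ) * (-1) : ℂ) =
      -((2 * Real.sin t ^ 2 : ℝ) : ℂ) := by
    push_cast; ring
  have e2 : ((2 : ℝ) + (Real.cos t ^ 2 : ℝ) * (-2) : ℂ) = ((2 * Real.sin t ^ 2 : ℝ) : ℂ) := by
    rw [Real.cos_sq']
    push_cast
    ring
  rw [e1, e2, csqrt_ofReal (by positivity), csqrt_neg_ofReal (by positivity)]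
  push_cast
  ring

/-- `∫₋₁¹ = ∫₋₁ᵃ + ∫ₐ¹` in the upper half plane. -/
lemma periodMid_eq_add {a : ℂ} (ha : 0 < a.im) :
    periodMid a = (a + 1) ^ 2 * gInt (-(a + 1)) + Complex.I * ((a - 1) ^ 2 * gInt (a - 1)) := by
  -- The difference G = F - L - iR solves the same equation and tends to 0 at both 1 and -1; the
  -- Wronskian with R turns this into G = 0.
  have hG := (isPeriod_mid.sub isPeriod_negOne).sub (isPeriod_one.const_mul Complex.I)
  set G : ℂ → ℂ := fun a => periodMid a - (a + 1) ^ 2 * gInt (-(a + 1)) -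
    Complex.I * ((a - 1) ^ 2 * gInt (a - 1)) with hGdef
  set U : ℂ → ℂ := fun a => periodMidDeriv a - 1 / 2 * (a + 1) * hInt (-(a + 1)) -
    Complex.I * (1 / 2 * (a - 1) * hInt (a - 1)) with hUdef
  have hid : ∀ x : ℝ, Tendsto (fun a : ℂ => a) (𝓝[{a : ℂ | 0 < a.im}] (x : ℂ)) (𝓝 (x : ℂ)) :=
    fun x => tendsto_id.mono_left nhdsWithin_le_nhds
  have hmid : ∀ x : ℝ, Tendsto periodMid (𝓝[{a : ℂ | 0 < a.im}] (x : ℂ)) (𝓝 (periodMid x)) :=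
    fun x => tendsto_upper_of_continuousOn continuousOn_periodMid (k := fun a => a) (by fun_prop)
      (fun a ha => ha.le) (by simp)
  have hGlim : ∀ x : ℝ, Tendsto G (𝓝[{a : ℂ | 0 < a.im}] (x : ℂ))
      (𝓝 (periodMid x - (x + 1) ^ 2 * (starRingEnd ℂ) (gInt (-x - 1)) -
        Complex.I * ((x - 1) ^ 2 * gInt (x - 1)))) := fun x =>
    ((hmid x).sub ((((hid x).add_const 1).pow 2).mul (tendsto_gInt_neg_add_one x))).sub
      (((((hid x).sub_const 1).pow 2).mul (tendsto_gInt_sub_one x)).const_mul _)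
  obtain ⟨g2, hg2, eg2⟩ := gInt_ofReal (x := -2) le_rfl
  push_cast at eg2
  have hG1 : Tendsto G (𝓝[{a : ℂ | 0 < a.im}] ((1 : ℝ) : ℂ)) (𝓝 0) := by
    convert hGlim 1 using 2
    push_cast
    rw [periodMid_one, show (-1 - 1 : ℂ) = -2 by norm_num, eg2, Complex.conj_ofReal]
    ring
  have hGm : Tendsto G (𝓝[{a : ℂ | 0 < a.im}] ((-1 : ℝ) : ℂ)) (𝓝 0) := by
    convert hGlim (-1) using 2
    push_cast
    rw [periodMid_negOne, show (-1 - 1 : ℂ) = -2 by norm_num, eg2]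
    ring
  obtain ⟨c, hc⟩ := hG.wronskian isPeriod_one
  have hc' : ∀ a : ℂ, 0 < a.im →
      U a * ((a - 1) * gInt (a - 1)) - G a * (1 / 2 * hInt (a - 1)) = c * (a + 1) := by
    intro a ha
    apply mul_left_cancel₀ (sub_one_ne_zero_of_im_pos ha)
    linear_combination hc a ha
  -- Only boundedness of G' near 1 matters, so that G'·(a-1) g(a-1) tends to 0 there.
  have hUlim : ∃ u, Tendsto U (𝓝[{a : ℂ | 0 < a.im}] ((1 : ℝ) : ℂ)) (𝓝 u) := by
    have hk : ContinuousAt (fun a : ℂ => -4 / (a + 1)) ((1 : ℝ) : ℂ) :=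
      ContinuousAt.div (by fun_prop) (by fun_prop) (by push_cast; norm_num)
    have hk1 : Tendsto (fun a : ℂ => -4 / (a + 1)) (𝓝[{a : ℂ | 0 < a.im}] ((1 : ℝ) : ℂ))
        (𝓝[{z | 0 ≤ z.im}] (-2)) := by
      apply tendsto_nhdsWithin_of_tendsto_nhds_of_eventually_within
      · have := hk.tendsto.mono_left (nhdsWithin_le_nhds (s := {a : ℂ | 0 < a.im}))
        convert this using 2
        push_cast
        norm_num
      · filter_upwards [self_mem_nhdsWithin] with a ha
        exact (im_neg_four_div (show 0 < (a + 1).im by simpa using ha)).le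
    have h1 := ((continuousOn_gInt (-2) (by simp)).tendsto).comp hk1
    have h2 := ((continuousOn_hInt (-2) (by simp)).tendsto).comp hk1
    have h3 : Tendsto (fun a : ℂ => csqrt ((a + 1) / 2)) (𝓝[{a : ℂ | 0 < a.im}] ((1 : ℝ) : ℂ))
        (𝓝 1) := by
      have h4 : ContinuousAt csqrt 1 := (hasDerivAt_csqrt (by simp)).continuousAt
      have h5 : csqrt 1 = 1 := by simpa using csqrt_ofReal (r := 1) zero_le_one
      have h6 : Tendsto (fun a : ℂ => (a + 1) / 2) (𝓝[{a : ℂ | 0 < a.im}] ((1 : ℝ) : ℂ)) (𝓝 1) := by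
        convert ((hid 1).add_const 1).div_const 2 using 2
        push_cast
        norm_num
      have h7 := h4.tendsto.comp h6
      rw [h5] at h7
      exact h7
    exact ⟨_, ((((h1.const_mul 5).sub h2).div h3 one_ne_zero).sub
      ((((hid 1).add_const 1).const_mul (1 / 2)).mul (tendsto_hInt_neg_add_one 1))).sub
      (((((hid 1).sub_const 1).const_mul (1 / 2)).mul (tendsto_hInt_sub_one 1)).const_mul _)⟩
  obtain ⟨u, hu⟩ := hUlim
  -- At a = 1 the left side of `hc'` tends to 0 and the right side to 2c.
  have hc0 : c = 0 := by
    have l1 := (hu.mul (((hid 1).sub_const 1).mul (tendsto_gInt_sub_one 1))).sub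
      (hG1.mul ((tendsto_hInt_sub_one 1).const_mul (1 / 2)))
    have l2 := ((hid 1).add_const 1).const_mul c
    have := neBot_upper 1
    have l3 := tendsto_nhds_unique (l1.congr' (by
      filter_upwards [self_mem_nhdsWithin] with a ha using hc' a ha)) l2
    push_cast at l3
    have : c * (1 + 1) = 0 := by rw [← l3]; ring
    simpa using this
  have hR : ∀ a : ℂ, 0 < a.im → (a - 1) ^ 2 * gInt (a - 1) ≠ 0 := by
    intro a ha
    exact mul_ne_zero (pow_ne_zero _ (sub_one_ne_zero_of_im_pos ha))
      (gInt_ne_zero (by simpa using ha))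
  obtain ⟨l, hl⟩ := exists_const_of_deriv_eq_zero
    (f := fun a => G a / ((a - 1) ^ 2 * gInt (a - 1))) (by
      intro a ha
      refine ((hG.deriv_fst a ha).fun_div (isPeriod_one.deriv_fst a ha) (hR a ha)).congr_deriv ?_
      have := hc a ha
      rw [hc0, zero_mul] at this
      simp only [this, zero_div])
  -- Now G is the multiple l·R. At a = -1, R tends to 4 g(-2) ≠ 0 while G tends to 0.
  have hl0 : l = 0 := by
    have l1 := hGm
    have l2 := ((((hid (-1)).sub_const 1).pow 2).mul (tendsto_gInt_sub_one (-1))).const_mul l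
    have := neBot_upper (-1)
    have l3 := tendsto_nhds_unique (l2.congr' (by
      filter_upwards [self_mem_nhdsWithin] with a ha
      rw [← hl a ha, div_mul_cancel₀ _ (hR a ha)])) l1
    push_cast at l3
    rw [show (-1 - 1 : ℂ) = -2 by norm_num, eg2] at l3
    have hg2' : (g2 : ℂ) ≠ 0 := by exact_mod_cast hg2.ne'
    simpa [hg2'] using l3
  have := hl a ha
  rw [hl0, div_eq_zero_iff] at this
  have h2 := this.resolve_right (hR a ha)
  linear_combination h2

/-! ### Two comparisons of arguments far from the segment -/

lemma hasDerivAt_comp_cos {H : ℝ → ℝ} {d t : ℝ} (h : HasDerivAt H d (Real.cos t)) :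
    HasDerivAt (fun t => -H (Real.cos t)) (Real.sin t * d) t := by
  refine (h.comp t (Real.hasDerivAt_cos t)).fun_neg.congr_deriv ?_
  ring

/-- Lower bound for the integrand of the argument comparison, where `cos² t` is large. -/
noncomputable def tailBound (s y : ℝ) : ℝ :=
  ((7 / 3 + s / 2) * y ^ 2 - 1 / 3) *
    (5 * (4 / (3 * s) * (1 / y ^ 2 - 1)) - 2 * (4 / (3 * s) * (1 / y ^ 2 - 1)) ^ 2) / 3

/-- As a function of y the bound is a combination of y², 1, y⁻² and y⁻⁴, so the primitive has no
logarithm. -/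
lemma hasDerivAt_tailPrimitive {s y : ℝ} (hs : 0 < s) (hy : y ≠ 0) :
    HasDerivAt (fun y : ℝ => (1 / 3) * ((7 / 3 + s / 2) * (5 * (4 / (3 * s)) * (y - y ^ 3 / 3) -
      2 * (4 / (3 * s)) ^ 2 * (-(1 / y) - 2 * y + y ^ 3 / 3)) - 1 / 3 *
      (5 * (4 / (3 * s)) * (-(1 / y) - y) - 2 * (4 / (3 * s)) ^ 2 *
      (-(1 / y) ^ 3 / 3 + 2 * (1 / y) + y)))) (tailBound s y) y := by
  have hi : HasDerivAt (fun y : ℝ => 1 / y) (-(1 / y ^ 2)) y := by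
    simpa [one_div] using hasDerivAt_inv hy
  have hid := hasDerivAt_id' y
  have h := ((((hid.fun_sub ((hid.fun_pow 3).div_const 3)).const_mul (5 * (4 / (3 * s)))).fun_sub
    (((hi.fun_neg.fun_sub (hid.const_mul 2)).fun_add ((hid.fun_pow 3).div_const 3)).const_mul
      (2 * (4 / (3 * s)) ^ 2))).const_mul (7 / 3 + s / 2)).fun_sub
    ((((hi.fun_neg.fun_sub hid).const_mul (5 * (4 / (3 * s)))).fun_sub
    (((((hi.fun_pow 3).fun_neg.div_const 3).fun_add (hi.const_mul 2)).fun_add hid).const_mul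
      (2 * (4 / (3 * s)) ^ 2))).const_mul (1 / 3))
  refine (h.const_mul (1 / 3)).congr_deriv ?_
  rw [tailBound]
  simp only [Nat.cast_ofNat, show (3 - 1 : ℕ) = 2 from rfl]
  field_simp
  ring

/-- After y = cos t both lower bounds integrate in closed form, and their sum over the two ranges is
manifestly positive. This is the final inequality behind `arg_hInt_lt`, with s = 1/|a+1|. -/
lemma integral_pos_of_bounds {s : ℝ} (hs : 0 < s) {G : ℝ → ℝ}
    (hG : ContinuousOn G (Icc 0 (Real.pi / 2)))
    (h1 : ∀ t ∈ Ioo 0 (Real.pi / 2), Real.cos t ^ 2 * (3 * s + 4) ≤ 4 →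
      Real.sin t * ((3 + s) * Real.cos t ^ 2 - 1) ≤ G t)
    (h2 : ∀ t ∈ Ioo 0 (Real.pi / 2), 4 ≤ Real.cos t ^ 2 * (3 * s + 4) →
      Real.sin t * tailBound s (Real.cos t) ≤ G t) :
    0 < ∫ t in (0 : ℝ)..(Real.pi / 2), G t := by
  -- The value of cos t at which the two ranges of the hypotheses meet.
  set y := Real.sqrt (4 / (3 * s + 4)) with hy
  have hy2 : y ^ 2 = 4 / (3 * s + 4) := Real.sq_sqrt (by positivity)
  have hy0 : 0 < y := Real.sqrt_pos.2 (by positivity)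
  have hy1 : y < 1 := by
    have : y ^ 2 < 1 := by rw [hy2, div_lt_one (by positivity)]; linarith
    nlinarith
  have hy3 : y ^ 2 * (3 * s + 4) = 4 := by rw [hy2]; field_simp
  set t₀ := Real.arccos y with ht₀
  have hcos : Real.cos t₀ = y := Real.cos_arccos (by linarith) hy1.le
  have ht0 : 0 < t₀ := Real.arccos_pos.2 hy1
  have ht1 : t₀ < Real.pi / 2 := Real.arccos_lt_pi_div_two.2 hy0
  have hint : ∀ a b : ℝ, 0 ≤ a → a ≤ b → b ≤ Real.pi / 2 →
      IntervalIntegrable G MeasureTheory.volume a b := fun a b ha hab hb =>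
    ContinuousOn.intervalIntegrable (by
      rw [uIcc_of_le hab]; exact hG.mono (Icc_subset_Icc ha hb))
  have i1 : (3 + s) * y ^ 3 / 3 - y ≤ ∫ t in t₀..(Real.pi / 2), G t := by
    have hF : ∫ t in t₀..(Real.pi / 2), Real.sin t * ((3 + s) * Real.cos t ^ 2 - 1) =
        (3 + s) * y ^ 3 / 3 - y := by
      rw [intervalIntegral.integral_eq_sub_of_hasDerivAt
        (f := fun t => -((3 + s) * Real.cos t ^ 3 / 3 - Real.cos t))]
      · rw [hcos, Real.cos_pi_div_two]; ring
      · intro t _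
        refine hasDerivAt_comp_cos (H := fun y => (3 + s) * y ^ 3 / 3 - y) ?_
        refine (((((hasDerivAt_id' (Real.cos t)).fun_pow 3).const_mul (3 + s)).div_const 3).fun_sub
          (hasDerivAt_id' (Real.cos t))).congr_deriv ?_
        push_cast
        ring
      · exact Continuous.intervalIntegrable (by fun_prop) _ _
    rw [← hF]
    refine intervalIntegral.integral_mono_on_of_le_Ioo ht1.le
      (Continuous.intervalIntegrable (by fun_prop) _ _) (hint _ _ ht0.le ht1.le le_rfl)
      fun t ht => h1 t ⟨ht0.trans ht.1, ht.2⟩ ?_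
    have hc : Real.cos t ≤ y := by
      rw [← hcos]
      exact Real.cos_le_cos_of_nonneg_of_le_pi ht0.le (by linarith [ht.2, Real.pi_pos]) ht.1.le
    have hc0 := (sin_cos_pos ⟨ht0.trans ht.1, ht.2⟩).2
    refine le_trans ?_ hy3.le
    gcongr
  have hcpos : ∀ t ∈ Icc 0 t₀, y ≤ Real.cos t := fun t ht => by
    rw [← hcos]
    exact Real.cos_le_cos_of_nonneg_of_le_pi ht.1 (by linarith [Real.pi_pos]) ht.2
  have i2 := intervalIntegral.integral_eq_sub_of_hasDerivAt (a := 0) (b := t₀)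
      (f' := fun t => Real.sin t * tailBound s (Real.cos t)) (fun t ht =>
        hasDerivAt_comp_cos (hasDerivAt_tailPrimitive hs (by
          rw [uIcc_of_le ht0.le] at ht
          exact (hy0.trans_le (hcpos t ht)).ne')))
  have hcT : ContinuousOn (fun t => Real.sin t * tailBound s (Real.cos t)) (Icc 0 t₀) := by
    unfold tailBound
    have : ∀ t ∈ Icc 0 t₀, Real.cos t ^ 2 ≠ 0 := fun t ht =>
      pow_ne_zero _ (hy0.trans_le (hcpos t ht)).ne'
    fun_prop (disch := assumption)
  have hiT : IntervalIntegrable (fun t => Real.sin t * tailBound s (Real.cos t))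
      MeasureTheory.volume 0 t₀ :=
    ContinuousOn.intervalIntegrable (by rwa [uIcc_of_le ht0.le])
  have i3 := intervalIntegral.integral_mono_on_of_le_Ioo ht0.le hiT (hint 0 t₀ le_rfl ht0.le ht1.le)
      fun t ht => h2 t ⟨ht.1, ht.2.trans ht1⟩ (by
        have := hcpos t ⟨ht.1.le, ht.2.le⟩
        refine le_trans hy3.ge ?_
        gcongr)
  rw [i2 hiT, hcos, Real.cos_zero] at i3
  rw [← intervalIntegral.integral_add_adjacent_intervals (hint 0 t₀ le_rfl ht0.le ht1.le)
    (hint t₀ _ ht0.le ht1.le le_rfl)]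
  have hs' : s = 4 * (1 - y ^ 2) / (3 * y ^ 2) := by
    field_simp
    linarith
  have hq : 0 < 1 - y ^ 2 := by nlinarith
  -- The total of the two integrals after s is eliminated in favour of the threshold y; the
  -- quadratic factor has no real root.
  have key : (0 : ℝ) < (1 - y) ^ 3 * (2 * y ^ 2 - 10 * y + 20) / (27 * (1 - y ^ 2) ^ 2) := by
    have : 0 < 1 - y := by linarith
    have : 0 < 2 * y ^ 2 - 10 * y + 20 := by nlinarith
    positivity
  refine key.trans_le (le_trans (le_of_eq ?_) (add_le_add i3 i1))
  rw [hs']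
  field_simp
  ring

lemma im_mul_conj_mul (z a u : ℂ) : (z * (starRingEnd ℂ) a * u).im =
    ‖z‖ * ‖a‖ * ‖u‖ * Real.sin (z.arg - a.arg + u.arg) := by
  rw [Complex.mul_im, im_mul_conj, re_mul_conj, Real.sin_add]
  linear_combination (-(‖z‖ * ‖a‖ * Real.cos (z.arg - a.arg))) * Complex.norm_mul_sin_arg u -
    (‖z‖ * ‖a‖ * Real.sin (z.arg - a.arg)) * Complex.norm_mul_cos_arg u

/-- The square of the sum is 2a + 2√(a-x)√(a+x). For Re a ≤ 0 the second summand has argument at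
most arg a, because a² - x² is turned clockwise from a²; hence so has the square. -/
lemma arg_add_csqrt_le {a : ℂ} (ha : 0 < a.im) (hre : a.re ≤ 0) (x : ℝ) :
    (csqrt (a - x) + csqrt (a + x)).arg ≤ a.arg / 2 := by
  have hp : 0 < (a - x).im := by simpa using ha
  have hq : 0 < (a + x).im := by simpa using ha
  have p1 := arg_pos_of_im_pos hp
  have p2 := arg_lt_pi_of_im_pos hp
  have q1 := arg_pos_of_im_pos hq
  have q2 := arg_lt_pi_of_im_pos hq
  have a2 := arg_lt_pi_of_im_pos ha
  have a1 : Real.pi / 2 ≤ a.arg := by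
    by_contra hc
    have := Real.cos_pos_of_mem_Ioo (x := a.arg)
      ⟨by linarith [arg_pos_of_im_pos ha, Real.pi_pos], not_le.1 hc⟩
    have h2 := Complex.norm_mul_cos_arg a
    have h3 := norm_pos_iff.2 (ne_zero_of_im_pos ha)
    nlinarith
  have hnp := norm_pos_iff.2 (ne_zero_of_im_pos hp)
  have hnq := norm_pos_iff.2 (ne_zero_of_im_pos hq)
  have hna := norm_pos_iff.2 (ne_zero_of_im_pos ha)
  -- The sign of the sine of the difference is that of Im((a² - x²) ā²) = 2x² Re a Im a ≤ 0.
  have hsum : (a - x).arg + (a + x).arg ≤ 2 * a.arg := by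
    by_contra hc
    have hs := Real.sin_pos_of_pos_of_lt_pi (x := (a - x).arg + (a + x).arg - 2 * a.arg)
      (by linarith) (by linarith)
    have h1 : ((a - x) * (starRingEnd ℂ) a * ((a + x) * (starRingEnd ℂ) a)).im =
        ‖a - x‖ * ‖a‖ * (‖a + x‖ * ‖a‖) *
          Real.sin ((a - x).arg + (a + x).arg - 2 * a.arg) := by
      rw [Complex.mul_im, im_mul_conj, im_mul_conj, re_mul_conj, re_mul_conj,
        show (a - x).arg + (a + x).arg - 2 * a.arg = ((a - x).arg - a.arg) + ((a + x).arg - a.arg)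
        by ring, Real.sin_add]
      ring
    have h2 : ((a - x) * (starRingEnd ℂ) a * ((a + x) * (starRingEnd ℂ) a)).im =
        2 * x ^ 2 * (a.re * a.im) := by
      simp only [Complex.mul_im, Complex.mul_re, Complex.sub_re, Complex.sub_im, Complex.add_re,
        Complex.add_im, Complex.conj_re, Complex.conj_im, Complex.ofReal_re, Complex.ofReal_im]
      ring
    have h3 : 0 < ‖a - x‖ * ‖a‖ * (‖a + x‖ * ‖a‖) *
          Real.sin ((a - x).arg + (a + x).arg - 2 * a.arg) := by positivity
    rw [← h1, h2] at h3
    have : 0 ≤ x ^ 2 * (-a.re * a.im) := by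
      have : 0 ≤ -a.re := by linarith
      positivity
    linarith
  have hP : 0 < (csqrt (a - x) + csqrt (a + x)).im := by
    have := csqrt_im_pos hp
    have := csqrt_im_pos hq
    rw [Complex.add_im]
    linarith
  have hP' : 0 < (csqrt (a - x) + csqrt (a + x)).re := by
    have := csqrt_re_pos (mem_slitPlane_of_im_pos hp)
    have := csqrt_re_pos (mem_slitPlane_of_im_pos hq)
    rw [Complex.add_re]
    linarith
  set P := csqrt (a - x) + csqrt (a + x) with hPdef
  have hPn := norm_pos_iff.2 (ne_zero_of_im_pos hP)
  have hP1 : P.arg < Real.pi / 2 :=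
    lt_of_abs_lt (Complex.abs_arg_lt_pi_div_two_iff.2 (Or.inl hP'))
  have hP0 := arg_pos_of_im_pos hP
  by_contra hc
  have hs := Real.sin_pos_of_pos_of_lt_pi (x := P.arg - a.arg + P.arg) (by linarith) (by linarith)
  have h1 : (P * (starRingEnd ℂ) a * P).im = ‖P‖ * ‖a‖ * ‖P‖ * Real.sin (P.arg - a.arg + P.arg) := by
    exact im_mul_conj_mul P a P
  -- P² ā is a real number plus a term with non-positive imaginary part, which contradicts 2 arg P >
  -- arg a.
  have h2 : P * (starRingEnd ℂ) a * P = ((2 * Complex.normSq a : ℝ) : ℂ) +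
      2 * (csqrt (a - x) * (starRingEnd ℂ) a * csqrt (a + x)) := by
    have e1 := csqrt_sq (a - x)
    have e2 := csqrt_sq (a + x)
    rw [hPdef]
    push_cast
    rw [← Complex.mul_conj]
    linear_combination (starRingEnd ℂ) a * e1 + (starRingEnd ℂ) a * e2
  have h3 : (csqrt (a - x) * (starRingEnd ℂ) a * csqrt (a + x)).im =
      ‖csqrt (a - x)‖ * ‖a‖ * ‖csqrt (a + x)‖ *
        Real.sin ((a - x).arg / 2 - a.arg + (a + x).arg / 2) := by
    rw [← arg_csqrt, ← arg_csqrt, im_mul_conj_mul]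
  have h4 : Real.sin ((a - x).arg / 2 - a.arg + (a + x).arg / 2) ≤ 0 :=
    Real.sin_nonpos_of_nonpos_of_neg_pi_le (by linarith) (by linarith)
  have h5 : 0 < (P * (starRingEnd ℂ) a * P).im := by rw [h1]; positivity
  rw [h2, Complex.add_im, Complex.ofReal_im, zero_add, Complex.mul_im, h3] at h5
  simp only [Complex.re_ofNat, Complex.im_ofNat, zero_mul, add_zero] at h5
  have : 0 ≤ ‖csqrt (a - x)‖ * ‖a‖ * ‖csqrt (a + x)‖ *
      -Real.sin ((a - x).arg / 2 - a.arg + (a + x).arg / 2) := by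
    have : 0 ≤ -Real.sin ((a - x).arg / 2 - a.arg + (a + x).arg / 2) := by linarith
    positivity
  linarith

/-- Averaging the integrand over x and -x prepares the pairwise estimate `arg_add_csqrt_le`, which
is false for each root alone. -/
lemma periodMid_symm {a : ℂ} (ha : 0 < a.im) :
    2 * periodMid a = ∫ t in (0 : ℝ)..(Real.pi / 2),
      ((8 * Real.sin t ^ 2 * Real.cos t ^ 2 : ℝ) : ℂ) *
        (csqrt (a - (2 * Real.sin t ^ 2 - 1 : ℝ)) + csqrt (a + (2 * Real.sin t ^ 2 - 1 : ℝ))) := by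
  have h := intervalIntegral.integral_comp_sub_left (a := 0) (b := Real.pi / 2)
    (fun t : ℝ => ((8 * Real.sin t ^ 2 * Real.cos t ^ 2 : ℝ) : ℂ) *
    csqrt ((1 - 2 * Real.sin t ^ 2 : ℝ) + (1 : ℝ) * a)) (Real.pi / 2)
  rw [sub_self, sub_zero] at h
  rw [two_mul]
  nth_rewrite 2 [periodMid]
  rw [← h, periodMid, ← intervalIntegral.integral_add]
  · refine intervalIntegral.integral_congr fun t _ => ?_
    simp only [Real.sin_pi_div_two_sub, Real.cos_pi_div_two_sub]
    have e1 : ((1 - 2 * Real.sin t ^ 2 : ℝ) + (1 : ℝ) * a : ℂ) =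
        a - (2 * Real.sin t ^ 2 - 1 : ℝ) := by push_cast; ring
    have e2 : ((1 - 2 * Real.cos t ^ 2 : ℝ) + (1 : ℝ) * a : ℂ) =
        a + (2 * Real.sin t ^ 2 - 1 : ℝ) := by rw [Real.cos_sq']; push_cast; ring
    rw [e1, e2]
    push_cast
    ring
  · exact (Continuous.mul (by fun_prop) (continuous_csqrt_comp (by fun_prop) fun t => by
      rw [im_ofReal_add_mul]; linarith)).intervalIntegrable _ _
  · exact (Continuous.mul (by fun_prop) (continuous_csqrt_comp (by fun_prop) fun t => by
      rw [im_ofReal_add_mul]; linarith)).intervalIntegrable _ _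

lemma arg_periodMid_le {a : ℂ} (ha : 0 < a.im) (hre : a.re ≤ 0) :
    (periodMid a).arg ≤ a.arg / 2 := by
  have a2 := arg_lt_pi_of_im_pos ha
  have a1 := arg_pos_of_im_pos ha
  -- `arg_integral_between` wants strict bounds on the integrand, whereas the pairwise estimate is
  -- not strict; the room ε is given up afterwards.
  refine le_of_forall_pos_lt_add fun ε hε => ?_
  rcases lt_or_ge (a.arg / 2 + ε) Real.pi with hlt | hge
  · rw [← Complex.arg_real_mul (periodMid a) two_pos, show ((2 : ℝ) : ℂ) = 2 by norm_num,
      periodMid_symm ha]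
    refine (arg_integral_between pi_div_two_pos' ?_ le_rfl (by positivity) hlt.le
      fun t ht => ?_).2
    · exact (Continuous.mul (by fun_prop) ((continuous_csqrt_comp (by fun_prop) fun t => by
        rw [Complex.sub_im, Complex.ofReal_im]; linarith).add
        (continuous_csqrt_comp (by fun_prop) fun t => by
        rw [Complex.add_im, Complex.ofReal_im]; linarith))).continuousOn
    · obtain ⟨hs, hc⟩ := sin_cos_pos ht
      rw [Complex.arg_real_mul _ (by positivity)]
      refine ⟨arg_pos_of_im_pos ?_, (arg_add_csqrt_le ha hre _).trans_lt (by linarith)⟩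
      rw [Complex.add_im]
      have h1 := csqrt_im_pos (z := a - (2 * Real.sin t ^ 2 - 1 : ℝ))
        (by rwa [Complex.sub_im, Complex.ofReal_im, sub_zero])
      have h2 := csqrt_im_pos (z := a + (2 * Real.sin t ^ 2 - 1 : ℝ))
        (by rwa [Complex.add_im, Complex.ofReal_im, add_zero])
      linarith
  · linarith [arg_periodMid_lt ha, Real.pi_pos]

/-- The right side decreases in r, so the bound is its value at r = 1. -/
lemma bound_of_le_one {s y r : ℝ} (hs : 0 < s) (hy : 0 < y) (hy1 : y < 1) (hr : 0 < r)
    (hr1 : r ≤ 1) : (3 + s) * y ^ 2 - 1 ≤ (2 + s) * y ^ 2 / r - (1 - y ^ 2) * r := by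
  have h1 : (2 + s) * y ^ 2 ≤ (2 + s) * y ^ 2 / r := by
    rw [le_div_iff₀ hr]
    exact mul_le_of_le_one_right (by positivity) hr1
  have h2 : (1 - y ^ 2) * r ≤ 1 - y ^ 2 := mul_le_of_le_one_right (by nlinarith) hr1
  linarith

/-- With N = 4(1-y²)/(3sy²) ≤ 1 the hypothesis is r² ≤ 1/3 + 2/(3N). The polynomial (5N - 2N²)/3 is
a lower bound for 1/r that makes the integral elementary. -/
lemma tailBound_le {s y r : ℝ} (hs : 0 < s) (hy : 0 < y) (hy1 : y < 1) (hr : 0 < r)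
    (hys : 4 ≤ y ^ 2 * (3 * s + 4)) (hr2 : r ^ 2 ≤ 1 / 3 + s * y ^ 2 / (1 - y ^ 2) / 2) :
    tailBound s y ≤ (2 + s) * y ^ 2 / r - (1 - y ^ 2) * r := by
  have hq : 0 < 1 - y ^ 2 := by nlinarith
  rw [tailBound]
  set N := 4 / (3 * s) * (1 / y ^ 2 - 1) with hN
  have hN0 : 0 < N := by
    have : 0 < 1 / y ^ 2 - 1 := by
      rw [sub_pos, lt_div_iff₀ (by positivity)]; linarith
    positivity
  have hN1 : N ≤ 1 := by
    rw [hN, show 4 / (3 * s) * (1 / y ^ 2 - 1) = 4 * (1 - y ^ 2) / (3 * s * y ^ 2) by field_simp,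
      div_le_one (by positivity)]
    linarith
  have hNr : r ^ 2 ≤ 1 / 3 + 2 / (3 * N) := by
    refine hr2.trans (le_of_eq ?_)
    rw [hN]
    have : 1 / y ^ 2 - 1 = (1 - y ^ 2) / y ^ 2 := by field_simp
    rw [this]
    field_simp
    ring
  have hD : 0 ≤ (7 / 3 + s / 2) * y ^ 2 - 1 / 3 := by nlinarith [sq_nonneg y]
  have hnum : (7 / 3 + s / 2) * y ^ 2 - 1 / 3 ≤ (2 + s) * y ^ 2 - (1 - y ^ 2) * r ^ 2 := by
    have := mul_le_mul_of_nonneg_left hr2 hq.le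
    have e : (1 - y ^ 2) * (1 / 3 + s * y ^ 2 / (1 - y ^ 2) / 2) =
        (1 - y ^ 2) / 3 + s * y ^ 2 / 2 := by field_simp
    linarith
  have hP0 : 0 ≤ 5 * N - 2 * N ^ 2 := by nlinarith
  -- The polynomial is chosen tangent at N = 1, where r = 1: hence the double factor (1 - N)² in the
  -- exact remainder below.
  have hinv : (5 * N - 2 * N ^ 2) / 3 * r ≤ 1 := by
    apply le_of_sq_le_sq _ zero_le_one
    rw [mul_pow]
    calc ((5 * N - 2 * N ^ 2) / 3) ^ 2 * r ^ 2
        ≤ ((5 * N - 2 * N ^ 2) / 3) ^ 2 * (1 / 3 + 2 / (3 * N)) := by gcongr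
      _ = 1 - (1 - N) ^ 2 * (27 + 4 * N - 4 * N ^ 2) / 27 := by
        field_simp
        ring
      _ ≤ 1 ^ 2 := by
        have : 0 ≤ 27 + 4 * N - 4 * N ^ 2 := by nlinarith
        have : 0 ≤ (1 - N) ^ 2 * (27 + 4 * N - 4 * N ^ 2) / 27 := by positivity
        linarith
  have e : (2 + s) * y ^ 2 / r - (1 - y ^ 2) * r =
      ((2 + s) * y ^ 2 - (1 - y ^ 2) * r ^ 2) * (1 / r) := by field_simp
  rw [e, mul_div_assoc]
  have h1 : (5 * N - 2 * N ^ 2) / 3 ≤ 1 / r := by rwa [le_div_iff₀ hr]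
  exact mul_le_mul hnum h1 (by positivity) (hD.trans hnum)

lemma csqrt_re_sq (z : ℂ) : 2 * (csqrt z).re ^ 2 = ‖z‖ + z.re := by
  have h1 := congrArg Complex.re (csqrt_sq z)
  have h2 := congrArg norm (csqrt_sq z)
  rw [norm_pow, ← Complex.normSq_eq_norm_sq, Complex.normSq_apply] at h2
  rw [sq, Complex.mul_re] at h1
  linarith

/-- Bounds for the real part of `√ζ` when `ζ = 1 - m e^{iκ}` with `cos κ ≥ 1/2`. -/
lemma csqrt_re_bounds {ζ : ℂ} {m c : ℝ} (hm : 0 ≤ m) (hc : 1 / 2 ≤ c) (hre : ζ.re = 1 - m * c)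
    (hn : ‖ζ‖ ^ 2 = 1 - 2 * m * c + m ^ 2) :
    (m ≤ 8 / 3 → (csqrt ζ).re ^ 2 ≤ 1) ∧ (8 / 3 ≤ m → (csqrt ζ).re ^ 2 ≤ 1 / 3 + m / 4) := by
  have h := csqrt_re_sq ζ
  have hmc : m * (1 / 2) ≤ m * c := mul_le_mul_of_nonneg_left hc hm
  constructor
  · intro hm2
    -- The case split at 8/3 is where the two linear bounds 1 + m/2 and m - 1/3 for |ζ| agree; each
    -- is valid on its side when c ≥ 1/2.
    have : ‖ζ‖ ≤ 1 + m / 2 := by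
      apply le_of_sq_le_sq _ (by positivity)
      rw [hn]
      nlinarith
    nlinarith
  · intro hm2
    have : ‖ζ‖ ≤ m - 1 / 3 := by
      apply le_of_sq_le_sq _ (by linarith)
      rw [hn]
      nlinarith
    nlinarith

/-- E is half the angle that the segment [0,1] subtends at v. Both sin 2E and cos 2E are known from
(v-1) v̄, and sin E = sin 2E / (2 cos E); the hypothesis on Re v bounds cos² E from below. -/
lemma sin_half_sub_arg_le {v : ℂ} (hv : 0 < v.im) (hP : ‖v‖ / 2 ≤ -v.re) :
    0 < Real.cos (((v - 1).arg - v.arg) / 2) ∧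
    Real.sin (((v - 1).arg - v.arg) / 2) ≤
      v.im * Real.cos (((v - 1).arg - v.arg) / 2) / (‖v‖ * (2 * ‖v‖ + 1)) := by
  have hρ : 0 < ‖v‖ := norm_pos_iff.2 (ne_zero_of_im_pos hv)
  have haim : 0 < (v - 1).im := by simpa using hv
  have a2 := arg_lt_pi_of_im_pos haim
  have v1 := arg_pos_of_im_pos hv
  have hav : v.arg < (v - 1).arg := by simpa using arg_add_real_lt haim one_pos
  set E := ((v - 1).arg - v.arg) / 2 with hE
  have hcosE : 0 < Real.cos E := Real.cos_pos_of_mem_Ioo ⟨by linarith, by linarith⟩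
  refine ⟨hcosE, ?_⟩
  rw [le_div_iff₀ (by positivity)]
  have h1 := im_mul_conj (v - 1) v
  have h2 := re_mul_conj (v - 1) v
  have e1 : ((v - 1) * (starRingEnd ℂ) v).im = v.im := by
    simp only [Complex.mul_im, Complex.sub_re, Complex.sub_im, Complex.conj_re,
      Complex.conj_im, Complex.one_re, Complex.one_im]
    ring
  have e2 : ((v - 1) * (starRingEnd ℂ) v).re = ‖v‖ ^ 2 - v.re := by
    rw [← Complex.normSq_eq_norm_sq, Complex.normSq_apply]
    simp only [Complex.mul_re, Complex.sub_re, Complex.sub_im, Complex.conj_re,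
      Complex.conj_im, Complex.one_re, Complex.one_im]
    ring
  rw [e1, show (v - 1).arg - v.arg = 2 * E by rw [hE]; ring, Real.sin_two_mul] at h1
  rw [e2, show (v - 1).arg - v.arg = 2 * E by rw [hE]; ring, Real.cos_two_mul] at h2
  -- Since cos 2E ≤ 1, |v-1||v| ≥ |v|² - Re v; adding |v|² - Re v once more gives at least 2|v|² +
  -- |v|.
  have h3 : ‖v‖ * (2 * ‖v‖ + 1) ≤ ‖v - 1‖ * ‖v‖ * (2 * Real.cos E ^ 2) := by
    have hn : ‖v - 1‖ * ‖v‖ * (2 * Real.cos E ^ 2) = ‖v‖ ^ 2 - v.re + ‖v - 1‖ * ‖v‖ := by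
      rw [h2]; ring
    have h4 : ‖v - 1‖ * ‖v‖ * (2 * Real.cos E ^ 2 - 1) ≤ ‖v - 1‖ * ‖v‖ * 1 := by
      gcongr
      nlinarith [Real.cos_le_one E]
    rw [← h2] at h4
    nlinarith
  have hsE : 0 ≤ Real.sin E := (Real.sin_pos_of_pos_of_lt_pi (by linarith) (by linarith)).le
  calc Real.sin E * (‖v‖ * (2 * ‖v‖ + 1)) ≤
      Real.sin E * (‖v - 1‖ * ‖v‖ * (2 * Real.cos E ^ 2)) := by gcongr
    _ = v.im * Real.cos E := by rw [h1]; ring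

/-- Splitting off √v leaves a root near which the real part can be bounded. The remaining factor
lies in the lower half plane, so the arguments add without wrapping. -/
lemma csqrt_two_add_factor {v : ℂ} (hv : 0 < v.im) {S C : ℝ} (hS : 0 < S) (hC : 0 < C)
    (hSC : S ^ 2 + C ^ 2 = 1) :
    csqrt ((2 : ℝ) + (S ^ 2 : ℝ) * (v - 2)) =
      (S : ℂ) * (csqrt v * csqrt (1 + ((2 * C ^ 2 / S ^ 2 : ℝ) : ℂ) * v⁻¹)) := by
  have hv0 := ne_zero_of_im_pos hv
  set k : ℝ := 2 * C ^ 2 / S ^ 2 with hk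
  have hk0 : 0 < k := by positivity
  set ζ : ℂ := 1 + (k : ℂ) * v⁻¹ with hζ
  have hζneg : ζ.im < 0 := by
    have := Complex.normSq_pos.2 hv0
    have h : ζ.im = -(k * (v.im / Complex.normSq v)) := by
      rw [hζ, Complex.add_im, Complex.one_im, Complex.im_ofReal_mul, Complex.inv_im]
      ring
    rw [h, neg_lt_zero]
    positivity
  have hD : ((2 : ℝ) + (S ^ 2 : ℝ) * (v - 2) : ℂ) = (S ^ 2 : ℝ) * (v * ζ) := by
    have hC2 : ((C ^ 2 : ℝ) : ℂ) = 1 - ((S ^ 2 : ℝ) : ℂ) := by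
      rw [← Complex.ofReal_one, ← Complex.ofReal_sub]; congr 1; linarith
    have hk' : (k : ℂ) * ((S ^ 2 : ℝ) : ℂ) = 2 * ((C ^ 2 : ℝ) : ℂ) := by
      rw [← Complex.ofReal_mul, hk]
      have : 2 * C ^ 2 / S ^ 2 * S ^ 2 = 2 * C ^ 2 := by field_simp
      rw [this]; push_cast; ring
    rw [hζ, mul_add, mul_left_comm v, mul_inv_cancel₀ hv0, mul_one, mul_one, mul_add,
      mul_comm ((S ^ 2 : ℝ) : ℂ) (k : ℂ), hk', hC2, Complex.ofReal_ofNat]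
    ring
  have hz1 := Complex.neg_pi_lt_arg ζ
  have hz2 : ζ.arg < 0 := Complex.arg_neg_iff.2 hζneg
  have v1 := arg_pos_of_im_pos hv
  have v2 := arg_lt_pi_of_im_pos hv
  have hζ0 : ζ ≠ 0 := by intro h; rw [h] at hζneg; simp at hζneg
  rw [hD, csqrt_real_mul (by positivity), Real.sqrt_sq hS.le,
    csqrt_mul hv0 hζ0 ⟨by linarith, by linarith⟩]

/-- The pointwise estimate behind `arg_hInt_lt`. -/
lemma exists_re_bound {v : ℂ} (hv : 0 < v.im) (hP : ‖v‖ / 2 ≤ -v.re) {S C : ℝ} (hS : 0 < S)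
    (hC : 0 < C) (hSC : S ^ 2 + C ^ 2 = 1) : ∃ r : ℝ, 0 < r ∧
      ((C ^ 2 * (3 * (1 / ‖v‖) + 4) ≤ 4) → r ≤ 1) ∧
      ((4 ≤ C ^ 2 * (3 * (1 / ‖v‖) + 4)) → r ^ 2 ≤ 1 / 3 + 1 / ‖v‖ * C ^ 2 / (1 - C ^ 2) / 2) ∧
      2 * r * (csqrt (1 + ((2 * C ^ 2 / S ^ 2 : ℝ) : ℂ) * v⁻¹)).im =
        -(2 * C ^ 2 / S ^ 2 * v.im / ‖v‖ ^ 2) ∧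
      (csqrt (1 + ((2 * C ^ 2 / S ^ 2 : ℝ) : ℂ) * v⁻¹)).re = r := by
  have hρ : 0 < ‖v‖ := norm_pos_iff.2 (ne_zero_of_im_pos hv)
  have hS2 : 1 - C ^ 2 = S ^ 2 := by linarith
  set k : ℝ := 2 * C ^ 2 / S ^ 2 with hk
  have hk0 : 0 < k := by positivity
  set ζ : ℂ := 1 + (k : ℂ) * v⁻¹ with hζ
  have hζre : ζ.re = 1 - k * (1 / ‖v‖) * (-v.re / ‖v‖) := by
    rw [hζ, Complex.add_re, Complex.one_re, Complex.re_ofReal_mul, Complex.inv_re,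
      Complex.normSq_eq_norm_sq]
    field_simp
    ring
  have hζim : ζ.im = -(k * v.im / ‖v‖ ^ 2) := by
    rw [hζ, Complex.add_im, Complex.one_im, Complex.im_ofReal_mul, Complex.inv_im,
      Complex.normSq_eq_norm_sq]
    ring
  have hζn : ‖ζ‖ ^ 2 = 1 - 2 * (k * (1 / ‖v‖)) * (-v.re / ‖v‖) + (k * (1 / ‖v‖)) ^ 2 := by
    rw [← Complex.normSq_eq_norm_sq, Complex.normSq_apply, hζre, hζim]
    have : v.im ^ 2 = ‖v‖ ^ 2 - v.re ^ 2 := by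
      rw [← Complex.normSq_eq_norm_sq, Complex.normSq_apply]; ring
    field_simp
    rw [this]
    ring
  have hζneg : ζ.im < 0 := by rw [hζim, neg_lt_zero]; positivity
  have hζs : ζ ∈ Complex.slitPlane := Complex.mem_slitPlane_iff.2 (Or.inr hζneg.ne)
  have hb := csqrt_re_bounds (ζ := ζ) (m := k * (1 / ‖v‖)) (c := -v.re / ‖v‖) (by positivity)
    (by rw [le_div_iff₀ hρ]; linarith) hζre hζn
  have hrpos := csqrt_re_pos hζs
  refine ⟨(csqrt ζ).re, hrpos, fun h => ?_, fun h => ?_, ?_, rfl⟩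
  · have h8 : k * (1 / ‖v‖) ≤ 8 / 3 := by
      rw [hk]
      field_simp at h ⊢
      nlinarith
    have := hb.1 h8
    nlinarith
  · have h8 : 8 / 3 ≤ k * (1 / ‖v‖) := by
      rw [hk]
      field_simp at h ⊢
      nlinarith
    refine (hb.2 h8).trans (le_of_eq ?_)
    rw [hS2, hk]
    field_simp
    ring
  · have := congrArg Complex.im (csqrt_sq ζ)
    rw [sq, Complex.mul_im, hζim] at this
    linarith

/-- X is the rotated imaginary part of the integrand, with `r` and `i` the real and imaginary parts
of the remaining root, and `σ`, `e` the sine and cosine of E. Eliminating `i` through r·i and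
bounding `σ` leaves an expression in r alone. -/
lemma scaled_bound_le {S C ρ Q e σ R r i X : ℝ} (hS : 0 < S) (hρ : 0 < ρ) (hQ : 0 < Q)
    (he : 0 < e) (hR : 0 < R) (hr : 0 < r) (hσ : σ ≤ Q * e / (ρ * (2 * ρ + 1)))
    (hi : 2 * r * i = -(2 * C ^ 2 / S ^ 2 * Q / ρ ^ 2))
    (hX : X = 2 * S ^ 3 * (R * (e * i + σ * r))) :
    S * ((2 + 1 / ρ) * C ^ 2 / r - S ^ 2 * r) ≤
      -(1 / (2 * (R * (e * Q / (ρ * (2 * ρ + 1)))))) * X := by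
  have hi' : i = -(C ^ 2 / S ^ 2 * Q / ρ ^ 2 / r) := by
    field_simp
    field_simp at hi
    linarith
  have hle : X ≤ 2 * S ^ 3 * (R * (e * i + Q * e / (ρ * (2 * ρ + 1)) * r)) := by
    rw [hX]; gcongr
  have h1 := mul_le_mul_of_nonneg_left hle
    (show 0 ≤ 1 / (2 * (R * (e * Q / (ρ * (2 * ρ + 1))))) by positivity)
  have h2 : 1 / (2 * (R * (e * Q / (ρ * (2 * ρ + 1))))) *
      (2 * S ^ 3 * (R * (e * i + Q * e / (ρ * (2 * ρ + 1)) * r))) =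
      -(S * ((2 + 1 / ρ) * C ^ 2 / r - S ^ 2 * r)) := by
    rw [hi']
    field_simp
    ring
  linarith

/-- With v = a + 1 and ψ = arg v - arg(v-1)/2 the claim is Im(e^{-iψ} h) < 0. This is false
pointwise in t, so the rotated integrand is bounded above by an explicit function whose integral is
negative. The hypothesis arg v ≥ 2π/3 enters as -Re v ≥ |v|/2. -/
lemma arg_hInt_lt {a : ℂ} (ha : 0 < a.im) (hv : 2 * Real.pi / 3 ≤ (a + 1).arg) :
    (hInt (a - 1)).arg < (a + 1).arg - a.arg / 2 := by
  have hvim : 0 < (a + 1).im := by simpa using ha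
  have hv0 := ne_zero_of_im_pos hvim
  have a1 := arg_pos_of_im_pos ha
  have a2 := arg_lt_pi_of_im_pos ha
  have v2 := arg_lt_pi_of_im_pos hvim
  obtain ⟨v, rfl⟩ : ∃ v, a = v - 1 := ⟨a + 1, by ring⟩
  rw [sub_add_cancel] at *
  have hρ : 0 < ‖v‖ := norm_pos_iff.2 hv0
  have hP : ‖v‖ / 2 ≤ -v.re := by
    have h1 : Real.cos v.arg ≤ Real.cos (2 * Real.pi / 3) :=
      Real.cos_le_cos_of_nonneg_of_le_pi (by positivity) v2.le hv
    have h2 : Real.cos (2 * Real.pi / 3) = -(1 / 2) := by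
      rw [show 2 * Real.pi / 3 = Real.pi - Real.pi / 3 by ring, Real.cos_pi_sub,
        Real.cos_pi_div_three]
    rw [← Complex.norm_mul_cos_arg v]
    nlinarith
  obtain ⟨hcosE, hsinE⟩ := sin_half_sub_arg_le hvim hP
  set E := ((v - 1).arg - v.arg) / 2 with hE
  set ψ := v.arg - (v - 1).arg / 2 with hψ
  have hSv : Complex.exp (-ψ * Complex.I) * csqrt v =
      (Real.sqrt ‖v‖ : ℂ) * Complex.exp (E * Complex.I) := by
    rw [csqrt_eq_polar, mul_left_comm, ← Complex.exp_add]
    congr 2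
    rw [hψ, hE]
    push_cast
    ring
  -- The common positive factor of the pointwise bound; dividing by it leaves the parameter 1/|v|
  -- alone.
  set c₀ := Real.sqrt ‖v‖ * (Real.cos E * v.im / (‖v‖ * (2 * ‖v‖ + 1))) with hc₀
  have hR := Real.sqrt_pos.2 hρ
  have hc₀pos : 0 < c₀ := by positivity
  set f : ℝ → ℂ := fun t => ((2 * Real.sin t ^ 2 : ℝ) : ℂ) *
    csqrt ((2 : ℝ) + (Real.sin t ^ 2 : ℝ) * (v - 2)) with hf
  have hfc : Continuous f := Continuous.mul (by fun_prop) (continuous_csqrt_comp (by fun_prop)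
    fun t => by
      rw [im_ofReal_add_mul]
      have : (v - 2).im = v.im := by simp
      rw [this]; positivity)
  have hpt : ∀ t ∈ Ioo 0 (Real.pi / 2), ∃ r : ℝ, 0 < r ∧
      ((Real.cos t ^ 2 * (3 * (1 / ‖v‖) + 4) ≤ 4) → r ≤ 1) ∧
      ((4 ≤ Real.cos t ^ 2 * (3 * (1 / ‖v‖) + 4)) →
        r ^ 2 ≤ 1 / 3 + 1 / ‖v‖ * Real.cos t ^ 2 / (1 - Real.cos t ^ 2) / 2) ∧
      Real.sin t * ((2 + 1 / ‖v‖) * Real.cos t ^ 2 / r - (1 - Real.cos t ^ 2) * r) ≤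
        -(1 / (2 * c₀)) * (Complex.exp (-ψ * Complex.I) * f t).im := by
    intro t ht
    obtain ⟨hs, hc⟩ := sin_cos_pos ht
    have hsq := Real.sin_sq_add_cos_sq t
    obtain ⟨r, hr, hr1, hr2, him, hre⟩ := exists_re_bound hvim hP hs hc hsq
    refine ⟨r, hr, hr1, hr2, ?_⟩
    rw [show 1 - Real.cos t ^ 2 = Real.sin t ^ 2 by linarith]
    refine scaled_bound_le hs hρ hvim hcosE hR hr hsinE him ?_
    have hfact : f t = ((2 * Real.sin t ^ 3 : ℝ) : ℂ) *
        (csqrt v * csqrt (1 + ((2 * Real.cos t ^ 2 / Real.sin t ^ 2 : ℝ) : ℂ) * v⁻¹)) := by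
      rw [hf]
      beta_reduce
      rw [csqrt_two_add_factor hvim hs hc hsq, ← mul_assoc, ← Complex.ofReal_mul]
      congr 2
      ring
    rw [hfact, mul_left_comm, ← mul_assoc (Complex.exp (-ψ * Complex.I)), hSv, mul_assoc,
      Complex.im_ofReal_mul, Complex.im_ofReal_mul, Complex.mul_im, Complex.exp_ofReal_mul_I_re,
      Complex.exp_ofReal_mul_I_im, hre]
  have hpos := integral_pos_of_bounds (s := 1 / ‖v‖) (by positivity)
    (G := fun t => -(1 / (2 * c₀)) * (Complex.exp (-ψ * Complex.I) * f t).im)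
    (by fun_prop) (fun t ht h => by
      obtain ⟨hs, hc⟩ := sin_cos_pos ht
      have hsq := Real.sin_sq_add_cos_sq t
      obtain ⟨r, hr, hr1, -, hle⟩ := hpt t ht
      refine le_trans ?_ hle
      exact mul_le_mul_of_nonneg_left (bound_of_le_one (by positivity) hc (by nlinarith) hr
        (hr1 h)) hs.le) (fun t ht h => by
      obtain ⟨hs, hc⟩ := sin_cos_pos ht
      have hsq := Real.sin_sq_add_cos_sq t
      obtain ⟨r, hr, -, hr2, hle⟩ := hpt t ht
      refine le_trans ?_ hle
      exact mul_le_mul_of_nonneg_left (tailBound_le (by positivity) hc (by nlinarith) hr h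
        (hr2 h)) hs.le)
  rw [intervalIntegral.integral_const_mul] at hpos
  have him : ∫ t in (0 : ℝ)..(Real.pi / 2), (Complex.exp (-ψ * Complex.I) * f t).im =
      (Complex.exp (-ψ * Complex.I) * hInt (v - 2)).im := by
    have := Complex.imCLM.intervalIntegral_comp_comm (μ := MeasureTheory.volume)
      (Continuous.intervalIntegrable (hfc.const_mul (Complex.exp (-ψ * Complex.I))) 0
        (Real.pi / 2))
    rw [intervalIntegral.integral_const_mul] at this
    exact this
  rw [him, im_exp_neg_mul] at hpos
  have hw : v - 1 - 1 = v - 2 := by ring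
  rw [hw]
  have hwim : 0 < (v - 2).im := by simpa using hvim
  have h1 := arg_hInt hwim
  have hsin : Real.sin ((hInt (v - 2)).arg - ψ) < 0 := by
    by_contra hc
    have : 0 ≤ ‖hInt (v - 2)‖ * Real.sin ((hInt (v - 2)).arg - ψ) :=
      mul_nonneg (norm_nonneg _) (not_lt.1 hc)
    have h3 : 0 ≤ 1 / (2 * c₀) * (‖hInt (v - 2)‖ * Real.sin ((hInt (v - 2)).arg - ψ)) := by
      positivity
    linarith
  by_contra hc
  have := Real.sin_nonneg_of_nonneg_of_le_pi (x := (hInt (v - 2)).arg - ψ) (by linarith)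
    (by linarith [Complex.arg_le_pi (v - 2 + 2)])
  linarith

/-! ### The vanishing conditions in terms of the period integrals -/

lemma integral_neg_one_one_eq {f : ℝ → ℂ} (hf : Continuous f) :
    ∫ x in (-1 : ℝ)..1, f x = ∫ t in (0 : ℝ)..(Real.pi / 2),
      ((4 * Real.sin t * Real.cos t : ℝ) : ℂ) * f (2 * Real.sin t ^ 2 - 1) := by
  have h := intervalIntegral.integral_deriv_smul_comp (a := 0) (b := Real.pi / 2)
    (f := fun t => 2 * Real.sin t ^ 2 - 1) (f' := fun t => 4 * Real.sin t * Real.cos t) (g := f)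
    (fun t _ => by
      refine ((((Real.hasDerivAt_sin t).fun_pow 2).const_mul 2).sub_const 1).congr_deriv ?_
      push_cast
      ring) (by fun_prop) hf
  simp only [Real.sin_zero, Real.sin_pi_div_two] at h
  norm_num at h
  rw [← h]
  refine intervalIntegral.integral_congr fun t _ => ?_
  simp

lemma periodMid_eq_integral {a : ℂ} (ha : 0 ≤ a.im) :
    periodMid a = ∫ x in (-1 : ℝ)..1, (Real.sqrt (1 - x ^ 2) : ℂ) * csqrt (a - x) := by
  rw [integral_neg_one_one_eq, periodMid, intervalIntegral.integral_of_le pi_div_two_pos'.le,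
      intervalIntegral.integral_of_le pi_div_two_pos'.le, MeasureTheory.integral_Ioc_eq_integral_Ioo,
      MeasureTheory.integral_Ioc_eq_integral_Ioo]
  · refine MeasureTheory.setIntegral_congr_fun measurableSet_Ioo fun t ht => ?_
    obtain ⟨hs, hc⟩ := sin_cos_pos ht
    have e1 : 1 - (2 * Real.sin t ^ 2 - 1) ^ 2 = (2 * Real.sin t * Real.cos t) ^ 2 := by
      rw [mul_pow, Real.cos_sq']; ring
    have e2 : (a - (2 * Real.sin t ^ 2 - 1 : ℝ) : ℂ) = (1 - 2 * Real.sin t ^ 2 : ℝ) + (1 : ℝ) * a := by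
      push_cast; ring
    rw [e1, Real.sqrt_sq (by positivity), e2]
    push_cast
    ring
  · refine Continuous.mul (by fun_prop) (continuous_csqrt_comp (by fun_prop) fun t => ?_)
    rwa [Complex.sub_im, Complex.ofReal_im, sub_zero]

lemma continuousOn_csqrt_two_add {w : ℂ} (hw : 0 ≤ w.im) :
    ContinuousOn (fun τ : ℝ => csqrt (2 + τ * w)) (Icc 0 1) := by
  refine continuousOn_csqrt.comp (f := fun τ : ℝ => (2 + τ * w : ℂ)) (by fun_prop) fun τ hτ => ?_
  have : (2 + τ * w : ℂ).im = τ * w.im := by simp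
  rw [mem_ofPred_eq, this]
  exact mul_nonneg hτ.1 hw

lemma gInt_eq_integral {w : ℂ} (hw : 0 ≤ w.im) :
    gInt w = ∫ τ in (0 : ℝ)..1, (Real.sqrt (τ * (1 - τ)) : ℂ) * csqrt (2 + τ * w) := by
  have h := intervalIntegral.integral_deriv_smul_comp' (a := 0) (b := Real.pi / 2)
    (f := fun t => Real.sin t ^ 2) (f' := fun t => 2 * Real.sin t * Real.cos t)
    (g := fun τ : ℝ => (Real.sqrt (τ * (1 - τ)) : ℂ) * csqrt (2 + τ * w))
    (fun t _ => by
      refine ((Real.hasDerivAt_sin t).fun_pow 2).congr_deriv ?_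
      push_cast
      ring) (by fun_prop) ?_
  · simp only [Real.sin_zero, Real.sin_pi_div_two, one_pow, ne_eq, OfNat.ofNat_ne_zero,
      not_false_eq_true, zero_pow] at h
    rw [← h, gInt, intervalIntegral.integral_of_le pi_div_two_pos'.le,
      intervalIntegral.integral_of_le pi_div_two_pos'.le, MeasureTheory.integral_Ioc_eq_integral_Ioo,
      MeasureTheory.integral_Ioc_eq_integral_Ioo]
    refine MeasureTheory.setIntegral_congr_fun measurableSet_Ioo fun t ht => ?_
    obtain ⟨hs, hc⟩ := sin_cos_pos ht
    have e1 : Real.sin t ^ 2 * (1 - Real.sin t ^ 2) = (Real.sin t * Real.cos t) ^ 2 := by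
      rw [mul_pow, Real.cos_sq']
    simp only [Function.comp, Complex.real_smul]
    rw [e1, Real.sqrt_sq (by positivity), Complex.ofReal_ofNat]
    push_cast
    ring
  · refine ContinuousOn.mul (by fun_prop) ((continuousOn_csqrt_two_add hw).mono ?_)
    rintro _ ⟨t, -, rfl⟩
    exact ⟨sq_nonneg _, Real.sin_sq_le_one t⟩

/-- Two square roots of a function without zeros on a connected interval agree up to one global
sign, so any explicit root computes the condition. Zeros at the end points are harmless, hence the
open interval. -/
lemma periodVanishes_iff {θ : ℝ} {a u v : ℂ} {r₀ : ℝ → ℂ} (hc : ContinuousOn r₀ (Icc 0 1))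
    (hsq : ∀ τ ∈ Icc (0 : ℝ) 1, r₀ τ ^ 2 = cubic a (u + (τ : ℂ) * (v - u)))
    (hne : ∀ τ ∈ Ioo (0 : ℝ) 1, r₀ τ ≠ 0) :
    PeriodVanishes θ a u v ↔
      (Complex.exp (θ * Complex.I) * (∫ τ in (0 : ℝ)..1, r₀ τ) * (v - u)).re = 0 := by
  have hI : ∀ r : ℝ → ℂ, ∫ τ in (0 : ℝ)..1, Complex.exp (θ * Complex.I) * r τ * (v - u) =
      Complex.exp (θ * Complex.I) * (∫ τ in (0 : ℝ)..1, r τ) * (v - u) := fun r => by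
    rw [intervalIntegral.integral_mul_const, intervalIntegral.integral_const_mul]
  constructor
  · rintro ⟨r, hrc, hrsq, hr⟩
    rw [hI] at hr
    have hcongr : ∀ f : ℝ → ℂ, EqOn r f (Ioo 0 1) →
        ∫ τ in (0 : ℝ)..1, r τ = ∫ τ in (0 : ℝ)..1, f τ := fun f hf => by
      rw [intervalIntegral.integral_of_le zero_le_one, intervalIntegral.integral_of_le zero_le_one,
        MeasureTheory.integral_Ioc_eq_integral_Ioo, MeasureTheory.integral_Ioc_eq_integral_Ioo]
      exact MeasureTheory.setIntegral_congr_fun measurableSet_Ioo hf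
    rcases isPreconnected_Ioo.eq_or_eq_neg_of_sq_eq (hrc.mono Ioo_subset_Icc_self)
      (hc.mono Ioo_subset_Icc_self) (fun τ hτ => by
        simp only [Pi.pow_apply]
        rw [hrsq τ (Ioo_subset_Icc_self hτ), hsq τ (Ioo_subset_Icc_self hτ)])
      (fun {τ} hτ => hne τ hτ) with h | h
    · rwa [hcongr _ h] at hr
    · rw [hcongr _ h] at hr
      simp only [Pi.neg_apply, intervalIntegral.integral_neg, mul_neg, neg_mul, Complex.neg_re,
        neg_eq_zero] at hr
      exact hr
  · intro h
    exact ⟨r₀, hc, hsq, by rwa [hI]⟩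

lemma intervalIntegral_conj (f : ℝ → ℂ) (a b : ℝ) :
    ∫ t in a..b, (starRingEnd ℂ) (f t) = (starRingEnd ℂ) (∫ t in a..b, f t) := by
  rw [intervalIntegral, intervalIntegral, map_sub, ← integral_conj, ← integral_conj]

/-- The cubic satisfies p_{-ā}(-z̄) = -conj(p_a(z)), so i·r̄ is a root for the reflected data; the
extra factor i is what turns θ into π/2 - θ. -/
lemma periodVanishes_reflect {θ : ℝ} {a u v : ℂ} (h : PeriodVanishes θ a u v) :
    PeriodVanishes (Real.pi / 2 - θ) (reflectIm a) (reflectIm u) (reflectIm v) := by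
  obtain ⟨r, hrc, hrsq, hr⟩ := h
  refine ⟨fun τ => Complex.I * (starRingEnd ℂ) (r τ),
    continuousOn_const.mul (Complex.continuous_conj.comp_continuousOn hrc), fun τ hτ => ?_, ?_⟩
  · rw [mul_pow, ← map_pow, hrsq τ hτ]
    simp only [cubic, reflectIm, map_mul, map_sub, map_add, map_pow, map_one, Complex.conj_ofReal,
      Complex.I_sq]
    ring
  · have e : ∀ τ : ℝ, Complex.exp ((Real.pi / 2 - θ : ℝ) * Complex.I) *
        (Complex.I * (starRingEnd ℂ) (r τ)) * (reflectIm v - reflectIm u) =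
        (starRingEnd ℂ) (Complex.exp (θ * Complex.I) * r τ * (v - u)) := fun τ => by
      have h1 : Complex.exp ((Real.pi / 2 - θ : ℝ) * Complex.I) =
          Complex.I * (starRingEnd ℂ) (Complex.exp (θ * Complex.I)) := by
        rw [← Complex.exp_conj, map_mul, Complex.conj_I, Complex.conj_ofReal]
        push_cast
        rw [sub_mul, sub_eq_add_neg, Complex.exp_add, Complex.exp_pi_div_two_mul_I, mul_neg]
      rw [h1]
      simp only [reflectIm, map_mul, map_sub]
      linear_combination (-(starRingEnd ℂ) (Complex.exp (θ * Complex.I)) *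
        (starRingEnd ℂ) (r τ) * ((starRingEnd ℂ) v - (starRingEnd ℂ) u)) * Complex.I_sq
    simp only [e]
    rw [intervalIntegral_conj, Complex.conj_re, hr]

lemma periodVanishes_reflect_iff {θ : ℝ} {a u v : ℂ} : PeriodVanishes θ a u v ↔
    PeriodVanishes (Real.pi / 2 - θ) (reflectIm a) (reflectIm u) (reflectIm v) := by
  refine ⟨periodVanishes_reflect, fun h => ?_⟩
  have := periodVanishes_reflect h
  simpa only [reflectIm_reflectIm, sub_sub_cancel] using this

lemma periodVanishes_conj {θ : ℝ} {a u v : ℂ} (h : PeriodVanishes θ a u v) :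
    PeriodVanishes (-θ) ((starRingEnd ℂ) a) ((starRingEnd ℂ) u) ((starRingEnd ℂ) v) := by
  obtain ⟨r, hrc, hrsq, hr⟩ := h
  refine ⟨fun τ => (starRingEnd ℂ) (r τ),
    Complex.continuous_conj.comp_continuousOn hrc, fun τ hτ => ?_, ?_⟩
  · rw [← map_pow, hrsq τ hτ]
    simp only [cubic, map_mul, map_sub, map_add, map_pow, map_one, Complex.conj_ofReal]
  · have e : ∀ τ : ℝ, Complex.exp ((-θ : ℝ) * Complex.I) * (starRingEnd ℂ) (r τ) *
        ((starRingEnd ℂ) v - (starRingEnd ℂ) u) =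
        (starRingEnd ℂ) (Complex.exp (θ * Complex.I) * r τ * (v - u)) := fun τ => by
      rw [map_mul, map_mul, map_sub, ← Complex.exp_conj, map_mul, Complex.conj_I,
        Complex.conj_ofReal]
      push_cast
      rw [neg_mul, mul_neg]
    simp only [e]
    rw [intervalIntegral_conj, Complex.conj_re, hr]

lemma re_exp_mul (θ : ℝ) (z : ℂ) :
    (Complex.exp (θ * Complex.I) * z).re = ‖z‖ * Real.cos (z.arg + θ) := by
  rw [Complex.mul_re, Complex.exp_ofReal_mul_I_re, Complex.exp_ofReal_mul_I_im, Real.cos_add]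
  linear_combination (-Real.cos θ) * Complex.norm_mul_cos_arg z +
    Real.sin θ * Complex.norm_mul_sin_arg z

/-- The vanishing condition on `[1,a]`. -/
lemma periodVanishes_one_iff {θ : ℝ} {a : ℂ} (ha : 0 ≤ a.im) (ha' : ¬(a.im = 0 ∧ a.re < -1)) :
    PeriodVanishes θ a 1 a ↔
      (Complex.exp (θ * Complex.I) * ((a - 1) ^ 2 * gInt (a - 1))).im = 0 := by
  rcases eq_or_ne a 1 with rfl | h1
  · refine iff_of_true ⟨0, continuousOn_const, fun τ _ => ?_, ?_⟩ ?_ <;> simp [cubic]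
  · have hw : 0 ≤ (a - 1).im := by simpa using ha
    -- At z = 1 + τ(a-1) the cubic equals -(a-1)² τ(1-τ)(2 + τ(a-1)). The factor i turns the real
    -- part of the period into an imaginary part of R.
    rw [periodVanishes_iff (r₀ := fun τ => Complex.I * (a - 1) *
      ((Real.sqrt (τ * (1 - τ)) : ℂ) * csqrt (2 + τ * (a - 1))))]
    · rw [intervalIntegral.integral_const_mul, ← gInt_eq_integral hw]
      rw [show Complex.exp (θ * Complex.I) * (Complex.I * (a - 1) * gInt (a - 1)) * (a - 1) =
        Complex.I * (Complex.exp (θ * Complex.I) * ((a - 1) ^ 2 * gInt (a - 1))) by ring,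
        Complex.I_mul_re, neg_eq_zero]
    · exact continuousOn_const.mul (ContinuousOn.mul (by fun_prop) (continuousOn_csqrt_two_add hw))
    · intro τ hτ
      have e : (Real.sqrt (τ * (1 - τ)) : ℂ) ^ 2 = τ * (1 - τ) := by
        rw [← Complex.ofReal_pow, Real.sq_sqrt (mul_nonneg hτ.1 (by linarith [hτ.2]))]
        push_cast; ring
      rw [mul_pow, mul_pow, mul_pow, e, csqrt_sq, Complex.I_sq, cubic]
      ring
    · intro τ hτ
      have h2 : (2 + τ * (a - 1) : ℂ) ≠ 0 := by
        intro h
        have him := congrArg Complex.im h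
        have hre := congrArg Complex.re h
        simp at him hre
        have h3 : a.im = 0 := him.resolve_left hτ.1.ne'
        refine ha' ⟨h3, ?_⟩
        by_contra hc
        nlinarith [hτ.1, hτ.2]
      have h3 : 0 < τ * (1 - τ) := mul_pos hτ.1 (by linarith [hτ.2])
      refine mul_ne_zero (mul_ne_zero Complex.I_ne_zero (sub_ne_zero.2 h1))
        (mul_ne_zero ?_ (csqrt_ne_zero h2))
      exact_mod_cast (Real.sqrt_pos.2 h3).ne'

/-- The vanishing condition on `[-1,a]`. -/
lemma periodVanishes_negOne_iff {θ : ℝ} {a : ℂ} (ha : 0 < a.im) :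
    PeriodVanishes θ a (-1) a ↔
      (Complex.exp (θ * Complex.I) * ((a + 1) ^ 2 * gInt (-(a + 1)))).re = 0 := by
  have e1 : reflectIm (-1) = 1 := by simp [reflectIm]
  rw [periodVanishes_reflect_iff, e1, periodVanishes_one_iff (by rw [reflectIm_im]; exact ha.le)
    (by rw [reflectIm_im]; exact fun h => ha.ne' h.1), gInt_neg_add_one ha]
  have h1 : Complex.exp ((Real.pi / 2 - θ : ℝ) * Complex.I) *
      ((reflectIm a - 1) ^ 2 * gInt (reflectIm a - 1)) =
      Complex.I * (starRingEnd ℂ) (Complex.exp (θ * Complex.I) *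
        ((a + 1) ^ 2 * (starRingEnd ℂ) (gInt (reflectIm a - 1)))) := by
    have h1 : Complex.exp ((Real.pi / 2 - θ : ℝ) * Complex.I) =
        Complex.I * (starRingEnd ℂ) (Complex.exp (θ * Complex.I)) := by
      rw [← Complex.exp_conj, map_mul, Complex.conj_I, Complex.conj_ofReal]
      push_cast
      rw [sub_mul, sub_eq_add_neg, Complex.exp_add, Complex.exp_pi_div_two_mul_I, mul_neg]
    rw [h1]
    simp only [map_mul, Complex.conj_conj, map_pow, map_add, map_one]
    generalize gInt (reflectIm a - 1) = G
    rw [reflectIm]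
    ring
  rw [h1, Complex.I_mul_im, Complex.conj_re]

/-- The vanishing condition on `[-1,1]`. -/
lemma periodVanishes_mid_iff {θ : ℝ} {a : ℂ} (ha : 0 ≤ a.im)
    (ha' : ¬(a.im = 0 ∧ -1 ≤ a.re ∧ a.re ≤ 1)) :
    PeriodVanishes θ a (-1) 1 ↔ (Complex.exp (θ * Complex.I) * periodMid a).re = 0 := by
  rw [periodVanishes_iff (r₀ := fun τ => (fun x : ℝ => (Real.sqrt (1 - x ^ 2) : ℂ) *
    csqrt (a - x)) (2 * τ + (-1)))]
  · have h := intervalIntegral.smul_integral_comp_mul_add (a := 0) (b := 1)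
      (fun x : ℝ => (Real.sqrt (1 - x ^ 2) : ℂ) * csqrt (a - x)) 2 (-1)
    norm_num only at h
    rw [← periodMid_eq_integral ha] at h
    rw [← h, Complex.real_smul, mul_assoc, mul_comm _ ((1 : ℂ) - -1)]
    norm_num
  · refine Continuous.continuousOn (Continuous.mul (by fun_prop)
      (continuous_csqrt_comp (by fun_prop) fun t => ?_))
    rwa [Complex.sub_im, Complex.ofReal_im, sub_zero]
  · intro τ hτ
    have e : (Real.sqrt (1 - (2 * τ + -1) ^ 2) : ℂ) ^ 2 = 1 - (2 * τ + -1) ^ 2 := by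
      rw [← Complex.ofReal_pow, Real.sq_sqrt (by nlinarith [hτ.1, hτ.2])]
      push_cast; ring
    rw [mul_pow, csqrt_sq, e, cubic]
    push_cast
    ring
  · intro τ hτ
    have h3 : 0 < 1 - (2 * τ + -1) ^ 2 := by nlinarith [hτ.1, hτ.2]
    refine mul_ne_zero (by exact_mod_cast (Real.sqrt_pos.2 h3).ne') (csqrt_ne_zero ?_)
    intro h
    rw [sub_eq_zero] at h
    rw [h] at ha'
    apply ha'
    rw [Complex.ofReal_im, Complex.ofReal_re]
    exact ⟨rfl, by linarith [hτ.1], by linarith [hτ.2]⟩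

/-- The vanishing condition for the boundary values. -/
lemma boundaryPeriodVanishes_iff {θ x : ℝ} :
    BoundaryPeriodVanishes θ x ↔ (Complex.exp (θ * Complex.I) * periodMid x).re = 0 := by
  -- For Im z ≤ 0 the points x - z, 1 - z and the conjugate of 1 + z all lie in the closed upper
  -- half plane, so each root is continuous up to the boundary; on [-1,1] the product has the
  -- integrand of F.
  set R₀ : ℂ → ℂ := fun z => csqrt (x - z) * csqrt (1 - z) *
    (starRingEnd ℂ) (csqrt ((starRingEnd ℂ) (1 + z))) with hR₀
  have hcR : ContinuousOn R₀ {z | z.im ≤ 0} := by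
    refine ContinuousOn.mul (ContinuousOn.mul ?_ ?_) (Complex.continuous_conj.comp_continuousOn ?_)
    · exact continuousOn_csqrt.comp (by fun_prop) fun z hz => by simpa using hz
    · exact continuousOn_csqrt.comp (by fun_prop) fun z hz => by simpa using hz
    · refine continuousOn_csqrt.comp (Continuous.continuousOn
        (Complex.continuous_conj.comp (by fun_prop))) fun z hz => by simpa using hz
  have hsqR : ∀ z : ℂ, R₀ z ^ 2 = cubic x z := fun z => by
    rw [hR₀]
    simp only [mul_pow, ← map_pow, csqrt_sq, Complex.conj_conj, cubic]
    ring
  have hne : ∀ z : ℂ, z.im < 0 → R₀ z ≠ 0 := fun z hz h => by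
    have h2 := hsqR z
    rw [h, cubic, eq_comm, zero_pow two_ne_zero, mul_eq_zero, sub_eq_zero,
      show z ^ 2 - 1 = (z - 1) * (z + 1) by ring, mul_eq_zero] at h2
    rcases h2 with h2 | h2 | h2 <;> have h3 := congrArg Complex.im h2 <;> simp at h3 <;> linarith
  have hval : ∀ τ ∈ Icc (-1 : ℝ) 1, R₀ τ = (Real.sqrt (1 - τ ^ 2) : ℂ) * csqrt (x - τ) := by
    intro τ hτ
    have e1 : (1 - τ : ℂ) = ((1 - τ : ℝ) : ℂ) := by push_cast; ring
    have e2 : (1 + τ : ℂ) = ((1 + τ : ℝ) : ℂ) := by push_cast; ring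
    rw [hR₀]
    beta_reduce
    rw [e1, e2, Complex.conj_ofReal, csqrt_ofReal (by linarith [hτ.2]),
      csqrt_ofReal (by linarith [hτ.1]), Complex.conj_ofReal, mul_assoc, ← Complex.ofReal_mul,
      ← Real.sqrt_mul (by linarith [hτ.2]), mul_comm]
    congr 3
    ring
  have hint : ∀ R : ℂ → ℂ, (∀ τ ∈ Icc (-1 : ℝ) 1, R τ = R₀ τ) →
      (∫ τ in (-1 : ℝ)..1, Complex.exp (θ * Complex.I) * R τ) =
        Complex.exp (θ * Complex.I) * periodMid x := by
    intro R hR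
    rw [intervalIntegral.integral_const_mul, periodMid_eq_integral (by simp)]
    congr 1
    refine intervalIntegral.integral_congr fun τ hτ => ?_
    rw [uIcc_of_le (by norm_num)] at hτ
    rw [hR τ hτ, hval τ hτ]
  constructor
  · rintro ⟨R, hRc, hRsq, hR⟩
    have hsub : {z : ℂ | z.im < 0} ⊆ {z : ℂ | z.im ≤ 0} := fun z hz =>
      show z.im ≤ 0 from le_of_lt (show z.im < 0 from hz)
    have hcl : {z : ℂ | z.im ≤ 0} ⊆ closure {z : ℂ | z.im < 0} := by
      rw [Complex.closure_setOfPred_im_lt]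
    have ext : ∀ f g : ℂ → ℂ, ContinuousOn f {z | z.im ≤ 0} → ContinuousOn g {z | z.im ≤ 0} →
        EqOn f g {z | z.im < 0} → EqOn f g {z | z.im ≤ 0} := fun f g hf hg h =>
      h.of_subset_closure hf hg hsub hcl
    rcases (convex_halfSpace_im_lt 0).isPreconnected.eq_or_eq_neg_of_sq_eq (hRc.mono hsub)
      (hcR.mono hsub) (fun z hz => by
        simp only [Pi.pow_apply]
        rw [hRsq z (hsub hz), hsqR z]) (fun {z} hz => hne z hz) with h | h
    · have h2 := ext _ _ hRc hcR h
      rwa [hint R fun τ _ => h2 (by simp)] at hR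
    · have h2 := ext _ _ hRc hcR.neg h
      have h3 := hint (fun z => -R z) fun τ _ => by
        have := h2 (show ((τ : ℝ) : ℂ) ∈ {z : ℂ | z.im ≤ 0} by simp)
        simp only [this, Pi.neg_apply, neg_neg]
      simp only [mul_neg, intervalIntegral.integral_neg] at h3
      rw [← h3, Complex.neg_re, hR, neg_zero]
  · intro h
    exact ⟨R₀, hcR, fun z _ => hsqR z, by rwa [hint R₀ fun _ _ => rfl]⟩


/-! ### Embedded and implicitly defined curves -/

/-- A continuous left inverse on the image suffices; every arc below has one, such as a distance, a
height or an angle. -/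
lemma isEmbedding_domRestrict {γ : ℝ → ℂ} {J : Set ℝ} {ρ : ℂ → ℝ} (hγ : ContinuousOn γ J)
    (hρ : ContinuousOn ρ (γ '' J)) (h : ∀ x ∈ J, ρ (γ x) = x) : IsEmbedding (J.domRestrict γ) := by
  let f : J → γ '' J := fun x => ⟨γ x, mem_image_of_mem γ x.2⟩
  let g : γ '' J → ℝ := fun a => ρ a
  have hf : Continuous f := (continuousOn_iff_continuous_domRestrict.1 hγ).subtype_mk _
  have hg : Continuous g := continuousOn_iff_continuous_domRestrict.1 hρ
  have hgf : IsEmbedding (g ∘ f) := by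
    have : g ∘ f = Subtype.val := funext fun x => h x x.2
    rw [this]
    exact IsEmbedding.subtypeVal
  exact IsEmbedding.subtypeVal.comp (IsEmbedding.of_comp hf hg hgf)

lemma eq_zero_of_im_mul_eq_zero {d₁ d₂ h : ℂ} (hd : (d₁ * (starRingEnd ℂ) d₂).im ≠ 0)
    (h₁ : (d₁ * h).im = 0) (h₂ : (d₂ * h).im = 0) : h = 0 := by
  have : (d₁ * (starRingEnd ℂ) d₂).im * Complex.normSq h = 0 := by
    simp only [Complex.mul_im, Complex.conj_re, Complex.conj_im, Complex.normSq_apply] at *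
    linear_combination (d₂.re * h.re - d₂.im * h.im) * h₁ - (d₁.re * h.re - d₁.im * h.im) * h₂
  exact Complex.normSq_eq_zero.1 ((mul_eq_zero.1 this).resolve_left hd)

/-- A curve given implicitly by prescribing, smoothly in the parameter, the imaginary parts of two
holomorphic functions with real-linearly independent derivatives. -/
lemma contDiffOn_of_im_eq {I : Set ℝ} (hI : UniqueDiffOn ℝ I) {γ : ℝ → ℂ} {U : Set ℂ}
    (hU : IsOpen U) {f₁ f₂ : ℂ → ℂ} (hf₁ : DifferentiableOn ℂ f₁ U) (hf₂ : DifferentiableOn ℂ f₂ U)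
    {c₁ c₂ : ℝ → ℝ} (hc₁ : ContDiffOn ℝ ∞ c₁ I) (hc₂ : ContDiffOn ℝ ∞ c₂ I)
    (hγU : ∀ x ∈ I, γ x ∈ U) (h₁ : ∀ x ∈ I, (f₁ (γ x)).im = c₁ x)
    (h₂ : ∀ x ∈ I, (f₂ (γ x)).im = c₂ x)
    (huniq : ∀ x ∈ I, ∀ z ∈ U, (f₁ z).im = c₁ x → (f₂ z).im = c₂ x → z = γ x)
    (hd : ∀ x ∈ I, (deriv f₁ (γ x) * (starRingEnd ℂ) (deriv f₂ (γ x))).im ≠ 0)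
    (hc : ∀ x ∈ I, derivWithin c₁ I x ≠ 0) :
    ContDiffOn ℝ ∞ γ I ∧ ∀ x ∈ I, derivWithin γ I x ≠ 0 := by
  have key : ContDiffOn ℝ ∞ γ I := by
    intro x hx
    have hxU := hU.mem_nhds (hγU x hx)
    let Φ : ℂ → ℝ × ℝ := fun z => ((f₁ z).im, (f₂ z).im)
    have hΦ : ContDiffAt ℝ ∞ Φ (γ x) := by
      have e₁ : ContDiffAt ℝ ∞ f₁ (γ x) := ((hf₁.analyticAt hxU).contDiffAt).restrict_scalars ℝ
      have e₂ : ContDiffAt ℝ ∞ f₂ (γ x) := ((hf₂.analyticAt hxU).contDiffAt).restrict_scalars ℝ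
      exact (Complex.imCLM.contDiff.contDiffAt.comp (γ x) e₁).prodMk
        (Complex.imCLM.contDiff.contDiffAt.comp (γ x) e₂)
    set d₁ := deriv f₁ (γ x) with hd₁
    set d₂ := deriv f₂ (γ x) with hd₂
    let D : ℂ →L[ℝ] ℝ × ℝ :=
      (Complex.imCLM.comp (((1 : ℂ →L[ℂ] ℂ).smulRight d₁).restrictScalars ℝ)).prod
        (Complex.imCLM.comp (((1 : ℂ →L[ℂ] ℂ).smulRight d₂).restrictScalars ℝ))
    have hDΦ : HasFDerivAt Φ D (γ x) := by
      have e₁ := ((hf₁.differentiableAt hxU).hasDerivAt.hasFDerivAt).restrictScalars ℝ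
      have e₂ := ((hf₂.differentiableAt hxU).hasDerivAt.hasFDerivAt).restrictScalars ℝ
      exact (Complex.imCLM.hasFDerivAt.comp (γ x) e₁).prodMk
        (Complex.imCLM.hasFDerivAt.comp (γ x) e₂)
    have hinj : Function.Injective D.toLinearMap := by
      rw [injective_iff_map_eq_zero]
      intro h hh
      have hh1 : (d₁ * h).im = 0 := by
        have := congrArg Prod.fst hh
        simpa [D, mul_comm] using this
      have hh2 : (d₂ * h).im = 0 := by
        have := congrArg Prod.snd hh
        simpa [D, mul_comm] using this
      exact eq_zero_of_im_mul_eq_zero (hd x hx) hh1 hh2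
    let E : ℂ ≃L[ℝ] ℝ × ℝ := (LinearEquiv.ofInjectiveOfFinrankEq D.toLinearMap hinj
      (by simp)).toContinuousLinearEquiv
    have hE : (E : ℂ →L[ℝ] ℝ × ℝ) = D := by
      ext <;> rfl
    have hDE : HasFDerivAt Φ (E : ℂ →L[ℝ] ℝ × ℝ) (γ x) := by rw [hE]; exact hDΦ
    have hn : (∞ : WithTop ℕ∞) ≠ 0 := by simp
    let Ψ := hΦ.localInverse hDE hn
    have hΨ : ContDiffAt ℝ ∞ Ψ (Φ (γ x)) := hΦ.to_localInverse hDE hn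
    have hΨx : Ψ (Φ (γ x)) = γ x := hΦ.localInverse_apply_image hDE hn
    have hr : ∀ᶠ y in 𝓝 (Φ (γ x)), Φ (Ψ y) = y :=
      (hΦ.hasStrictFDerivAt' hDE hn).eventually_right_inverse
    have hUe : ∀ᶠ y in 𝓝 (Φ (γ x)), Ψ y ∈ U := by
      refine hΨ.continuousAt.eventually_mem ?_
      rw [hΨx]
      exact hxU
    let c : ℝ → ℝ × ℝ := fun y => (c₁ y, c₂ y)
    have hcx : c x = Φ (γ x) := Prod.ext (h₁ x hx).symm (h₂ x hx).symm
    have hcd : ContDiffWithinAt ℝ ∞ c I x := (hc₁ x hx).prodMk (hc₂ x hx)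
    have hct : Tendsto c (𝓝[I] x) (𝓝 (Φ (γ x))) := by
      rw [← hcx]
      exact hcd.continuousWithinAt
    -- The uniqueness hypothesis is global in `U`, so γ is identified with the local inverse without
    -- knowing beforehand that γ is continuous.
    have heq : ∀ᶠ y in 𝓝[I] x, γ y = Ψ (c y) := by
      filter_upwards [hct.eventually hr, hct.eventually hUe, self_mem_nhdsWithin] with y hy hyU hyI
      exact (huniq y hyI _ hyU (congrArg Prod.fst hy) (congrArg Prod.snd hy)).symm
    have hcomp : ContDiffWithinAt ℝ ∞ (Ψ ∘ c) I x := by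
      rw [← hcx] at hΨ
      exact hΨ.comp_contDiffWithinAt x hcd
    exact hcomp.congr_of_eventuallyEq heq (heq.self_of_nhdsWithin hx)
  -- If the velocity of γ vanished, so would the derivative of `c₁`.
  refine ⟨key, fun x hx h0 => hc x hx ?_⟩
  have hxU := hU.mem_nhds (hγU x hx)
  have hγd : HasDerivWithinAt γ (derivWithin γ I x) I x :=
    ((key x hx).differentiableWithinAt (by simp)).hasDerivWithinAt
  have h3 : HasDerivWithinAt (fun y => (f₁ (γ y)).im) (deriv f₁ (γ x) * derivWithin γ I x).im I x := by
    have := (hf₁.differentiableAt hxU).hasDerivAt.comp_hasDerivWithinAt_of_eq x hγd rfl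
    exact Complex.imCLM.hasFDerivAt.comp_hasDerivWithinAt x this
  have h4 : HasDerivWithinAt c₁ 0 I x := by
    rw [h0, mul_zero, Complex.zero_im] at h3
    exact h3.congr (fun y hy => (h₁ y hy).symm) (h₁ x hx).symm
  exact h4.derivWithin (hI x hx)


/-! ### The argument of R and the rays from 1 -/

/-- The case of real w < -2 is included: there the root is imaginary for part of the range of t, but
near t = 0 it is close to √2. -/
lemma gInt_re_pos {w : ℂ} (hw : 0 ≤ w.im) : 0 < (gInt w).re := by
  have hc : Continuous fun t : ℝ => csqrt (2 + ((Real.sin t ^ 2 : ℝ) : ℂ) * w) := by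
    refine continuous_csqrt_comp (by fun_prop) fun t => ?_
    rw [Complex.add_im, Complex.im_ofReal_mul]
    simpa using mul_nonneg (sq_nonneg (Real.sin t)) hw
  have hcc : Continuous fun t : ℝ => ((2 * Real.sin t ^ 2 * Real.cos t ^ 2 : ℝ) : ℂ) *
      csqrt (2 + ((Real.sin t ^ 2 : ℝ) : ℂ) * w) := by
    refine Continuous.mul ?_ hc
    exact Complex.continuous_ofReal.comp (by fun_prop)
  have hre : (gInt w).re = ∫ t in (0 : ℝ)..(Real.pi / 2),
      (((2 * Real.sin t ^ 2 * Real.cos t ^ 2 : ℝ) : ℂ) *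
        csqrt (2 + ((Real.sin t ^ 2 : ℝ) : ℂ) * w)).re := by
    rw [gInt]
    have := Complex.reCLM.intervalIntegral_comp_comm (μ := MeasureTheory.volume)
      (hcc.intervalIntegrable 0 (Real.pi / 2))
    exact this.symm
  rw [hre]
  have hnn : ∀ z : ℂ, 0 ≤ (csqrt z).re := fun z => by
    rcases eq_or_ne z 0 with rfl | hz
    · simp [csqrt_zero]
    · rw [← Complex.abs_arg_le_pi_div_two_iff, arg_csqrt, abs_le]
      constructor <;> linarith [Complex.neg_pi_lt_arg z, Complex.arg_le_pi z, Real.pi_pos]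
  have hlim : Tendsto (fun t : ℝ => (csqrt (2 + ((Real.sin t ^ 2 : ℝ) : ℂ) * w)).re)
      (𝓝[>] 0) (𝓝 (csqrt 2).re) := by
    have h1 := ((Complex.continuous_re.comp hc).tendsto 0).mono_left
      (nhdsWithin_le_nhds (s := Ioi (0 : ℝ)))
    simpa [Function.comp_def] using h1
  have h2 : 0 < (csqrt 2).re := csqrt_re_pos (by simp)
  obtain ⟨t, ht, ht'⟩ := ((hlim.eventually_const_lt h2).and
    (Ioo_mem_nhdsGT pi_div_two_pos')).exists
  refine intervalIntegral.integral_pos pi_div_two_pos'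
    (Complex.continuous_re.comp hcc).continuousOn (fun t _ => ?_) ⟨t, Ioo_subset_Icc_self ht', ?_⟩
  · rw [Complex.re_ofReal_mul]
    exact mul_nonneg (by positivity) (hnn _)
  · rw [Complex.re_ofReal_mul]
    obtain ⟨hs, hc⟩ := sin_cos_pos ht'
    exact mul_pos (by positivity) ht

lemma gInt_im_nonneg {w : ℂ} (hw : 0 ≤ w.im) : 0 ≤ (gInt w).im := by
  have h1 : MapsTo gInt {w : ℂ | 0 < w.im} {z | 0 ≤ z.im} := fun w hw => by
    rw [mem_ofPred_eq, ← Complex.arg_nonneg_iff]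
    exact (arg_gInt hw).1.le
  have h2 := h1.closure_of_continuousOn (t := {z : ℂ | 0 ≤ z.im})
    (by rw [Complex.closure_setOfPred_lt_im]; exact continuousOn_gInt)
  have hcl : IsClosed {z : ℂ | 0 ≤ z.im} := isClosed_le continuous_const Complex.continuous_im
  rw [Complex.closure_setOfPred_lt_im, hcl.closure_eq] at h2
  exact h2 hw

/-- A continuous argument of `w² g(w)` on the closed upper half plane without `0`. -/
noncomputable def argOne (w : ℂ) : ℝ := 2 * w.arg + (gInt w).arg

/-- A holomorphic logarithm of `w² g(w)`. -/
noncomputable def logOne (w : ℂ) : ℂ := 2 * Complex.log w + Complex.log (gInt w)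

lemma logOne_im (w : ℂ) : (logOne w).im = argOne w := by
  rw [logOne, argOne, Complex.add_im, Complex.log_im, Complex.mul_im, Complex.log_im]
  simp

lemma gInt_mem_slitPlane {w : ℂ} (hw : 0 ≤ w.im) : gInt w ∈ Complex.slitPlane :=
  Or.inl (gInt_re_pos hw)

lemma gInt_ne_zero' {w : ℂ} (hw : 0 ≤ w.im) : gInt w ≠ 0 :=
  Complex.slitPlane_ne_zero (gInt_mem_slitPlane hw)

lemma two_add_mem_slitPlane_of_im_pos {w : ℂ} (hw : 0 < w.im) : w + 2 ∈ Complex.slitPlane :=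
  mem_slitPlane_of_im_pos (by simpa using hw)

/-- The logarithmic derivative of w² g is h/(2wg), from (w² g)' = wh/2. -/
lemma hasDerivAt_logOne {w : ℂ} (hw : 0 < w.im) :
    HasDerivAt logOne (hInt w / (2 * w * gInt w)) w := by
  obtain ⟨d, hd, hd'⟩ := hasDerivAt_gInt (two_add_mem_slitPlane_of_im_pos hw)
  have h1 := ((Complex.hasDerivAt_log (mem_slitPlane_of_im_pos hw)).const_mul 2).fun_add
    (hd.clog (gInt_mem_slitPlane hw.le))
  have hw0 := ne_zero_of_im_pos hw
  have hg := gInt_ne_zero hw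
  refine h1.congr_deriv ?_
  field_simp
  linear_combination 2 * hd'

/-- Both arguments lie in (0, arg(w+2)/2), so they differ by less than π/2. -/
lemma re_hInt_div_gInt_pos {w : ℂ} (hw : 0 < w.im) : 0 < (hInt w / gInt w).re := by
  have hg := gInt_ne_zero hw
  have hh := hInt_ne_zero hw
  have h1 : (hInt w / gInt w).re = (hInt w * (starRingEnd ℂ) (gInt w)).re / Complex.normSq (gInt w) := by
    rw [div_eq_mul_inv, Complex.inv_def, ← mul_assoc, Complex.re_mul_ofReal, div_eq_mul_inv]
  rw [h1, re_mul_conj]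
  have a1 := arg_gInt hw
  have a2 := arg_hInt hw
  have a3 := Complex.arg_le_pi (w + 2)
  refine div_pos (mul_pos (mul_pos (norm_pos_iff.2 hh) (norm_pos_iff.2 hg))
    (Real.cos_pos_of_mem_Ioo ⟨?_, ?_⟩)) (Complex.normSq_pos.2 hg) <;> linarith

lemma continuousOn_argOne : ContinuousOn argOne {w | 0 ≤ w.im ∧ w ≠ 0} := by
  refine ContinuousOn.add (continuousOn_const.mul fun w hw => ?_) fun w hw => ?_
  · exact (continuousWithinAt_arg_upper hw.2).mono fun z hz => hz.1
  · exact (Complex.continuousAt_arg (gInt_mem_slitPlane hw.1)).comp_continuousWithinAt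
      ((continuousOn_gInt w hw.1).mono fun z hz => hz.1)

lemma polar_im (ρ φ : ℝ) : ((ρ : ℂ) * Complex.exp (φ * Complex.I)).im = ρ * Real.sin φ := by
  rw [Complex.im_ofReal_mul, Complex.exp_ofReal_mul_I_im]

lemma polar_mem {ρ φ : ℝ} (hρ : 0 < ρ) (hφ : φ ∈ Icc 0 Real.pi) :
    (ρ : ℂ) * Complex.exp (φ * Complex.I) ∈ {w : ℂ | 0 ≤ w.im ∧ w ≠ 0} := by
  refine ⟨?_, by simp [hρ.ne']⟩
  rw [polar_im]
  exact mul_nonneg hρ.le (Real.sin_nonneg_of_mem_Icc hφ)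

/-- Along w = ρe^{iφ} the derivative of the argument is Im(iw·h/(2wg)) = Re(h/g)/2. -/
lemma strictMonoOn_argOne {ρ : ℝ} (hρ : 0 < ρ) :
    StrictMonoOn (fun φ : ℝ => argOne (ρ * Complex.exp (φ * Complex.I))) (Icc 0 Real.pi) := by
  refine strictMonoOn_of_deriv_pos (convex_Icc _ _) ?_ fun φ hφ => ?_
  · exact continuousOn_argOne.comp (f := fun φ : ℝ => (ρ : ℂ) * Complex.exp (φ * Complex.I))
      (Continuous.continuousOn (by fun_prop)) fun φ hφ => polar_mem hρ hφ
  · rw [interior_Icc] at hφ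
    have hw : 0 < ((ρ : ℂ) * Complex.exp (φ * Complex.I)).im := by
      rw [polar_im]
      exact mul_pos hρ (Real.sin_pos_of_mem_Ioo hφ)
    set w := (ρ : ℂ) * Complex.exp (φ * Complex.I) with hwd
    have h1 : HasDerivAt (fun φ : ℝ => (ρ : ℂ) * Complex.exp (φ * Complex.I)) (Complex.I * w) φ := by
      have := (((Complex.ofRealCLM.hasDerivAt (x := φ)).mul_const Complex.I).cexp).const_mul (ρ : ℂ)
      refine this.congr_deriv ?_
      simp [hwd]
      ring
    have h2 := HasDerivAt.comp φ (hasDerivAt_logOne hw) h1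
    have h3 : HasDerivAt (fun φ : ℝ => argOne (ρ * Complex.exp (φ * Complex.I)))
        (hInt w / (2 * w * gInt w) * (Complex.I * w)).im φ := by
      have := Complex.imCLM.hasFDerivAt.comp_hasDerivAt φ h2
      exact this.congr_of_eventuallyEq (Eventually.of_forall fun x => (logOne_im _).symm)
    rw [h3.deriv]
    have hw0 := ne_zero_of_im_pos hw
    have hg := gInt_ne_zero hw
    have e : hInt w / (2 * w * gInt w) * (Complex.I * w) =
        ((1 / 2 : ℝ) : ℂ) * (Complex.I * (hInt w / gInt w)) := by
      push_cast
      field_simp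
    rw [e, Complex.im_ofReal_mul, Complex.I_mul_im]
    exact mul_pos (by norm_num) (re_hInt_div_gInt_pos hw)

lemma arg_gInt_ofReal {x : ℝ} (hx : -2 ≤ x) : (gInt x).arg = 0 := by
  obtain ⟨r, hr, h⟩ := gInt_ofReal hx
  rw [h, Complex.arg_ofReal_of_nonneg hr.le]

lemma argOne_of_pos {x : ℝ} (hx : 0 < x) : argOne x = 0 := by
  rw [argOne, arg_gInt_ofReal (by linarith), Complex.arg_ofReal_of_nonneg hx.le]
  ring

lemma argOne_of_neg {x : ℝ} (hx : x < 0) (hx' : -2 ≤ x) : argOne x = 2 * Real.pi := by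
  rw [argOne, arg_gInt_ofReal hx', Complex.arg_ofReal_of_neg hx]
  ring

lemma two_pi_le_argOne_of_neg {x : ℝ} (hx : x < 0) : 2 * Real.pi ≤ argOne x := by
  rw [argOne, Complex.arg_ofReal_of_neg hx]
  have : 0 ≤ (gInt x).arg := Complex.arg_nonneg_iff.2 (gInt_im_nonneg (by simp))
  linarith

lemma argOne_pos {w : ℂ} (hw : 0 < w.im) : 0 < argOne w := by
  have := (arg_gInt hw).1
  have := arg_pos_of_im_pos hw
  rw [argOne]
  linarith

lemma argOne_lt {w : ℂ} (hw : 0 < w.im) : argOne w < 5 * Real.pi / 2 := by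
  have := (arg_gInt hw).2
  have := arg_lt_pi_of_im_pos hw
  have := Complex.arg_le_pi (w + 2)
  rw [argOne]
  linarith

lemma argOne_unique {w z : ℂ} (hw : 0 ≤ w.im) (hz : 0 ≤ z.im) (hw0 : w ≠ 0) (hn : ‖w‖ = ‖z‖)
    (h : argOne w = argOne z) : w = z := by
  have hρ : 0 < ‖w‖ := norm_pos_iff.2 hw0
  have h1 := (strictMonoOn_argOne hρ).injOn
    (⟨Complex.arg_nonneg_iff.2 hw, Complex.arg_le_pi w⟩ : w.arg ∈ Icc 0 Real.pi)
    (⟨Complex.arg_nonneg_iff.2 hz, Complex.arg_le_pi z⟩ : z.arg ∈ Icc 0 Real.pi)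
  simp only [Complex.norm_mul_exp_arg_mul_I] at h1
  rw [hn, Complex.norm_mul_exp_arg_mul_I] at h1
  exact Complex.ext_norm_arg hn (h1 h)

/-- On each half circle the argument runs from 0 on the positive axis to at least 2π on the negative
one. -/
lemma exists_argOne_eq {α ρ : ℝ} (hα : α ∈ Ioo 0 (2 * Real.pi)) (hρ : 0 < ρ) :
    ∃ w : ℂ, 0 < w.im ∧ ‖w‖ = ρ ∧ argOne w = α := by
  have hc : ContinuousOn (fun φ : ℝ => argOne (ρ * Complex.exp (φ * Complex.I))) (Icc 0 Real.pi) :=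
    continuousOn_argOne.comp (f := fun φ : ℝ => (ρ : ℂ) * Complex.exp (φ * Complex.I))
      (Continuous.continuousOn (by fun_prop)) fun φ hφ => polar_mem hρ hφ
  have h0 : argOne (ρ * Complex.exp ((0 : ℝ) * Complex.I)) = 0 := by
    simpa using argOne_of_pos hρ
  have hpi : 2 * Real.pi ≤ argOne (ρ * Complex.exp (Real.pi * Complex.I)) := by
    have := two_pi_le_argOne_of_neg (neg_lt_zero.2 hρ)
    simpa using this
  obtain ⟨φ, hφ, h⟩ := intermediate_value_Ioo Real.pi_pos.le hc
    (⟨by rw [h0]; exact hα.1, lt_of_lt_of_le hα.2 hpi⟩)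
  refine ⟨ρ * Complex.exp (φ * Complex.I), ?_, ?_, h⟩
  · rw [polar_im]
    exact mul_pos hρ (Real.sin_pos_of_mem_Ioo hφ)
  · rw [norm_mul, Complex.norm_exp_ofReal_mul_I, mul_one, Complex.norm_real,
      Real.norm_of_nonneg hρ.le]


lemma sq_mul_gInt_eq (w : ℂ) : w ^ 2 * gInt w =
    ((‖w‖ ^ 2 * ‖gInt w‖ : ℝ) : ℂ) * Complex.exp (argOne w * Complex.I) := by
  have hw := Complex.norm_mul_exp_arg_mul_I w
  have hg := Complex.norm_mul_exp_arg_mul_I (gInt w)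
  rw [argOne]
  push_cast
  rw [show ((2 * (w.arg : ℂ) + ((gInt w).arg : ℂ)) * Complex.I) =
    w.arg * Complex.I + w.arg * Complex.I + (gInt w).arg * Complex.I by ring, Complex.exp_add,
    Complex.exp_add]
  linear_combination (-(w + ‖w‖ * Complex.exp (w.arg * Complex.I)) * gInt w) * hw -
    (‖w‖ * Complex.exp (w.arg * Complex.I)) ^ 2 * hg

lemma exp_mul_sq_mul_gInt_im (θ : ℝ) (w : ℂ) :
    (Complex.exp (θ * Complex.I) * (w ^ 2 * gInt w)).im =
      ‖w‖ ^ 2 * ‖gInt w‖ * Real.sin (argOne w + θ) := by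
  rw [sq_mul_gInt_eq, mul_left_comm, Complex.im_ofReal_mul, ← Complex.exp_add, ← add_mul,
    ← Complex.ofReal_add, Complex.exp_ofReal_mul_I_im, add_comm θ]

lemma mem_sigmaOne_iff {θ : ℝ} {a : ℂ} (ha : 0 ≤ a.im) (h1 : a ≠ 1) :
    a ∈ sigmaOne θ ↔ ¬(a.im = 0 ∧ a.re ≤ -1) ∧ Real.sin (argOne (a - 1) + θ) = 0 := by
  refine and_congr_right fun h => ?_
  rw [periodVanishes_one_iff ha fun h' => h ⟨h'.1, h'.2.le⟩, exp_mul_sq_mul_gInt_im]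
  have h2 : ‖a - 1‖ ≠ 0 := norm_ne_zero_iff.2 (sub_ne_zero.2 h1)
  have h3 : ‖gInt (a - 1)‖ ≠ 0 := norm_ne_zero_iff.2 (gInt_ne_zero' (by simpa using ha))
  simp [h2, h3]

lemma one_mem_sigmaOne (θ : ℝ) : (1 : ℂ) ∈ sigmaOne θ := by
  refine ⟨by norm_num, ?_⟩
  rw [periodVanishes_one_iff (by simp) (by norm_num)]
  simp

/-- The points of the open upper half plane at which `argOne (a - 1)` equals `α`. -/
def levelOne (α : ℝ) : Set ℂ := {a | 0 < a.im ∧ argOne (a - 1) = α}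

lemma levelOne_subset_sigmaOne {θ α : ℝ} (h : Real.sin (α + θ) = 0) : levelOne α ⊆ sigmaOne θ :=
  fun a ha => (mem_sigmaOne_iff ha.1.le (fun h1 => by simpa [h1] using ha.1)).2
    ⟨fun h1 => ha.1.ne' h1.1, by rw [ha.2, h]⟩

lemma sub_one_im (a : ℂ) : (a - 1).im = a.im := by simp

/-- `argOne` takes values in (0, 5π/2), so only the first two positive multiples of π are possible
for argOne + θ. On the allowed part of the real axis it is 0 or 2π, and sin θ ≠ 0 excludes that part
apart from the point 1. -/
lemma sigmaOne_inter_upper {θ : ℝ} (h0 : 0 < θ) (h1 : θ ≤ Real.pi / 2) :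
    sigmaOne θ ∩ {a | 0 ≤ a.im} =
      insert 1 (levelOne (2 * Real.pi - θ)) ∪ insert 1 (levelOne (Real.pi - θ)) := by
  have hpi := Real.pi_pos
  have hs : Real.sin θ ≠ 0 := (Real.sin_pos_of_pos_of_lt_pi h0 (by linarith)).ne'
  ext a
  constructor
  · rintro ⟨haS, ha : 0 ≤ a.im⟩
    by_cases ha1 : a = 1
    · exact Or.inl (Or.inl ha1)
    obtain ⟨hr, hsin⟩ := (mem_sigmaOne_iff ha ha1).1 haS
    rcases ha.eq_or_lt with him | him
    · exfalso
      have hw : a - 1 = ((a.re - 1 : ℝ) : ℂ) := Complex.ext (by simp) (by simp [← him])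
      rw [hw] at hsin
      have hre : a.re ≠ 1 := fun h => ha1 (Complex.ext (by simpa using h) (by simp [← him]))
      rcases lt_or_gt_of_ne hre with h | h
      · have : -1 < a.re := by by_contra h'; exact hr ⟨him.symm, not_lt.1 h'⟩
        rw [argOne_of_neg (by linarith) (by linarith), add_comm, Real.sin_add_two_pi] at hsin
        exact hs hsin
      · rw [argOne_of_pos (by linarith), zero_add] at hsin
        exact hs hsin
    · have hw : 0 < (a - 1).im := by rwa [sub_one_im]
      have a1 := argOne_pos hw
      have a2 := argOne_lt hw
      obtain ⟨n, hn⟩ := Real.sin_eq_zero_iff.1 hsin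
      have n1 : (0 : ℝ) < n := by
        by_contra h
        have : (n : ℝ) * Real.pi ≤ 0 := mul_nonpos_of_nonpos_of_nonneg (not_lt.1 h) hpi.le
        linarith
      have n2 : (n : ℝ) < 3 := by
        by_contra h
        have : 3 * Real.pi ≤ (n : ℝ) * Real.pi := by gcongr; exact not_lt.1 h
        linarith
      have n3 : 0 < n := by exact_mod_cast n1
      have n4 : n < 3 := by exact_mod_cast n2
      obtain rfl | rfl : n = 1 ∨ n = 2 := by omega
      · exact Or.inr (Or.inr ⟨him, by push_cast at hn; linarith⟩)
      · exact Or.inl (Or.inr ⟨him, by push_cast at hn; linarith⟩)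
  · have hc : ∀ α, Real.sin (α + θ) = 0 → insert 1 (levelOne α) ⊆ sigmaOne θ ∩ {a | 0 ≤ a.im} :=
      fun α hα => insert_subset ⟨one_mem_sigmaOne θ, by simp⟩
        fun a ha => ⟨levelOne_subset_sigmaOne hα ha, ha.1.le⟩
    rintro (h | h)
    · exact hc _ (by simp) h
    · exact hc _ (by simp) h

/-- On the real axis the argument is 0 or at least 2π, so the level set can accumulate there only at
1. The closure in `ray` therefore adds nothing. -/
lemma isClosed_insert_levelOne {α : ℝ} (hα : α ∈ Ioo 0 (2 * Real.pi)) :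
    IsClosed (insert 1 (levelOne α)) := by
  refine isClosed_of_closure_subset fun a ha => ?_
  by_cases h1 : a = 1
  · exact Or.inl h1
  have hb : a ∈ closure (levelOne α) := by
    rw [insert_eq, closure_union, closure_singleton] at ha
    exact ha.resolve_left h1
  have him : 0 ≤ a.im := by
    have hcl : IsClosed {z : ℂ | 0 ≤ z.im} := isClosed_le continuous_const Complex.continuous_im
    exact closure_minimal (fun z (hz : z ∈ levelOne α) => hz.1.le) hcl hb
  have hA : argOne (a - 1) = α := by
    have hc : ContinuousWithinAt (fun z => argOne (z - 1)) (levelOne α) a := by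
      refine (continuousOn_argOne (a - 1) ⟨by rwa [sub_one_im], sub_ne_zero.2 h1⟩).comp
        (f := fun z : ℂ => z - 1) (by fun_prop) fun z hz => ⟨?_, ?_⟩
      · rw [sub_one_im]; exact hz.1.le
      · exact sub_ne_zero.2 fun h => by simpa [h] using hz.1
    have := hc.mem_closure (t := {α}) hb fun z hz => hz.2
    simpa using this
  refine Or.inr ⟨him.lt_of_ne fun him0 => ?_, hA⟩
  have hw : a - 1 = ((a.re - 1 : ℝ) : ℂ) := Complex.ext (by simp) (by simp [← him0])
  rw [hw] at hA
  have hre : a.re ≠ 1 := fun h => h1 (Complex.ext (by simpa using h) (by simp [← him0]))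
  rcases lt_or_gt_of_ne hre with h | h
  · have := two_pi_le_argOne_of_neg (sub_neg.2 h)
    linarith [hα.2]
  · have := argOne_of_pos (sub_pos.2 h)
    linarith [hα.1]

/-- Near w = 0 the factor g is close to the positive number g(0), so arg R is asymptotically twice
the polar angle. This ties an initial angle to a level. -/
lemma tendsto_argOne_of_direction {l : Filter ℝ} {γ : ℝ → ℂ} {c : ℂ} {φ : ℝ}
    (hφ : φ ∈ Ioo 0 Real.pi) (h0 : Tendsto γ l (𝓝 c)) (him : ∀ᶠ x in l, 0 ≤ (γ x - c).im)
    (hd : Tendsto (fun x => (γ x - c) / (‖γ x - c‖ : ℂ)) l (𝓝 (Complex.exp (φ * Complex.I)))) :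
    Tendsto (fun x => argOne (γ x - c)) l (𝓝 (2 * φ)) := by
  have harg : (Complex.exp (φ * Complex.I)).arg = φ := by
    rw [Complex.arg_exp_mul_I, toIocMod_eq_self]
    constructor <;> linarith [hφ.1, hφ.2]
  have h1 : Tendsto (fun x => (γ x - c).arg) l (𝓝 φ) := by
    have hs : Complex.exp (φ * Complex.I) ∈ Complex.slitPlane := by
      refine mem_slitPlane_of_im_pos ?_
      rw [Complex.exp_ofReal_mul_I_im]
      exact Real.sin_pos_of_mem_Ioo hφ
    have := (Complex.continuousAt_arg hs).tendsto.comp hd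
    rw [harg] at this
    refine this.congr fun x => ?_
    rcases eq_or_ne (γ x - c) 0 with h | h
    · simp [h]
    · rw [Function.comp_apply, div_eq_mul_inv, ← Complex.ofReal_inv, mul_comm,
        Complex.arg_real_mul _ (inv_pos.2 (norm_pos_iff.2 h))]
  have h2 : Tendsto (fun x => (gInt (γ x - c)).arg) l (𝓝 0) := by
    have hg0 : (gInt 0).arg = 0 := by simpa using arg_gInt_ofReal (x := 0) (by norm_num)
    have e : Tendsto (fun x => γ x - c) l (𝓝[{w : ℂ | 0 ≤ w.im}] 0) := by
      refine tendsto_nhdsWithin_iff.2 ⟨?_, him⟩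
      simpa using h0.sub_const c
    have := (((Complex.continuousAt_arg (gInt_mem_slitPlane (w := 0) (by simp))).tendsto.comp
      (continuousOn_gInt 0 (by simp))).comp e)
    rwa [hg0] at this
  have := (h1.const_mul 2).add h2
  simpa [argOne] using this

/-- The parameter is the distance to 1: each half circle about 1 meets the level exactly once. -/
lemma exists_isRay_sigmaOne {θ α : ℝ} (hα : α ∈ Ioo 0 (2 * Real.pi)) (h : Real.sin (α + θ) = 0) :
    ∃ γ : ℝ → ℂ, IsRay (sigmaOne θ) 1 (α / 2) γ ∧ γ '' Ici 0 = insert 1 (levelOne α) := by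
  have hex : ∀ x : ℝ, ∃ w : ℂ, (0 < x → 0 < w.im ∧ ‖w‖ = x ∧ argOne w = α) ∧ (x ≤ 0 → w = 0) := by
    intro x
    rcases lt_or_ge 0 x with hx | hx
    · obtain ⟨w, hw⟩ := exists_argOne_eq hα hx
      exact ⟨w, fun _ => hw, fun h => absurd hx (not_lt.2 h)⟩
    · exact ⟨0, fun h => absurd h (not_lt.2 hx), fun _ => rfl⟩
  choose w hw hw0 using hex
  let γ : ℝ → ℂ := fun x => w x + 1
  have hγ1 : ∀ x, γ x - 1 = w x := fun x => add_sub_cancel_right _ _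
  have hγ0 : γ 0 = 1 := by simp [γ, hw0 0 le_rfl]
  have hlev : ∀ x, 0 < x → γ x ∈ levelOne α := fun x hx =>
    ⟨by simpa [γ] using (hw x hx).1, by rw [hγ1]; exact (hw x hx).2.2⟩
  have hnorm : ∀ x, 0 ≤ x → ‖γ x - 1‖ = x := fun x hx => by
    rw [hγ1]
    rcases hx.eq_or_lt with rfl | hx
    · simp [hw0 0 le_rfl]
    · exact (hw x hx).2.1
  have hU1 : ∀ z : ℂ, 0 < z.im → 0 < (z - 1).im := fun z hz => by rwa [sub_one_im]
  have hd1 : ∀ z : ℂ, 0 < z.im →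
      HasDerivAt (fun z : ℂ => Complex.I * Complex.log (z - 1)) (Complex.I * (1 / (z - 1))) z :=
    fun z hz => (((hasDerivAt_id' z).sub_const 1).clog
      (mem_slitPlane_of_im_pos (hU1 z hz))).const_mul Complex.I
  have hd2 : ∀ z : ℂ, 0 < z.im →
      HasDerivAt (fun z : ℂ => logOne (z - 1)) (hInt (z - 1) / (2 * (z - 1) * gInt (z - 1))) z :=
    fun z hz => (hasDerivAt_logOne (hU1 z hz)).comp_sub_const z 1
  have him1 : ∀ z : ℂ, (Complex.I * Complex.log (z - 1)).im = Real.log ‖z - 1‖ := fun z => by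
    rw [Complex.I_mul_im, Complex.log_re]
  -- The factor i makes log|z - 1| an imaginary part, as the implicit curve lemma requires. The
  -- independence of the two derivatives is again Re(h/g) > 0.
  have hsm := contDiffOn_of_im_eq (I := Ioi 0) (uniqueDiffOn_Ioi 0) (γ := γ) isOpen_upper
    (f₁ := fun z => Complex.I * Complex.log (z - 1)) (f₂ := fun z => logOne (z - 1))
    (fun z hz => (hd1 z hz).differentiableAt.differentiableWithinAt)
    (fun z hz => (hd2 z hz).differentiableAt.differentiableWithinAt)
    (c₁ := Real.log) (c₂ := fun _ => α)
    (fun x hx => (Real.contDiffAt_log.2 (ne_of_gt hx)).contDiffWithinAt) contDiffOn_const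
    (fun x hx => (hlev x hx).1) (fun x hx => by rw [him1, hnorm x (le_of_lt hx)])
    (fun x hx => by rw [logOne_im]; exact (hlev x hx).2)
    (fun x hx z hz e1 e2 => by
      rw [him1] at e1
      rw [logOne_im] at e2
      have hz0 : z - 1 ≠ 0 := ne_zero_of_im_pos (hU1 z hz)
      have e3 : ‖z - 1‖ = x := Real.log_injOn_pos (norm_pos_iff.2 hz0) hx e1
      have := argOne_unique (hU1 z hz).le (hw x hx).1.le hz0 (e3.trans (hw x hx).2.1.symm)
        (e2.trans (hw x hx).2.2.symm)
      exact sub_eq_iff_eq_add.1 this)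
    (fun x hx => by
      rw [(hd1 _ (hlev x hx).1).deriv, (hd2 _ (hlev x hx).1).deriv, hγ1]
      have h3 := re_hInt_div_gInt_pos (hw x hx).1
      have hwx := ne_zero_of_im_pos (hw x hx).1
      have hcw : (starRingEnd ℂ) (w x) ≠ 0 := (map_ne_zero _).2 hwx
      have hcg : (starRingEnd ℂ) (gInt (w x)) ≠ 0 := (map_ne_zero _).2 (gInt_ne_zero (hw x hx).1)
      have e : Complex.I * (1 / w x) * (starRingEnd ℂ) (hInt (w x) / (2 * w x * gInt (w x))) =
          (((2 * Complex.normSq (w x))⁻¹ : ℝ) : ℂ) *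
            (Complex.I * (starRingEnd ℂ) (hInt (w x) / gInt (w x))) := by
        rw [Complex.ofReal_inv, Complex.ofReal_mul, Complex.normSq_eq_conj_mul_self]
        simp only [map_div₀, map_mul, Complex.conj_ofNat, Complex.ofReal_ofNat]
        field_simp
      rw [e, Complex.im_ofReal_mul, Complex.I_mul_im, Complex.conj_re]
      exact (mul_pos (inv_pos.2 (mul_pos two_pos (Complex.normSq_pos.2 hwx))) h3).ne')
    (fun x hx => by
      rw [((Real.hasDerivAt_log (ne_of_gt hx)).hasDerivWithinAt).derivWithin
        (uniqueDiffOn_Ioi 0 x hx)]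
      exact inv_ne_zero (ne_of_gt hx))
  have hcont : ContinuousOn γ (Ici 0) := by
    intro x hx
    rcases (show 0 ≤ x from hx).eq_or_lt with rfl | hx
    · rw [ContinuousWithinAt, hγ0, tendsto_iff_norm_sub_tendsto_zero]
      refine (tendsto_id.mono_left nhdsWithin_le_nhds).congr' ?_
      filter_upwards [self_mem_nhdsWithin] with x hx
      exact (hnorm x hx).symm
    · exact (hsm.1.continuousOn.continuousAt (Ioi_mem_nhds hx)).continuousWithinAt
  refine ⟨γ, ⟨⟨?_, hsm.1, hsm.2⟩, hγ0, ?_, ?_, ?_, ?_⟩, ?_⟩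
  · exact isEmbedding_domRestrict (ρ := fun z => ‖z - 1‖) hcont
      (Continuous.continuousOn (by fun_prop)) fun x hx => hnorm x hx
  · intro x hx
    rcases hx.eq_or_lt with rfl | hx
    · rw [hγ0]; exact one_mem_sigmaOne θ
    · exact levelOne_subset_sigmaOne h (hlev x hx)
  · intro x hx
    rcases hx.eq_or_lt with rfl | hx
    · simp [hγ0]
    · exact (hlev x hx).1.le
  · have hw0' : Tendsto w (𝓝[>] 0) (𝓝[{w : ℂ | 0 ≤ w.im}] 0) := by
      refine tendsto_nhdsWithin_iff.2 ⟨?_, ?_⟩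
      · rw [tendsto_zero_iff_norm_tendsto_zero]
        refine (tendsto_id.mono_left nhdsWithin_le_nhds).congr' ?_
        filter_upwards [self_mem_nhdsWithin] with x hx
        exact (hw x hx).2.1.symm
      · filter_upwards [self_mem_nhdsWithin] with x hx
        exact (hw x hx).1.le
    have hg0 : (gInt 0).arg = 0 := by simpa using arg_gInt_ofReal (x := 0) (by norm_num)
    have h2 := ((Complex.continuousAt_arg (gInt_mem_slitPlane (w := 0) (by simp))).tendsto.comp
      (continuousOn_gInt 0 (by simp))).comp hw0'
    rw [hg0] at h2
    have h3 : Tendsto (fun x => Complex.exp (((α - (gInt (w x)).arg) / 2 : ℝ) * Complex.I)) (𝓝[>] 0)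
        (𝓝 (Complex.exp ((α / 2 : ℝ) * Complex.I))) := by
      have hc : Continuous fun u : ℝ => Complex.exp (((α - u) / 2 : ℝ) * Complex.I) := by fun_prop
      have := (hc.tendsto 0).comp h2
      simpa [Function.comp_def] using this
    refine h3.congr' ?_
    filter_upwards [self_mem_nhdsWithin] with x hx
    have h4 := hw x hx
    rw [hγ1, ← h4.2.2, argOne]
    have hn : (‖w x‖ : ℂ) ≠ 0 := by simpa using ne_zero_of_im_pos h4.1
    rw [eq_div_iff hn, mul_comm]
    conv_rhs => rw [← Complex.norm_mul_exp_arg_mul_I (w x)]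
    congr 3
    ring_nf
  · intro K hK _
    obtain ⟨C, hC⟩ := hK.isBounded.exists_norm_le
    filter_upwards [eventually_gt_atTop (C + 1), eventually_ge_atTop 0] with x hx hx0 hxK
    have h1 := hC _ hxK
    have h2 := hnorm x hx0
    have h3 := norm_sub_le (γ x) 1
    rw [norm_one] at h3
    linarith
  · ext a
    constructor
    · rintro ⟨x, hx, rfl⟩
      rcases (show 0 ≤ x from hx).eq_or_lt with rfl | hx
      · exact Or.inl hγ0
      · exact Or.inr (hlev x hx)
    · rintro (rfl | ha)
      · exact ⟨0, mem_Ici.2 le_rfl, hγ0⟩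
      · have hw1 := hU1 a ha.1
        have hp := norm_pos_iff.2 (ne_zero_of_im_pos hw1)
        refine ⟨‖a - 1‖, norm_nonneg _, ?_⟩
        have := argOne_unique (hw _ hp).1.le hw1.le (ne_zero_of_im_pos (hw _ hp).1) (hw _ hp).2.1
          ((hw _ hp).2.2.trans ha.2.symm)
        simp only [γ, this, sub_add_cancel]


/-! ### Uniqueness of the rays and the degenerate ray [-1,1] -/

/-- A continuous function on an interval whose sine, after a shift, vanishes is constant. -/
lemma eq_of_sin_add_eq_zero {f : ℝ → ℝ} {θ : ℝ} (hf : ContinuousOn f (Ioi 0))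
    (h : ∀ x, 0 < x → Real.sin (f x + θ) = 0) {x y : ℝ} (hx : 0 < x) (hy : 0 < y) : f x = f y := by
  have key : ∀ x y, 0 < x → 0 < y → ¬ f x < f y := by
    intro x y hx hy hlt
    -- If f were not constant it would take a value f x + δ with 0 < δ < π, where the sine is ± sin
    -- δ ≠ 0.
    obtain ⟨δ, hδ0, hδ⟩ : ∃ δ, 0 < δ ∧ δ < min (f y - f x) Real.pi :=
      exists_between (lt_min (sub_pos.2 hlt) Real.pi_pos)
    have h1 := lt_of_lt_of_le hδ (min_le_left _ _)
    have h2 := lt_of_lt_of_le hδ (min_le_right _ _)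
    have him := (ordConnected_Ioi (a := (0 : ℝ))).isPreconnected.image f hf
    obtain ⟨z, hz, hz'⟩ := him.ordConnected.out (mem_image_of_mem f hx) (mem_image_of_mem f hy)
      (show f x + δ ∈ Icc (f x) (f y) from ⟨by linarith, by linarith⟩)
    have h3 := h z hz
    rw [hz', show f x + δ + θ = f x + θ + δ by ring, Real.sin_add, h x hx, zero_mul, zero_add] at h3
    rcases mul_eq_zero.1 h3 with h4 | h4
    · have := Real.sin_sq_add_cos_sq (f x + θ)
      rw [h x hx, h4] at this
      norm_num at this
    · exact (Real.sin_pos_of_pos_of_lt_pi hδ0 h2).ne' h4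
  exact le_antisymm (not_lt.1 (key y x hy hx)) (not_lt.1 (key x y hx hy))

lemma IsRay.injOn {S : Set ℂ} {c : ℂ} {φ : ℝ} {γ : ℝ → ℂ} (h : IsRay S c φ γ) :
    InjOn γ (Ici 0) := injOn_iff_injective.2 h.arc.embedding.injective

lemma IsRay.continuousOn {S : Set ℂ} {c : ℂ} {φ : ℝ} {γ : ℝ → ℂ} (h : IsRay S c φ γ) :
    ContinuousOn γ (Ici 0) := continuousOn_iff_continuous_domRestrict.2 h.arc.embedding.continuous

lemma IsRay.ne_start {S : Set ℂ} {c : ℂ} {φ : ℝ} {γ : ℝ → ℂ} (h : IsRay S c φ γ) {x : ℝ}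
    (hx : 0 < x) : γ x ≠ c := fun h' =>
  hx.ne' (h.injOn (mem_Ici.2 hx.le) (mem_Ici.2 le_rfl) (h'.trans h.start.symm))

lemma IsRay.tendsto_start {S : Set ℂ} {c : ℂ} {φ : ℝ} {γ : ℝ → ℂ} (h : IsRay S c φ γ) :
    Tendsto γ (𝓝[>] 0) (𝓝 c) := by
  have := (h.continuousOn 0 (mem_Ici.2 le_rfl)).mono Ioi_subset_Ici_self
  rwa [ContinuousWithinAt, h.start] at this

lemma IsRay.argOne_continuousOn {S : Set ℂ} {φ : ℝ} {γ : ℝ → ℂ} (h : IsRay S 1 φ γ) :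
    ContinuousOn (fun x => argOne (γ x - 1)) (Ioi 0) :=
  continuousOn_argOne.comp (f := fun x => γ x - 1)
    ((h.continuousOn.mono Ioi_subset_Ici_self).sub continuousOn_const) fun x hx =>
    ⟨by rw [sub_one_im]; exact h.upper x (le_of_lt hx), sub_ne_zero.2 (h.ne_start hx)⟩

/-- Along any ray argOne + θ is a continuous function with values in πℤ, hence constant; its value
is read off at the starting point. -/
lemma IsRay.argOne_eq {θ φ : ℝ} {γ : ℝ → ℂ} (hφ : φ ∈ Ioo 0 Real.pi)
    (h : IsRay (sigmaOne θ) 1 φ γ) {x : ℝ} (hx : 0 < x) : argOne (γ x - 1) = 2 * φ := by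
  have hs : ∀ x, 0 < x → Real.sin (argOne (γ x - 1) + θ) = 0 := fun x hx =>
    ((mem_sigmaOne_iff (h.upper x hx.le) (h.ne_start hx)).1 (h.mem x hx.le)).2
  have h1 := tendsto_argOne_of_direction hφ h.tendsto_start (by
    filter_upwards [self_mem_nhdsWithin] with x hx
    rw [sub_one_im]
    exact h.upper x (le_of_lt hx)) h.direction
  refine tendsto_nhds_unique ((tendsto_const_nhds (x := argOne (γ x - 1))).congr' ?_) h1
  filter_upwards [self_mem_nhdsWithin] with y hy
  exact eq_of_sin_add_eq_zero h.argOne_continuousOn hs hx hy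

lemma ray_sigmaOne {θ α : ℝ} (hα : α ∈ Ioo 0 (2 * Real.pi)) (h : Real.sin (α + θ) = 0) :
    ray (sigmaOne θ) 1 (α / 2) = insert 1 (levelOne α) := by
  have : {a | ∃ γ : ℝ → ℂ, IsRay (sigmaOne θ) 1 (α / 2) γ ∧ ∃ x, 0 ≤ x ∧ γ x = a} =
      insert 1 (levelOne α) := by
    apply Subset.antisymm
    · rintro a ⟨γ, hγ, x, hx, rfl⟩
      rcases hx.eq_or_lt with rfl | hx
      · exact Or.inl hγ.start
      · have h1 := hγ.argOne_eq ⟨by linarith [hα.1], by linarith [hα.2]⟩ hx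
        have hA : argOne (γ x - 1) = α := by rw [h1]; ring
        refine Or.inr ⟨(hγ.upper x hx.le).lt_of_ne fun him0 => ?_, hA⟩
        have hw : γ x - 1 = (((γ x).re - 1 : ℝ) : ℂ) := Complex.ext (by simp) (by simp [← him0])
        rw [hw] at hA
        have hre : (γ x).re ≠ 1 := fun h => hγ.ne_start hx
          (Complex.ext (by simpa using h) (by simp [← him0]))
        rcases lt_or_gt_of_ne hre with h | h
        · have := two_pi_le_argOne_of_neg (sub_neg.2 h)
          linarith [hα.2]
        · have := argOne_of_pos (sub_pos.2 h)
          linarith [hα.1]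
    · obtain ⟨γ, hγ, him⟩ := exists_isRay_sigmaOne hα h
      rw [← him]
      rintro a ⟨x, hx, rfl⟩
      exact ⟨γ, hγ, x, hx, rfl⟩
  rw [ray, this, (isClosed_insert_levelOne hα).closure_eq]

/-- The Möbius map x ↦ (1-x)/(1+x) carries [0,∞) onto (-1,1] and is its own inverse. The ray leaves
compact subsets of the level set because -1 does not belong to it. -/
lemma isRay_segment : IsRay (sigmaOne 0) 1 Real.pi (fun x : ℝ => (((1 - x) / (1 + x) : ℝ) : ℂ)) := by
  have hne : ∀ x : ℝ, x ∈ Ici (0 : ℝ) → 1 + x ≠ 0 := fun x hx => by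
    have : (0 : ℝ) ≤ x := hx
    positivity
  have hmem : ∀ x : ℝ, 0 ≤ x → -1 < (1 - x) / (1 + x) ∧ (1 - x) / (1 + x) ≤ 1 := fun x hx => by
    have : 0 < 1 + x := by linarith
    rw [lt_div_iff₀ this, div_le_iff₀ this]
    constructor <;> linarith
  have hd : ∀ x : ℝ, 0 ≤ x → HasDerivAt (fun x : ℝ => (((1 - x) / (1 + x) : ℝ) : ℂ))
      ((-2 / (1 + x) ^ 2 : ℝ) : ℂ) x := fun x hx => by
    have h1 := (((hasDerivAt_id' x).const_sub 1).fun_div ((hasDerivAt_id' x).const_add 1) (hne x hx))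
    refine (h1.congr_deriv ?_).ofReal_comp
    congr 1
    ring
  refine ⟨⟨?_, ?_, ?_⟩, by simp, ?_, fun x _ => (Complex.ofReal_im _).ge, ?_, ?_⟩
  · refine isEmbedding_domRestrict (ρ := fun z => (1 - z.re) / (1 + z.re))
      (fun x hx => (hd x hx).continuousAt.continuousWithinAt) ?_ fun x hx => ?_
    · refine ContinuousOn.div (by fun_prop) (by fun_prop) ?_
      rintro _ ⟨x, hx, rfl⟩
      have := (hmem x hx).1
      rw [Complex.ofReal_re]
      linarith
    · have := hne x hx
      rw [Complex.ofReal_re]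
      field_simp
      ring
  · have h1 : ContDiffOn ℝ ∞ (fun x : ℝ => (1 - x) / (1 + x)) (Ioi 0) :=
      ContDiffOn.div (by fun_prop) (by fun_prop) fun x hx => hne x (Ioi_subset_Ici_self hx)
    exact Complex.ofRealCLM.contDiff.comp_contDiffOn h1
  · intro x hx
    rw [(hd x (le_of_lt hx)).hasDerivWithinAt.derivWithin (uniqueDiffOn_Ioi 0 x hx)]
    have := hne x (Ioi_subset_Ici_self hx)
    rw [Ne, Complex.ofReal_eq_zero]
    positivity
  · intro x hx
    rcases hx.eq_or_lt with rfl | hx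
    · simpa using one_mem_sigmaOne 0
    have h1 := hmem x hx.le
    have h2 : (1 - x) / (1 + x) < 1 := by
      rw [div_lt_iff₀ (by linarith)]
      linarith
    refine (mem_sigmaOne_iff (Complex.ofReal_im _).ge fun h => h2.ne (by exact_mod_cast h)).2 ⟨?_, ?_⟩
    · rw [Complex.ofReal_re]
      exact fun h => absurd h.2 (not_le.2 h1.1)
    · have := argOne_of_neg (x := (1 - x) / (1 + x) - 1) (by linarith) (by linarith)
      rw [← Complex.ofReal_one, ← Complex.ofReal_sub, this]
      simp
  · refine tendsto_const_nhds.congr' ?_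
    filter_upwards [self_mem_nhdsWithin] with x hx
    have hx : 0 < x := hx
    have e : ((1 - x) / (1 + x) - 1 : ℝ) = -(2 * x / (1 + x)) := by
      field_simp
      ring
    rw [← Complex.ofReal_one, ← Complex.ofReal_sub, e, Complex.norm_real, Real.norm_eq_abs, abs_neg,
      abs_of_pos (by positivity), ← Complex.ofReal_div, neg_div, div_self (by positivity),
      Complex.exp_pi_mul_I]
    simp
  · intro K hK hKS
    have hcl : IsClosed {x : ℝ | ((x : ℝ) : ℂ) ∈ K} := hK.isClosed.preimage Complex.continuous_ofReal
    have hnot : ((-1 : ℝ) : ℂ) ∉ K := fun h => (hKS h).1 (by simp)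
    have hlim : Tendsto (fun x : ℝ => (1 - x) / (1 + x)) atTop (𝓝 (-1)) := by
      have h1 : Tendsto (fun x : ℝ => 2 / (1 + x) - 1) atTop (𝓝 (0 - 1)) :=
        (tendsto_const_nhds.div_atTop (tendsto_atTop_add_const_left _ 1 tendsto_id)).sub_const 1
      rw [zero_sub] at h1
      refine h1.congr' ?_
      filter_upwards [eventually_ge_atTop 0] with x hx
      have := hne x hx
      field_simp
      ring
    exact hlim.eventually (hcl.isOpen_compl.mem_nhds hnot)

/-- The direction is π, where the principal argument is not continuous, so the level 2π is found by
trapping it between π and 3π. The end point -1 enters only through the closure. -/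
lemma ray_sigmaOne_zero_pi :
    ray (sigmaOne 0) 1 Real.pi = {a | a.im = 0 ∧ -1 ≤ a.re ∧ a.re ≤ 1} := by
  have hseg : {a | ∃ γ : ℝ → ℂ, IsRay (sigmaOne 0) 1 Real.pi γ ∧ ∃ x, 0 ≤ x ∧ γ x = a} =
      Complex.ofReal '' Ioc (-1) 1 := by
    apply Subset.antisymm
    · rintro a ⟨γ, hγ, x, hx, rfl⟩
      rcases hx.eq_or_lt with rfl | hx
      · exact ⟨1, by simp, by simp [hγ.start]⟩
      have hs : ∀ x, 0 < x → Real.sin (argOne (γ x - 1) + 0) = 0 := fun x hx =>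
        ((mem_sigmaOne_iff (hγ.upper x hx.le) (hγ.ne_start hx)).1 (hγ.mem x hx.le)).2
      have hA : argOne (γ x - 1) = 2 * Real.pi := by
        have hgt : ∀ᶠ y in 𝓝[>] (0 : ℝ), Real.pi < argOne (γ y - 1) := by
          have hre : ∀ᶠ y in 𝓝[>] (0 : ℝ), ((γ y - 1) / (‖γ y - 1‖ : ℂ)).re < 0 := by
            have := (Complex.continuous_re.tendsto _).comp hγ.direction
            refine this.eventually_lt_const ?_
            simp
          have hsm : ∀ᶠ y in 𝓝[>] (0 : ℝ), ‖γ y - 1‖ < 1 := by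
            have := (hγ.tendsto_start.sub_const 1).norm
            exact this.eventually_lt_const (by simp)
          filter_upwards [hre, hsm, self_mem_nhdsWithin] with y hy hy' hy0
          have h0 : 0 < y := hy0
          have hn := norm_pos_iff.2 (sub_ne_zero.2 (hγ.ne_start h0))
          rw [← Complex.ofReal_one, Complex.div_ofReal_re] at hy
          have hre' : (γ y - 1).re < 0 := by
            by_contra h
            exact absurd hy (not_lt.2 (div_nonneg (by simpa using h) hn.le))
          have him : 0 ≤ (γ y - 1).im := by rw [sub_one_im]; exact hγ.upper y h0.le
          have h1 : Real.pi / 2 < (γ y - 1).arg := by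
            by_contra h
            have h2 := Complex.abs_arg_le_pi_div_two_iff.1
              (abs_le.2 ⟨by linarith [Complex.arg_nonneg_iff.2 him, Real.pi_pos], not_lt.1 h⟩)
            linarith
          have h3 := Complex.arg_nonneg_iff.2 (gInt_im_nonneg him)
          rw [argOne]
          linarith
        obtain ⟨y, hy, hy0⟩ := (hgt.and self_mem_nhdsWithin).exists
        have hc : ∀ y, 0 < y → argOne (γ x - 1) = argOne (γ y - 1) := fun y hy' =>
          eq_of_sin_add_eq_zero hγ.argOne_continuousOn hs hx hy'
        have hgt' : Real.pi < argOne (γ x - 1) := by rw [hc y hy0]; exact hy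
        have hlt : argOne (γ x - 1) < 3 * Real.pi := by
          have h1 := (Complex.abs_arg_le_pi_div_two_iff.2 (gInt_re_pos (w := γ x - 1)
            (by rw [sub_one_im]; exact hγ.upper x hx.le)).le)
          have h2 := Complex.arg_le_pi (γ x - 1)
          have h3 := (abs_le.1 h1).2
          rw [argOne]
          linarith [Real.pi_pos]
        have hs' := hs x hx
        rw [add_zero] at hs'
        obtain ⟨n, hn⟩ := Real.sin_eq_zero_iff.1 hs'
        have n1 : (1 : ℝ) < n := by
          have : 1 * Real.pi < n * Real.pi := by rw [hn]; linarith
          exact lt_of_mul_lt_mul_right this Real.pi_pos.le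
        have n2 : (n : ℝ) < 3 := by
          have : n * Real.pi < 3 * Real.pi := by rw [hn]; linarith
          exact lt_of_mul_lt_mul_right this Real.pi_pos.le
        have n3 : 1 < n := by exact_mod_cast n1
        have n4 : n < 3 := by exact_mod_cast n2
        obtain rfl : n = 2 := by omega
        rw [← hn]
        norm_num
      have hAc : ∀ y, 0 < y → argOne (γ y - 1) = 2 * Real.pi := fun y hy => by
        rw [← hA]
        exact eq_of_sin_add_eq_zero hγ.argOne_continuousOn hs hy hx
      -- On the half circle of radius ρ ≤ 2 the value 2π is attained at -ρ, and by monotonicity only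
      -- there.
      have hreal : ∀ y, 0 < y → ‖γ y - 1‖ ≤ 2 → γ y - 1 = ((-‖γ y - 1‖ : ℝ) : ℂ) := by
        intro y hy hy2
        have hn := norm_pos_iff.2 (sub_ne_zero.2 (hγ.ne_start hy))
        refine argOne_unique (by rw [sub_one_im]; exact hγ.upper y hy.le) (by simp)
          (sub_ne_zero.2 (hγ.ne_start hy)) ?_ ?_
        · rw [Complex.norm_real, norm_neg, norm_norm]
        · rw [hAc y hy, argOne_of_neg (by linarith) (by linarith)]
      -- Otherwise the ray would pass through a point at distance exactly 2, that is through -1,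
      -- which is excluded from `sigmaOne`.
      have hn2 : ‖γ x - 1‖ < 2 := by
        by_contra hge
        have hc : ContinuousOn (fun y => ‖γ y - 1‖) (Ici 0) :=
          (hγ.continuousOn.sub continuousOn_const).norm
        obtain ⟨y, hy, hy2⟩ := intermediate_value_Icc hx.le (hc.mono Icc_subset_Ici_self)
          (show (2 : ℝ) ∈ Icc ‖γ 0 - 1‖ ‖γ x - 1‖ by
            rw [hγ.start]
            exact ⟨by simp, not_lt.1 hge⟩)
        have hy0 : 0 < y := hy.1.lt_of_ne fun h => by
          simp only [← h, hγ.start] at hy2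
          norm_num at hy2
        have h1 := hreal y hy0 hy2.le
        simp only at hy2
        rw [hy2] at h1
        have h2 : γ y = -1 := by
          rw [sub_eq_iff_eq_add] at h1
          rw [h1]
          norm_num
        exact (hγ.mem y hy0.le).1 (by simp [h2])
      have h1 := hreal x hx hn2.le
      refine ⟨1 - ‖γ x - 1‖, ⟨by linarith, by linarith [norm_nonneg (γ x - 1)]⟩, ?_⟩
      rw [Complex.ofReal_neg] at h1
      rw [Complex.ofReal_sub, Complex.ofReal_one]
      linear_combination -h1
    · rintro _ ⟨y, hy, rfl⟩
      have h1 : 0 < 1 + y := by linarith [hy.1]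
      refine ⟨_, isRay_segment, (1 - y) / (1 + y), div_nonneg (by linarith [hy.2]) h1.le, ?_⟩
      congr 1
      field_simp
      ring
  rw [ray, hseg]
  have hemb : IsClosedEmbedding Complex.ofReal := Complex.isometry_ofReal.isClosedEmbedding
  rw [hemb.closure_image_eq, closure_Ioc (by norm_num)]
  ext a
  constructor
  · rintro ⟨x, hx, rfl⟩
    exact ⟨Complex.ofReal_im x, by simpa using hx.1, by simpa using hx.2⟩
  · rintro ⟨h0, h1, h2⟩
    exact ⟨a.re, ⟨h1, h2⟩, Complex.ext (by simp) (by simp [h0])⟩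


/-! ### Reflection in the imaginary axis and the rays from -1 -/

lemma norm_reflectIm (a : ℂ) : ‖reflectIm a‖ = ‖a‖ := by
  rw [reflectIm, norm_neg, Complex.norm_conj]

lemma reflectIm_sub (a b : ℂ) : reflectIm (a - b) = reflectIm a - reflectIm b := by
  simp only [reflectIm, map_sub]
  ring

lemma reflectIm_one : reflectIm 1 = -1 := by simp [reflectIm]

lemma reflectIm_neg_one : reflectIm (-1) = 1 := by simp [reflectIm]

/-- The reflection in the imaginary axis as a homeomorphism. -/
noncomputable def reflectImHomeomorph : ℂ ≃ₜ ℂ where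
  toFun := reflectIm
  invFun := reflectIm
  left_inv := reflectIm_reflectIm
  right_inv := reflectIm_reflectIm
  continuous_toFun := continuous_reflectIm
  continuous_invFun := continuous_reflectIm

lemma IsSmoothArc.reflectIm_comp {γ : ℝ → ℂ} {J I : Set ℝ} (hI : UniqueDiffOn ℝ I)
    (h : IsSmoothArc γ J I) : IsSmoothArc (fun x => reflectIm (γ x)) J I where
  embedding := reflectImHomeomorph.isEmbedding.comp h.embedding
  smooth := (Complex.conjCLE.contDiff.comp_contDiffOn h.smooth).neg
  regular := fun x hx => by
    have h1 : HasDerivWithinAt γ (derivWithin γ I x) I x :=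
      ((h.smooth x hx).differentiableWithinAt (by simp)).hasDerivWithinAt
    have h2 : HasDerivWithinAt (fun x => reflectIm (γ x))
        (-(starRingEnd ℂ) (derivWithin γ I x)) I x :=
      (Complex.conjCLE.toContinuousLinearMap.hasFDerivAt.comp_hasDerivWithinAt x h1).neg
    rw [h2.derivWithin (hI x hx), neg_ne_zero]
    exact (map_ne_zero _).2 (h.regular x hx)

lemma exp_pi_sub_mul_I (φ : ℝ) : Complex.exp ((Real.pi - φ : ℝ) * Complex.I) =
    reflectIm (Complex.exp (φ * Complex.I)) := by
  apply Complex.ext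
  · rw [Complex.exp_ofReal_mul_I_re, reflectIm_re, Complex.exp_ofReal_mul_I_re, Real.cos_pi_sub]
  · rw [Complex.exp_ofReal_mul_I_im, reflectIm_im, Complex.exp_ofReal_mul_I_im, Real.sin_pi_sub]

lemma IsRay.reflectIm_comp {S : Set ℂ} {c : ℂ} {φ : ℝ} {γ : ℝ → ℂ} (h : IsRay S c φ γ) :
    IsRay (reflectIm ⁻¹' S) (reflectIm c) (Real.pi - φ) (fun x => reflectIm (γ x)) where
  arc := h.arc.reflectIm_comp (uniqueDiffOn_Ioi 0)
  start := by rw [h.start]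
  mem := fun x hx => by rw [mem_preimage, reflectIm_reflectIm]; exact h.mem x hx
  upper := fun x hx => by rw [reflectIm_im]; exact h.upper x hx
  direction := by
    have h1 := (continuous_reflectIm.tendsto _).comp h.direction
    rw [← exp_pi_sub_mul_I] at h1
    refine h1.congr fun x => ?_
    rw [Function.comp_apply, ← reflectIm_sub, norm_reflectIm]
    simp only [reflectIm, map_div₀, Complex.conj_ofReal]
    ring
  leaves := fun K hK hKS => by
    have h1 := h.leaves (reflectIm '' K) (hK.image continuous_reflectIm) (by
      rintro _ ⟨z, hz, rfl⟩
      exact hKS hz)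
    filter_upwards [h1] with x hx hxK
    exact hx ⟨_, hxK, reflectIm_reflectIm _⟩

lemma ray_reflectIm (S : Set ℂ) (c : ℂ) (φ : ℝ) :
    ray (reflectIm ⁻¹' S) (reflectIm c) (Real.pi - φ) = reflectIm ⁻¹' ray S c φ := by
  rw [ray, ray]
  have h := reflectImHomeomorph.preimage_closure
    {a | ∃ γ : ℝ → ℂ, IsRay S c φ γ ∧ ∃ x, 0 ≤ x ∧ γ x = a}
  refine Eq.trans (congrArg closure ?_) h.symm
  ext a
  constructor
  · rintro ⟨γ, hγ, x, hx, rfl⟩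
    have := hγ.reflectIm_comp
    rw [reflectIm_reflectIm, sub_sub_cancel, ← preimage_comp,
      show reflectIm ∘ reflectIm = id from funext reflectIm_reflectIm, preimage_id] at this
    exact ⟨_, this, x, hx, rfl⟩
  · rintro ⟨γ, hγ, x, hx, h⟩
    refine ⟨_, hγ.reflectIm_comp, x, hx, ?_⟩
    simp only [h]
    exact reflectIm_reflectIm a

/-- Transfers everything known at 1 to -1; the complementary angle is why the results at 1 are
stated for θ up to π/2. -/
lemma sigmaNegOne_eq_preimage (θ : ℝ) :
    sigmaNegOne θ = reflectIm ⁻¹' sigmaOne (Real.pi / 2 - θ) := by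
  ext a
  refine and_congr ?_ ?_
  · rw [reflectIm_im, reflectIm_re, neg_le_neg_iff]
  · rw [periodVanishes_reflect_iff, reflectIm_neg_one]

/-- A continuous argument of `(a + 1)² g(-(a + 1))` on the upper half plane. -/
noncomputable def argNegOne (a : ℂ) : ℝ := 2 * (a + 1).arg + (gInt (-(a + 1))).arg

lemma arg_reflectIm {a : ℂ} (ha : 0 < a.im) : (reflectIm a).arg = Real.pi - a.arg := by
  have h := arg_pos_of_im_pos ha
  rw [show reflectIm a = ((‖a‖ : ℝ) : ℂ) * Complex.exp ((Real.pi - a.arg : ℝ) * Complex.I) by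
    rw [exp_pi_sub_mul_I]
    conv_lhs => rw [← Complex.norm_mul_exp_arg_mul_I a]
    simp only [reflectIm, map_mul, Complex.conj_ofReal]
    ring, Complex.arg_real_mul _ (norm_pos_iff.2 (ne_zero_of_im_pos ha)), Complex.arg_exp_mul_I,
    toIocMod_eq_self]
  constructor <;> linarith [Complex.arg_le_pi a, Real.pi_pos]

lemma reflectIm_sub_one_im (a : ℂ) : (reflectIm a - 1).im = a.im := by
  rw [sub_one_im, reflectIm_im]

lemma arg_gInt_neg_add_one {a : ℂ} (ha : 0 < a.im) :
    (gInt (-(a + 1))).arg = -(gInt (reflectIm a - 1)).arg := by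
  have hw : 0 < (reflectIm a - 1).im := by rwa [reflectIm_sub_one_im]
  have h1 := arg_gInt hw
  rw [gInt_neg_add_one ha, Complex.arg_conj, if_neg]
  have := Complex.arg_le_pi (reflectIm a - 1 + 2)
  have := Real.pi_pos
  intro h
  linarith

lemma argOne_reflectIm {a : ℂ} (ha : 0 < a.im) :
    argOne (reflectIm a - 1) = 2 * Real.pi - argNegOne a := by
  have h1 : reflectIm a - 1 = reflectIm (a + 1) := by
    rw [reflectIm, reflectIm, map_add, map_one]
    ring
  rw [argNegOne, arg_gInt_neg_add_one ha, argOne]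
  nth_rewrite 1 [h1]
  rw [arg_reflectIm (by simpa using ha)]
  ring

/-- The points of the open upper half plane at which `argNegOne` equals `α`. -/
def levelNegOne (α : ℝ) : Set ℂ := {a | 0 < a.im ∧ argNegOne a = α}

lemma preimage_levelOne (α : ℝ) :
    reflectIm ⁻¹' insert 1 (levelOne α) = insert (-1) (levelNegOne (2 * Real.pi - α)) := by
  ext a
  refine or_congr ⟨fun h => ?_, fun h => ?_⟩ ⟨fun h => ?_, fun h => ?_⟩
  · rw [← reflectIm_reflectIm a, h, reflectIm_one]
  · rw [h, reflectIm_neg_one]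
  · have ha : 0 < a.im := by rw [← reflectIm_im]; exact h.1
    have := h.2
    rw [argOne_reflectIm ha] at this
    exact ⟨ha, by linarith⟩
  · refine ⟨by rw [reflectIm_im]; exact h.1, ?_⟩
    rw [argOne_reflectIm h.1, h.2]
    ring

/-! ### The four rays as level sets -/

section rays

variable {θ : ℝ}

lemma sigmaOneRight_eq (hθ : θ ∈ Icc 0 (Real.pi / 4)) :
    sigmaOneRight θ = insert 1 (levelOne (Real.pi - θ)) := by
  have := Real.pi_pos
  exact ray_sigmaOne ⟨by linarith [hθ.2], by linarith [hθ.1]⟩ (by simp)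

lemma sigmaOneLeft_eq (hθ : θ ∈ Icc 0 (Real.pi / 4)) (h0 : 0 < θ) :
    sigmaOneLeft θ = insert 1 (levelOne (2 * Real.pi - θ)) := by
  have := Real.pi_pos
  exact ray_sigmaOne ⟨by linarith [hθ.2], by linarith [hθ.1]⟩ (by simp)

lemma sigmaOneLeft_zero : sigmaOneLeft 0 = {a | a.im = 0 ∧ -1 ≤ a.re ∧ a.re ≤ 1} := by
  rw [← ray_sigmaOne_zero_pi, sigmaOneLeft, angleOneLeft]
  congr 1
  ring

lemma sigmaNegOneLeft_eq (hθ : θ ∈ Icc 0 (Real.pi / 4)) :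
    sigmaNegOneLeft θ = insert (-1) (levelNegOne (3 * Real.pi / 2 - θ)) := by
  have hpi := Real.pi_pos
  have h := ray_sigmaOne (θ := Real.pi / 2 - θ) (α := Real.pi / 2 + θ)
    ⟨by linarith [hθ.1], by linarith [hθ.2]⟩
    (by rw [show Real.pi / 2 + θ + (Real.pi / 2 - θ) = Real.pi by ring, Real.sin_pi])
  rw [sigmaNegOneLeft, angleNegOneLeft, sigmaNegOne_eq_preimage, ← reflectIm_one,
    show (3 * Real.pi - 2 * θ) / 4 = Real.pi - (Real.pi / 2 + θ) / 2 by ring, ray_reflectIm, h,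
    preimage_levelOne, reflectIm_one]
  congr 2
  ring

lemma sigmaNegOneRight_eq (hθ : θ ∈ Icc 0 (Real.pi / 4)) :
    sigmaNegOneRight θ = insert (-1) (levelNegOne (Real.pi / 2 - θ)) := by
  have hpi := Real.pi_pos
  have h := ray_sigmaOne (θ := Real.pi / 2 - θ) (α := 3 * Real.pi / 2 + θ)
    ⟨by linarith [hθ.1], by linarith [hθ.2]⟩
    (by rw [show 3 * Real.pi / 2 + θ + (Real.pi / 2 - θ) = 2 * Real.pi by ring, Real.sin_two_pi])
  rw [sigmaNegOneRight, angleNegOneRight, sigmaNegOne_eq_preimage, ← reflectIm_one,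
    show (Real.pi - 2 * θ) / 4 = Real.pi - (3 * Real.pi / 2 + θ) / 2 by ring, ray_reflectIm, h,
    preimage_levelOne, reflectIm_one]
  congr 2
  ring

lemma exists_isRay_oneLeft (hθ : θ ∈ Icc 0 (Real.pi / 4)) :
    ∃ γ, IsRay (sigmaOne θ) 1 (angleOneLeft θ) γ := by
  have hpi := Real.pi_pos
  rcases hθ.1.eq_or_lt with rfl | h0
  · rw [angleOneLeft, show (2 * Real.pi - 0) / 2 = Real.pi by ring]
    exact ⟨_, isRay_segment⟩
  · obtain ⟨γ, hγ, -⟩ := exists_isRay_sigmaOne (θ := θ) (α := 2 * Real.pi - θ)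
      ⟨by linarith [hθ.2], by linarith⟩ (by simp)
    exact ⟨γ, hγ⟩

lemma exists_isRay_oneRight (hθ : θ ∈ Icc 0 (Real.pi / 4)) :
    ∃ γ, IsRay (sigmaOne θ) 1 (angleOneRight θ) γ := by
  have hpi := Real.pi_pos
  obtain ⟨γ, hγ, -⟩ := exists_isRay_sigmaOne (θ := θ) (α := Real.pi - θ)
    ⟨by linarith [hθ.2], by linarith [hθ.1]⟩ (by simp)
  exact ⟨γ, hγ⟩

lemma exists_isRay_negOne {φ : ℝ}
    (h : ∃ γ, IsRay (sigmaOne (Real.pi / 2 - θ)) 1 (Real.pi - φ) γ) :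
    ∃ γ, IsRay (sigmaNegOne θ) (-1) φ γ := by
  obtain ⟨γ, hγ⟩ := h
  have := hγ.reflectIm_comp
  rw [← sigmaNegOne_eq_preimage, reflectIm_one, sub_sub_cancel] at this
  exact ⟨_, this⟩

lemma exists_isRay_negOneLeft (hθ : θ ∈ Icc 0 (Real.pi / 4)) :
    ∃ γ, IsRay (sigmaNegOne θ) (-1) (angleNegOneLeft θ) γ := by
  have hpi := Real.pi_pos
  obtain ⟨γ, hγ, -⟩ := exists_isRay_sigmaOne (θ := Real.pi / 2 - θ) (α := Real.pi / 2 + θ)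
    ⟨by linarith [hθ.1], by linarith [hθ.2]⟩
    (by rw [show Real.pi / 2 + θ + (Real.pi / 2 - θ) = Real.pi by ring, Real.sin_pi])
  refine exists_isRay_negOne ⟨γ, ?_⟩
  rwa [angleNegOneLeft, show Real.pi - (3 * Real.pi - 2 * θ) / 4 = (Real.pi / 2 + θ) / 2 by ring]

lemma exists_isRay_negOneRight (hθ : θ ∈ Icc 0 (Real.pi / 4)) :
    ∃ γ, IsRay (sigmaNegOne θ) (-1) (angleNegOneRight θ) γ := by
  have hpi := Real.pi_pos
  obtain ⟨γ, hγ, -⟩ := exists_isRay_sigmaOne (θ := Real.pi / 2 - θ) (α := 3 * Real.pi / 2 + θ)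
    ⟨by linarith [hθ.1], by linarith [hθ.2]⟩
    (by rw [show 3 * Real.pi / 2 + θ + (Real.pi / 2 - θ) = 2 * Real.pi by ring, Real.sin_two_pi])
  refine exists_isRay_negOne ⟨γ, ?_⟩
  rwa [angleNegOneRight, show Real.pi - (Real.pi - 2 * θ) / 4 = (3 * Real.pi / 2 + θ) / 2 by ring]

lemma sigmaOne_inter_eq_union (hθ : θ ∈ Icc 0 (Real.pi / 4)) (h0 : 0 < θ) :
    sigmaOne θ ∩ {a | 0 ≤ a.im} = sigmaOneLeft θ ∪ sigmaOneRight θ := by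
  rw [sigmaOneLeft_eq hθ h0, sigmaOneRight_eq hθ, sigmaOne_inter_upper h0
    (by linarith [hθ.2, Real.pi_pos])]

lemma sigmaNegOne_inter_eq_union (hθ : θ ∈ Icc 0 (Real.pi / 4)) :
    sigmaNegOne θ ∩ {a | 0 ≤ a.im} = sigmaNegOneLeft θ ∪ sigmaNegOneRight θ := by
  have hpi := Real.pi_pos
  have h1 : {a : ℂ | 0 ≤ a.im} = reflectIm ⁻¹' {a : ℂ | 0 ≤ a.im} := by
    ext a
    rw [mem_preimage, mem_ofPred_eq, mem_ofPred_eq, reflectIm_im]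
  rw [sigmaNegOneLeft_eq hθ, sigmaNegOneRight_eq hθ, sigmaNegOne_eq_preimage, h1, ← preimage_inter,
    sigmaOne_inter_upper (by linarith [hθ.2]) (by linarith [hθ.1]), preimage_union,
    preimage_levelOne, preimage_levelOne, union_comm]
  congr 3
  · ring_nf
  · ring_nf

end rays


/-! ### F on the real axis and the end point s_θ -/

/-- The real part of `periodMid` on the real axis. -/
noncomputable def realMid (x : ℝ) : ℝ :=
  ∫ t in (0 : ℝ)..(Real.pi / 2),
    8 * Real.sin t ^ 2 * Real.cos t ^ 2 * Real.sqrt (x + (1 - 2 * Real.sin t ^ 2))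

lemma realMid_neg (x : ℝ) : realMid (-x) = ∫ t in (0 : ℝ)..(Real.pi / 2),
    8 * Real.sin t ^ 2 * Real.cos t ^ 2 * Real.sqrt (-(x + (1 - 2 * Real.sin t ^ 2))) := by
  have h := intervalIntegral.integral_comp_sub_left (a := 0) (b := Real.pi / 2)
    (fun t => 8 * Real.sin t ^ 2 * Real.cos t ^ 2 * Real.sqrt (-x + (1 - 2 * Real.sin t ^ 2)))
    (Real.pi / 2)
  rw [sub_self, sub_zero] at h
  rw [realMid, ← h]
  refine intervalIntegral.integral_congr fun t _ => ?_
  simp only [Real.sin_pi_div_two_sub, Real.cos_pi_div_two_sub]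
  rw [show -x + (1 - 2 * Real.cos t ^ 2) = -(x + (1 - 2 * Real.sin t ^ 2)) by
    rw [Real.cos_sq']; ring]
  ring

lemma csqrt_ofReal_eq (x : ℝ) :
    csqrt x = (Real.sqrt x : ℂ) + (Real.sqrt (-x) : ℂ) * Complex.I := by
  rcases le_total 0 x with h | h
  · rw [csqrt_ofReal h, Real.sqrt_eq_zero_of_nonpos (neg_nonpos.2 h)]
    simp
  · have := csqrt_neg_ofReal (neg_nonneg.2 h)
    rw [Complex.ofReal_neg, neg_neg] at this
    rw [this, Real.sqrt_eq_zero_of_nonpos h]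
    simp

/-- The root √(x - u) is real where u < x and imaginary where u > x; the imaginary part is the
mirror image of the real one. -/
lemma periodMid_ofReal (x : ℝ) :
    periodMid x = (realMid x : ℂ) + (realMid (-x) : ℂ) * Complex.I := by
  rw [realMid_neg, realMid, ← intervalIntegral.integral_ofReal, ← intervalIntegral.integral_ofReal,
    ← intervalIntegral.integral_mul_const, ← intervalIntegral.integral_add, periodMid]
  · refine intervalIntegral.integral_congr fun t _ => ?_
    rw [← Complex.ofReal_mul, ← Complex.ofReal_add, csqrt_ofReal_eq, one_mul,
      add_comm (1 - 2 * Real.sin t ^ 2)]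
    push_cast
    ring
  · exact (Continuous.intervalIntegrable (Complex.continuous_ofReal.comp (by fun_prop)) _ _)
  · exact (Continuous.intervalIntegrable ((Complex.continuous_ofReal.comp (by fun_prop)).mul
      continuous_const) _ _)

lemma continuous_realMid_integrand (x : ℝ) : Continuous fun t : ℝ =>
    8 * Real.sin t ^ 2 * Real.cos t ^ 2 * Real.sqrt (x + (1 - 2 * Real.sin t ^ 2)) := by
  fun_prop

lemma realMid_mono : Monotone realMid := fun x y h =>
  intervalIntegral.integral_mono_on pi_div_two_pos'.le
    ((continuous_realMid_integrand x).intervalIntegrable _ _)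
    ((continuous_realMid_integrand y).intervalIntegrable _ _) fun t _ => by gcongr

lemma realMid_strictMonoOn : StrictMonoOn realMid (Ici (-1)) := by
  intro x hx y _ h
  have hlim : Tendsto (fun t : ℝ => y + (1 - 2 * Real.sin t ^ 2)) (𝓝[>] 0) (𝓝 (y + 1)) := by
    have hc : Continuous fun t : ℝ => y + (1 - 2 * Real.sin t ^ 2) := by fun_prop
    simpa using (hc.tendsto 0).mono_left nhdsWithin_le_nhds
  have hy : 0 < y + 1 := by have : -1 ≤ x := hx; linarith
  obtain ⟨t, ht, ht'⟩ := ((hlim.eventually_const_lt hy).and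
    (Ioo_mem_nhdsGT pi_div_two_pos')).exists
  refine intervalIntegral.integral_lt_integral_of_continuousOn_of_le_of_exists_lt pi_div_two_pos'
    (continuous_realMid_integrand x).continuousOn (continuous_realMid_integrand y).continuousOn
    (fun t _ => by gcongr) ⟨t, Ioo_subset_Icc_self ht', ?_⟩
  obtain ⟨hs, hc⟩ := sin_cos_pos ht'
  refine mul_lt_mul_of_pos_left ((Real.sqrt_lt_sqrt_iff_of_pos ht).2 (by linarith)) (by positivity)

lemma realMid_eq_zero {x : ℝ} (hx : x ≤ -1) : realMid x = 0 := by
  have h1 : realMid (-1) = 0 := by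
    rw [realMid]
    refine intervalIntegral.integral_zero_ae (MeasureTheory.ae_of_all _ fun t _ => ?_)
    rw [Real.sqrt_eq_zero_of_nonpos, mul_zero]
    nlinarith [sq_nonneg (Real.sin t)]
  have h2 : 0 ≤ realMid x := intervalIntegral.integral_nonneg pi_div_two_pos'.le fun t _ => by
    positivity
  exact le_antisymm (by rw [← h1]; exact realMid_mono hx) h2

lemma realMid_pos {x : ℝ} (hx : -1 < x) : 0 < realMid x := by
  rw [← realMid_eq_zero le_rfl]
  exact realMid_strictMonoOn (mem_Ici.2 le_rfl) (mem_Ici.2 hx.le) hx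

lemma continuous_realMid : Continuous realMid := by
  have h : Continuous fun x : ℝ => (periodMid x).re :=
    Complex.continuous_re.comp (continuousOn_periodMid.comp_continuous Complex.continuous_ofReal
      fun x => (Complex.ofReal_im x).ge)
  refine h.congr fun x => ?_
  rw [periodMid_ofReal]
  simp

lemma exp_mul_periodMid_ofReal_re (θ x : ℝ) : (Complex.exp (θ * Complex.I) * periodMid x).re =
    Real.cos θ * realMid x - Real.sin θ * realMid (-x) := by
  rw [Complex.mul_re, Complex.exp_ofReal_mul_I_re, Complex.exp_ofReal_mul_I_im, periodMid_ofReal]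
  simp

/-- Both terms are monotone in the same sense, and at least one strictly: the first beyond -1, the
second up to 1. -/
lemma strictMono_exp_mul_periodMid {θ : ℝ} (hθ : θ ∈ Ioo 0 (Real.pi / 2)) :
    StrictMono fun x : ℝ => (Complex.exp (θ * Complex.I) * periodMid x).re := by
  intro x y h
  have hpi := Real.pi_pos
  have hs := Real.sin_pos_of_pos_of_lt_pi hθ.1 (by linarith [hθ.2])
  have hc := Real.cos_pos_of_mem_Ioo ⟨by linarith [hθ.1], hθ.2⟩
  simp only [exp_mul_periodMid_ofReal_re]
  have h1 : realMid x ≤ realMid y := realMid_mono h.le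
  have h2 : realMid (-y) ≤ realMid (-x) := realMid_mono (by linarith)
  rcases le_or_gt (-1) x with hx | hx
  · have h3 : realMid x < realMid y := realMid_strictMonoOn hx (by rw [mem_Ici]; linarith) h
    nlinarith
  · rcases le_or_gt y 1 with hy | hy
    · have h3 : realMid (-y) < realMid (-x) := realMid_strictMonoOn (by rw [mem_Ici]; linarith)
        (by rw [mem_Ici]; linarith) (by linarith)
      nlinarith
    · have h3 : realMid x < realMid y := by
        rw [realMid_eq_zero hx.le]
        exact realMid_pos (by linarith)
      nlinarith

lemma exists_boundaryPeriod_root {θ : ℝ} (hθ : θ ∈ Icc 0 (Real.pi / 4)) :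
    ∃ s ∈ Icc (-1 : ℝ) 0, (Complex.exp (θ * Complex.I) * periodMid s).re = 0 ∧
      ∀ x ∈ Icc (-1 : ℝ) 1, BoundaryPeriodVanishes θ x ↔ x = s := by
  have hpi := Real.pi_pos
  have hs : 0 ≤ Real.sin θ := Real.sin_nonneg_of_nonneg_of_le_pi hθ.1 (by linarith [hθ.2])
  have hsc : Real.sin θ ≤ Real.cos θ := by
    rw [← Real.cos_pi_div_two_sub]
    exact Real.cos_le_cos_of_nonneg_of_le_pi hθ.1 (by linarith [hθ.1]) (by linarith [hθ.2])
  have hcont : Continuous fun x : ℝ => Real.cos θ * realMid x - Real.sin θ * realMid (-x) := by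
    have h1 := continuous_realMid
    have h2 := continuous_realMid.comp continuous_neg
    exact (continuous_const.mul h1).sub (continuous_const.mul h2)
  have h0 := realMid_pos (x := 0) (by norm_num)
  have h1 := realMid_pos (x := 1) (by norm_num)
  have hm1 := realMid_eq_zero (x := -1) le_rfl
  obtain ⟨s, hs1, hs0⟩ := intermediate_value_Icc (show (-1 : ℝ) ≤ 0 by norm_num) hcont.continuousOn
    (show (0 : ℝ) ∈ Icc _ _ from ⟨by simp only [hm1, neg_neg]; nlinarith,
      by simp only [neg_zero]; nlinarith⟩)
  simp only [← exp_mul_periodMid_ofReal_re] at hs0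
  refine ⟨s, hs1, hs0, fun x hx => ?_⟩
  rw [boundaryPeriodVanishes_iff]
  refine ⟨fun h => ?_, fun h => by rw [h, hs0]⟩
  -- For θ = 0 only the term `realMid` remains. It is constant to the left of -1, so uniqueness uses
  -- x ≥ -1.
  rcases hθ.1.eq_or_lt with rfl | hθ0
  · rw [exp_mul_periodMid_ofReal_re] at h hs0
    simp only [Real.cos_zero, Real.sin_zero, one_mul, zero_mul, sub_zero] at h hs0
    have : ∀ u : ℝ, -1 ≤ u → realMid u = 0 → u = -1 := fun u hu h => by
      by_contra hne
      exact (realMid_pos (lt_of_le_of_ne hu (Ne.symm hne))).ne' h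
    rw [this x hx.1 h, this s hs1.1 hs0]
  · exact (strictMono_exp_mul_periodMid ⟨hθ0, by linarith [hθ.2]⟩).injective
      (by simp only [h, hs0])

/-! ### The argument of F and the set Σ_θ -/

/-- A continuous argument of `periodMid`. -/
noncomputable def argMid (a : ℂ) : ℝ := (periodMid a).arg

/-- A holomorphic logarithm of `periodMid`. -/
noncomputable def logMid (a : ℂ) : ℂ := Complex.log (periodMid a)

lemma logMid_im (a : ℂ) : (logMid a).im = argMid a := Complex.log_im _

lemma periodMid_re_im_pos {a : ℂ} (ha : 0 < a.im) : 0 < (periodMid a).re ∧ 0 < (periodMid a).im := by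
  have h1 := arg_periodMid_pos ha
  have h2 := arg_periodMid_lt ha
  have hpi := Real.pi_pos
  have hn := norm_pos_iff.2 (periodMid_ne_zero ha)
  rw [← Complex.norm_mul_cos_arg, ← Complex.norm_mul_sin_arg]
  exact ⟨mul_pos hn (Real.cos_pos_of_mem_Ioo ⟨by linarith, h2⟩),
    mul_pos hn (Real.sin_pos_of_pos_of_lt_pi h1 (by linarith))⟩

lemma hasDerivAt_logMid {a : ℂ} (ha : 0 < a.im) :
    HasDerivAt logMid (periodMidDeriv a / periodMid a) a :=
  (isPeriod_mid.deriv_fst a ha).clog (Or.inl (periodMid_re_im_pos ha).1)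

/-- F is in the first quadrant and F' in the fourth. -/
lemma logMid_deriv_im_neg {a : ℂ} (ha : 0 < a.im) : (periodMidDeriv a / periodMid a).im < 0 := by
  obtain ⟨h1, h2⟩ := periodMidDeriv_re_pos_im_neg ha
  obtain ⟨h3, h4⟩ := periodMid_re_im_pos ha
  rw [Complex.div_im, ← sub_div]
  refine div_neg_of_neg_of_pos ?_ (Complex.normSq_pos.2 (periodMid_ne_zero ha))
  nlinarith [mul_pos h1 h4, mul_neg_of_neg_of_pos h2 h3]

lemma continuousOn_argMid : ContinuousOn argMid {a | 0 < a.im} := fun a ha =>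
  (Complex.continuousAt_arg (Or.inl (periodMid_re_im_pos ha).1)).comp_continuousWithinAt
    ((continuousOn_periodMid a (show 0 ≤ a.im from le_of_lt ha)).mono fun z hz => show 0 ≤ z.im from le_of_lt hz)

lemma strictAnti_argMid {y : ℝ} (hy : 0 < y) :
    StrictAnti fun x : ℝ => argMid (x + y * Complex.I) := by
  have him : ∀ x : ℝ, 0 < (x + y * Complex.I : ℂ).im := fun x => by simpa using hy
  have hd : ∀ x : ℝ, HasDerivAt (fun x : ℝ => argMid (x + y * Complex.I))
      (periodMidDeriv (x + y * Complex.I) / periodMid (x + y * Complex.I)).im x := fun x => by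
    have h1 : HasDerivAt (fun x : ℝ => (x + y * Complex.I : ℂ)) 1 x :=
      (Complex.ofRealCLM.hasDerivAt (x := x)).add_const _
    have h2 := HasDerivAt.comp x (hasDerivAt_logMid (him x)) h1
    have := Complex.imCLM.hasFDerivAt.comp_hasDerivAt x h2
    rw [mul_one] at this
    exact this.congr_of_eventuallyEq (Eventually.of_forall fun x => (logMid_im _).symm)
  exact strictAnti_of_deriv_neg fun x => by rw [(hd x).deriv]; exact logMid_deriv_im_neg (him x)

lemma argMid_pos {a : ℂ} (ha : 0 < a.im) : 0 < argMid a := arg_periodMid_pos ha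

lemma argMid_lt {a : ℂ} (ha : 0 < a.im) : argMid a < Real.pi / 2 := arg_periodMid_lt ha

/-- Since arg F lies in (0, π/2), the sum with θ lies in (0, π), where the cosine has a single zero.
-/
lemma exp_mul_periodMid_re_eq_zero_iff {θ : ℝ} (hθ : θ ∈ Icc 0 (Real.pi / 2)) {a : ℂ}
    (ha : 0 < a.im) : (Complex.exp (θ * Complex.I) * periodMid a).re = 0 ↔
      argMid a = Real.pi / 2 - θ := by
  have hn := norm_pos_iff.2 (periodMid_ne_zero ha)
  have h1 := argMid_pos ha
  have h2 := argMid_lt ha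
  rw [re_exp_mul, mul_eq_zero, or_iff_right hn.ne']
  change Real.cos (argMid a + θ) = 0 ↔ _
  refine ⟨fun h => ?_, fun h => by rw [h, sub_add_cancel, Real.cos_pi_div_two]⟩
  by_contra hne
  rcases lt_or_gt_of_ne hne with h3 | h3
  · exact (Real.cos_pos_of_mem_Ioo ⟨by linarith [hθ.1], by linarith⟩).ne' h
  · exact (Real.cos_neg_of_pi_div_two_lt_of_lt (by linarith) (by linarith [hθ.2])).ne h

/-- Conjugation turns θ into -θ, and e^{-iθ}F has positive real part when F is in the first
quadrant. -/
lemma periodVanishes_mid_conj {θ : ℝ} (hθ : θ ∈ Ico 0 (Real.pi / 2)) {a : ℂ} (ha : a.im < 0) :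
    ¬ PeriodVanishes θ a (-1) 1 := by
  intro h
  have h1 := periodVanishes_conj h
  have ha' : 0 < ((starRingEnd ℂ) a).im := by simpa using ha
  rw [map_neg, map_one, periodVanishes_mid_iff ha'.le (fun h => ha'.ne' h.1)] at h1
  have h2 := periodMid_re_im_pos ha'
  have hpi := Real.pi_pos
  have hs : 0 ≤ Real.sin θ := Real.sin_nonneg_of_nonneg_of_le_pi hθ.1 (by linarith [hθ.2])
  have hc := Real.cos_pos_of_mem_Ioo ⟨by linarith [hθ.1], hθ.2⟩
  rw [Complex.mul_re, Complex.exp_ofReal_mul_I_re, Complex.exp_ofReal_mul_I_im, Real.cos_neg,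
    Real.sin_neg] at h1
  nlinarith [mul_pos hc h2.1, mul_nonneg hs h2.2.le]

lemma sigmaMid_eq {θ : ℝ} (hθ : θ ∈ Ioo 0 (Real.pi / 2)) :
    sigmaMid θ = {a | 0 < a.im ∧ argMid a = Real.pi / 2 - θ} := by
  have hpi := Real.pi_pos
  have hs := Real.sin_pos_of_pos_of_lt_pi hθ.1 (by linarith [hθ.2])
  have hc := Real.cos_pos_of_mem_Ioo ⟨by linarith [hθ.1], hθ.2⟩
  ext a
  constructor
  · rintro ⟨h1, h2⟩
    rcases lt_trichotomy a.im 0 with h | h | h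
    · exact absurd h2 (periodVanishes_mid_conj ⟨hθ.1.le, hθ.2⟩ h)
    · exfalso
      rw [periodVanishes_mid_iff h.ge h1] at h2
      have ha : a = (a.re : ℂ) := Complex.ext (by simp) (by simp [h])
      rw [ha, exp_mul_periodMid_ofReal_re] at h2
      have h3 : a.re < -1 ∨ 1 < a.re := by
        by_contra h4
        rw [not_or, not_lt, not_lt] at h4
        exact h1 ⟨h, h4⟩
      rcases h3 with h3 | h3
      · have h5 := realMid_pos (x := -a.re) (by linarith)
        rw [realMid_eq_zero h3.le] at h2
        nlinarith [mul_pos hs h5]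
      · have h5 := realMid_pos (x := a.re) (by linarith)
        rw [realMid_eq_zero (x := -a.re) (by linarith)] at h2
        nlinarith [mul_pos hc h5]
    · rw [periodVanishes_mid_iff h.le h1,
        exp_mul_periodMid_re_eq_zero_iff ⟨hθ.1.le, hθ.2.le⟩ h] at h2
      exact ⟨h, h2⟩
  · rintro ⟨h1, h2⟩
    have h3 : ¬(a.im = 0 ∧ -1 ≤ a.re ∧ a.re ≤ 1) := fun h => h1.ne' h.1
    refine ⟨h3, ?_⟩
    rwa [periodVanishes_mid_iff h1.le h3, exp_mul_periodMid_re_eq_zero_iff ⟨hθ.1.le, hθ.2.le⟩ h1]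

lemma sigmaMid_zero : sigmaMid 0 = {a | a.im = 0 ∧ a.re < -1} := by
  have hpi := Real.pi_pos
  ext a
  constructor
  · rintro ⟨h1, h2⟩
    rcases lt_trichotomy a.im 0 with h | h | h
    · exact absurd h2 (periodVanishes_mid_conj ⟨le_rfl, by linarith⟩ h)
    · rw [periodVanishes_mid_iff h.ge h1] at h2
      have ha : a = (a.re : ℂ) := Complex.ext (by simp) (by simp [h])
      rw [ha, exp_mul_periodMid_ofReal_re] at h2
      refine ⟨h, ?_⟩
      by_contra h3
      have h4 : -1 < a.re := by
        refine (not_lt.1 h3).lt_of_ne fun h5 => h1 ⟨h, h5.le, by linarith⟩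
      have := realMid_pos h4
      simp at h2
      linarith
    · rw [periodVanishes_mid_iff h.le h1,
        exp_mul_periodMid_re_eq_zero_iff ⟨le_rfl, by linarith⟩ h] at h2
      have := argMid_lt h
      linarith
  · rintro ⟨h1, h2⟩
    have h3 : ¬(a.im = 0 ∧ -1 ≤ a.re ∧ a.re ≤ 1) := fun h => absurd h.2.1 (not_le.2 h2)
    refine ⟨h3, ?_⟩
    rw [periodVanishes_mid_iff h1.ge h3]
    have ha : a = (a.re : ℂ) := Complex.ext (by simp) (by simp [h1])
    rw [ha, exp_mul_periodMid_ofReal_re, realMid_eq_zero h2.le]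
    simp


/-! ### Σ_θ as a curve parametrized by height -/

lemma arg_polar {r ψ : ℝ} (hr : 0 < r) (hψ : ψ ∈ Ioc (-Real.pi) Real.pi) :
    ((r : ℂ) * Complex.exp (ψ * Complex.I)).arg = ψ := by
  rw [Complex.arg_real_mul _ hr, Complex.arg_exp_mul_I, toIocMod_eq_self]
  rwa [show -Real.pi + 2 * Real.pi = Real.pi by ring]

/-- Let k + iy be the point of height y and argument ψ = π - 2θ. At k + 1 + iy the bound by
arg(a-1)/2 puts arg F below ψ/2, at k - 1 + iy the bound by arg(a+1)/2 puts it above. -/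
lemma exists_argMid_eq {θ y : ℝ} (hθ : θ ∈ Ioo 0 (Real.pi / 2)) (hy : 0 < y) :
    ∃ x : ℝ, argMid (x + y * Complex.I) = Real.pi / 2 - θ := by
  have hpi := Real.pi_pos
  have hs : 0 < Real.sin (Real.pi - 2 * θ) := Real.sin_pos_of_pos_of_lt_pi (by linarith [hθ.2])
    (by linarith [hθ.1])
  set ψ := Real.pi - 2 * θ with hψ
  have hr : 0 < y / Real.sin ψ := div_pos hy hs
  have him : ∀ x : ℝ, 0 < (x + y * Complex.I : ℂ).im := fun x => by simpa using hy
  have hpol : ((y / Real.sin ψ : ℝ) : ℂ) * Complex.exp (ψ * Complex.I) =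
      ((y / Real.sin ψ * Real.cos ψ : ℝ) : ℂ) + y * Complex.I := by
    apply Complex.ext
    · rw [Complex.re_ofReal_mul, Complex.exp_ofReal_mul_I_re, Complex.add_re, Complex.ofReal_re,
        Complex.re_ofReal_mul, Complex.I_re, mul_zero, add_zero]
    · rw [Complex.im_ofReal_mul, Complex.exp_ofReal_mul_I_im, div_mul_cancel₀ _ hs.ne',
        Complex.add_im, Complex.ofReal_im, Complex.im_ofReal_mul, Complex.I_im, mul_one, zero_add]
  have harg := arg_polar hr (ψ := ψ) ⟨by linarith [hθ.2], by linarith [hθ.1]⟩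
  set k := y / Real.sin ψ * Real.cos ψ
  have h1 : argMid ((k + 1 : ℝ) + y * Complex.I) < Real.pi / 2 - θ := by
    have h := (arg_periodMid (him (k + 1))).2
    rw [show ((k + 1 : ℝ) + y * Complex.I - 1 : ℂ) = k + y * Complex.I by push_cast; ring, ← hpol,
      harg] at h
    rw [argMid]
    linarith
  have h2 : Real.pi / 2 - θ < argMid ((k - 1 : ℝ) + y * Complex.I) := by
    have h := (arg_periodMid (him (k - 1))).1
    rw [show ((k - 1 : ℝ) + y * Complex.I + 1 : ℂ) = k + y * Complex.I by push_cast; ring, ← hpol,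
      harg] at h
    rw [argMid]
    linarith
  have hc : Continuous fun x : ℝ => argMid (x + y * Complex.I) :=
    continuousOn_argMid.comp_continuous (by fun_prop) him
  exact mem_range_of_exists_le_of_exists_ge hc ⟨_, h1.le⟩ ⟨_, h2.le⟩

/-- The abscissa of the point of height `y` on the curve `argMid = π / 2 - θ`. -/
noncomputable def midAbscissa (θ y : ℝ) : ℝ :=
  Classical.epsilon fun x : ℝ => argMid (x + y * Complex.I) = Real.pi / 2 - θ

/-- The point of height `y` on the curve `argMid = π / 2 - θ`. -/
noncomputable def midPoint (θ y : ℝ) : ℂ := midAbscissa θ y + y * Complex.I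

lemma midPoint_im (θ y : ℝ) : (midPoint θ y).im = y := by simp [midPoint]

lemma midPoint_re (θ y : ℝ) : (midPoint θ y).re = midAbscissa θ y := by simp [midPoint]

lemma argMid_midPoint {θ y : ℝ} (hθ : θ ∈ Ioo 0 (Real.pi / 2)) (hy : 0 < y) :
    argMid (midPoint θ y) = Real.pi / 2 - θ :=
  Classical.epsilon_spec (exists_argMid_eq hθ hy)

lemma re_add_im_mul_I (a : ℂ) : (a.re : ℂ) + a.im * Complex.I = a := Complex.re_add_im a

lemma argMid_lt_iff {a b : ℂ} (ha : 0 < a.im) (h : a.im = b.im) :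
    argMid a < argMid b ↔ b.re < a.re := by
  have := (strictAnti_argMid ha).lt_iff_gt (a := a.re) (b := b.re)
  simp only [re_add_im_mul_I] at this
  rwa [h, re_add_im_mul_I] at this

lemma eq_of_argMid_eq {a b : ℂ} (ha : 0 < a.im) (h : a.im = b.im) (h' : argMid a = argMid b) :
    a = b := by
  refine Complex.ext ((strictAnti_argMid ha).injective ?_) h
  simp only [re_add_im_mul_I]
  rw [h, re_add_im_mul_I, h']

lemma eq_midPoint {θ : ℝ} (hθ : θ ∈ Ioo 0 (Real.pi / 2)) {a : ℂ} (ha : 0 < a.im)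
    (h : argMid a = Real.pi / 2 - θ) : a = midPoint θ a.im :=
  eq_of_argMid_eq ha (midPoint_im _ _).symm (h.trans (argMid_midPoint hθ ha).symm)

lemma image_midPoint {θ : ℝ} (hθ : θ ∈ Ioo 0 (Real.pi / 2)) :
    midPoint θ '' Ioi 0 = sigmaMid θ := by
  rw [sigmaMid_eq hθ]
  ext a
  constructor
  · rintro ⟨y, hy, rfl⟩
    exact ⟨by rw [midPoint_im]; exact hy, argMid_midPoint hθ hy⟩
  · rintro ⟨h1, h2⟩
    exact ⟨a.im, h1, (eq_midPoint hθ h1 h2).symm⟩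

lemma differentiableOn_logMid : DifferentiableOn ℂ logMid {a | 0 < a.im} := fun _ ha =>
  (hasDerivAt_logMid ha).differentiableAt.differentiableWithinAt

/-- With the height as first function, independence of the derivatives is the strict monotonicity of
arg F on horizontal lines. -/
lemma contDiffOn_midPoint {θ : ℝ} (hθ : θ ∈ Ioo 0 (Real.pi / 2)) :
    ContDiffOn ℝ ∞ (midPoint θ) (Ioi 0) ∧ ∀ y ∈ Ioi 0, derivWithin (midPoint θ) (Ioi 0) y ≠ 0 := by
  have him : ∀ y ∈ Ioi (0 : ℝ), 0 < (midPoint θ y).im := fun y hy => by rwa [midPoint_im]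
  refine contDiffOn_of_im_eq (uniqueDiffOn_Ioi 0) isOpen_upper (f₁ := id) (f₂ := logMid)
    differentiableOn_id differentiableOn_logMid (c₁ := id) (c₂ := fun _ => Real.pi / 2 - θ)
    contDiffOn_id contDiffOn_const him (fun y _ => midPoint_im θ y)
    (fun y hy => by rw [logMid_im, argMid_midPoint hθ hy]) (fun y hy z hz h1 h2 => ?_)
    (fun y hy => ?_) (fun y hy => ?_)
  · rw [logMid_im] at h2
    rw [eq_midPoint hθ hz h2]
    congr 1
  · rw [deriv_id, one_mul, (hasDerivAt_logMid (him y hy)).deriv, Complex.conj_im, neg_ne_zero]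
    exact (logMid_deriv_im_neg (him y hy)).ne
  · rw [derivWithin_id _ _ (uniqueDiffOn_Ioi 0 y hy)]
    exact one_ne_zero

/-- Dependence on θ at fixed height, needed only for the borderline angle π/8. -/
lemma continuousOn_midPoint_angle {y : ℝ} (hy : 0 < y) :
    ContinuousOn (fun θ => midPoint θ y) (Ioo 0 (Real.pi / 2)) := by
  have him : ∀ θ ∈ Ioo 0 (Real.pi / 2), 0 < (midPoint θ y).im := fun θ _ => by rwa [midPoint_im]
  refine (contDiffOn_of_im_eq (uniqueDiffOn_Ioo _ _) isOpen_upper (f₁ := logMid) (f₂ := id)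
    differentiableOn_logMid differentiableOn_id (c₁ := fun θ => Real.pi / 2 - θ) (c₂ := fun _ => y)
    (by fun_prop) contDiffOn_const him
    (fun θ hθ => by rw [logMid_im, argMid_midPoint hθ hy])
    (fun θ _ => midPoint_im θ y) (fun θ hθ z hz h1 h2 => ?_)
    (fun θ hθ => ?_) (fun θ hθ => ?_)).1.continuousOn
  · rw [logMid_im] at h1
    rw [eq_midPoint hθ hz h1]
    congr 1
  · rw [deriv_id, map_one, mul_one, (hasDerivAt_logMid (him θ hθ)).deriv]
    exact (logMid_deriv_im_neg (him θ hθ)).ne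
  · rw [((hasDerivAt_id' θ).const_sub _).hasDerivWithinAt.derivWithin (uniqueDiffOn_Ioo _ _ θ hθ)]
    norm_num

lemma isSmoothArc_midPoint {θ : ℝ} (hθ : θ ∈ Ioo 0 (Real.pi / 2)) :
    IsSmoothArc (midPoint θ) (Ioi 0) (Ioi 0) :=
  ⟨isEmbedding_domRestrict (ρ := Complex.im) (contDiffOn_midPoint hθ).1.continuousOn
    Complex.continuous_im.continuousOn fun y _ => midPoint_im θ y,
    (contDiffOn_midPoint hθ).1, (contDiffOn_midPoint hθ).2⟩

lemma argMid_lt_iff_re_pos {θ : ℝ} (hθ : θ ∈ Ioo 0 (Real.pi / 2)) {a : ℂ} (ha : 0 < a.im) :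
    argMid a < Real.pi / 2 - θ ↔ 0 < (Complex.exp (θ * Complex.I) * periodMid a).re := by
  have hn := norm_pos_iff.2 (periodMid_ne_zero ha)
  have h1 := argMid_pos ha
  have h2 := argMid_lt ha
  rw [re_exp_mul, mul_pos_iff_of_pos_left hn]
  change _ ↔ 0 < Real.cos (argMid a + θ)
  refine ⟨fun h => Real.cos_pos_of_mem_Ioo ⟨by linarith [hθ.1], by linarith⟩, fun h => ?_⟩
  by_contra h3
  exact absurd h (not_lt.2 (Real.cos_nonpos_of_pi_div_two_le_of_le (by linarith)
    (by linarith [hθ.2])))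

/-- On the real axis Re(e^{iθ}F) changes sign exactly at s. By continuity the sign persists at small
heights above any x ≠ s, which places the curve on the correct side of x. -/
lemma tendsto_midPoint_zero {θ s : ℝ} (hθ : θ ∈ Ioo 0 (Real.pi / 2))
    (hs : (Complex.exp (θ * Complex.I) * periodMid s).re = 0) :
    Tendsto (midPoint θ) (𝓝[>] 0) (𝓝 (s : ℂ)) := by
  have hcont : ContinuousOn (fun a => (Complex.exp (θ * Complex.I) * periodMid a).re)
      {a | 0 ≤ a.im} :=
    Complex.continuous_re.comp_continuousOn (continuousOn_const.mul continuousOn_periodMid)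
  have hlim : ∀ x : ℝ, Tendsto (fun y : ℝ => (Complex.exp (θ * Complex.I) *
      periodMid (x + y * Complex.I)).re) (𝓝[>] 0)
      (𝓝 (Complex.exp (θ * Complex.I) * periodMid x).re) := fun x => by
    have h1 : Tendsto (fun y : ℝ => (x + y * Complex.I : ℂ)) (𝓝[>] 0) (𝓝[{a | 0 ≤ a.im}] (x : ℂ)) := by
      refine tendsto_nhdsWithin_iff.2 ⟨?_, ?_⟩
      · have : Continuous fun y : ℝ => (x + y * Complex.I : ℂ) := by fun_prop
        simpa using (this.tendsto 0).mono_left nhdsWithin_le_nhds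
      · filter_upwards [self_mem_nhdsWithin] with y hy
        have : (x + y * Complex.I : ℂ).im = y := by simp
        rw [this]
        exact le_of_lt hy
    exact (hcont x (Complex.ofReal_im x).ge).tendsto.comp h1
  have hmono := strictMono_exp_mul_periodMid hθ
  have him : ∀ x y : ℝ, (x + y * Complex.I : ℂ).im = y := fun x y => by simp
  have hre : ∀ x y : ℝ, (x + y * Complex.I : ℂ).re = x := fun x y => by simp
  have hx : Tendsto (midAbscissa θ) (𝓝[>] 0) (𝓝 s) := by
    refine tendsto_order.2 ⟨fun x hx => ?_, fun x hx => ?_⟩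
    · have h1 := hmono hx
      simp only [hs] at h1
      filter_upwards [(hlim x).eventually_lt_const h1, self_mem_nhdsWithin] with y hy hy0
      have hy0 : 0 < y := hy0
      have h2 : Real.pi / 2 - θ < argMid (x + y * Complex.I) := by
        refine lt_of_le_of_ne (not_lt.1 fun h => ?_) fun h => ?_
        · exact absurd ((argMid_lt_iff_re_pos hθ (by rwa [him])).1 h) (not_lt.2 hy.le)
        · exact hy.ne ((exp_mul_periodMid_re_eq_zero_iff ⟨hθ.1.le, hθ.2.le⟩
            (by rwa [him])).2 h.symm)
      rw [← argMid_midPoint hθ hy0, argMid_lt_iff (by rwa [midPoint_im]) (by rw [midPoint_im, him]),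
        hre, midPoint_re] at h2
      exact h2
    · have h1 := hmono hx
      simp only [hs] at h1
      filter_upwards [(hlim x).eventually_const_lt h1, self_mem_nhdsWithin] with y hy hy0
      have hy0 : 0 < y := hy0
      have h2 := (argMid_lt_iff_re_pos hθ (by rwa [him])).2 hy
      rw [← argMid_midPoint hθ hy0, argMid_lt_iff (by rwa [him]) (by rw [midPoint_im, him]),
        hre, midPoint_re] at h2
      exact h2
  have h2 : Tendsto (fun y : ℝ => (y : ℂ) * Complex.I) (𝓝[>] 0) (𝓝 0) := by
    have : Continuous fun y : ℝ => (y : ℂ) * Complex.I := by fun_prop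
    simpa using (this.tendsto 0).mono_left nhdsWithin_le_nhds
  have := ((Complex.continuous_ofReal.tendsto s).comp hx).add h2
  rw [add_zero] at this
  exact this

lemma im_exp_two_mul (θ : ℝ) (z : ℂ) :
    (Complex.exp (2 * θ * Complex.I) * z).im = ‖z‖ * Real.sin (z.arg + 2 * θ) := by
  have := im_exp_neg_mul (-(2 * θ)) z
  rw [sub_neg_eq_add] at this
  rw [← this]
  congr 3
  push_cast
  ring

/-- The bounds arg(a+1)/2 < arg F < arg(a-1)/2 on the level π/2 - θ; geometrically this is the
strip. -/
lemma arg_mid_bounds {θ : ℝ} {a : ℂ} (ha : 0 < a.im) (h : argMid a = Real.pi / 2 - θ) :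
    (a + 1).arg < Real.pi - 2 * θ ∧ Real.pi - 2 * θ < (a - 1).arg := by
  have := arg_periodMid ha
  rw [← argMid, h] at this
  constructor <;> linarith [this.1, this.2]

lemma add_one_im (a : ℂ) : (a + 1).im = a.im := by simp

lemma sigmaMid_subset_openStrip {θ : ℝ} (hθ : θ ∈ Ioc 0 (Real.pi / 4)) :
    sigmaMid θ ⊆ openStrip θ := by
  have hpi := Real.pi_pos
  rw [sigmaMid_eq ⟨hθ.1, by linarith [hθ.2]⟩]
  rintro a ⟨ha, h⟩
  obtain ⟨h1, h2⟩ := arg_mid_bounds ha h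
  have hv : 0 < (a + 1).im := by rwa [add_one_im]
  have hw : 0 < (a - 1).im := by rwa [sub_one_im]
  refine ⟨ha, ?_, ?_⟩
  · rw [im_exp_two_mul]
    refine mul_pos (norm_pos_iff.2 (ne_zero_of_im_pos hv)) (Real.sin_pos_of_pos_of_lt_pi ?_ ?_)
    · linarith [arg_pos_of_im_pos hv, hθ.1]
    · linarith
  · rw [im_exp_two_mul]
    refine mul_neg_of_pos_of_neg (norm_pos_iff.2 (ne_zero_of_im_pos hw)) ?_
    rw [← Real.sin_sub_two_pi]
    exact Real.sin_neg_of_neg_of_neg_pi_lt (by linarith [arg_lt_pi_of_im_pos hw, hθ.2])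
      (by linarith)

lemma sigmaMid_subset_closedStrip {θ : ℝ} (hθ : θ ∈ Icc 0 (Real.pi / 4)) :
    sigmaMid θ ⊆ closedStrip θ := by
  rcases hθ.1.eq_or_lt with rfl | h0
  · rw [sigmaMid_zero]
    rintro a ⟨h1, -⟩
    refine ⟨h1.ge, ?_, ?_⟩ <;> simp [h1]
  · intro a ha
    have := sigmaMid_subset_openStrip ⟨h0, hθ.2⟩ ha
    exact ⟨this.1.le, this.2.1.le, this.2.2.le⟩

lemma tendsto_norm_midPoint (θ : ℝ) : Tendsto (fun y => ‖midPoint θ y‖) atTop atTop := by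
  refine tendsto_atTop_mono (fun y => ?_) tendsto_id
  have := Complex.abs_im_le_norm (midPoint θ y)
  rw [midPoint_im] at this
  exact (le_abs_self y).trans this

/-- The strip has bounded width, so after scaling by sin 2θ / y the point differs from e^{i(π-2θ)}
by at most sin 2θ / y. -/
lemma tendsto_midPoint_direction {θ : ℝ} (hθ : θ ∈ Ioc 0 (Real.pi / 4)) :
    Tendsto (fun y => midPoint θ y / (‖midPoint θ y‖ : ℂ)) atTop
      (𝓝 (Complex.exp ((Real.pi - 2 * θ) * Complex.I))) := by
  have hpi := Real.pi_pos
  have hs : 0 < Real.sin (2 * θ) := Real.sin_pos_of_pos_of_lt_pi (by linarith [hθ.1])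
    (by linarith [hθ.2])
  set u : ℂ := Complex.exp ((Real.pi - 2 * θ) * Complex.I) with hu
  have hue : u = Complex.exp ((Real.pi - 2 * θ : ℝ) * Complex.I) := by rw [hu]; push_cast; rfl
  have hure : u.re = -Real.cos (2 * θ) := by
    rw [hue, Complex.exp_ofReal_mul_I_re, Real.cos_pi_sub]
  have huim : u.im = Real.sin (2 * θ) := by
    rw [hue, Complex.exp_ofReal_mul_I_im, Real.sin_pi_sub]
  have hun : ‖u‖ = 1 := by rw [hue, Complex.norm_exp_ofReal_mul_I]
  have hbd : ∀ y : ℝ, 0 < y →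
      ‖((Real.sin (2 * θ) / y : ℝ) : ℂ) * midPoint θ y - u‖ ≤ Real.sin (2 * θ) / y := by
    intro y hy
    have hmem : midPoint θ y ∈ sigmaMid θ := by
      rw [← image_midPoint ⟨hθ.1, by linarith [hθ.2]⟩]
      exact mem_image_of_mem _ hy
    obtain ⟨-, h1, h2⟩ := sigmaMid_subset_openStrip hθ hmem
    have e : Complex.exp (2 * θ * Complex.I) = Complex.exp ((2 * θ : ℝ) * Complex.I) := by
      push_cast; rfl
    rw [e, Complex.mul_im, Complex.exp_ofReal_mul_I_re, Complex.exp_ofReal_mul_I_im] at h1 h2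
    simp only [Complex.add_im, Complex.add_re, Complex.sub_im, Complex.sub_re, Complex.one_im,
      Complex.one_re, midPoint_im, midPoint_re] at h1 h2
    have hform : ((Real.sin (2 * θ) / y : ℝ) : ℂ) * midPoint θ y - u =
        ((Real.sin (2 * θ) / y * midAbscissa θ y + Real.cos (2 * θ) : ℝ) : ℂ) := by
      apply Complex.ext
      · rw [Complex.sub_re, Complex.re_ofReal_mul, midPoint_re, hure, Complex.ofReal_re,
          sub_neg_eq_add]
      · rw [Complex.sub_im, Complex.im_ofReal_mul, midPoint_im, huim, Complex.ofReal_im,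
          div_mul_cancel₀ _ hy.ne', sub_self]
    rw [hform, Complex.norm_real, Real.norm_eq_abs,
      show Real.sin (2 * θ) / y * midAbscissa θ y + Real.cos (2 * θ) =
        (Real.sin (2 * θ) * midAbscissa θ y + y * Real.cos (2 * θ)) / y by field_simp,
      abs_div, abs_of_pos hy]
    gcongr
    rw [abs_le]
    constructor <;> linarith
  have hlim : Tendsto (fun y : ℝ => ((Real.sin (2 * θ) / y : ℝ) : ℂ) * midPoint θ y) atTop
      (𝓝 u) := by
    rw [tendsto_iff_norm_sub_tendsto_zero]
    refine squeeze_zero' (Eventually.of_forall fun _ => norm_nonneg _) ?_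
      (tendsto_const_nhds.div_atTop tendsto_id (a := Real.sin (2 * θ)))
    filter_upwards [eventually_gt_atTop 0] with y hy
    exact hbd y hy
  have h2 := hlim.div ((Complex.continuous_ofReal.tendsto _).comp hlim.norm) (by simp [hun])
  rw [hun, Complex.ofReal_one, div_one] at h2
  refine h2.congr' ?_
  filter_upwards [eventually_gt_atTop 0] with y hy
  have h3 : 0 < Real.sin (2 * θ) / y := div_pos hs hy
  simp only [Pi.div_apply, Function.comp_apply]
  rw [norm_mul, Complex.norm_real, Real.norm_of_nonneg h3.le, Complex.ofReal_mul,
    mul_div_mul_left _ _ (by exact_mod_cast h3.ne')]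

/-- At θ = 0 the set lies in the real axis, so the height is no longer a parameter and the half line
(-∞,-1) is parametrized directly. -/
lemma exists_sigmaMid_zero_arc : ∃ γ : ℝ → ℂ, IsSmoothArc γ (Ioi 0) (Ioi 0) ∧
    γ '' Ioi 0 = sigmaMid 0 ∧ Tendsto γ (𝓝[>] 0) (𝓝 ((-1 : ℝ) : ℂ)) ∧
    Tendsto (fun x => ‖γ x‖) atTop atTop ∧
    Tendsto (fun x => γ x / (‖γ x‖ : ℂ)) atTop
      (𝓝 (Complex.exp ((Real.pi - 2 * (0 : ℝ)) * Complex.I))) := by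
  have hc : Continuous fun x : ℝ => ((-1 - x : ℝ) : ℂ) := by fun_prop
  have hd : ∀ x : ℝ, HasDerivAt (fun x : ℝ => ((-1 - x : ℝ) : ℂ)) ((-1 : ℝ) : ℂ) x := fun x =>
    ((hasDerivAt_id' x).const_sub (-1)).ofReal_comp
  have hnorm : ∀ x : ℝ, 0 < x → ‖((-1 - x : ℝ) : ℂ)‖ = 1 + x := fun x hx => by
    rw [Complex.norm_real, Real.norm_eq_abs, abs_of_neg (by linarith)]
    ring
  refine ⟨fun x : ℝ => ((-1 - x : ℝ) : ℂ), ⟨?_, ?_, fun x hx => ?_⟩, ?_, ?_, ?_, ?_⟩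
  · exact isEmbedding_domRestrict (ρ := fun z => -1 - z.re) hc.continuousOn
      (Continuous.continuousOn (by fun_prop)) fun x _ => by rw [Complex.ofReal_re]; ring
  · exact Complex.ofRealCLM.contDiff.comp_contDiffOn (f := fun x : ℝ => -1 - x) (by fun_prop)
  · rw [(hd x).hasDerivWithinAt.derivWithin (uniqueDiffOn_Ioi 0 x hx)]
    norm_num
  · rw [sigmaMid_zero]
    ext a
    constructor
    · rintro ⟨x, hx, rfl⟩
      have : 0 < x := hx
      refine ⟨Complex.ofReal_im _, ?_⟩
      rw [Complex.ofReal_re]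
      linarith
    · rintro ⟨h1, h2⟩
      refine ⟨-1 - a.re, mem_Ioi.2 (by linarith), Complex.ext ?_ ?_⟩
      · rw [Complex.ofReal_re]; ring
      · rw [Complex.ofReal_im, h1]
  · simpa using (hc.tendsto 0).mono_left (nhdsWithin_le_nhds (s := Ioi 0))
  · refine (tendsto_atTop_add_const_left _ 1 tendsto_id).congr' ?_
    filter_upwards [eventually_gt_atTop 0] with x hx
    exact (hnorm x hx).symm
  · refine tendsto_const_nhds.congr' ?_
    filter_upwards [eventually_gt_atTop 0] with x hx
    rw [hnorm x hx, ← Complex.ofReal_div, show (-1 - x) / (1 + x) = -1 by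
      rw [div_eq_iff (by positivity)]; ring]
    simp [Complex.exp_pi_mul_I]


/-! ### The argument of L and transversality -/

/-- A holomorphic logarithm of `(a + 1)² g(-(a + 1))`. -/
noncomputable def logNegOne (a : ℂ) : ℂ :=
  2 * Complex.log (a + 1) + Complex.log (gInt (-(a + 1)))

lemma logNegOne_im (a : ℂ) : (logNegOne a).im = argNegOne a := by
  rw [logNegOne, argNegOne, Complex.add_im, Complex.log_im, Complex.mul_im, Complex.log_im]
  simp

lemma gInt_neg_add_one_mem_slitPlane {a : ℂ} (ha : 0 < a.im) :
    gInt (-(a + 1)) ∈ Complex.slitPlane := by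
  refine Or.inl ?_
  rw [gInt_neg_add_one ha, Complex.conj_re]
  exact gInt_re_pos (by rw [reflectIm_sub_one_im]; exact ha.le)

lemma hasDerivAt_logNegOne {a : ℂ} (ha : 0 < a.im) :
    HasDerivAt logNegOne (hInt (-(a + 1)) / (2 * (a + 1) * gInt (-(a + 1)))) a := by
  have hv : 0 < (a + 1).im := by rwa [add_one_im]
  obtain ⟨d, hd, hd'⟩ := hasDerivAt_gInt (neg_add_one_add_two_mem ha)
  have h1 : HasDerivAt (fun a : ℂ => -(a + 1)) (-1) a := ((hasDerivAt_id' a).add_const 1).fun_neg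
  have h2 := HasDerivAt.comp a hd h1
  have h3 := (((hasDerivAt_id' a).add_const 1).clog (mem_slitPlane_of_im_pos hv)).const_mul 2
  have hg := gInt_neg_add_one_mem_slitPlane ha
  have h4 := h3.fun_add (HasDerivAt.clog h2 hg)
  have hv0 := ne_zero_of_im_pos hv
  have hg0 := Complex.slitPlane_ne_zero hg
  refine h4.congr_deriv ?_
  simp only [Function.comp_apply]
  field_simp
  linear_combination 2 * hd'

lemma differentiableOn_logNegOne : DifferentiableOn ℂ logNegOne {a | 0 < a.im} := fun _ ha =>
  (hasDerivAt_logNegOne ha).differentiableAt.differentiableWithinAt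

lemma sq_mul_gInt_neg_eq (a : ℂ) : (a + 1) ^ 2 * gInt (-(a + 1)) =
    ((‖a + 1‖ ^ 2 * ‖gInt (-(a + 1))‖ : ℝ) : ℂ) * Complex.exp (argNegOne a * Complex.I) := by
  have hw := Complex.norm_mul_exp_arg_mul_I (a + 1)
  have hg := Complex.norm_mul_exp_arg_mul_I (gInt (-(a + 1)))
  rw [argNegOne]
  push_cast
  rw [show (2 * ((a + 1).arg : ℂ) + ((gInt (-(a + 1))).arg : ℂ)) * Complex.I =
    (a + 1).arg * Complex.I + (a + 1).arg * Complex.I + (gInt (-(a + 1))).arg * Complex.I by ring,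
    Complex.exp_add, Complex.exp_add]
  linear_combination
    (-(a + 1 + ‖a + 1‖ * Complex.exp ((a + 1).arg * Complex.I)) * gInt (-(a + 1))) * hw -
    (‖a + 1‖ * Complex.exp ((a + 1).arg * Complex.I)) ^ 2 * hg

lemma exp_mul_sq_mul_gInt_neg_re (θ : ℝ) (a : ℂ) :
    (Complex.exp (θ * Complex.I) * ((a + 1) ^ 2 * gInt (-(a + 1)))).re =
      ‖a + 1‖ ^ 2 * ‖gInt (-(a + 1))‖ * Real.cos (argNegOne a + θ) := by
  rw [sq_mul_gInt_neg_eq, mul_left_comm, Complex.re_ofReal_mul, ← Complex.exp_add, ← add_mul,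
    ← Complex.ofReal_add, Complex.exp_ofReal_mul_I_re, add_comm θ]

lemma periodVanishes_negOne_iff_cos {θ : ℝ} {a : ℂ} (ha : 0 < a.im) :
    PeriodVanishes θ a (-1) a ↔ Real.cos (argNegOne a + θ) = 0 := by
  have h1 : ‖a + 1‖ ≠ 0 := norm_ne_zero_iff.2 (add_one_ne_zero_of_im_pos ha)
  have h2 : ‖gInt (-(a + 1))‖ ≠ 0 :=
    norm_ne_zero_iff.2 (Complex.slitPlane_ne_zero (gInt_neg_add_one_mem_slitPlane ha))
  rw [periodVanishes_negOne_iff ha, exp_mul_sq_mul_gInt_neg_re, mul_eq_zero,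
    or_iff_right (mul_ne_zero (pow_ne_zero 2 h1) h2)]

lemma periodVanishes_one_iff_sin {θ : ℝ} {a : ℂ} (ha : 0 < a.im) :
    PeriodVanishes θ a 1 a ↔ Real.sin (argOne (a - 1) + θ) = 0 := by
  have h1 : a ≠ 1 := fun h => by simp [h] at ha
  have := mem_sigmaOne_iff (θ := θ) ha.le h1
  exact ⟨fun h => (this.1 ⟨fun h' => ha.ne' h'.1, h⟩).2, fun h =>
    (this.2 ⟨fun h' => ha.ne' h'.1, h⟩).2⟩

lemma argNegOne_bounds {a : ℂ} (ha : 0 < a.im) :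
    -(Real.pi / 2) < argNegOne a ∧ argNegOne a < 2 * Real.pi := by
  have hw : 0 < (reflectIm a - 1).im := by rwa [reflectIm_sub_one_im]
  have h1 := argOne_pos hw
  have h2 := argOne_lt hw
  rw [argOne_reflectIm ha] at h1 h2
  constructor <;> linarith

lemma cos_argNegOne_eq_zero_iff {θ : ℝ} (hθ : θ ∈ Icc 0 (Real.pi / 4)) {a : ℂ} (ha : 0 < a.im) :
    Real.cos (argNegOne a + θ) = 0 ↔
      argNegOne a = Real.pi / 2 - θ ∨ argNegOne a = 3 * Real.pi / 2 - θ := by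
  have hpi := Real.pi_pos
  have hb := argNegOne_bounds ha
  constructor
  · intro h
    rw [Real.cos_eq_zero_iff] at h
    obtain ⟨n, hn⟩ := h
    have n1 : (-1 : ℝ) < n := by
      by_contra h
      have : (n : ℝ) * Real.pi ≤ (-1) * Real.pi := by gcongr; exact not_lt.1 h
      linarith [hθ.1]
    have n2 : (n : ℝ) < 2 := by
      by_contra h
      have : 2 * Real.pi ≤ (n : ℝ) * Real.pi := by gcongr; exact not_lt.1 h
      linarith [hθ.2]
    have n3 : -1 < n := by exact_mod_cast n1
    have n4 : n < 2 := by exact_mod_cast n2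
    obtain rfl | rfl : n = 0 ∨ n = 1 := by omega
    · left; push_cast at hn; linarith
    · right; push_cast at hn; linarith
  · rintro (h | h)
    · rw [h, sub_add_cancel, Real.cos_pi_div_two]
    · rw [h, sub_add_cancel, show 3 * Real.pi / 2 = Real.pi / 2 + Real.pi by ring, Real.cos_add_pi,
        Real.cos_pi_div_two, neg_zero]

lemma exp_mul_periodMid_re (θ : ℝ) {a : ℂ} (ha : 0 < a.im) :
    (Complex.exp (θ * Complex.I) * periodMid a).re =
      (Complex.exp (θ * Complex.I) * ((a + 1) ^ 2 * gInt (-(a + 1)))).re -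
      (Complex.exp (θ * Complex.I) * ((a - 1) ^ 2 * gInt (a - 1))).im := by
  rw [periodMid_eq_add ha, mul_add, Complex.add_re, mul_left_comm _ Complex.I, Complex.I_mul_re]
  ring

/-- On the curve `argMid = π / 2 - θ`, the periods along `[-1,a]` and `[1,a]` vanish together. -/
lemma cos_eq_zero_iff_sin_eq_zero {θ : ℝ} (hθ : θ ∈ Icc 0 (Real.pi / 2)) {a : ℂ} (ha : 0 < a.im)
    (h : argMid a = Real.pi / 2 - θ) :
    Real.cos (argNegOne a + θ) = 0 ↔ Real.sin (argOne (a - 1) + θ) = 0 := by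
  rw [← periodVanishes_negOne_iff_cos ha, ← periodVanishes_one_iff_sin ha,
    periodVanishes_negOne_iff ha, periodVanishes_one_iff ha.le fun h => ha.ne' h.1]
  have h1 := (exp_mul_periodMid_re_eq_zero_iff hθ ha).2 h
  rw [exp_mul_periodMid_re θ ha] at h1
  constructor <;> intro h2 <;> linarith

lemma argMid_eq_of_sin_cos {θ : ℝ} (hθ : θ ∈ Icc 0 (Real.pi / 2)) {a : ℂ} (ha : 0 < a.im)
    (h1 : Real.cos (argNegOne a + θ) = 0) (h2 : Real.sin (argOne (a - 1) + θ) = 0) :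
    argMid a = Real.pi / 2 - θ := by
  rw [← exp_mul_periodMid_re_eq_zero_iff hθ ha, exp_mul_periodMid_re θ ha,
    exp_mul_sq_mul_gInt_neg_re, exp_mul_sq_mul_gInt_im, h1, h2]
  ring

/-- On Σ_θ, arg(a-1) > π - 2θ forces argOne + θ > 2π - 3θ > π, so only the left level 2π - θ is
possible. This is why the right ray from 1 meets no ray from -1. -/
lemma argOne_eq_of_argMid {θ : ℝ} (hθ : θ ∈ Icc 0 (Real.pi / 4)) {a : ℂ} (ha : 0 < a.im)
    (h : argMid a = Real.pi / 2 - θ) (h' : Real.sin (argOne (a - 1) + θ) = 0) :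
    argOne (a - 1) = 2 * Real.pi - θ := by
  have hpi := Real.pi_pos
  have hw : 0 < (a - 1).im := by rwa [sub_one_im]
  have h1 := (arg_mid_bounds ha h).2
  have h2 := argOne_lt hw
  have h3 : 2 * (a - 1).arg < argOne (a - 1) := by
    have := (arg_gInt hw).1
    rw [argOne]
    linarith
  obtain ⟨n, hn⟩ := Real.sin_eq_zero_iff.1 h'
  have n1 : (1 : ℝ) < n := by
    have : 1 * Real.pi < n * Real.pi := by rw [hn]; linarith [hθ.2]
    exact lt_of_mul_lt_mul_right this hpi.le
  have n2 : (n : ℝ) < 3 := by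
    have : n * Real.pi < 3 * Real.pi := by rw [hn]; linarith [hθ.2]
    exact lt_of_mul_lt_mul_right this hpi.le
  have n3 : 1 < n := by exact_mod_cast n1
  have n4 : n < 3 := by exact_mod_cast n2
  obtain rfl : n = 2 := by omega
  push_cast at hn
  linarith

/-- The angle `-arg g(-(a + 1))` is positive and less than `(π - arg (a - 1)) / 2`. -/
lemma neg_arg_gInt_neg_bounds {a : ℂ} (ha : 0 < a.im) :
    0 < -(gInt (-(a + 1))).arg ∧ -(gInt (-(a + 1))).arg < (Real.pi - (a - 1).arg) / 2 := by
  have hw : 0 < (reflectIm a - 1).im := by rwa [reflectIm_sub_one_im]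
  have h1 := arg_gInt hw
  have e : reflectIm a - 1 + 2 = reflectIm (a - 1) := by
    rw [reflectIm_sub, reflectIm_one]
    ring
  rw [e, arg_reflectIm (by rwa [sub_one_im])] at h1
  rw [arg_gInt_neg_add_one ha, neg_neg]
  exact h1

/-- The transversality inequality at the points of the curve where the other periods vanish. -/
lemma angle_mem_Ioo {θ : ℝ} (hθ : θ ∈ Icc 0 (Real.pi / 4)) {a : ℂ} (ha : 0 < a.im)
    (h : argMid a = Real.pi / 2 - θ)
    (h' : argNegOne a = Real.pi / 2 - θ ∨ argNegOne a = 3 * Real.pi / 2 - θ) :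
    (a + 1).arg + (gInt (-(a + 1))).arg + (hInt (a - 1)).arg ∈ Ioo 0 Real.pi := by
  have hpi := Real.pi_pos
  have hw : 0 < (a - 1).im := by rwa [sub_one_im]
  have hv : 0 < (a + 1).im := by rwa [add_one_im]
  obtain ⟨h1, h2⟩ := arg_mid_bounds ha h
  obtain ⟨b1, b2⟩ := neg_arg_gInt_neg_bounds ha
  obtain ⟨e1, e2⟩ := arg_hInt hw
  rw [show a - 1 + 2 = a + 1 by ring] at e2
  rw [argNegOne] at h'
  rcases h' with h' | h'
  · constructor <;> linarith [hθ.2]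
  -- Since arg g(-(a+1)) < 0, 2 arg(a+1) > 3π/2 - θ; since the point lies on Σ_θ, 2θ < π - arg(a+1).
  -- Eliminating θ gives 2π/3.
  · have hφ : 2 * Real.pi / 3 ≤ (a + 1).arg := by linarith
    have hre : a.re ≤ 0 := by
      by_contra hre
      have := Complex.abs_arg_le_pi_div_two_iff.2 (show 0 ≤ (a + 1).re by
        simp only [Complex.add_re, Complex.one_re]; linarith)
      have := (abs_le.1 this).2
      linarith
    have h3 := arg_periodMid_le ha hre
    have h4 := arg_hInt_lt ha hφ
    rw [← argMid, h] at h3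
    -- The sum is 3π/2 - θ - arg(a+1) + arg h(a-1), less than 3π/2 - θ - (arg a)/2, hence less than
    -- π because (arg a)/2 ≥ arg F = π/2 - θ.
    constructor <;> linarith [hθ.2]

/-- The sign is that of the derivative of arg L along Σ_θ. At a common point iR = mF and L = (1-m)F
with m > 0 real, so F'/F is a real combination of L'/L and R'/R. The Legendre relation expresses
L'/L through R'/R, and only Im Z is left to be signed, which is `angle_mem_Ioo`. -/
lemma logDeriv_im_pos {θ : ℝ} (hθ : θ ∈ Icc 0 (Real.pi / 4)) {a : ℂ} (ha : 0 < a.im)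
    (h : argMid a = Real.pi / 2 - θ)
    (h' : argNegOne a = Real.pi / 2 - θ ∨ argNegOne a = 3 * Real.pi / 2 - θ) :
    0 < (hInt (-(a + 1)) / (2 * (a + 1) * gInt (-(a + 1))) *
      (starRingEnd ℂ) (periodMidDeriv a / periodMid a)).im := by
  have hpi := Real.pi_pos
  have hw : 0 < (a - 1).im := by rwa [sub_one_im]
  have hcos := (cos_argNegOne_eq_zero_iff hθ ha).2 h'
  have hθ2 : θ ∈ Icc 0 (Real.pi / 2) := ⟨hθ.1, by linarith [hθ.2]⟩
  have hsin := (cos_eq_zero_iff_sin_eq_zero hθ2 ha h).1 hcos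
  have hone := argOne_eq_of_argMid hθ ha h hsin
  have hX := angle_mem_Ioo hθ ha h h'
  have hF0 := periodMid_ne_zero ha
  have hv0 := add_one_ne_zero_of_im_pos ha
  have hw0 := sub_one_ne_zero_of_im_pos ha
  have hgv := Complex.slitPlane_ne_zero (gInt_neg_add_one_mem_slitPlane ha)
  have hgw := gInt_ne_zero hw
  have hhw := hInt_ne_zero hw
  obtain ⟨C, hC, hleg⟩ := exists_legendre_relation
  have hleg := hleg a ha
  set v := a + 1 with hvd
  set w := a - 1 with hwd
  -- the ratio `i R / F` is a positive real number
  obtain ⟨m, hm, hmF⟩ : ∃ m : ℝ, 0 < m ∧ Complex.I * (w ^ 2 * gInt w) = m * periodMid a := by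
    refine ⟨‖w‖ ^ 2 * ‖gInt w‖ / ‖periodMid a‖, by
      have := norm_pos_iff.2 hw0; have := norm_pos_iff.2 hgw; have := norm_pos_iff.2 hF0
      positivity, ?_⟩
    have e1 := sq_mul_gInt_eq w
    have e2 := Complex.norm_mul_exp_arg_mul_I (periodMid a)
    rw [← argMid, h] at e2
    have hn : (‖periodMid a‖ : ℂ) ≠ 0 := by simpa using hF0
    rw [e1, hone]
    nth_rewrite 2 [← e2]
    have e3 : Complex.exp ((2 * Real.pi - θ : ℝ) * Complex.I) =
        Complex.exp (((-θ : ℝ) : ℂ) * Complex.I) := by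
      rw [show ((2 * Real.pi - θ : ℝ) : ℂ) * Complex.I = ((-θ : ℝ) : ℂ) * Complex.I +
        2 * Real.pi * Complex.I by push_cast; ring, Complex.exp_add, Complex.exp_two_pi_mul_I, mul_one]
    have e4 : Complex.exp ((Real.pi / 2 - θ : ℝ) * Complex.I) =
        Complex.I * Complex.exp (((-θ : ℝ) : ℂ) * Complex.I) := by
      rw [show ((Real.pi / 2 - θ : ℝ) : ℂ) * Complex.I = Real.pi / 2 * Complex.I +
        ((-θ : ℝ) : ℂ) * Complex.I by push_cast; ring, Complex.exp_add, Complex.exp_pi_div_two_mul_I]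
    rw [e3, e4]
    push_cast
    field_simp
  have hsum := periodMid_eq_add ha
  rw [← hvd, ← hwd] at hsum
  have hL : v ^ 2 * gInt (-v) = (1 - m : ℝ) * periodMid a := by
    push_cast
    linear_combination -hsum - hmF
  -- derivative of the decomposition
  have hderiv : periodMidDeriv a = 1 / 2 * v * hInt (-v) + Complex.I * (1 / 2 * w * hInt w) := by
    have h1 := isPeriod_mid.deriv_fst a ha
    have h2 := (isPeriod_negOne.deriv_fst a ha).fun_add
      ((isPeriod_one.deriv_fst a ha).const_mul Complex.I)
    refine h1.unique (h2.congr_of_eventuallyEq ?_)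
    filter_upwards [isOpen_upper.mem_nhds ha] with z hz
    exact periodMid_eq_add hz
  set ℓL := hInt (-v) / (2 * v * gInt (-v)) with hℓL
  set ℓR := hInt w / (2 * w * gInt w) with hℓR
  -- F'/F = (1-m) L'/L + m R'/R. The first term contributes a real number to the product with
  -- conj(L'/L), so only the second matters.
  have hℓF : periodMidDeriv a / periodMid a = (1 - m : ℝ) * ℓL + (m : ℝ) * ℓR := by
    rw [div_eq_iff hF0, add_mul, mul_right_comm, ← hL, mul_right_comm (m : ℂ), ← hmF, hderiv, hℓL,
      hℓR]
    field_simp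
  set Z := v * gInt (-v) * hInt w with hZ
  have hZ0 : Z ≠ 0 := mul_ne_zero (mul_ne_zero hv0 hgv) hhw
  -- The Legendre relation divided by Z: L'/L = (R'/R)(1 - C/Z).
  have hLR : ℓL = ℓR - ℓR * (C / Z) := by
    rw [← hleg, hℓL, hℓR, hZ]
    field_simp
    ring
  have hZim : 0 < Z.im := by
    have e1 := Complex.norm_mul_exp_arg_mul_I v
    have e2 := Complex.norm_mul_exp_arg_mul_I (gInt (-v))
    have e3 := Complex.norm_mul_exp_arg_mul_I (hInt w)
    have e4 : Z = ((‖v‖ * ‖gInt (-v)‖ * ‖hInt w‖ : ℝ) : ℂ) *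
        Complex.exp ((v.arg + (gInt (-v)).arg + (hInt w).arg : ℝ) * Complex.I) := by
      rw [hZ]
      nth_rewrite 1 [← e1, ← e2, ← e3]
      push_cast
      rw [add_mul, add_mul, Complex.exp_add, Complex.exp_add]
      ring
    rw [e4, Complex.im_ofReal_mul, Complex.exp_ofReal_mul_I_im]
    exact mul_pos (mul_pos (mul_pos (norm_pos_iff.2 hv0) (norm_pos_iff.2 hgv))
      (norm_pos_iff.2 hhw)) (Real.sin_pos_of_mem_Ioo hX)
  have hℓR0 : ℓR ≠ 0 := div_ne_zero hhw (mul_ne_zero (mul_ne_zero two_ne_zero hw0) hgw)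
  have hkey : (ℓL * (starRingEnd ℂ) (periodMidDeriv a / periodMid a)).im =
      m * (Complex.normSq ℓR * (C * Z.im / Complex.normSq Z)) := by
    have e1 : ℓL * (starRingEnd ℂ) (periodMidDeriv a / periodMid a) =
        ((1 - m : ℝ) * Complex.normSq ℓL : ℝ) + (m : ℝ) * (ℓL * (starRingEnd ℂ) ℓR) := by
      rw [hℓF, map_add, map_mul, map_mul, Complex.conj_ofReal, Complex.conj_ofReal,
        Complex.ofReal_mul, Complex.normSq_eq_conj_mul_self]
      ring
    have e2 : ℓL * (starRingEnd ℂ) ℓR = Complex.normSq ℓR + (-Complex.normSq ℓR * C : ℝ) * Z⁻¹ := by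
      rw [hLR, Complex.ofReal_mul, Complex.ofReal_neg, Complex.normSq_eq_conj_mul_self, div_eq_mul_inv]
      ring
    rw [e1, Complex.add_im, Complex.ofReal_im, Complex.im_ofReal_mul, e2, Complex.add_im,
      Complex.ofReal_im, Complex.im_ofReal_mul, Complex.inv_im]
    ring
  rw [hkey]
  have := Complex.normSq_pos.2 hZ0
  have := Complex.normSq_pos.2 hℓR0
  positivity


/-! ### Values of arg L along Σ_θ -/

/-- A function whose derivative is positive whenever it equals c crosses c upwards only, so it
cannot return. Positivity is needed at level c alone, which is all that transversality gives. -/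
lemma lt_of_crossing {g g' : ℝ → ℝ} {c y₀ y : ℝ} (hd : ∀ x, 0 < x → HasDerivAt g (g' x) x)
    (hc : ∀ x, 0 < x → g x = c → 0 < g' x) (h0 : 0 < y₀) (h : g y₀ = c) (hy : y₀ < y) : c < g y := by
  have hle : ∀ x ∈ Icc y₀ y, c ≤ g x := fun x hx => by
    have h1 := image_le_of_deriv_right_lt_deriv_boundary (f := fun x => -g x) (f' := fun x => -g' x)
      (B := fun _ => -c) (B' := fun _ => 0)
      (fun x hx => ((hd x (h0.trans_le hx.1)).continuousAt.neg).continuousWithinAt)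
      (fun x hx => ((hd x (h0.trans_le hx.1)).neg).hasDerivWithinAt) (by simp [h])
      (fun x => hasDerivAt_const x _) (fun x hx hx' => by
        have := hc x (h0.trans_le hx.1) (by linarith)
        linarith) hx
    linarith
  -- If equality held at y, the positive derivative would make g smaller than c just to the left of
  -- y.
  refine (hle y ⟨hy.le, le_rfl⟩).lt_of_ne fun hne => ?_
  have hpos := hc y (h0.trans hy) hne.symm
  have hslope := (hasDerivAt_iff_tendsto_slope_left_right.1 (hd y (h0.trans hy))).1
  obtain ⟨x, hx, hx'⟩ := ((hslope.eventually_const_lt hpos).and (Ioo_mem_nhdsLT hy)).exists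
  rw [slope_def_field, ← hne] at hx
  have := hle x ⟨hx'.1.le, hx'.2.le⟩
  exact absurd hx (not_lt.2 (div_nonpos_of_nonneg_of_nonpos (by linarith) (by linarith [hx'.2])))

/-- The velocity γ' satisfies Im γ' = 1 and Im((F'/F) γ') = 0, so it is a positive multiple of
conj(F'/F); this converts the derivative into the quantity of `logDeriv_im_pos`. -/
lemma hasDerivAt_argNegOne_midPoint {θ : ℝ} (hθ : θ ∈ Ioo 0 (Real.pi / 2)) {y : ℝ} (hy : 0 < y) :
    ∃ d : ℝ, HasDerivAt (fun y => argNegOne (midPoint θ y)) d y ∧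
      d * (-(periodMidDeriv (midPoint θ y) / periodMid (midPoint θ y)).im) =
        (hInt (-(midPoint θ y + 1)) / (2 * (midPoint θ y + 1) * gInt (-(midPoint θ y + 1))) *
        (starRingEnd ℂ) (periodMidDeriv (midPoint θ y) / periodMid (midPoint θ y))).im := by
  have him : 0 < (midPoint θ y).im := by rwa [midPoint_im]
  have hγ : HasDerivAt (midPoint θ) (deriv (midPoint θ) y) y :=
    (((contDiffOn_midPoint hθ).1.contDiffAt (Ioi_mem_nhds hy)).differentiableAt
      (by simp)).hasDerivAt
  have h1 := Complex.imCLM.hasFDerivAt.comp_hasDerivAt y hγ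
  have h2 := Complex.imCLM.hasFDerivAt.comp_hasDerivAt y
    (HasDerivAt.comp y (hasDerivAt_logMid him) hγ)
  have h3 := Complex.imCLM.hasFDerivAt.comp_hasDerivAt y
    (HasDerivAt.comp y (hasDerivAt_logNegOne him) hγ)
  have e1 : (deriv (midPoint θ) y).im = 1 := by
    refine HasDerivAt.unique h1 ((hasDerivAt_id' y).congr_of_eventuallyEq ?_)
    exact Eventually.of_forall fun y => midPoint_im θ y
  have e2 : (periodMidDeriv (midPoint θ y) / periodMid (midPoint θ y) *
      deriv (midPoint θ) y).im = 0 := by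
    refine HasDerivAt.unique h2 ((hasDerivAt_const y (Real.pi / 2 - θ)).congr_of_eventuallyEq ?_)
    filter_upwards [Ioi_mem_nhds hy] with z hz
    exact (logMid_im _).trans (argMid_midPoint hθ hz)
  refine ⟨_, h3.congr_of_eventuallyEq (Eventually.of_forall fun y => (logNegOne_im _).symm), ?_⟩
  change (hInt (-(midPoint θ y + 1)) / (2 * (midPoint θ y + 1) * gInt (-(midPoint θ y + 1))) *
    deriv (midPoint θ) y).im * _ = _
  generalize hInt (-(midPoint θ y + 1)) / (2 * (midPoint θ y + 1) * gInt (-(midPoint θ y + 1))) = L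
  generalize periodMidDeriv (midPoint θ y) / periodMid (midPoint θ y) = F at e2 ⊢
  rw [Complex.mul_im, e1] at e2
  rw [Complex.mul_im, e1, Complex.mul_im, Complex.conj_re, Complex.conj_im]
  linear_combination (-L.im) * e2

lemma argNegOne_midPoint_lt_of_eq {θ : ℝ} (hθ : θ ∈ Ioc 0 (Real.pi / 4)) {c : ℝ}
    (hc : c = Real.pi / 2 - θ ∨ c = 3 * Real.pi / 2 - θ) {y₀ y : ℝ} (h0 : 0 < y₀)
    (h : argNegOne (midPoint θ y₀) = c) (hy : y₀ < y) : c < argNegOne (midPoint θ y) := by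
  have hθ' : θ ∈ Ioo 0 (Real.pi / 2) := ⟨hθ.1, by linarith [hθ.2, Real.pi_pos]⟩
  have hex : ∀ y : ℝ, ∃ d : ℝ, 0 < y → HasDerivAt (fun y => argNegOne (midPoint θ y)) d y ∧
      (argNegOne (midPoint θ y) = c → 0 < d) := by
    intro y
    by_cases hy : 0 < y
    · obtain ⟨d, hd, hd'⟩ := hasDerivAt_argNegOne_midPoint hθ' hy
      refine ⟨d, fun _ => ⟨hd, fun hyc => ?_⟩⟩
      have him : 0 < (midPoint θ y).im := by rwa [midPoint_im]
      have h1 := logDeriv_im_pos ⟨hθ.1.le, hθ.2⟩ him (argMid_midPoint hθ' hy) (by rwa [hyc])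
      have h2 := logMid_deriv_im_neg him
      rw [← hd'] at h1
      exact pos_of_mul_pos_left h1 (neg_pos.2 h2).le
    · exact ⟨0, fun h => absurd h hy⟩
  choose d hd using hex
  exact lt_of_crossing (g := fun y => argNegOne (midPoint θ y)) (g' := d) (fun x hx => (hd x hx).1)
    (fun x hx => (hd x hx).2) h0 h hy

lemma tendsto_add_const_direction {ι : Type*} {l : Filter ι} [l.NeBot] {γ : ι → ℂ} {u : ℂ} (c : ℂ)
    (hn : Tendsto (fun x => ‖γ x‖) l atTop) (hd : Tendsto (fun x => γ x / (‖γ x‖ : ℂ)) l (𝓝 u)) :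
    Tendsto (fun x => ‖γ x + c‖) l atTop ∧
      Tendsto (fun x => (γ x + c) / (‖γ x + c‖ : ℂ)) l (𝓝 u) := by
  have h1 : Tendsto (fun x => ‖γ x + c‖) l atTop := by
    refine tendsto_atTop_mono (fun x => ?_) (tendsto_atTop_add_const_right _ (-‖c‖) hn)
    have := norm_sub_le (γ x + c) c
    rw [add_sub_cancel_right] at this
    linarith
  refine ⟨h1, ?_⟩
  have hinv : Tendsto (fun x => (‖γ x‖⁻¹ : ℝ)) l (𝓝 0) := tendsto_inv_atTop_zero.comp hn
  have hc : Tendsto (fun x => ((‖γ x‖⁻¹ : ℝ) : ℂ) * c) l (𝓝 0) := by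
    simpa using ((Complex.continuous_ofReal.tendsto 0).comp hinv).mul_const c
  have h2 := hd.add hc
  rw [add_zero] at h2
  have hun : ‖u‖ = 1 := by
    have h3 := hd.norm
    refine tendsto_nhds_unique h3 (tendsto_const_nhds.congr' ?_)
    filter_upwards [hn.eventually_gt_atTop 0] with x hx
    rw [norm_div, Complex.norm_real, norm_norm, div_self hx.ne']
  have h3 := h2.div ((Complex.continuous_ofReal.tendsto _).comp h2.norm) (by simp [hun])
  rw [hun, Complex.ofReal_one, div_one] at h3
  refine h3.congr' ?_
  filter_upwards [hn.eventually_gt_atTop 0] with x hx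
  have hx' : (‖γ x‖ : ℂ) ≠ 0 := by exact_mod_cast hx.ne'
  have e : γ x / (‖γ x‖ : ℂ) + ((‖γ x‖⁻¹ : ℝ) : ℂ) * c = ((‖γ x‖⁻¹ : ℝ) : ℂ) * (γ x + c) := by
    push_cast
    field_simp
  simp only [Pi.div_apply, Function.comp_apply]
  rw [e, norm_mul, Complex.norm_real, Real.norm_of_nonneg (inv_nonneg.2 hx.le), Complex.ofReal_mul,
    mul_div_mul_left]
  exact_mod_cast inv_ne_zero hx.ne'

lemma tendsto_arg_of_direction {ι : Type*} {l : Filter ι} {γ : ι → ℂ} {u : ℂ}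
    (hu : u ∈ Complex.slitPlane) (hd : Tendsto (fun x => γ x / (‖γ x‖ : ℂ)) l (𝓝 u)) :
    Tendsto (fun x => (γ x).arg) l (𝓝 u.arg) := by
  refine ((Complex.continuousAt_arg hu).tendsto.comp hd).congr fun x => ?_
  rcases eq_or_ne (γ x) 0 with h | h
  · simp [h]
  · rw [Function.comp_apply, div_eq_mul_inv, ← Complex.ofReal_inv, mul_comm,
      Complex.arg_real_mul _ (inv_pos.2 (norm_pos_iff.2 h))]

/-- By scaling, g(w) = √|w| · G(2/|w|, w/|w|) with G continuous, and G(0,u) is a positive multiple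
of √u. The map `foldUp` makes G continuous everywhere. -/
lemma tendsto_arg_gInt {ι : Type*} {l : Filter ι} {w : ι → ℂ} {u : ℂ} (hu : 0 < u.im)
    (him : ∀ x, 0 ≤ (w x).im) (hn : Tendsto (fun x => ‖w x‖) l atTop)
    (hd : Tendsto (fun x => w x / (‖w x‖ : ℂ)) l (𝓝 u)) :
    Tendsto (fun x => (gInt (w x)).arg) l (𝓝 (u.arg / 2)) := by
  let G : ℝ × ℂ → ℂ := fun p => ∫ t in (0 : ℝ)..(Real.pi / 2),
    ((2 * Real.sin t ^ 2 * Real.cos t ^ 2 : ℝ) : ℂ) *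
      csqrt (foldUp (p.1 + ((Real.sin t ^ 2 : ℝ) : ℂ) * p.2))
  have hG : Continuous G := by
    apply intervalIntegral.continuous_parametric_intervalIntegral_of_continuous'
    have h : Continuous (fun x : (ℝ × ℂ) × ℝ =>
        csqrt (foldUp (x.1.1 + ((Real.sin x.2 ^ 2 : ℝ) : ℂ) * x.1.2))) :=
      continuous_csqrt_foldUp.comp (by fun_prop)
    exact Continuous.mul (by fun_prop) h
  have hG0 : G (0, u) =
      ((∫ t in (0 : ℝ)..(Real.pi / 2), 2 * Real.sin t ^ 3 * Real.cos t ^ 2 : ℝ) : ℂ) * csqrt u := by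
    rw [← intervalIntegral.integral_ofReal, ← intervalIntegral.integral_mul_const]
    refine intervalIntegral.integral_congr fun t ht => ?_
    rw [uIcc_of_le pi_div_two_pos'.le] at ht
    have hs : 0 ≤ Real.sin t := Real.sin_nonneg_of_nonneg_of_le_pi ht.1
      (by linarith [ht.2, Real.pi_pos])
    simp only [Complex.ofReal_zero, zero_add]
    rw [foldUp_of_nonneg, csqrt_real_mul (sq_nonneg _), Real.sqrt_sq hs, ← mul_assoc,
      ← Complex.ofReal_mul]
    · congr 2
      ring
    · rw [Complex.im_ofReal_mul]
      exact mul_nonneg (sq_nonneg _) hu.le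
  have hpos : 0 < ∫ t in (0 : ℝ)..(Real.pi / 2), 2 * Real.sin t ^ 3 * Real.cos t ^ 2 := by
    refine intervalIntegral.intervalIntegral_pos_of_pos_on
      (Continuous.intervalIntegrable (by fun_prop) _ _) (fun t ht => ?_) pi_div_two_pos'
    obtain ⟨h1, h2⟩ := sin_cos_pos ht
    positivity
  have hGarg : (G (0, u)).arg = u.arg / 2 := by
    rw [hG0, Complex.arg_real_mul _ hpos, arg_csqrt]
  have hslit : G (0, u) ∈ Complex.slitPlane := by
    rw [hG0]
    refine mem_slitPlane_of_im_pos ?_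
    rw [Complex.im_ofReal_mul]
    exact mul_pos hpos (csqrt_im_pos hu)
  have hlim : Tendsto (fun x => ((2 * ‖w x‖⁻¹ : ℝ), w x / (‖w x‖ : ℂ))) l (𝓝 ((0 : ℝ), u)) := by
    have h1 := (tendsto_inv_atTop_zero.comp hn).const_mul 2
    rw [mul_zero] at h1
    exact h1.prodMk_nhds hd
  have h2 := (Complex.continuousAt_arg hslit).tendsto.comp ((hG.tendsto _).comp hlim)
  rw [hGarg] at h2
  refine h2.congr' ?_
  filter_upwards [hn.eventually_gt_atTop 0] with x hx
  have hx' : (‖w x‖ : ℂ) ≠ 0 := by exact_mod_cast hx.ne'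
  have e : gInt (w x) = (Real.sqrt ‖w x‖ : ℂ) * G (2 * ‖w x‖⁻¹, w x / (‖w x‖ : ℂ)) := by
    rw [gInt, ← intervalIntegral.integral_const_mul]
    refine intervalIntegral.integral_congr fun t _ => ?_
    have e1 : (((2 : ℝ) : ℂ) + ((Real.sin t ^ 2 : ℝ) : ℂ) * w x) = ((‖w x‖ : ℝ) : ℂ) *
        (((2 * ‖w x‖⁻¹ : ℝ) : ℂ) + ((Real.sin t ^ 2 : ℝ) : ℂ) * (w x / (‖w x‖ : ℂ))) := by
      push_cast
      field_simp
    rw [e1, csqrt_real_mul hx.le, foldUp_of_nonneg]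
    · ring
    · rw [Complex.add_im, Complex.ofReal_im, Complex.im_ofReal_mul, Complex.div_ofReal_im, zero_add]
      exact mul_nonneg (sq_nonneg _) (div_nonneg (him x) hx.le)
  rw [Function.comp_apply, Function.comp_apply, e, Complex.arg_real_mul _ (Real.sqrt_pos.2 hx)]

/-- The direction at infinity contributes 2(π - 2θ), and arg g(-(a+1)) tends to -θ, half the angle
between -(a+1) and the positive axis with its sign. -/
lemma tendsto_argNegOne_midPoint_atTop {θ : ℝ} (hθ : θ ∈ Ioc 0 (Real.pi / 4)) :
    Tendsto (fun y => argNegOne (midPoint θ y)) atTop (𝓝 (2 * Real.pi - 5 * θ)) := by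
  have hpi := Real.pi_pos
  obtain ⟨h1, h2⟩ := tendsto_add_const_direction 1 (tendsto_norm_midPoint θ)
    (tendsto_midPoint_direction hθ)
  set u := Complex.exp ((Real.pi - 2 * θ) * Complex.I) with hu
  have hue : u = Complex.exp ((Real.pi - 2 * θ : ℝ) * Complex.I) := by rw [hu]; push_cast; rfl
  have huim : 0 < u.im := by
    rw [hue, Complex.exp_ofReal_mul_I_im]
    exact Real.sin_pos_of_pos_of_lt_pi (by linarith [hθ.2]) (by linarith [hθ.1])
  have huarg : u.arg = Real.pi - 2 * θ := by
    have := arg_polar one_pos (ψ := Real.pi - 2 * θ) ⟨by linarith [hθ.2], by linarith [hθ.1]⟩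
    rwa [Complex.ofReal_one, one_mul, ← hue] at this
  have h3 := tendsto_arg_of_direction (mem_slitPlane_of_im_pos huim) h2
  -- The absolute value makes the imaginary part non-negative for every y, as `tendsto_arg_gInt`
  -- demands; it disappears for large y.
  have h4 : Tendsto (fun y => (gInt (reflectIm (midPoint θ |y| + 1))).arg) atTop (𝓝 (θ)) := by
    have := tendsto_arg_gInt (l := atTop) (w := fun y => reflectIm (midPoint θ |y| + 1))
      (u := reflectIm u) (by rwa [reflectIm_im]) (fun y => by
        rw [reflectIm_im, add_one_im, midPoint_im]; exact abs_nonneg y) ?_ ?_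
    · rw [arg_reflectIm huim, huarg] at this
      convert this using 2
      ring
    · simp only [norm_reflectIm]
      refine h1.congr' ?_
      filter_upwards [eventually_ge_atTop 0] with y hy
      rw [abs_of_nonneg hy]
    · have := (continuous_reflectIm.tendsto _).comp h2
      refine this.congr' ?_
      filter_upwards [eventually_ge_atTop 0] with y hy
      rw [abs_of_nonneg hy, Function.comp_apply, norm_reflectIm]
      simp only [reflectIm, map_div₀, Complex.conj_ofReal]
      ring
  have h5 := (h3.const_mul 2).sub h4
  rw [huarg, show 2 * (Real.pi - 2 * θ) - θ = 2 * Real.pi - 5 * θ by ring] at h5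
  refine h5.congr' ?_
  filter_upwards [eventually_gt_atTop 0] with y hy
  rw [argNegOne, arg_gInt_neg_add_one (by rwa [midPoint_im]), abs_of_pos hy]
  have e : reflectIm (midPoint θ y) - 1 = reflectIm (midPoint θ y + 1) := by
    rw [reflectIm, reflectIm, map_add, map_one]
    ring
  rw [e]
  ring

/-- The curve ends at s > -1, where arg(a+1) tends to 0, and arg g(-(a+1)) is negative. This gives
the start for the intermediate value argument. -/
lemma eventually_argNegOne_midPoint_lt {θ : ℝ} (hθ : θ ∈ Ioc 0 (Real.pi / 4)) :
    ∀ᶠ y in 𝓝[>] (0 : ℝ), argNegOne (midPoint θ y) < Real.pi / 2 - θ := by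
  have hpi := Real.pi_pos
  obtain ⟨s, hs, hs0, -⟩ := exists_boundaryPeriod_root ⟨hθ.1.le, hθ.2⟩
  have hθ' : θ ∈ Ioo 0 (Real.pi / 2) := ⟨hθ.1, by linarith [hθ.2]⟩
  have hlim := tendsto_midPoint_zero hθ' hs0
  have hs1 : -1 < s := by
    refine hs.1.lt_of_ne fun h => ?_
    rw [← h, exp_mul_periodMid_ofReal_re, realMid_eq_zero le_rfl, neg_neg] at hs0
    have h1 := realMid_pos (x := 1) (by norm_num)
    have h2 := Real.sin_pos_of_pos_of_lt_pi hθ.1 (by linarith [hθ.2])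
    nlinarith [mul_pos h2 h1]
  have hv : ((s : ℂ) + 1) ∈ Complex.slitPlane := Or.inl (by simpa using by linarith)
  have harg : ((s : ℂ) + 1).arg = 0 := by
    rw [show (s : ℂ) + 1 = ((s + 1 : ℝ) : ℂ) by push_cast; ring,
      Complex.arg_ofReal_of_nonneg (by linarith)]
  have h1 := (Complex.continuousAt_arg hv).tendsto.comp (hlim.add_const 1)
  rw [harg] at h1
  filter_upwards [h1.eventually_lt_const (show (0 : ℝ) < (Real.pi / 2 - θ) / 2 by linarith [hθ.2]),
    self_mem_nhdsWithin] with y hy hy0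
  have h2 := (neg_arg_gInt_neg_bounds (a := midPoint θ y) (by rwa [midPoint_im])).1
  have hy' : (midPoint θ y + 1).arg < (Real.pi / 2 - θ) / 2 := hy
  rw [argNegOne]
  linarith

lemma continuousOn_argNegOne : ContinuousOn argNegOne {a | 0 < a.im} := by
  have h := Complex.continuous_im.comp_continuousOn differentiableOn_logNegOne.continuousOn
  exact h.congr fun a _ => (logNegOne_im a).symm

lemma continuousOn_argNegOne_midPoint {θ : ℝ} (hθ : θ ∈ Ioo 0 (Real.pi / 2)) :
    ContinuousOn (fun y => argNegOne (midPoint θ y)) (Ioi 0) :=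
  continuousOn_argNegOne.comp (f := midPoint θ) (contDiffOn_midPoint hθ).1.continuousOn
    fun y hy => show 0 < (midPoint θ y).im by rwa [midPoint_im]

lemma exists_argNegOne_midPoint_eq {θ : ℝ} (hθ : θ ∈ Ioc 0 (Real.pi / 4)) {c y₁ : ℝ}
    (h1 : Real.pi / 2 - θ ≤ c) (hy : 0 < y₁) (h2 : c < argNegOne (midPoint θ y₁)) :
    ∃ y, 0 < y ∧ argNegOne (midPoint θ y) = c := by
  have hpi := Real.pi_pos
  obtain ⟨y₀, hy₀, hy₀'⟩ := ((eventually_argNegOne_midPoint_lt hθ).and self_mem_nhdsWithin).exists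
  have := (ordConnected_Ioi (a := (0 : ℝ))).isPreconnected.image _
    (continuousOn_argNegOne_midPoint (θ := θ) ⟨hθ.1, by linarith [hθ.2]⟩)
  obtain ⟨y, hy, hy'⟩ := this.ordConnected.out (mem_image_of_mem _ hy₀')
    (mem_image_of_mem _ (show y₁ ∈ Ioi 0 from hy)) (show c ∈ Icc _ _ from ⟨by
      exact (lt_of_lt_of_le hy₀ h1).le, h2.le⟩)
  exact ⟨y, hy, hy'⟩

lemma argNegOne_midPoint_inj {θ : ℝ} (hθ : θ ∈ Ioc 0 (Real.pi / 4)) {c : ℝ}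
    (hc : c = Real.pi / 2 - θ ∨ c = 3 * Real.pi / 2 - θ) {y z : ℝ} (hy : 0 < y) (hz : 0 < z)
    (h1 : argNegOne (midPoint θ y) = c) (h2 : argNegOne (midPoint θ z) = c) : y = z := by
  by_contra hne
  rcases lt_or_gt_of_ne hne with h | h
  · exact (argNegOne_midPoint_lt_of_eq hθ hc hy h1 h).ne' h2
  · exact (argNegOne_midPoint_lt_of_eq hθ hc hz h2 h).ne' h1

lemma eq_of_argMid_argNegOne {θ : ℝ} (hθ : θ ∈ Ioc 0 (Real.pi / 4)) {c : ℝ}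
    (hc : c = Real.pi / 2 - θ ∨ c = 3 * Real.pi / 2 - θ) {a b : ℂ} (ha : 0 < a.im) (hb : 0 < b.im)
    (ha1 : argMid a = Real.pi / 2 - θ) (hb1 : argMid b = Real.pi / 2 - θ) (ha2 : argNegOne a = c)
    (hb2 : argNegOne b = c) : a = b := by
  have hθ' : θ ∈ Ioo 0 (Real.pi / 2) := ⟨hθ.1, by linarith [hθ.2, Real.pi_pos]⟩
  have ea := eq_midPoint hθ' ha ha1
  have eb := eq_midPoint hθ' hb hb1
  rw [ea] at ha2
  rw [eb] at hb2
  rw [ea, eb, argNegOne_midPoint_inj hθ hc ha hb ha2 hb2]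

lemma exists_argMid_argNegOne {θ c : ℝ} (hθ : θ ∈ Ioc 0 (Real.pi / 4)) (hc : Real.pi / 2 - θ ≤ c)
    (hc' : c < 2 * Real.pi - 5 * θ) :
    ∃ a : ℂ, 0 < a.im ∧ argMid a = Real.pi / 2 - θ ∧ argNegOne a = c := by
  have hpi := Real.pi_pos
  obtain ⟨y₁, hy₁, hy₁'⟩ := (((tendsto_argNegOne_midPoint_atTop hθ).eventually_const_lt hc').and
    (eventually_gt_atTop 0)).exists
  obtain ⟨y, hy, h⟩ := exists_argNegOne_midPoint_eq hθ hc hy₁' hy₁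
  exact ⟨midPoint θ y, by rwa [midPoint_im], argMid_midPoint ⟨hθ.1, by linarith [hθ.2]⟩ hy, h⟩

/-- Once above 3π/2 - θ, arg L would stay above it, against the limit 2π - 5θ when θ > π/8. -/
lemma argNegOne_ne {θ : ℝ} (hθ : θ ∈ Icc (Real.pi / 8) (Real.pi / 4)) {a : ℂ} (ha : 0 < a.im)
    (h : argMid a = Real.pi / 2 - θ) : argNegOne a ≠ 3 * Real.pi / 2 - θ := by
  have hpi := Real.pi_pos
  have key : ∀ θ ∈ Ioc (Real.pi / 8) (Real.pi / 4), ∀ y, 0 < y →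
      ¬ 3 * Real.pi / 2 - θ < argNegOne (midPoint θ y) := by
    intro θ hθ y hy hlt
    have hθ' : θ ∈ Ioc 0 (Real.pi / 4) := ⟨by linarith [hθ.1], hθ.2⟩
    obtain ⟨z, hz, hz'⟩ := exists_argNegOne_midPoint_eq hθ' (by linarith) hy hlt
    have h1 : ∀ᶠ x in atTop, 3 * Real.pi / 2 - θ ≤ argNegOne (midPoint θ x) := by
      filter_upwards [eventually_gt_atTop z] with x hx
      exact (argNegOne_midPoint_lt_of_eq hθ' (Or.inr rfl) hz hz' hx).le
    have h2 := ge_of_tendsto (tendsto_argNegOne_midPoint_atTop hθ') h1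
    linarith [hθ.1]
  intro h'
  have hθ' : θ ∈ Ioc 0 (Real.pi / 4) := ⟨by linarith [hθ.1], hθ.2⟩
  have hθ2 : θ ∈ Ioo 0 (Real.pi / 2) := ⟨hθ'.1, by linarith [hθ.2]⟩
  rw [eq_midPoint hθ2 ha h] at h'
  have hlt := argNegOne_midPoint_lt_of_eq hθ' (Or.inr rfl) ha h' (lt_add_one a.im)
  have hy : 0 < a.im + 1 := by linarith
  rcases hθ.1.eq_or_lt with h8 | h8
  -- At θ = π/8 limit and level coincide and there is no contradiction. But arg L is strictly above
  -- the level one unit higher on the curve, and this persists at that height for slightly larger θ.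
  · have hcont : ContinuousOn (fun θ => argNegOne (midPoint θ (a.im + 1)) + θ)
        (Ioo 0 (Real.pi / 2)) :=
      (continuousOn_argNegOne.comp (f := fun θ => midPoint θ (a.im + 1))
        (continuousOn_midPoint_angle hy)
        fun θ _ => show 0 < (midPoint θ (a.im + 1)).im by rwa [midPoint_im]).add continuousOn_id
    have h1 := (hcont.continuousAt (Ioo_mem_nhds hθ2.1 hθ2.2)).tendsto.mono_left
      (nhdsWithin_le_nhds (s := Ioi θ))
    obtain ⟨θ', hθ1', hθ2'⟩ := ((h1.eventually_const_lt (show 3 * Real.pi / 2 < _ by linarith)).and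
      (Ioo_mem_nhdsGT (show θ < Real.pi / 4 by linarith))).exists
    exact key θ' ⟨by linarith [hθ2'.1], hθ2'.2.le⟩ _ hy (by linarith)
  · exact key θ ⟨h8, hθ.2⟩ _ hy hlt


/-! ### The crossing points as functions of θ -/

/-- The point of the upper half plane where `argMid = π / 2 - θ` and `argNegOne = k - θ`, continued
by `-1` at `θ = 0`. -/
noncomputable def crossPoint (k θ : ℝ) : ℂ :=
  if 0 < θ then Classical.epsilon fun a : ℂ =>
    0 < a.im ∧ argMid a = Real.pi / 2 - θ ∧ argNegOne a = k - θ
  else -1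

lemma crossPoint_zero (k : ℝ) : crossPoint k 0 = -1 := if_neg (lt_irrefl 0)

lemma pi_div_two_le_of {k : ℝ} (hk : k = Real.pi / 2 ∨ k = 3 * Real.pi / 2) :
    Real.pi / 2 ≤ k ∧ k ≤ 3 * Real.pi / 2 := by
  have := Real.pi_pos
  rcases hk with rfl | rfl <;> constructor <;> linarith

lemma crossPoint_spec {k θ : ℝ} (hk : k = Real.pi / 2 ∨ k = 3 * Real.pi / 2)
    (hθ : θ ∈ Ioc 0 (Real.pi / 4)) (hkθ : k - θ < 2 * Real.pi - 5 * θ) :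
    0 < (crossPoint k θ).im ∧ argMid (crossPoint k θ) = Real.pi / 2 - θ ∧
      argNegOne (crossPoint k θ) = k - θ := by
  rw [crossPoint, if_pos hθ.1]
  exact Classical.epsilon_spec (exists_argMid_argNegOne hθ
    (sub_le_sub_right (pi_div_two_le_of hk).1 θ) hkθ)

lemma eq_or_eq_sub {k : ℝ} (hk : k = Real.pi / 2 ∨ k = 3 * Real.pi / 2) (θ : ℝ) :
    k - θ = Real.pi / 2 - θ ∨ k - θ = 3 * Real.pi / 2 - θ :=
  hk.imp (fun h => by rw [h]) (fun h => by rw [h])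

lemma eq_crossPoint {k θ : ℝ} (hk : k = Real.pi / 2 ∨ k = 3 * Real.pi / 2)
    (hθ : θ ∈ Ioc 0 (Real.pi / 4)) (hkθ : k - θ < 2 * Real.pi - 5 * θ) {a : ℂ} (ha : 0 < a.im)
    (h1 : argMid a = Real.pi / 2 - θ) (h2 : argNegOne a = k - θ) : a = crossPoint k θ := by
  obtain ⟨s1, s2, s3⟩ := crossPoint_spec hk hθ hkθ
  exact eq_of_argMid_argNegOne hθ (eq_or_eq_sub hk θ) ha s1 h1 s2 h2 s3

/-- The point is prescribed by arg L and arg F, whose derivatives are independent by transversality;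
the prescribed values have slope -1 in θ, so the velocity does not vanish. -/
lemma contDiffOn_crossPoint {k : ℝ} (hk : k = Real.pi / 2 ∨ k = 3 * Real.pi / 2) {I : Set ℝ}
    (hI : UniqueDiffOn ℝ I) (hI' : I ⊆ Ioc 0 (Real.pi / 4))
    (hkI : ∀ θ ∈ I, k - θ < 2 * Real.pi - 5 * θ) :
    ContDiffOn ℝ ∞ (crossPoint k) I ∧ ∀ θ ∈ I, derivWithin (crossPoint k) I θ ≠ 0 := by
  have hs := fun θ hθ => crossPoint_spec hk (hI' hθ) (hkI θ hθ)
  refine contDiffOn_of_im_eq hI isOpen_upper (f₁ := logNegOne) (f₂ := logMid)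
    differentiableOn_logNegOne differentiableOn_logMid (c₁ := fun θ => k - θ)
    (c₂ := fun θ => Real.pi / 2 - θ) (by fun_prop) (by fun_prop) (fun θ hθ => (hs θ hθ).1)
    (fun θ hθ => by rw [logNegOne_im, (hs θ hθ).2.2])
    (fun θ hθ => by rw [logMid_im, (hs θ hθ).2.1]) (fun θ hθ z hz h1 h2 => ?_)
    (fun θ hθ => ?_) (fun θ hθ => ?_)
  · rw [logNegOne_im] at h1
    rw [logMid_im] at h2
    exact eq_crossPoint hk (hI' hθ) (hkI θ hθ) hz h2 h1
  · rw [(hasDerivAt_logNegOne (hs θ hθ).1).deriv, (hasDerivAt_logMid (hs θ hθ).1).deriv]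
    refine (logDeriv_im_pos ⟨(hI' hθ).1.le, (hI' hθ).2⟩ (hs θ hθ).1 (hs θ hθ).2.1 ?_).ne'
    rw [(hs θ hθ).2.2]
    exact eq_or_eq_sub hk θ
  · rw [((hasDerivAt_id' θ).const_sub _).hasDerivWithinAt.derivWithin (hI θ hθ)]
    norm_num

lemma arg_add_one_bounds {k θ : ℝ} {a : ℂ} (ha : 0 < a.im) (h1 : argMid a = Real.pi / 2 - θ)
    (h2 : argNegOne a = k - θ) : (k - θ) / 2 < (a + 1).arg ∧ (a + 1).arg < k / 2 := by
  have h3 := (arg_mid_bounds ha h1).2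
  obtain ⟨h4, h5⟩ := neg_arg_gInt_neg_bounds ha
  rw [argNegOne] at h2
  constructor <;> linarith

/-- The law of sines in the triangle with vertices -1, 1, a. -/
lemma norm_add_one_mul_sin (a : ℂ) (ha : 0 < a.im) :
    ‖a + 1‖ * Real.sin ((a - 1).arg - (a + 1).arg) = 2 * Real.sin (a - 1).arg := by
  have hw := norm_pos_iff.2 (sub_one_ne_zero_of_im_pos ha)
  have h1 := im_mul_conj (a - 1) (a + 1)
  have h2 := Complex.norm_mul_sin_arg (a - 1)
  have h3 : ((a - 1) * (starRingEnd ℂ) (a + 1)).im = 2 * (a - 1).im := by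
    simp only [Complex.mul_im, Complex.conj_re, Complex.conj_im, Complex.add_re, Complex.add_im,
      Complex.sub_re, Complex.sub_im, Complex.one_re, Complex.one_im]
    ring
  rw [h3, ← h2] at h1
  refine mul_left_cancel₀ hw.ne' ?_
  linear_combination -h1

/-- Here arg(a-1) > π - 2θ while arg(a+1) < k/2 ≤ 3π/4, so for θ ≤ π/16 the angle at a stays between
π/8 and 7π/8. The law of sines then shows |a+1| = O(θ). -/
lemma norm_add_one_le {k θ : ℝ} (hk : k = Real.pi / 2 ∨ k = 3 * Real.pi / 2)
    (hθ : θ ∈ Ioc 0 (Real.pi / 16)) {a : ℂ} (ha : 0 < a.im)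
    (h1 : argMid a = Real.pi / 2 - θ) (h2 : argNegOne a = k - θ) :
    ‖a + 1‖ * Real.sin (Real.pi / 8) ≤ 2 * Real.sin (2 * θ) := by
  have hpi := Real.pi_pos
  have hk' := pi_div_two_le_of hk
  obtain ⟨b1, b2⟩ := arg_add_one_bounds ha h1 h2
  have b3 := (arg_mid_bounds ha h1).2
  have b4 := Complex.arg_le_pi (a - 1)
  have e1 : Real.sin (a - 1).arg ≤ Real.sin (2 * θ) := by
    rw [← Real.sin_pi_sub]
    exact Real.sin_le_sin_of_le_of_le_pi_div_two (by linarith) (by linarith [hθ.2]) (by linarith)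
  have e2 : Real.sin (Real.pi / 8) ≤ Real.sin ((a - 1).arg - (a + 1).arg) := by
    rcases le_total ((a - 1).arg - (a + 1).arg) (Real.pi / 2) with h | h
    · exact Real.sin_le_sin_of_le_of_le_pi_div_two (by linarith) h (by linarith [hθ.2])
    · rw [← Real.sin_pi_sub ((a - 1).arg - (a + 1).arg)]
      exact Real.sin_le_sin_of_le_of_le_pi_div_two (by linarith) (by linarith) (by linarith [hθ.2])
  have e3 := norm_add_one_mul_sin a ha
  have e4 := mul_le_mul_of_nonneg_left e2 (norm_nonneg (a + 1))
  linarith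

lemma tendsto_crossPoint_zero {k : ℝ} (hk : k = Real.pi / 2 ∨ k = 3 * Real.pi / 2) :
    Tendsto (crossPoint k) (𝓝[>] 0) (𝓝 (-1)) := by
  have hpi := Real.pi_pos
  have hk' := pi_div_two_le_of hk
  have hs : 0 < Real.sin (Real.pi / 8) :=
    Real.sin_pos_of_pos_of_lt_pi (by linarith) (by linarith)
  rw [tendsto_iff_norm_sub_tendsto_zero]
  have hlim : Tendsto (fun θ => 2 * Real.sin (2 * θ) / Real.sin (Real.pi / 8)) (𝓝[>] 0) (𝓝 0) := by
    have hc : Continuous fun θ => 2 * Real.sin (2 * θ) / Real.sin (Real.pi / 8) := by fun_prop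
    simpa using (hc.tendsto 0).mono_left nhdsWithin_le_nhds
  refine squeeze_zero' (Eventually.of_forall fun _ => norm_nonneg _) ?_ hlim
  filter_upwards [Ioo_mem_nhdsGT (show (0 : ℝ) < Real.pi / 16 by linarith)] with θ hθ
  obtain ⟨s1, s2, s3⟩ := crossPoint_spec hk ⟨hθ.1, by linarith [hθ.2]⟩ (by linarith [hθ.2])
  rw [le_div_iff₀ hs, sub_neg_eq_add]
  exact norm_add_one_le hk ⟨hθ.1, hθ.2.le⟩ s1 s2 s3

lemma argMid_neg_one : argMid (-1) = Real.pi / 2 := by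
  obtain ⟨r, hr, h⟩ := gInt_ofReal (x := -2) le_rfl
  rw [argMid, periodMid_negOne]
  rw [Complex.ofReal_neg, Complex.ofReal_ofNat] at h
  rw [h, show Complex.I * (4 * (r : ℂ)) = ((4 * r : ℝ) : ℂ) * Complex.I by push_cast; ring,
    Complex.arg_real_mul _ (by positivity), Complex.arg_I]

/-- The continuous inverse is a ↦ π/2 - arg F(a), which also works at the end point because arg
F(-1) = π/2. -/
lemma isSmoothArc_crossPoint {k : ℝ} (hk : k = Real.pi / 2 ∨ k = 3 * Real.pi / 2) {I J : Set ℝ}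
    (hI : UniqueDiffOn ℝ I) (hI' : I ⊆ Ioc 0 (Real.pi / 4))
    (hkI : ∀ θ ∈ I, k - θ < 2 * Real.pi - 5 * θ) (hJ0 : J ⊆ Ici 0) (hJ : J ∩ Ioi 0 = I) :
    IsSmoothArc (crossPoint k) J I := by
  obtain ⟨h1, h2⟩ := contDiffOn_crossPoint hk hI hI' hkI
  have hs := fun θ hθ => crossPoint_spec hk (hI' hθ) (hkI θ hθ)
  refine ⟨?_, h1, h2⟩
  have hcases : ∀ θ ∈ J, θ = 0 ∨ θ ∈ I := fun θ hθ => by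
    rcases (show 0 ≤ θ from hJ0 hθ).eq_or_lt with h | h
    · exact Or.inl h.symm
    · exact Or.inr (hJ ▸ ⟨hθ, h⟩)
  have hup : crossPoint k '' J ⊆ {a | 0 ≤ a.im} := by
    rintro _ ⟨θ, hθ, rfl⟩
    rcases hcases θ hθ with rfl | h
    · simp [crossPoint_zero]
    · exact (hs θ h).1.le
  refine isEmbedding_domRestrict (ρ := fun a => Real.pi / 2 - argMid a) ?_ ?_ ?_
  · intro θ hθ
    rcases hcases θ hθ with rfl | h
    · have h3 : ContinuousWithinAt (crossPoint k) (Ioi 0) 0 := by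
        rw [ContinuousWithinAt, crossPoint_zero]
        exact tendsto_crossPoint_zero hk
      refine (continuousWithinAt_insert_self.2 h3).mono fun x hx => ?_
      exact (hJ0 hx).eq_or_lt.imp Eq.symm id
    · have h3 := (h1 θ h).continuousWithinAt
      rw [← hJ] at h3
      exact (continuousWithinAt_inter (Ioi_mem_nhds (hI' h).1)).1 h3
  · refine continuousOn_const.sub ?_
    rintro _ ⟨θ, hθ, rfl⟩
    have hsl : periodMid (crossPoint k θ) ∈ Complex.slitPlane := by
      rcases hcases θ hθ with rfl | h
      · rw [Complex.mem_slitPlane_iff_arg]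
        refine ⟨?_, ?_⟩
        · change argMid _ ≠ _
          rw [crossPoint_zero, argMid_neg_one]
          have := Real.pi_pos
          exact fun h => by linarith
        · intro h
          have := argMid_neg_one
          rw [argMid, ← crossPoint_zero k, h, Complex.arg_zero] at this
          have := Real.pi_pos
          linarith
      · exact Or.inl (periodMid_re_im_pos (hs θ h).1).1
    exact (Complex.continuousAt_arg hsl).comp_continuousWithinAt
      ((continuousOn_periodMid _ (hup (mem_image_of_mem _ hθ))).mono hup)
  · intro θ hθ
    rcases hcases θ hθ with rfl | h
    · rw [crossPoint_zero, argMid_neg_one, sub_self]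
    · rw [(hs θ h).2.1, sub_sub_cancel]

/-! ### The curves 𝒜 and ℰ -/

section classification

variable {θ : ℝ}

/-- Common points of the level sets in the open upper half plane. -/
lemma common_point (hθ : θ ∈ Icc 0 (Real.pi / 4)) {a : ℂ} (ha : 0 < a.im)
    (h1 : PeriodVanishes θ a 1 a) (h2 : PeriodVanishes θ a (-1) a) :
    0 < θ ∧ argMid a = Real.pi / 2 - θ ∧
      (argNegOne a = Real.pi / 2 - θ ∨ argNegOne a = 3 * Real.pi / 2 - θ) := by
  have hpi := Real.pi_pos
  rw [periodVanishes_one_iff_sin ha] at h1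
  rw [periodVanishes_negOne_iff_cos ha] at h2
  have h3 := argMid_eq_of_sin_cos ⟨hθ.1, by linarith [hθ.2]⟩ ha h2 h1
  have h4 := argMid_lt ha
  exact ⟨by linarith, h3, (cos_argNegOne_eq_zero_iff hθ ha).1 h2⟩

lemma periodVanishes_of_argMid (hθ : θ ∈ Icc 0 (Real.pi / 4)) {a : ℂ} (ha : 0 < a.im)
    (h1 : argMid a = Real.pi / 2 - θ)
    (h2 : argNegOne a = Real.pi / 2 - θ ∨ argNegOne a = 3 * Real.pi / 2 - θ) :
    PeriodVanishes θ a 1 a ∧ PeriodVanishes θ a (-1) a := by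
  have h3 := (cos_argNegOne_eq_zero_iff hθ ha).2 h2
  rw [periodVanishes_one_iff_sin ha, periodVanishes_negOne_iff_cos ha]
  exact ⟨(cos_eq_zero_iff_sin_eq_zero ⟨hθ.1, by linarith [hθ.2, Real.pi_pos]⟩ ha h1).1 h3, h3⟩

lemma neg_one_lt_re {a : ℂ} (ha : 0 < a.im) (h1 : argMid a = Real.pi / 2 - θ)
    (h2 : argNegOne a = Real.pi / 2 - θ) : -1 < a.re := by
  have hpi := Real.pi_pos
  have h3 := (arg_add_one_bounds ha h1 h2).2
  have h4 : 0 < (a + 1).im := by rwa [add_one_im]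
  have h5 : 0 < (a + 1).re := by
    rw [← Complex.norm_mul_cos_arg]
    exact mul_pos (norm_pos_iff.2 (ne_zero_of_im_pos h4))
      (Real.cos_pos_of_mem_Ioo ⟨by linarith [arg_pos_of_im_pos h4], by linarith⟩)
  rw [Complex.add_re, Complex.one_re] at h5
  linarith

lemma re_lt_neg_one (hθ : θ ∈ Ioc 0 (Real.pi / 4)) {a : ℂ} (ha : 0 < a.im)
    (h1 : argMid a = Real.pi / 2 - θ) (h2 : argNegOne a = 3 * Real.pi / 2 - θ) : a.re < -1 := by
  have hpi := Real.pi_pos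
  have h3 := (arg_add_one_bounds ha h1 h2).1
  have h4 : 0 < (a + 1).im := by rwa [add_one_im]
  have h5 : (a + 1).re < 0 := by
    rw [← Complex.norm_mul_cos_arg]
    exact mul_neg_of_pos_of_neg (norm_pos_iff.2 (ne_zero_of_im_pos h4))
      (Real.cos_neg_of_pi_div_two_lt_of_lt (by linarith [hθ.2])
        (by linarith [arg_lt_pi_of_im_pos h4]))
  rw [Complex.add_re, Complex.one_re] at h5
  linarith

/-- The common point on the inner rays. -/
noncomputable def innerPoint (θ : ℝ) : ℂ := crossPoint (Real.pi / 2) θ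

/-- The common point on the left rays. -/
noncomputable def outerPoint (θ : ℝ) : ℂ := crossPoint (3 * Real.pi / 2) θ

lemma innerPoint_spec (hθ : θ ∈ Ioc 0 (Real.pi / 4)) : 0 < (innerPoint θ).im ∧
    argMid (innerPoint θ) = Real.pi / 2 - θ ∧ argNegOne (innerPoint θ) = Real.pi / 2 - θ :=
  crossPoint_spec (Or.inl rfl) hθ (by linarith [hθ.2, Real.pi_pos])

lemma eq_innerPoint (hθ : θ ∈ Ioc 0 (Real.pi / 4)) {a : ℂ} (ha : 0 < a.im)
    (h1 : argMid a = Real.pi / 2 - θ) (h2 : argNegOne a = Real.pi / 2 - θ) : a = innerPoint θ :=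
  eq_crossPoint (Or.inl rfl) hθ (by linarith [hθ.2, Real.pi_pos]) ha h1 h2

lemma outerPoint_spec (hθ : θ ∈ Ioo 0 (Real.pi / 8)) : 0 < (outerPoint θ).im ∧
    argMid (outerPoint θ) = Real.pi / 2 - θ ∧ argNegOne (outerPoint θ) = 3 * Real.pi / 2 - θ :=
  crossPoint_spec (Or.inr rfl) ⟨hθ.1, by linarith [hθ.2, Real.pi_pos]⟩
    (by linarith [hθ.2, Real.pi_pos])

lemma eq_outerPoint (hθ : θ ∈ Ioo 0 (Real.pi / 8)) {a : ℂ} (ha : 0 < a.im)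
    (h1 : argMid a = Real.pi / 2 - θ) (h2 : argNegOne a = 3 * Real.pi / 2 - θ) :
    a = outerPoint θ :=
  eq_crossPoint (Or.inr rfl) ⟨hθ.1, by linarith [hθ.2, Real.pi_pos]⟩
    (by linarith [hθ.2, Real.pi_pos]) ha h1 h2

lemma isSmoothArc_innerPoint :
    IsSmoothArc innerPoint (Icc 0 (Real.pi / 4)) (Ioc 0 (Real.pi / 4)) :=
  isSmoothArc_crossPoint (Or.inl rfl) (uniqueDiffOn_Ioc _ _) subset_rfl
    (fun θ hθ => by linarith [hθ.2, Real.pi_pos]) (fun θ hθ => hθ.1) (by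
      ext θ
      exact ⟨fun h => ⟨h.2, h.1.2⟩, fun h => ⟨⟨h.1.le, h.2⟩, h.1⟩⟩)

lemma isSmoothArc_outerPoint :
    IsSmoothArc outerPoint (Ico 0 (Real.pi / 8)) (Ioo 0 (Real.pi / 8)) :=
  isSmoothArc_crossPoint (Or.inr rfl) (uniqueDiffOn_Ioo _ _)
    (fun θ hθ => ⟨hθ.1, by linarith [hθ.2, Real.pi_pos]⟩)
    (fun θ hθ => by linarith [hθ.2, Real.pi_pos]) (fun θ hθ => hθ.1) (by
      ext θ
      exact ⟨fun h => ⟨h.2, h.1.2⟩, fun h => ⟨⟨h.1.le, h.2⟩, h.1⟩⟩)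

lemma reflectIm_eq_self {a : ℂ} (h : a.re = 0) : reflectIm a = a :=
  Complex.ext (by rw [reflectIm_re, h, neg_zero]) (reflectIm_im a)

lemma periodVanishes_pair_reflect {a : ℂ} (h1 : PeriodVanishes θ a 1 a)
    (h2 : PeriodVanishes θ a (-1) a) : PeriodVanishes (Real.pi / 2 - θ) (reflectIm a) 1 (reflectIm a) ∧
      PeriodVanishes (Real.pi / 2 - θ) (reflectIm a) (-1) (reflectIm a) := by
  have h3 := periodVanishes_reflect h1
  have h4 := periodVanishes_reflect h2
  rw [reflectIm_one] at h3
  rw [reflectIm_neg_one] at h4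
  exact ⟨h4, h3⟩

/-- A point on the imaginary axis is fixed by the reflection, so it would belong to the angles θ and
π/2 - θ at once; arg F then gives θ = π/4. -/
lemma innerPoint_re_ne_zero (hθ : θ ∈ Ioo 0 (Real.pi / 4)) : (innerPoint θ).re ≠ 0 := by
  have hpi := Real.pi_pos
  intro h
  obtain ⟨s1, s2, s3⟩ := innerPoint_spec ⟨hθ.1, hθ.2.le⟩
  obtain ⟨p1, p2⟩ := periodVanishes_of_argMid ⟨hθ.1.le, hθ.2.le⟩ s1 s2 (Or.inl s3)
  obtain ⟨q1, q2⟩ := periodVanishes_pair_reflect p1 p2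
  rw [reflectIm_eq_self h] at q1 q2
  have h5 := argMid_eq_of_sin_cos (θ := Real.pi / 2 - θ) ⟨by linarith [hθ.2], by linarith [hθ.1]⟩ s1
    ((periodVanishes_negOne_iff_cos s1).1 q2) ((periodVanishes_one_iff_sin s1).1 q1)
  linarith [hθ.2]

lemma continuousOn_innerPoint : ContinuousOn innerPoint (Icc 0 (Real.pi / 4)) :=
  continuousOn_iff_continuous_domRestrict.2 isSmoothArc_innerPoint.embedding.continuous

/-- The arc starts at -1 and cannot cross the imaginary axis before θ = π/4. -/
lemma innerPoint_re_neg (hθ : θ ∈ Ico 0 (Real.pi / 4)) : (innerPoint θ).re < 0 := by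
  by_contra h
  have hc : ContinuousOn (fun θ => (innerPoint θ).re) (Icc 0 θ) :=
    (Complex.continuous_re.comp_continuousOn continuousOn_innerPoint).mono
      (Icc_subset_Icc_right hθ.2.le)
  have h0 : (innerPoint 0).re = -1 := by simp [innerPoint, crossPoint_zero]
  obtain ⟨x, hx, hx0⟩ := intermediate_value_Icc hθ.1 hc
    (show (0 : ℝ) ∈ Icc _ _ from ⟨by rw [h0]; norm_num, not_lt.1 h⟩)
  rcases hx.1.eq_or_lt with h1 | h1
  · rw [← h1] at hx0
    simp only [h0] at hx0
    norm_num at hx0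
  · exact innerPoint_re_ne_zero ⟨h1, lt_of_le_of_lt hx.2 hθ.2⟩ hx0

lemma innerPoint_re_nonpos (hθ : θ ∈ Icc 0 (Real.pi / 4)) : (innerPoint θ).re ≤ 0 := by
  have hpi := Real.pi_pos
  have hc := Complex.continuous_re.comp_continuousOn continuousOn_innerPoint
  have h1 : MapsTo (fun θ => (innerPoint θ).re) (Ico 0 (Real.pi / 4)) (Iic 0) := fun θ hθ =>
    (innerPoint_re_neg hθ).le
  have h2 := h1.closure_of_continuousOn (by rw [closure_Ico (by positivity)]; exact hc)
  rw [closure_Ico (by positivity), closure_Iic] at h2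
  exact h2 hθ

lemma periodVanishes_neg_one_self (θ : ℝ) : PeriodVanishes θ (-1) (-1) (-1) :=
  ⟨0, continuousOn_const, fun τ _ => by simp [cubic], by simp⟩

lemma periodVanishes_neg_one_one : PeriodVanishes 0 (-1) 1 (-1) := by
  obtain ⟨r, hr, h⟩ := gInt_ofReal (x := -2) le_rfl
  rw [periodVanishes_one_iff (by simp) (by simp), show (-1 - 1 : ℂ) = ((-2 : ℝ) : ℂ) by norm_num, h,
    Complex.ofReal_zero, zero_mul, Complex.exp_zero, one_mul, ← Complex.ofReal_pow,
    ← Complex.ofReal_mul, Complex.ofReal_im]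

/-- After reflection argOne is 0 or 2π on the real axis, so the condition would force cos θ = 0. -/
lemma not_periodVanishes_neg_one_of_real (hθ : θ ∈ Ico 0 (Real.pi / 2)) {a : ℂ} (ha : a.im = 0)
    (h1 : a.re < 1) (h2 : a.re ≠ -1) : ¬ PeriodVanishes θ a (-1) a := by
  intro h
  have h3 := periodVanishes_reflect h
  rw [reflectIm_neg_one] at h3
  have hb : reflectIm a = ((-a.re : ℝ) : ℂ) :=
    Complex.ext (by rw [reflectIm_re, Complex.ofReal_re]) (by rw [reflectIm_im, ha, Complex.ofReal_im])
  rw [hb] at h3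
  have hne : ((-a.re : ℝ) : ℂ) ≠ 1 := fun h => h2 (by
    have : -a.re = 1 := by exact_mod_cast h
    linarith)
  have hr : ¬((((-a.re : ℝ) : ℂ)).im = 0 ∧ (((-a.re : ℝ) : ℂ)).re ≤ -1) := fun h => by
    have := h.2
    rw [Complex.ofReal_re] at this
    linarith
  have h4 := ((mem_sigmaOne_iff (Complex.ofReal_im _).ge hne).1 ⟨hr, h3⟩).2
  have hc : 0 < Real.cos θ := Real.cos_pos_of_mem_Ioo ⟨by linarith [hθ.1, Real.pi_pos], hθ.2⟩
  rw [← Complex.ofReal_one, ← Complex.ofReal_sub] at h4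
  rcases lt_or_gt_of_ne (show -a.re ≠ 1 from fun h => h2 (by linarith)) with h5 | h5
  · rw [argOne_of_neg (by linarith) (by linarith), add_comm, Real.sin_add_two_pi,
      Real.sin_pi_div_two_sub] at h4
    exact hc.ne' h4
  · rw [argOne_of_pos (by linarith), zero_add, Real.sin_pi_div_two_sub] at h4
    exact hc.ne' h4

/-- Points of the open upper half plane with non-positive real part where both periods vanish. -/
lemma common_point_of_re_nonpos (hθ : θ ∈ Ico 0 (Real.pi / 2)) {a : ℂ} (ha : 0 < a.im)
    (hre : a.re ≤ 0) (h1 : PeriodVanishes θ a 1 a) (h2 : PeriodVanishes θ a (-1) a) :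
    θ ∈ Ioc 0 (Real.pi / 4) ∧ argMid a = Real.pi / 2 - θ ∧
      (argNegOne a = Real.pi / 2 - θ ∨ argNegOne a = 3 * Real.pi / 2 - θ) := by
  rcases le_or_gt θ (Real.pi / 4) with h | h
  · obtain ⟨h0, h3⟩ := common_point ⟨hθ.1, h⟩ ha h1 h2
    exact ⟨⟨h0, h⟩, h3⟩
  -- An angle above π/4 reflects to one below π/4 and a point of non-negative real part, whereas
  -- both kinds of common points have negative real part there.
  · exfalso
    obtain ⟨q1, q2⟩ := periodVanishes_pair_reflect h1 h2
    have hb : 0 < (reflectIm a).im := by rwa [reflectIm_im]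
    have hbre : 0 ≤ (reflectIm a).re := by rw [reflectIm_re]; linarith
    have hθ' : Real.pi / 2 - θ ∈ Ioo 0 (Real.pi / 4) := ⟨by linarith [hθ.2], by linarith⟩
    obtain ⟨-, h3, h4 | h4⟩ := common_point ⟨hθ'.1.le, hθ'.2.le⟩ hb q1 q2
    · rw [eq_innerPoint ⟨hθ'.1, hθ'.2.le⟩ hb h3 h4] at hbre
      exact absurd hbre (not_le.2 (innerPoint_re_neg ⟨hθ'.1.le, hθ'.2⟩))
    · have := re_lt_neg_one ⟨hθ'.1, hθ'.2.le⟩ hb h3 h4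
      linarith

lemma image_innerPoint :
    innerPoint '' Icc 0 (Real.pi / 4) = curveA ∩ {a | -1 ≤ a.re ∧ a.re ≤ 0 ∧ 0 ≤ a.im} := by
  have hpi := Real.pi_pos
  apply Subset.antisymm
  · rintro _ ⟨θ, hθ, rfl⟩
    rcases hθ.1.eq_or_lt with rfl | h0
    · rw [innerPoint, crossPoint_zero]
      exact ⟨⟨by simp, by norm_num, 0, ⟨le_rfl, by positivity⟩, periodVanishes_neg_one_one,
        periodVanishes_neg_one_self 0⟩, by simp, by norm_num, by simp⟩
    · obtain ⟨s1, s2, s3⟩ := innerPoint_spec ⟨h0, hθ.2⟩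
      have h1 := neg_one_lt_re s1 s2 s3
      have h2 := innerPoint_re_nonpos hθ
      exact ⟨⟨h1.le, by linarith, θ, ⟨hθ.1, by linarith [hθ.2]⟩,
        periodVanishes_of_argMid hθ s1 s2 (Or.inl s3)⟩, h1.le, h2, s1.le⟩
  · rintro a ⟨⟨-, -, θ, hθ, p1, p2⟩, h1, h2, h3⟩
    rcases h3.eq_or_lt with him | him
    · by_cases hre : a.re = -1
      · refine ⟨0, ⟨le_rfl, by positivity⟩, ?_⟩
        rw [innerPoint, crossPoint_zero]
        exact Complex.ext (by simp [hre]) (by simp [← him])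
      · exact absurd p2 (not_periodVanishes_neg_one_of_real hθ him.symm (by linarith) hre)
    · obtain ⟨q1, q2, q3 | q3⟩ := common_point_of_re_nonpos hθ him h2 p1 p2
      · exact ⟨θ, ⟨q1.1.le, q1.2⟩, (eq_innerPoint q1 him q2 q3).symm⟩
      · have := re_lt_neg_one q1 him q2 q3
        linarith

lemma image_outerPoint :
    outerPoint '' Ico 0 (Real.pi / 8) = curveE ∩ {a | a.re ≤ -1 ∧ 0 ≤ a.im} := by
  have hpi := Real.pi_pos
  apply Subset.antisymm
  · rintro _ ⟨θ, hθ, rfl⟩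
    rcases hθ.1.eq_or_lt with rfl | h0
    · rw [outerPoint, crossPoint_zero]
      exact ⟨⟨by simp, 0, ⟨le_rfl, by positivity⟩, periodVanishes_neg_one_one,
        periodVanishes_neg_one_self 0⟩, by simp, by simp⟩
    · obtain ⟨s1, s2, s3⟩ := outerPoint_spec ⟨h0, hθ.2⟩
      have h1 := re_lt_neg_one ⟨h0, by linarith [hθ.2]⟩ s1 s2 s3
      exact ⟨⟨by rw [abs_of_neg (by linarith)]; linarith, θ, ⟨hθ.1, by linarith [hθ.2]⟩,
        periodVanishes_of_argMid ⟨hθ.1, by linarith [hθ.2]⟩ s1 s2 (Or.inr s3)⟩, h1.le, s1.le⟩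
  · rintro a ⟨⟨-, θ, hθ, p1, p2⟩, h1, h3⟩
    rcases h3.eq_or_lt with him | him
    · by_cases hre : a.re = -1
      · refine ⟨0, ⟨le_rfl, by positivity⟩, ?_⟩
        rw [outerPoint, crossPoint_zero]
        exact Complex.ext (by simp [hre]) (by simp [← him])
      · exact absurd p2 (not_periodVanishes_neg_one_of_real hθ him.symm (by linarith) hre)
    · obtain ⟨q1, q2, q3 | q3⟩ := common_point_of_re_nonpos hθ him (by linarith) p1 p2
      · have := neg_one_lt_re him q2 q3
        linarith
      · have h8 : θ < Real.pi / 8 := by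
          by_contra h
          exact argNegOne_ne ⟨not_lt.1 h, q1.2⟩ him q2 q3
        exact ⟨θ, ⟨q1.1.le, h8⟩, (eq_outerPoint ⟨q1.1, h8⟩ him q2 q3).symm⟩

end classification


/-! ### The table of intersections -/

section intersections

variable {θ : ℝ}

lemma mem_levelNegOne_inner_or_outer (hθ : θ ∈ Icc 0 (Real.pi / 4)) {a : ℂ} (ha : 0 < a.im)
    (h : argNegOne a = Real.pi / 2 - θ ∨ argNegOne a = 3 * Real.pi / 2 - θ) :
    PeriodVanishes θ a (-1) a :=
  (periodVanishes_negOne_iff_cos ha).2 ((cos_argNegOne_eq_zero_iff hθ ha).2 h)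

/-- Intersecting the level sets of arg R and arg L is rewritten as fixing arg F and arg L, the
description for which uniqueness is known. -/
lemma levelOne_left_inter (hθ : θ ∈ Ioc 0 (Real.pi / 4)) {k : ℝ}
    (hk : k = Real.pi / 2 ∨ k = 3 * Real.pi / 2) :
    insert 1 (levelOne (2 * Real.pi - θ)) ∩ insert (-1) (levelNegOne (k - θ)) =
      {a : ℂ | 0 < a.im ∧ argMid a = Real.pi / 2 - θ ∧ argNegOne a = k - θ} := by
  have hθ' : θ ∈ Icc 0 (Real.pi / 4) := ⟨hθ.1.le, hθ.2⟩
  ext a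
  constructor
  · rintro ⟨rfl | h1, h2⟩
    · rcases h2 with h2 | h2
      · norm_num at h2
      · have := h2.1
        simp at this
    · rcases h2 with rfl | h2
      · have := h1.1
        simp at this
      · have hk' := (eq_or_eq_sub hk θ).imp h2.2.trans h2.2.trans
        exact ⟨h1.1, (common_point hθ' h1.1
          ((periodVanishes_one_iff_sin h1.1).2 (by rw [h1.2]; simp))
          (mem_levelNegOne_inner_or_outer hθ' h1.1 hk')).2.1, h2.2⟩
  · rintro ⟨h1, h2, h3⟩
    have hk' := (eq_or_eq_sub hk θ).imp h3.trans h3.trans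
    have h4 := (periodVanishes_one_iff_sin h1).1 (periodVanishes_of_argMid hθ' h1 h2 hk').1
    exact ⟨Or.inr ⟨h1, argOne_eq_of_argMid hθ' h1 h2 h4⟩, Or.inr ⟨h1, h3⟩⟩

lemma levelOne_right_inter (hθ : θ ∈ Icc 0 (Real.pi / 4)) {k : ℝ}
    (hk : k = Real.pi / 2 ∨ k = 3 * Real.pi / 2) :
    insert 1 (levelOne (Real.pi - θ)) ∩ insert (-1) (levelNegOne (k - θ)) = ∅ := by
  have hpi := Real.pi_pos
  refine eq_empty_of_forall_notMem ?_
  rintro a ⟨rfl | h1, h2⟩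
  · rcases h2 with h2 | h2
    · norm_num at h2
    · have := h2.1
      simp at this
  · rcases h2 with rfl | h2
    · have := h1.1
      simp at this
    · have hs : Real.sin (argOne (a - 1) + θ) = 0 := by rw [h1.2]; simp
      have h3 := (common_point hθ h1.1 ((periodVanishes_one_iff_sin h1.1).2 hs)
        (mem_levelNegOne_inner_or_outer hθ h1.1
          ((eq_or_eq_sub hk θ).imp h2.2.trans h2.2.trans))).2.1
      have h4 := argOne_eq_of_argMid hθ h1.1 h3 hs
      rw [h1.2] at h4
      linarith

lemma segment_inter {k : ℝ} :
    {a : ℂ | a.im = 0 ∧ -1 ≤ a.re ∧ a.re ≤ 1} ∩ insert (-1) (levelNegOne k) = {-1} := by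
  ext a
  constructor
  · rintro ⟨h1, h2 | h2⟩
    · exact h2
    · exact absurd h1.1 h2.1.ne'
  · rintro rfl
    exact ⟨⟨by simp, by simp, by norm_num⟩, Or.inl rfl⟩

lemma sigmaOneLeft_inter_sigmaNegOneRight (hθ : θ ∈ Icc 0 (Real.pi / 4)) :
    sigmaOneLeft θ ∩ sigmaNegOneRight θ = {innerPoint θ} := by
  rw [sigmaNegOneRight_eq hθ]
  rcases hθ.1.eq_or_lt with rfl | h0
  · rw [sigmaOneLeft_zero, segment_inter, innerPoint, crossPoint_zero]
  · rw [sigmaOneLeft_eq hθ h0, levelOne_left_inter ⟨h0, hθ.2⟩ (Or.inl rfl)]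
    exact Subset.antisymm (fun a ha => eq_innerPoint ⟨h0, hθ.2⟩ ha.1 ha.2.1 ha.2.2)
      (singleton_subset_iff.2 (innerPoint_spec ⟨h0, hθ.2⟩))

lemma sigmaOneLeft_inter_sigmaNegOneLeft (hθ : θ ∈ Ico 0 (Real.pi / 8)) :
    sigmaOneLeft θ ∩ sigmaNegOneLeft θ = {outerPoint θ} := by
  have hθ' : θ ∈ Icc 0 (Real.pi / 4) := ⟨hθ.1, by linarith [hθ.2, Real.pi_pos]⟩
  rw [sigmaNegOneLeft_eq hθ']
  rcases hθ.1.eq_or_lt with rfl | h0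
  · rw [sigmaOneLeft_zero, segment_inter, outerPoint, crossPoint_zero]
  · rw [sigmaOneLeft_eq hθ' h0, levelOne_left_inter ⟨h0, hθ'.2⟩ (Or.inr rfl)]
    exact Subset.antisymm (fun a ha => eq_outerPoint ⟨h0, hθ.2⟩ ha.1 ha.2.1 ha.2.2)
      (singleton_subset_iff.2 (outerPoint_spec ⟨h0, hθ.2⟩))

lemma sigmaOneLeft_inter_sigmaNegOneLeft_eq_empty (hθ : θ ∈ Icc (Real.pi / 8) (Real.pi / 4)) :
    sigmaOneLeft θ ∩ sigmaNegOneLeft θ = ∅ := by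
  have h0 : 0 < θ := by linarith [hθ.1, Real.pi_pos]
  have hθ' : θ ∈ Icc 0 (Real.pi / 4) := ⟨h0.le, hθ.2⟩
  rw [sigmaNegOneLeft_eq hθ', sigmaOneLeft_eq hθ' h0, levelOne_left_inter ⟨h0, hθ.2⟩ (Or.inr rfl)]
  exact eq_empty_of_forall_notMem fun a ha => argNegOne_ne hθ ha.1 ha.2.1 ha.2.2

lemma sigmaOneRight_inter_sigmaNegOneRight (hθ : θ ∈ Icc 0 (Real.pi / 4)) :
    sigmaOneRight θ ∩ sigmaNegOneRight θ = ∅ := by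
  rw [sigmaOneRight_eq hθ, sigmaNegOneRight_eq hθ, levelOne_right_inter hθ (Or.inl rfl)]

lemma sigmaOneRight_inter_sigmaNegOneLeft (hθ : θ ∈ Icc 0 (Real.pi / 4)) :
    sigmaOneRight θ ∩ sigmaNegOneLeft θ = ∅ := by
  rw [sigmaOneRight_eq hθ, sigmaNegOneLeft_eq hθ, levelOne_right_inter hθ (Or.inr rfl)]

lemma mem_sigmaMid_of_argMid (hθ : θ ∈ Ioc 0 (Real.pi / 4)) {a : ℂ} (ha : 0 < a.im)
    (h : argMid a = Real.pi / 2 - θ) : a ∈ sigmaMid θ := by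
  rw [sigmaMid_eq ⟨hθ.1, by linarith [hθ.2, Real.pi_pos]⟩]
  exact ⟨ha, h⟩

lemma exists_sigmaMid_arc (hθ : θ ∈ Icc 0 (Real.pi / 4)) {s : ℝ}
    (hs : (Complex.exp (θ * Complex.I) * periodMid s).re = 0) (hs0 : θ = 0 → s = -1) :
    ∃ γ : ℝ → ℂ, IsSmoothArc γ (Ioi 0) (Ioi 0) ∧ γ '' Ioi 0 = sigmaMid θ ∧
      Tendsto γ (𝓝[>] 0) (𝓝 (s : ℂ)) ∧ Tendsto (fun x => ‖γ x‖) atTop atTop ∧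
      Tendsto (fun x => γ x / (‖γ x‖ : ℂ)) atTop
        (𝓝 (Complex.exp ((Real.pi - 2 * θ) * Complex.I))) := by
  rcases hθ.1.eq_or_lt with rfl | h0
  · rw [hs0 rfl]
    exact exists_sigmaMid_zero_arc
  · have hθ' : θ ∈ Ioo 0 (Real.pi / 2) := ⟨h0, by linarith [hθ.2, Real.pi_pos]⟩
    exact ⟨midPoint θ, isSmoothArc_midPoint hθ', image_midPoint hθ', tendsto_midPoint_zero hθ' hs,
      tendsto_norm_midPoint θ, tendsto_midPoint_direction ⟨h0, hθ.2⟩⟩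

/-- Conjugation moves the point up and changes θ to -θ. The sum formula for F would give
Re(e^{-iθ}F) = 0, impossible in the first quadrant. -/
lemma not_periodVanishes_pair_of_im_neg (hθ : θ ∈ Icc 0 (Real.pi / 4)) {a : ℂ} (ha : a.im < 0)
    (h1 : PeriodVanishes θ a 1 a) (h2 : PeriodVanishes θ a (-1) a) : False := by
  have hpi := Real.pi_pos
  have h3 := periodVanishes_conj h1
  have h4 := periodVanishes_conj h2
  rw [map_one] at h3
  rw [map_neg, map_one] at h4
  have hb : 0 < ((starRingEnd ℂ) a).im := by simpa using ha
  rw [periodVanishes_one_iff hb.le fun h => hb.ne' h.1] at h3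
  rw [periodVanishes_negOne_iff hb] at h4
  have h5 := exp_mul_periodMid_re (-θ) hb
  rw [h3, h4, sub_zero] at h5
  have h6 := periodMid_re_im_pos hb
  have hs : 0 ≤ Real.sin θ := Real.sin_nonneg_of_nonneg_of_le_pi hθ.1 (by linarith [hθ.2])
  have hc := Real.cos_pos_of_mem_Ioo ⟨by linarith [hθ.1], show θ < Real.pi / 2 by linarith [hθ.2]⟩
  rw [Complex.mul_re, Complex.exp_ofReal_mul_I_re, Complex.exp_ofReal_mul_I_im, Real.cos_neg,
    Real.sin_neg] at h5
  nlinarith [mul_pos hc h6.1, mul_nonneg hs h6.2.le]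

end intersections

theorem mainTheorem5 :
    ∃ (t e : ℝ → ℂ) (s : ℝ → ℝ),
      -- the left and right curves exist, and they make up the level sets in the upper half plane
      (∀ θ ∈ Icc (0 : ℝ) (Real.pi / 4),
        (∃ γ, IsRay (sigmaOne θ) 1 (angleOneLeft θ) γ) ∧
        (∃ γ, IsRay (sigmaOne θ) 1 (angleOneRight θ) γ) ∧
        (∃ γ, IsRay (sigmaNegOne θ) (-1) (angleNegOneLeft θ) γ) ∧
        (∃ γ, IsRay (sigmaNegOne θ) (-1) (angleNegOneRight θ) γ) ∧
        (0 < θ → sigmaOne θ ∩ {a | 0 ≤ a.im} = sigmaOneLeft θ ∪ sigmaOneRight θ) ∧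
        sigmaNegOne θ ∩ {a | 0 ≤ a.im} = sigmaNegOneLeft θ ∪ sigmaNegOneRight θ) ∧
      -- the table of intersections
      (∀ θ ∈ Icc (0 : ℝ) (Real.pi / 4),
        sigmaOneLeft θ ∩ sigmaNegOneRight θ = {t θ} ∧
        (θ < Real.pi / 8 → sigmaOneLeft θ ∩ sigmaNegOneLeft θ = {e θ}) ∧
        (Real.pi / 8 ≤ θ → sigmaOneLeft θ ∩ sigmaNegOneLeft θ = ∅) ∧
        sigmaOneRight θ ∩ sigmaNegOneRight θ = ∅ ∧
        sigmaOneRight θ ∩ sigmaNegOneLeft θ = ∅) ∧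
      t 0 = -1 ∧ e 0 = -1 ∧ s 0 = -1 ∧
      -- the curves described by `t θ` and `e θ`
      IsSmoothArc t (Icc 0 (Real.pi / 4)) (Ioc 0 (Real.pi / 4)) ∧
      t '' Icc 0 (Real.pi / 4) = curveA ∩ {a | -1 ≤ a.re ∧ a.re ≤ 0 ∧ 0 ≤ a.im} ∧
      IsSmoothArc e (Ico 0 (Real.pi / 8)) (Ioo 0 (Real.pi / 8)) ∧
      e '' Ico 0 (Real.pi / 8) = curveE ∩ {a | a.re ≤ -1 ∧ 0 ≤ a.im} ∧
      -- the set `Σ_θ`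
      (∀ θ ∈ Icc (0 : ℝ) (Real.pi / 4),
        s θ ∈ Icc (-1 : ℝ) 0 ∧
        (∀ x ∈ Icc (-1 : ℝ) 1, BoundaryPeriodVanishes θ x ↔ x = s θ) ∧
        sigmaMid θ ⊆ closedStrip θ ∧
        (0 < θ → sigmaMid θ ⊆ openStrip θ) ∧
        (0 < θ → t θ ∈ sigmaMid θ) ∧
        (0 < θ → θ < Real.pi / 8 → e θ ∈ sigmaMid θ) ∧
        ∃ γ : ℝ → ℂ,
          IsSmoothArc γ (Ioi 0) (Ioi 0) ∧
          γ '' Ioi 0 = sigmaMid θ ∧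
          Tendsto γ (𝓝[>] 0) (𝓝 (s θ : ℂ)) ∧
          Tendsto (fun x => ‖γ x‖) atTop atTop ∧
          Tendsto (fun x => γ x / (‖γ x‖ : ℂ)) atTop
            (𝓝 (Complex.exp ((Real.pi - 2 * θ) * Complex.I)))) ∧
      -- common points of the level sets
      (∀ θ ∈ Icc (0 : ℝ) (Real.pi / 4),
        (θ < Real.pi / 8 → sigmaOne θ ∩ sigmaNegOne θ ∩ {a | 0 < a.im} ⊆ {t θ, e θ}) ∧
        (Real.pi / 8 ≤ θ → sigmaOne θ ∩ sigmaNegOne θ ∩ {a | 0 < a.im} ⊆ {t θ}) ∧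
        sigmaOne θ ∩ sigmaNegOne θ ∩ {a | a.im < 0} = ∅) := by
  have hpi := Real.pi_pos
  have hex : ∀ θ : ℝ, ∃ s : ℝ, θ ∈ Icc (0 : ℝ) (Real.pi / 4) → s ∈ Icc (-1 : ℝ) 0 ∧
      (Complex.exp (θ * Complex.I) * periodMid s).re = 0 ∧
      ∀ x ∈ Icc (-1 : ℝ) 1, BoundaryPeriodVanishes θ x ↔ x = s := fun θ => by
    by_cases h : θ ∈ Icc (0 : ℝ) (Real.pi / 4)
    · obtain ⟨s, h1, h2, h3⟩ := exists_boundaryPeriod_root h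
      exact ⟨s, fun _ => ⟨h1, h2, h3⟩⟩
    · exact ⟨0, fun h' => absurd h' h⟩
  choose s hs using hex
  have h00 : (0 : ℝ) ∈ Icc (0 : ℝ) (Real.pi / 4) := ⟨le_rfl, by positivity⟩
  have hs0 : s 0 = -1 := by
    refine (((hs 0 h00).2.2 (-1) (by norm_num)).1 ?_).symm
    rw [boundaryPeriodVanishes_iff, exp_mul_periodMid_ofReal_re, realMid_eq_zero le_rfl]
    simp
  refine ⟨innerPoint, outerPoint, s, ?_, ?_, crossPoint_zero _, crossPoint_zero _, hs0,
    isSmoothArc_innerPoint, image_innerPoint, isSmoothArc_outerPoint, image_outerPoint, ?_, ?_⟩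
  · intro θ hθ
    exact ⟨exists_isRay_oneLeft hθ, exists_isRay_oneRight hθ, exists_isRay_negOneLeft hθ,
      exists_isRay_negOneRight hθ, sigmaOne_inter_eq_union hθ, sigmaNegOne_inter_eq_union hθ⟩
  · intro θ hθ
    exact ⟨sigmaOneLeft_inter_sigmaNegOneRight hθ,
      fun h => sigmaOneLeft_inter_sigmaNegOneLeft ⟨hθ.1, h⟩,
      fun h => sigmaOneLeft_inter_sigmaNegOneLeft_eq_empty ⟨h, hθ.2⟩,
      sigmaOneRight_inter_sigmaNegOneRight hθ, sigmaOneRight_inter_sigmaNegOneLeft hθ⟩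
  · intro θ hθ
    obtain ⟨h1, h2, h3⟩ := hs θ hθ
    refine ⟨h1, h3, sigmaMid_subset_closedStrip hθ, fun h => sigmaMid_subset_openStrip ⟨h, hθ.2⟩,
      fun h => ?_, fun h h8 => ?_, exists_sigmaMid_arc hθ h2 fun h => by rw [h, hs0]⟩
    · obtain ⟨s1, s2, -⟩ := innerPoint_spec ⟨h, hθ.2⟩
      exact mem_sigmaMid_of_argMid ⟨h, hθ.2⟩ s1 s2
    · obtain ⟨s1, s2, -⟩ := outerPoint_spec ⟨h, h8⟩
      exact mem_sigmaMid_of_argMid ⟨h, hθ.2⟩ s1 s2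
  · intro θ hθ
    refine ⟨fun h8 => ?_, fun h8 => ?_, eq_empty_of_forall_notMem fun a ha =>
      not_periodVanishes_pair_of_im_neg hθ ha.2 ha.1.1.2 ha.1.2.2⟩
    · rintro a ⟨⟨h1, h2⟩, h3⟩
      obtain ⟨q1, q2, q3 | q3⟩ := common_point hθ h3 h1.2 h2.2
      · exact Or.inl (eq_innerPoint ⟨q1, hθ.2⟩ h3 q2 q3)
      · exact Or.inr (eq_outerPoint ⟨q1, h8⟩ h3 q2 q3)
    · rintro a ⟨⟨h1, h2⟩, h3⟩
      obtain ⟨q1, q2, q3 | q3⟩ := common_point hθ h3 h1.2 h2.2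
      · exact eq_innerPoint ⟨q1, hθ.2⟩ h3 q2 q3
      · exact absurd q3 (argNegOne_ne ⟨h8, hθ.2⟩ h3 q2)
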